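/- **Setting.** Let $\theta>1$ and let $F(X,Y,u)\in C^1(\mathbb R^3)$ be $2\pi$-periodic in $X$ and in $Y$ with $F(X,Y,0)=0$. For $\Delta\in\mathbb S^1=\mathbb R/2\pi\mathbb Z$ consider the equation $\ddot u=F(x,\theta x+\Delta,u)$. Let $\mathcal P$ send $(\Delta,u(0),\dot u(0))$ to $(\Delta\oplus2\theta\pi,u(2\pi),\dot u(2\pi))$, where $u$ solves this equation; let $\mathscr U^+_\Delta$, $\mathscr U^-_\Delta\subset\mathbb R^2$ be the sets of data $(u(0),\dot u(0))$ whose solution exists on $[0,2\pi]$, respectively on $[-2\pi,0]$, and $\mathscr U_\Delta=\mathscr U^+_\Delta\cap\mathscr U^-_\Delta$. Monotonicity is non-strict. A *$\gamma$-island* ($\gamma\ge0$) is an open curvilinear quadrangle $D\subset\mathscr U_\Delta$ with two disjoint opposite sides $\alpha^\pm$ and two disjoint opposite sides $\beta^\pm$. The sides $\alpha^\pm$ are graphs $u'=h_\pm(u)$ and the sides $\beta^\pm$ are graphs $u=v_\pm(u')$ of monotonic $\gamma$-Lipschitz functions on compact intervals. Both $h_\pm$ are of one type of monotonicity (the type of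 the island, which is part of its data), and both $v_\pm$ are of the opposite type. Solutions with initial data on $\alpha^\pm$ collapse ($|u|\to\infty$) at $x=-2\pi$, those with data on $\beta^\pm$ at $x=2\pi$. A *$\gamma$-donut* is a family of $\gamma$-islands $D_\Delta$, $\Delta\in\mathbb S^1$, whose sides depend continuously on $\Delta$ and whose type does not depend on $\Delta$. An *$h_\gamma$-curve* of an island is the graph $u'=h(u)$, inside the closed island, of a monotonic $\gamma$-Lipschitz function of the type of the island, that connects $\beta^-$ to $\beta^+$. An *$h_\gamma$-strip* is the open part of the island between two disjoint $h_\gamma$-curves $u'=h_\pm(u)$. Its *thickness* $d_h$ is $\max|\widetilde h_+-\widetilde h_-|$ over the smallest interval that contains both domains, where $\widetilde h_\pm$ continue $h_\pm$ by constants beyond their domains. For an island, $d_h$ and $d_v$ denote the thickness between $\alpha^\pm$ and, with $u$ and $u'$ interchanged, between $\beta^\pm$. **Theorem.** Let $\mathcal A$ be a finite alphabet, and let $D^i_\Delta$ ($i\in\mathcal A$, $\Delta\in\mathbb S^1$) be the islands of pairwise disjoint $\gamma$-donuts such that, for some constant $M$, $d_h(D^i_\Delta)\le M$ and $d_v(D^i_\Delta)\le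 M$ for all $i,\Delta$. Put $V_{i,j}(\Delta)=\mathcal P^{-1}(D^j_{\Delta\oplus2\theta\pi})\cap D^i_\Delta$. Suppose that for every $\Delta\in\mathbb S^1$ and all $i,j\in\mathcal A$ the set $V_{i,j}(\Delta)$ is not empty, $\mathcal P$ is defined on $\overline{V_{i,j}(\Delta)}$, and the linearization $\mathcal D\mathcal P_{\mathbf p}=(a_{mn})$ within slices satisfies: (H-1) the strict signs of the entries $a_{mn}$ form the same pattern for all $\mathbf p\in\overline{V_{i,j}(\Delta)}$, and this pattern is * $\begin{pmatrix}+&+\\+&+\end{pmatrix}$ or $\begin{pmatrix}-&-\\-&-\end{pmatrix}$ if the $\alpha$-borders of $D^i_\Delta$ and of $D^j_{\Delta\oplus2\theta\pi}$ are both increasing; * $\begin{pmatrix}+&+\\-&-\end{pmatrix}$ or $\begin{pmatrix}-&-\\+&+\end{pmatrix}$ if those of $D^i_\Delta$ are increasing and those of $D^j_{\Delta\oplus2\theta\pi}$ decreasing; * $\begin{pmatrix}+&-\\-&+\end{pmatrix}$ or $\begin{pmatrix}-&+\\+&-\end{pmatrix}$ if both are decreasing; * $\begin{pmatrix}+&-\\+&-\end{pmatrix}$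 or $\begin{pmatrix}-&+\\-&+\end{pmatrix}$ if those of $D^i_\Delta$ are decreasing and those of $D^j_{\Delta\oplus2\theta\pi}$ increasing; (H-2) there is $\rho_h>1$ (possibly depending on $\Delta,i,j$) with $|a_{11}|\ge\rho_h$ for all $\mathbf p\in\overline{V_{i,j}(\Delta)}$. Then for all $i,j\in\mathcal A$ there is $\gamma_{ij}\ge\gamma$, independent of $\Delta$, such that for every $\Delta$ and every $h_\gamma$-strip $H\subset D^i_\Delta$ the set $\widetilde H^j=\mathcal P(H)\cap D^j_{\Delta\oplus2\theta\pi}$ is an $h_{\gamma_{ij}}$-strip of $D^j_{\Delta\oplus2\theta\pi}$, and $d_h(\widetilde H^j)\le d_h(H)/\rho_h$. -/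

import Mathlib

open Set Filter Topology
open scoped NNReal

noncomputable section

namespace StripMap

/-! ### The equation and its Poincaré map -/

/-- Standing assumptions on `F(X, Y, u)`: `C¹`, vanishing at `u = 0`, and `2π`-periodic in `X`
and in `Y`. -/
structure IsAdmissible (F : ℝ → ℝ → ℝ → ℝ) : Prop where
  contDiff : ContDiff ℝ 1 (fun z : ℝ × ℝ × ℝ => F z.1 z.2.1 z.2.2)
  zero : ∀ X Y, F X Y 0 = 0
  periodic_fst : ∀ X Y u, F (X + 2 * Real.pi) Y u = F X Y u
  periodic_snd : ∀ X Y u, F X (Y + 2 * Real.pi) u = F X Y u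

/-- `u` (with velocity `w`) solves `u'' = F(x, θ x + Δ, u)` on the set `s`. By periodicity of `F`
the choice of the representative of the angle `Δ` does not matter. -/
def IsSolutionOn (F : ℝ → ℝ → ℝ → ℝ) (θ : ℝ) (Δ : Real.Angle) (u w : ℝ → ℝ) (s : Set ℝ) : Prop :=
  ∀ x ∈ s, HasDerivWithinAt u (w x) s x ∧
    HasDerivWithinAt w (F x (θ * x + Δ.toReal) (u x)) s x

/-- The solution with data `p` at `x = 0` exists on `[0, 2π]` and has data `q` at `x = 2π`. -/
def FlowsTo (F : ℝ → ℝ → ℝ → ℝ) (θ : ℝ) (Δ : Real.Angle) (p q : ℝ × ℝ) : Prop :=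
  ∃ u w : ℝ → ℝ, IsSolutionOn F θ Δ u w (Icc 0 (2 * Real.pi)) ∧
    (u 0, w 0) = p ∧ (u (2 * Real.pi), w (2 * Real.pi)) = q

/-- The slice over `Δ` of the domain of the Poincaré map. -/
def forwardDomain (F : ℝ → ℝ → ℝ → ℝ) (θ : ℝ) (Δ : Real.Angle) : Set (ℝ × ℝ) :=
  {p | ∃ q, FlowsTo F θ Δ p q}

/-- The slice over `Δ` of the domain of the inverse Poincaré map: the solution with data `p` at
`x = 0` exists on `[-2π, 0]`. -/
def backwardDomain (F : ℝ → ℝ → ℝ → ℝ) (θ : ℝ) (Δ : Real.Angle) : Set (ℝ × ℝ) :=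
  {p | ∃ u w : ℝ → ℝ, IsSolutionOn F θ Δ u w (Icc (-(2 * Real.pi)) 0) ∧ (u 0, w 0) = p}

/-- The rotation `Δ ↦ Δ ⊕ 2θπ` of the circle. -/
def shift (θ : ℝ) (Δ : Real.Angle) : Real.Angle := Δ + ((2 * θ * Real.pi : ℝ) : Real.Angle)

/-- The Poincaré map from the slice over `Δ` to the slice over `shift θ Δ` (both identified with
the plane of pairs `(u, u')`); it is meaningful on `forwardDomain F θ Δ`. -/
def poincare (F : ℝ → ℝ → ℝ → ℝ) (θ : ℝ) (Δ : Real.Angle) (p : ℝ × ℝ) : ℝ × ℝ :=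
  Classical.epsilon (fun q => FlowsTo F θ Δ p q)

/-- The matrix `(a_{mn})` of the linearization of the Poincaré map (within slices) at `p`. -/
def jacobian (F : ℝ → ℝ → ℝ → ℝ) (θ : ℝ) (Δ : Real.Angle) (p : ℝ × ℝ) :
    Matrix (Fin 2) (Fin 2) ℝ :=
  let L := fderiv ℝ (poincare F θ Δ) p
  !![(L (1, 0)).1, (L (0, 1)).1; (L (1, 0)).2, (L (0, 1)).2]

/-- The solution with data `p` at `x = 0` collapses at `x = 2π`. -/
def CollapsesForward (F : ℝ → ℝ → ℝ → ℝ) (θ : ℝ) (Δ : Real.Angle) (p : ℝ × ℝ) : Prop :=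
  ∃ u w : ℝ → ℝ, IsSolutionOn F θ Δ u w (Ico 0 (2 * Real.pi)) ∧ (u 0, w 0) = p ∧
    Tendsto (fun x => |u x|) (𝓝[<] (2 * Real.pi)) atTop

/-- The solution with data `p` at `x = 0` collapses at `x = -2π`. -/
def CollapsesBackward (F : ℝ → ℝ → ℝ → ℝ) (θ : ℝ) (Δ : Real.Angle) (p : ℝ × ℝ) : Prop :=
  ∃ u w : ℝ → ℝ, IsSolutionOn F θ Δ u w (Ioc (-(2 * Real.pi)) 0) ∧ (u 0, w 0) = p ∧
    Tendsto (fun x => |u x|) (𝓝[>] (-(2 * Real.pi))) atTop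

/-! ### Arcs -/

/-- A type of (non-strict) monotonicity. -/
inductive MonoType where
  | increasing : MonoType
  | decreasing : MonoType

/-- The opposite type of monotonicity. -/
def MonoType.opposite : MonoType → MonoType
  | .increasing => .decreasing
  | .decreasing => .increasing

/-- A real function on a nondegenerate compact interval `[lo, hi]` (values of `f` outside the
interval are irrelevant). -/
structure Arc where
  lo : ℝ
  hi : ℝ
  lo_lt_hi : lo < hi
  f : ℝ → ℝ

namespace Arc

/-- The continuation of the function by constants outside `[lo, hi]`. -/
def ext (c : Arc) (t : ℝ) : ℝ := c.f (max c.lo (min c.hi t))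

/-- The curve `u' = f(u)` in the `(u, u')`-plane. -/
def hGraph (c : Arc) : Set (ℝ × ℝ) := {p | p.1 ∈ Icc c.lo c.hi ∧ p.2 = c.f p.1}

/-- The curve `u = f(u')` in the `(u, u')`-plane. -/
def vGraph (c : Arc) : Set (ℝ × ℝ) := {p | p.2 ∈ Icc c.lo c.hi ∧ p.1 = c.f p.2}

/-- The function has the given type of monotonicity. -/
def HasType (c : Arc) : MonoType → Prop
  | .increasing => MonotoneOn c.f (Icc c.lo c.hi)
  | .decreasing => AntitoneOn c.f (Icc c.lo c.hi)

/-- The function is `γ`-Lipschitz. -/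
def IsLipschitz (c : Arc) (γ : ℝ≥0) : Prop := LipschitzOnWith γ c.f (Icc c.lo c.hi)

/-- The thickness between two curves: the maximum of the distance between the continuations by
constants, over the smallest interval that contains both domains. -/
def thickness (c d : Arc) : ℝ :=
  sSup ((fun t => |d.ext t - c.ext t|) '' Icc (min c.lo d.lo) (max c.hi d.hi))

/-- A family of arcs depends continuously on the angle. -/
def IsContinuousFamily (c : Real.Angle → Arc) : Prop :=
  Continuous (fun Δ => (c Δ).lo) ∧ Continuous (fun Δ => (c Δ).hi) ∧
    ContinuousOn (fun q : Real.Angle × ℝ => (c q.1).f q.2)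
      {q | q.2 ∈ Icc (c q.1).lo (c q.1).hi}

end Arc

/-! ### Islands, donuts, strips -/

/-- The four sides of a curvilinear quadrangle: `αm` (lower) and `αp` (upper) are to be read as
curves `u' = h(u)`; `βm` (left) and `βp` (right) as curves `u = v(u')`. -/
structure Quadrangle where
  αm : Arc
  αp : Arc
  βm : Arc
  βp : Arc

/-- The open region enclosed by the four sides. -/
def Quadrangle.region (D : Quadrangle) : Set (ℝ × ℝ) :=
  {p | D.αm.ext p.1 < p.2 ∧ p.2 < D.αp.ext p.1 ∧ D.βm.ext p.2 < p.1 ∧ p.1 < D.βp.ext p.2}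

/-- `D` is a `γ`-island in the slice over `Δ`, whose `α`-borders have monotonicity type `τ`. -/
structure IsIsland (F : ℝ → ℝ → ℝ → ℝ) (θ : ℝ) (Δ : Real.Angle) (γ : ℝ≥0) (τ : MonoType)
    (D : Quadrangle) : Prop where
  /-- the four corners: bottom left, bottom right, top left, top right -/
  corner_bl : (D.αm.lo, D.αm.f D.αm.lo) = (D.βm.f D.βm.lo, D.βm.lo)
  corner_br : (D.αm.hi, D.αm.f D.αm.hi) = (D.βp.f D.βp.lo, D.βp.lo)
  corner_tl : (D.αp.lo, D.αp.f D.αp.lo) = (D.βm.f D.βm.hi, D.βm.hi)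
  corner_tr : (D.αp.hi, D.αp.f D.αp.hi) = (D.βp.f D.βp.hi, D.βp.hi)
  α_disjoint : Disjoint D.αm.hGraph D.αp.hGraph
  β_disjoint : Disjoint D.βm.vGraph D.βp.vGraph
  αm_lipschitz : D.αm.IsLipschitz γ
  αp_lipschitz : D.αp.IsLipschitz γ
  βm_lipschitz : D.βm.IsLipschitz γ
  βp_lipschitz : D.βp.IsLipschitz γ
  αm_type : D.αm.HasType τ
  αp_type : D.αp.HasType τ
  βm_type : D.βm.HasType τ.opposite
  βp_type : D.βp.HasType τ.opposite
  α_collapse : ∀ p ∈ D.αm.hGraph ∪ D.αp.hGraph, CollapsesBackward F θ Δ p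
  β_collapse : ∀ p ∈ D.βm.vGraph ∪ D.βp.vGraph, CollapsesForward F θ Δ p
  region_subset : D.region ⊆ forwardDomain F θ Δ ∩ backwardDomain F θ Δ

/-- The slices `D Δ` form a `γ`-donut: islands that deform continuously with `Δ` and keep their
monotonicity type. -/
structure IsDonut (F : ℝ → ℝ → ℝ → ℝ) (θ : ℝ) (γ : ℝ≥0) (τ : MonoType)
    (D : Real.Angle → Quadrangle) : Prop where
  island : ∀ Δ, IsIsland F θ Δ γ τ (D Δ)
  αm_cont : Arc.IsContinuousFamily (fun Δ => (D Δ).αm)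
  αp_cont : Arc.IsContinuousFamily (fun Δ => (D Δ).αp)
  βm_cont : Arc.IsContinuousFamily (fun Δ => (D Δ).βm)
  βp_cont : Arc.IsContinuousFamily (fun Δ => (D Δ).βp)

/-- A `γ`-donut set indexed by the alphabet `ι`, with islands of uniformly bounded
`h`-thickness and `v`-thickness. -/
structure IsBoundedDonutSet {ι : Type*} (F : ℝ → ℝ → ℝ → ℝ) (θ : ℝ) (γ : ℝ≥0) (τ : ι → MonoType)
    (D : ι → Real.Angle → Quadrangle) : Prop where
  donut : ∀ i, IsDonut F θ γ (τ i) (D i)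
  disjoint : ∀ i j, i ≠ j → ∀ Δ, Disjoint (D i Δ).region (D j Δ).region
  bounded : ∃ M : ℝ, ∀ i Δ, Arc.thickness (D i Δ).αm (D i Δ).αp ≤ M ∧
    Arc.thickness (D i Δ).βm (D i Δ).βp ≤ M

/-- `c` is an `h_γ`-curve of the island `D` of type `τ`: the graph of a `γ`-Lipschitz function of
type `τ`, running inside the closed island from one `β`-side to the other. -/
structure IsHCurve (γ : ℝ≥0) (τ : MonoType) (D : Quadrangle) (c : Arc) : Prop where
  lipschitz : c.IsLipschitz γ
  type : c.HasType τ
  left_mem : (c.lo, c.f c.lo) ∈ D.βm.vGraph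
  right_mem : (c.hi, c.f c.hi) ∈ D.βp.vGraph
  subset : c.hGraph ⊆ closure D.region

/-- `H` is the `h_γ`-strip of the island `D` of type `τ` that is bounded by the disjoint
`h_γ`-curves `c` (below) and `d` (above). -/
structure IsHStrip (γ : ℝ≥0) (τ : MonoType) (D : Quadrangle) (H : Set (ℝ × ℝ)) (c d : Arc) :
    Prop where
  lower : IsHCurve γ τ D c
  upper : IsHCurve γ τ D d
  below : ∀ t, c.ext t < d.ext t
  eq : H = {p ∈ D.region | c.ext p.1 < p.2 ∧ p.2 < d.ext p.1}

/-! ### Strip mapping -/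

/-- `V_{ij}(Δ)`: the points of the island `D` over `Δ` that the Poincaré map sends to `E`. -/
def transit (F : ℝ → ℝ → ℝ → ℝ) (θ : ℝ) (Δ : Real.Angle) (D E : Quadrangle) : Set (ℝ × ℝ) :=
  {p ∈ D.region | poincare F θ Δ p ∈ E.region}

/-- The sign patterns of the Jacobian that are allowed for `α`-borders of the source island of the
first type and `α`-borders of the target island of the second type. -/
def AllowedPattern : MonoType → MonoType → Matrix (Fin 2) (Fin 2) SignType → Prop
  | .increasing, .increasing, S => S = !![1, 1; 1, 1] ∨ S = !![-1, -1; -1, -1]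
  | .increasing, .decreasing, S => S = !![1, 1; -1, -1] ∨ S = !![-1, -1; 1, 1]
  | .decreasing, .decreasing, S => S = !![1, -1; -1, 1] ∨ S = !![-1, 1; 1, -1]
  | .decreasing, .increasing, S => S = !![1, -1; 1, -1] ∨ S = !![-1, 1; -1, 1]

/-- On the closure of `V_{ij}(Δ)`, which is not empty, the Poincaré map is defined and the entries
of its Jacobian have one and the same allowed strict sign pattern. -/
def SignCondition (F : ℝ → ℝ → ℝ → ℝ) (θ : ℝ) (Δ : Real.Angle) (τ τ' : MonoType)
    (D E : Quadrangle) : Prop :=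
  (transit F θ Δ D E).Nonempty ∧
  ∃ S, AllowedPattern τ τ' S ∧ ∀ p ∈ closure (transit F θ Δ D E),
    p ∈ forwardDomain F θ Δ ∧ (jacobian F θ Δ p).map SignType.sign = S

end StripMap

end

open StripMap

/-! Normal position. Reflecting `u'` in the islands with decreasing α-borders and, if necessary,
turning the target by π makes every allowed sign pattern all-positive
(`AllowedPattern.exists_sign`). Lower and upper sides then rise, left and right sides fall. The flow
preserves area (`det_fderiv_timeMap`), so after the reflections the determinant is `κ = ±1`. The
structure `Crossing` records what is used of the resulting map `Q` from the source to the target;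
`V` denotes the set of points of the source that `Q` sends into the target.

Passages. Along a rising leaf of the source the image of `V` moves to the right at rate at least `ρ`
and never down, whereas the leaves of the target that interpolate its left and right sides fall. The
closure of `V` contains no point of the β-sides of the source, where solutions collapse at `2π`, and
none with image on the α-sides of the target, where they collapse at `-2π`. Hence every passage of a
leaf through the target enters through its left side and leaves through its right side, with slope
at most `B * (1 + γ)` for a bound `B` of the linearizations.

One passage only. This is the topological core, `Crossing.false_of_two_crossings`. If a leaf passed
twice, its image between the passages could be closed up by a piece of a leaf of the target.
Solutions starting on this loop exist backwards for the time `2π`, while those starting at the two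
ends of a neighbouring leaf of the target collapse; carrying the loop along the backward flow shows
that it winds around neither end (`hasClosedLog_of_collapse`). But it crosses this neighbouring leaf
exactly once, so its winding numbers around the ends differ by one (`false_of_single_crossing`).
Consequently the label of the source leaf and the label of the target leaf are coordinates that
identify `V` with the open unit square (`Crossing.exists_isParam`); in particular `V` is connected.

The band. The image of `V` is swept out by rising curves with a common Lipschitz constant. Its
boundary curves are obtained as Lipschitz envelopes from below and from above, so no boundary values
of the parametrization are needed (`Sweep.exists_strip`). A strip of the source is itself a
quadrangle with the same β-sides, and `V` meets it because `V` reaches from the lower to the upper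
side (`Crossing.exists_mem_between`); the whole argument therefore applies to the strip.

Thickness. The inverse linearization is `κ` times the adjugate. On a path in the image that goes up
and to the left, the ordinate of the preimage changes at least `ρ` times as much as that of the
image, and the preimage goes up and left or down and right (`Crossing.pull_back`). Between rising
borders such a displacement has height at most the thickness of the strip.

Uniformity. The new Lipschitz constant only requires `B` to be independent of the angle
(`exists_uniform_bound`). This follows from compactness of the circle once the closures of the sets
`V` depend upper semicontinuously on the angle (`CrossingFamily.eventually_closure_subset`). That
rests on connectedness of `V` and on the fact that each of its points can be moved, by steps small
uniformly in the angle, to coordinates bounded away from the boundary of the square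
(`Crossing.exists_interior`). -/

noncomputable section

namespace StripMap

/-! ### Second-order equations with a parameter -/

/-- `u` (with velocity `w`) solves `u'' = g(t, δ, u)` on `s`. -/
def SolOn (g : ℝ → ℝ → ℝ → ℝ) (δ : ℝ) (u w : ℝ → ℝ) (s : Set ℝ) : Prop :=
  ∀ x ∈ s, HasDerivWithinAt u (w x) s x ∧ HasDerivWithinAt w (g x δ (u x)) s x

/-- The first-order system on triples `(u, w, δ)` that corresponds to `u'' = g(t, δ, u)`. -/
def field (g : ℝ → ℝ → ℝ → ℝ) (t : ℝ) (z : ℝ × ℝ × ℝ) : ℝ × ℝ × ℝ := (z.2.1, g t z.2.2 z.1, 0)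

/-- The coordinatewise retraction onto the sup-norm ball of radius `R`. -/
def clampBall (R : ℝ) (z : ℝ × ℝ × ℝ) : ℝ × ℝ × ℝ :=
  (max (-R) (min R z.1), max (-R) (min R z.2.1), max (-R) (min R z.2.2))

lemma abs_clamp_sub_le (R a b : ℝ) :
    |max (-R) (min R a) - max (-R) (min R b)| ≤ |a - b| :=
  (abs_max_sub_max_le_max _ _ _ _).trans <| by
    simpa using (abs_min_sub_min_le_max R a R b)

lemma abs_clamp_le {R : ℝ} (hR : 0 ≤ R) (a : ℝ) : |max (-R) (min R a)| ≤ R :=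
  abs_le.2 ⟨le_max_left _ _, max_le (by linarith) (min_le_left _ _)⟩

lemma clamp_eq_self {R a : ℝ} (h : |a| ≤ R) : max (-R) (min R a) = a := by
  rw [abs_le] at h
  rw [min_eq_right h.2, max_eq_right h.1]

lemma norm_triple_le {R : ℝ} {z : ℝ × ℝ × ℝ} :
    ‖z‖ ≤ R ↔ |z.1| ≤ R ∧ |z.2.1| ≤ R ∧ |z.2.2| ≤ R := by
  simp [Prod.norm_def]

lemma clampBall_lipschitz (R : ℝ) : LipschitzWith 1 (clampBall R) := by
  refine LipschitzWith.of_dist_le_mul fun z z' => ?_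
  simp only [NNReal.coe_one, one_mul, Prod.dist_eq, Real.dist_eq, clampBall]
  exact max_le_max (abs_clamp_sub_le _ _ _)
    (max_le_max (abs_clamp_sub_le _ _ _) (abs_clamp_sub_le _ _ _))

lemma clampBall_mem {R : ℝ} (hR : 0 ≤ R) (z : ℝ × ℝ × ℝ) :
    clampBall R z ∈ Metric.closedBall (0 : ℝ × ℝ × ℝ) R := by
  rw [mem_closedBall_zero_iff, norm_triple_le]
  exact ⟨abs_clamp_le hR _, abs_clamp_le hR _, abs_clamp_le hR _⟩

lemma clampBall_eq_self {R : ℝ} {z : ℝ × ℝ × ℝ} (h : ‖z‖ ≤ R) : clampBall R z = z := by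
  rw [norm_triple_le] at h
  simp [clampBall, clamp_eq_self h.1, clamp_eq_self h.2.1, clamp_eq_self h.2.2]

variable {g : ℝ → ℝ → ℝ → ℝ}

lemma field_lipschitzOn (hg : ContDiff ℝ 1 (fun z : ℝ × ℝ × ℝ => g z.1 z.2.1 z.2.2)) (T R : ℝ) :
    ∃ K : ℝ≥0, ∀ t ∈ Icc 0 T,
      LipschitzOnWith K (field g t) (Metric.closedBall (0 : ℝ × ℝ × ℝ) R) := by
  obtain ⟨K, hK⟩ := (hg.locallyLipschitz.locallyLipschitzOn
    (s := Icc 0 T ×ˢ Metric.closedBall (0 : ℝ × ℝ) R)).exists_lipschitzOnWith_of_compact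
    (isCompact_Icc.prod (isCompact_closedBall _ _))
  refine ⟨max 1 K, fun t ht => LipschitzOnWith.of_dist_le_mul fun z hz z' hz' => ?_⟩
  rw [mem_closedBall_zero_iff, norm_triple_le] at hz hz'
  have h := hK.dist_le_mul (t, z.2.2, z.1) ⟨ht, by simp [Prod.norm_def, hz]⟩
    (t, z'.2.2, z'.1) ⟨ht, by simp [Prod.norm_def, hz']⟩
  have hd : dist (t, z.2.2, z.1) (t, z'.2.2, z'.1) ≤ dist z z' := by
    simp only [Prod.dist_eq, dist_self]
    refine max_le (le_max_of_le_left dist_nonneg) (max_le ?_ (le_max_left _ _))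
    exact le_max_of_le_right (le_max_right _ _)
  have hw : dist z.2.1 z'.2.1 ≤ dist z z' := by
    simp only [Prod.dist_eq]; exact le_max_of_le_right (le_max_left _ _)
  have h0 : 0 ≤ dist z z' := dist_nonneg
  have h1 : (1 : ℝ) ≤ (max 1 K : ℝ≥0) := by exact_mod_cast le_max_left _ _
  have h2 : (K : ℝ) ≤ (max 1 K : ℝ≥0) := by exact_mod_cast le_max_right _ _
  have e : dist (field g t z) (field g t z')
      = max (dist z.2.1 z'.2.1) (max (dist (g t z.2.2 z.1) (g t z'.2.2 z'.1)) 0) := by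
    simp [field, Prod.dist_eq]
  rw [e]
  refine max_le (hw.trans (by nlinarith)) (max_le (h.trans ?_) (by positivity))
  calc (K : ℝ) * dist (t, z.2.2, z.1) (t, z'.2.2, z'.1) ≤ K * dist z z' := by gcongr
    _ ≤ _ := by gcongr

lemma SolOn.mono {δ : ℝ} {u w : ℝ → ℝ} {s t : Set ℝ} (h : SolOn g δ u w s) (hts : t ⊆ s) :
    SolOn g δ u w t :=
  fun x hx => ⟨(h x (hts hx)).1.mono hts, (h x (hts hx)).2.mono hts⟩

lemma SolOn.continuousOn {δ : ℝ} {u w : ℝ → ℝ} {s : Set ℝ} (h : SolOn g δ u w s) :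
    ContinuousOn (fun t => (u t, w t)) s :=
  ContinuousOn.prodMk (fun x hx => (h x hx).1.continuousWithinAt)
    fun x hx => (h x hx).2.continuousWithinAt

lemma SolOn.exists_bound {δ T : ℝ} {u w : ℝ → ℝ} (h : SolOn g δ u w (Icc 0 T)) :
    ∃ R, 0 ≤ R ∧ |δ| ≤ R ∧ ∀ t ∈ Icc 0 T, |u t| ≤ R ∧ |w t| ≤ R := by
  obtain ⟨C, hC⟩ := isCompact_Icc.exists_bound_of_continuousOn h.continuousOn
  refine ⟨max |δ| C, le_max_of_le_left (abs_nonneg _), le_max_left _ _, fun t ht => ?_⟩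
  have := hC t ht
  simp only [Prod.norm_def, Real.norm_eq_abs, max_le_iff] at this
  exact ⟨this.1.trans (le_max_right _ _), this.2.trans (le_max_right _ _)⟩

lemma SolOn.hasDerivWithinAt_Ici {δ T : ℝ} {u w : ℝ → ℝ} (h : SolOn g δ u w (Icc 0 T)) {t : ℝ}
    (ht : t ∈ Ico 0 T) :
    HasDerivWithinAt (fun t => (u t, w t, δ)) (field g t (u t, w t, δ)) (Ici t) t := by
  have h1 := h t ⟨ht.1, ht.2.le⟩
  have hm : Icc (0 : ℝ) T ∈ 𝓝[≥] t :=
    mem_of_superset (Icc_mem_nhdsGE ht.2) (Icc_subset_Icc_left ht.1)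
  exact (h1.1.mono_of_mem_nhdsWithin hm).prodMk
    ((h1.2.mono_of_mem_nhdsWithin hm).prodMk (hasDerivWithinAt_const _ _ _))

/-- Grönwall's estimate for solutions inside a box, with a constant that only depends on the
box. -/
lemma SolOn.gronwall (hg : ContDiff ℝ 1 (fun z : ℝ × ℝ × ℝ => g z.1 z.2.1 z.2.2)) (T R : ℝ) :
    ∃ K : ℝ, 1 ≤ K ∧ ∀ S ≤ T, ∀ δ δ' : ℝ, ∀ u w u' w' : ℝ → ℝ,
      SolOn g δ u w (Icc 0 S) → SolOn g δ' u' w' (Icc 0 S) → |δ| ≤ R → |δ'| ≤ R →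
      (∀ t ∈ Ico 0 S, |u t| ≤ R ∧ |w t| ≤ R) → (∀ t ∈ Ico 0 S, |u' t| ≤ R ∧ |w' t| ≤ R) →
      ∀ t ∈ Icc 0 S, dist (u t, w t, δ) (u' t, w' t, δ') ≤
        K * dist (u 0, w 0, δ) (u' 0, w' 0, δ') := by
  obtain ⟨K, hK⟩ := field_lipschitzOn hg T R
  refine ⟨Real.exp (K * max T 0), Real.one_le_exp (by positivity), ?_⟩
  intro S hS δ δ' u w u' w' h h' hδ hδ' hb hb' t ht
  have hc : ∀ {δ : ℝ} {u w : ℝ → ℝ}, SolOn g δ u w (Icc 0 S) →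
      ContinuousOn (fun t => (u t, w t, δ)) (Icc 0 S) := fun h =>
    (continuous_fst.comp_continuousOn h.continuousOn).prodMk
      ((continuous_snd.comp_continuousOn h.continuousOn).prodMk continuousOn_const)
  have key := dist_le_of_trajectories_ODE_of_mem (v := field g)
    (s := fun _ => Metric.closedBall (0 : ℝ × ℝ × ℝ) R) (K := K)
    (f := fun t => (u t, w t, δ)) (g := fun t => (u' t, w' t, δ')) (a := 0) (b := S)
    (δ := dist (u 0, w 0, δ) (u' 0, w' 0, δ'))
    (fun t ht => hK t ⟨ht.1, ht.2.le.trans hS⟩) (hc h)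
    (fun t ht => h.hasDerivWithinAt_Ici ht)
    (fun t ht => by
      rw [mem_closedBall_zero_iff, norm_triple_le]; exact ⟨(hb t ht).1, (hb t ht).2, hδ⟩)
    (hc h') (fun t ht => h'.hasDerivWithinAt_Ici ht)
    (fun t ht => by
      rw [mem_closedBall_zero_iff, norm_triple_le]; exact ⟨(hb' t ht).1, (hb' t ht).2, hδ'⟩)
    le_rfl t ht
  refine key.trans ?_
  rw [mul_comm]
  gcongr
  linarith [ht.2, le_max_left T 0]

/-- Two solutions with the same initial data coincide. -/
lemma SolOn.unique (hg : ContDiff ℝ 1 (fun z : ℝ × ℝ × ℝ => g z.1 z.2.1 z.2.2)) {δ T : ℝ}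
    {u w u' w' : ℝ → ℝ} (h : SolOn g δ u w (Icc 0 T)) (h' : SolOn g δ u' w' (Icc 0 T))
    (h0 : (u 0, w 0) = (u' 0, w' 0)) : ∀ t ∈ Icc 0 T, (u t, w t) = (u' t, w' t) := by
  intro t ht
  obtain ⟨R, -, hδ, hR⟩ := h.exists_bound
  obtain ⟨R', -, hδ', hR'⟩ := h'.exists_bound
  obtain ⟨K, -, hK⟩ := SolOn.gronwall hg T (max R R')
  simp only [Prod.mk.injEq] at h0
  have := hK T le_rfl δ δ u w u' w' h h' (hδ.trans (le_max_left _ _)) (hδ.trans (le_max_left _ _))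
    (fun t ht => ⟨(hR t ⟨ht.1, ht.2.le⟩).1.trans (le_max_left _ _),
      (hR t ⟨ht.1, ht.2.le⟩).2.trans (le_max_left _ _)⟩)
    (fun t ht => ⟨(hR' t ⟨ht.1, ht.2.le⟩).1.trans (le_max_right _ _),
      (hR' t ⟨ht.1, ht.2.le⟩).2.trans (le_max_right _ _)⟩) t ht
  rw [h0.1, h0.2, dist_self, mul_zero] at this
  have := dist_le_zero.1 this
  simp only [Prod.mk.injEq] at this ⊢
  exact ⟨this.1, this.2.1⟩

/-- Lipschitz dependence on parameter and initial data near a given solution. -/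
theorem SolOn.exists_nearby (hg : ContDiff ℝ 1 (fun z : ℝ × ℝ × ℝ => g z.1 z.2.1 z.2.2))
    {δ₀ T : ℝ} (hT : 0 ≤ T) {u₀ w₀ : ℝ → ℝ} (h₀ : SolOn g δ₀ u₀ w₀ (Icc 0 T)) :
    ∃ ε > 0, ∃ K : ℝ, 1 ≤ K ∧
      (∀ δ (p : ℝ × ℝ), dist (p.1, p.2, δ) (u₀ 0, w₀ 0, δ₀) < ε →
        ∃ u w, SolOn g δ u w (Icc 0 T) ∧ (u 0, w 0) = p) ∧
      ∀ δ δ' : ℝ, ∀ u w u' w' : ℝ → ℝ,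
        SolOn g δ u w (Icc 0 T) → SolOn g δ' u' w' (Icc 0 T) →
        dist (u 0, w 0, δ) (u₀ 0, w₀ 0, δ₀) < ε → dist (u' 0, w' 0, δ') (u₀ 0, w₀ 0, δ₀) < ε →
        ∀ t ∈ Icc 0 T, dist (u t, w t, δ) (u' t, w' t, δ') ≤
          K * dist (u 0, w 0, δ) (u' 0, w' 0, δ') := by
  obtain ⟨R₀, hR₀, hδ₀, hb₀⟩ := h₀.exists_bound
  set R := R₀ + 1 with hR
  obtain ⟨K, hK1, hK⟩ := SolOn.gronwall hg T R
  have hK0 : 0 < K := by linarith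
  obtain ⟨L, hL⟩ := field_lipschitzOn hg T R
  have hK0 : 0 < K := by linarith
  -- Distances grow at most by the factor `exp (L * T)`, so data within `ε` of the reference data
  -- stay within distance 1 of the reference solution, hence in the box of radius `R = R₀ + 1`,
  -- where clamping changes nothing.
  set ε := Real.exp (-(L * T)) with hε
  have hεpos : 0 < ε := Real.exp_pos _
  have hε1 : ε ≤ 1 := Real.exp_le_one_iff.2 (by have := L.2; simp only [neg_nonpos]; positivity)
  have hexist : ∀ δ (p : ℝ × ℝ), dist (p.1, p.2, δ) (u₀ 0, w₀ 0, δ₀) < ε →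
      ∃ u w, SolOn g δ u w (Icc 0 T) ∧ (u 0, w 0) = p ∧
        ∀ t ∈ Icc 0 T, |u t| ≤ R ∧ |w t| ≤ R := by
    intro δ p hp
    have hcont : Continuous (fun q : ℝ × (ℝ × ℝ × ℝ) => field g q.1 (clampBall R q.2)) := by
      have h1 : Continuous fun q : ℝ × (ℝ × ℝ × ℝ) =>
        (q.1, (clampBall R q.2).2.2, (clampBall R q.2).1) := by
        have := (clampBall_lipschitz R).continuous
        fun_prop
      have h2 := hg.continuous.comp h1
      have := (clampBall_lipschitz R).continuous
      refine Continuous.prodMk (by fun_prop) (Continuous.prodMk h2 continuous_const)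
    have hR0 : 0 ≤ R := by linarith
    have hv : ∀ t ∈ Icc 0 T, LipschitzWith L (fun z => field g t (clampBall R z)) := by
      intro t ht
      rw [← lipschitzOnWith_univ]
      have := (hL t ht).comp ((clampBall_lipschitz R).lipschitzOnWith (s := univ))
        (fun z _ => clampBall_mem hR0 z)
      simpa using! this
    obtain ⟨M, hM⟩ : ∃ M : ℝ, ∀ t ∈ Icc 0 T, ∀ z, ‖field g t (clampBall R z)‖ ≤ M := by
      have hc2 : Continuous (fun q : ℝ × (ℝ × ℝ × ℝ) => field g q.1 q.2) := by
        have h2 := hg.continuous.comp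
          (by fun_prop : Continuous fun q : ℝ × (ℝ × ℝ × ℝ) => (q.1, q.2.2.2, q.2.1))
        exact Continuous.prodMk (by fun_prop) (Continuous.prodMk h2 continuous_const)
      obtain ⟨M, hM⟩ := (isCompact_Icc.prod
        (isCompact_closedBall (0 : ℝ × ℝ × ℝ) R)).exists_bound_of_continuousOn
        (s := Icc 0 T ×ˢ Metric.closedBall (0 : ℝ × ℝ × ℝ) R) hc2.continuousOn
      exact ⟨M, fun t ht z => hM (t, clampBall R z) ⟨ht, clampBall_mem hR0 z⟩⟩
    have hM0 : 0 ≤ M := (norm_nonneg _).trans (hM 0 ⟨le_rfl, hT⟩ 0)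
    -- The clamped field is globally Lipschitz and bounded by `M`, so Picard–Lindelöf on a ball of
    -- radius `M * T` reaches all of `[0, T]`.
    have hPL : IsPicardLindelof (fun t z => field g t (clampBall R z))
        (⟨0, le_rfl, hT⟩ : Icc (0 : ℝ) T) (p.1, p.2, δ) (⟨M * T, by positivity⟩) 0 ⟨M, hM0⟩ L := by
      refine ⟨fun t ht => (hv t ht).lipschitzOnWith, fun z _ => ?_, fun t ht z _ => hM t ht z, ?_⟩
      · exact (hcont.comp (by fun_prop : Continuous fun t : ℝ => (t, z))).continuousOn
      · simp only [sub_zero, sub_self, NNReal.coe_zero]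
        rw [max_eq_left hT]; exact le_rfl
    obtain ⟨α, hα0, hα⟩ := hPL.exists_eq_forall_mem_Icc_hasDerivWithinAt₀
    have hαc : ContinuousOn α (Icc 0 T) := fun t ht => (hα t ht).continuousWithinAt
    have hα2 : ∀ t ∈ Icc 0 T, (α t).2.2 = δ := by
      have hd : ∀ t ∈ Ico (0:ℝ) T, HasDerivWithinAt (fun t => (α t).2.2) 0 (Ici t) t := by
        intro t ht
        have h1 := hα t ⟨ht.1, ht.2.le⟩
        have hm : Icc (0 : ℝ) T ∈ 𝓝[≥] t :=
          mem_of_superset (Icc_mem_nhdsGE ht.2) (Icc_subset_Icc_left ht.1)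
        have h2 := (h1.mono_of_mem_nhdsWithin hm).hasFDerivWithinAt.snd.snd.hasDerivWithinAt
        simpa [field] using h2
      have hc : ContinuousOn (fun t => (α t).2.2) (Icc 0 T) := by fun_prop
      intro t ht
      have := constant_of_has_deriv_right_zero hc hd t ht
      rw [this]
      simp only [] at hα0
      rw [hα0]
    have hdist : ∀ t ∈ Icc 0 T, dist (α t) (u₀ t, w₀ t, δ₀) ≤
        dist (α 0) (u₀ 0, w₀ 0, δ₀) * Real.exp (L * (t - 0)) := by
      refine dist_le_of_trajectories_ODE_of_mem (v := fun t z => field g t (clampBall R z))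
        (s := fun _ => univ) (K := L) (fun t ht => (hv t ⟨ht.1, ht.2.le⟩).lipschitzOnWith)
        hαc ?_ (fun _ _ => mem_univ _) (g := fun t => (u₀ t, w₀ t, δ₀)) ?_ ?_
        (fun _ _ => mem_univ _) le_rfl
      · intro t ht
        exact (hα t ⟨ht.1, ht.2.le⟩).mono_of_mem_nhdsWithin
          (mem_of_superset (Icc_mem_nhdsGE ht.2) (Icc_subset_Icc_left ht.1))
      · exact (continuous_fst.comp_continuousOn h₀.continuousOn).prodMk
          ((continuous_snd.comp_continuousOn h₀.continuousOn).prodMk continuousOn_const)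
      · intro t ht
        have hb := hb₀ t ⟨ht.1, ht.2.le⟩
        rw [clampBall_eq_self (norm_triple_le.2
          ⟨by linarith [hb.1], by linarith [hb.2], by linarith⟩)]
        exact h₀.hasDerivWithinAt_Ici ht
    have hδR : |δ| ≤ R := by
      have h1 : dist δ δ₀ < 1 := by
        refine lt_of_le_of_lt ?_ (hp.trans_le hε1)
        simp only [Prod.dist_eq]; exact le_max_of_le_right (le_max_right _ _)
      rw [Real.dist_eq] at h1
      calc |δ| = |(δ - δ₀) + δ₀| := by ring_nf
        _ ≤ |δ - δ₀| + |δ₀| := abs_add_le _ _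
        _ ≤ R := by linarith
    have hbox : ∀ t ∈ Icc 0 T, |(α t).1| ≤ R ∧ |(α t).2.1| ≤ R := by
      intro t ht
      have h1 : dist (α t) (u₀ t, w₀ t, δ₀) ≤ 1 := by
        refine (hdist t ht).trans ?_
        simp only [] at hα0
        rw [hα0]
        calc _ ≤ ε * Real.exp (L * T) := by
              gcongr
              simpa using ht.2
          _ = 1 := by rw [hε, ← Real.exp_add]; simp
      have hb := hb₀ t ht
      simp only [Prod.dist_eq, max_le_iff, Real.dist_eq] at h1
      constructor
      · calc |(α t).1| = |((α t).1 - u₀ t) + u₀ t| := by ring_nf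
          _ ≤ |(α t).1 - u₀ t| + |u₀ t| := abs_add_le _ _
          _ ≤ R := by linarith [h1.1, hb.1]
      · calc |(α t).2.1| = |((α t).2.1 - w₀ t) + w₀ t| := by ring_nf
          _ ≤ |(α t).2.1 - w₀ t| + |w₀ t| := abs_add_le _ _
          _ ≤ R := by linarith [h1.2.1, hb.2]
    refine ⟨fun t => (α t).1, fun t => (α t).2.1, fun t ht => ?_, ?_, hbox⟩
    · have h1 := hα t ht
      rw [clampBall_eq_self (norm_triple_le.2
        ⟨(hbox t ht).1, (hbox t ht).2, by rw [hα2 t ht]; exact hδR⟩)] at h1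
      have h2 := h1.hasFDerivWithinAt.fst.hasDerivWithinAt
      have h3 := h1.hasFDerivWithinAt.snd.fst.hasDerivWithinAt
      rw [← hα2 t ht]
      exact ⟨by simpa [field] using h2, by simpa [field] using h3⟩
    · simp only [] at hα0
      simp [hα0]
  refine ⟨ε, hεpos, K, hK1, fun δ p hp => ?_, ?_⟩
  · obtain ⟨u, w, h1, h2, -⟩ := hexist δ p hp
    exact ⟨u, w, h1, h2⟩
  · have hbd : ∀ {δ : ℝ} {u w : ℝ → ℝ}, SolOn g δ u w (Icc 0 T) →
        dist (u 0, w 0, δ) (u₀ 0, w₀ 0, δ₀) < ε →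
        |δ| ≤ R ∧ ∀ t ∈ Ico 0 T, |u t| ≤ R ∧ |w t| ≤ R := by
      intro δ u w h hd
      -- By uniqueness an arbitrary solution with these data is the constructed one and inherits its
      -- bounds.
      obtain ⟨u', w', h', h0', hb'⟩ := hexist δ (u 0, w 0) hd
      refine ⟨?_, fun t ht => ?_⟩
      · have h1 : dist δ δ₀ < 1 := by
          refine lt_of_le_of_lt ?_ (hd.trans_le hε1)
          simp only [Prod.dist_eq]; exact le_max_of_le_right (le_max_right _ _)
        rw [Real.dist_eq] at h1
        calc |δ| = |(δ - δ₀) + δ₀| := by ring_nf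
          _ ≤ |δ - δ₀| + |δ₀| := abs_add_le _ _
          _ ≤ R := by linarith
      · have := SolOn.unique hg h h' h0'.symm t ⟨ht.1, ht.2.le⟩
        simp only [Prod.mk.injEq] at this
        rw [this.1, this.2]
        exact hb' t ⟨ht.1, ht.2.le⟩
    intro δ δ' u w u' w' h h' hd hd' t ht
    exact hK T le_rfl δ δ' u w u' w' h h' (hbd h hd).1 (hbd h' hd').1 (hbd h hd).2 (hbd h' hd').2
      t ht

end StripMap
end

/-! ### The time map: domain, Lipschitz dependence, preservation of area. -/

noncomputable section

namespace StripMap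

variable {g : ℝ → ℝ → ℝ → ℝ}

/-- The solution of `u'' = g(t, δ, u)` with data `p` at `0` exists on `[0, T]` and has data `q`
at `T`. -/
def Reaches (g : ℝ → ℝ → ℝ → ℝ) (T δ : ℝ) (p q : ℝ × ℝ) : Prop :=
  ∃ u w : ℝ → ℝ, SolOn g δ u w (Icc 0 T) ∧ (u 0, w 0) = p ∧ (u T, w T) = q

/-- The map that sends the data at `0` to the data at `T`. -/
def timeMap (g : ℝ → ℝ → ℝ → ℝ) (T δ : ℝ) (p : ℝ × ℝ) : ℝ × ℝ :=
  Classical.epsilon (fun q => Reaches g T δ p q)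

/-- The pairs of a parameter and initial data for which the solution exists on `[0, T]`. -/
def flowDomain (g : ℝ → ℝ → ℝ → ℝ) (T : ℝ) : Set (ℝ × ℝ × ℝ) :=
  {x | ∃ q, Reaches g T x.1 x.2 q}

lemma reaches_timeMap {T δ : ℝ} {p : ℝ × ℝ} (h : (δ, p) ∈ flowDomain g T) :
    Reaches g T δ p (timeMap g T δ p) :=
  Classical.epsilon_spec h

lemma SolOn.mem_flowDomain {T δ : ℝ} {u w : ℝ → ℝ} (h : SolOn g δ u w (Icc 0 T)) :
    (δ, u 0, w 0) ∈ flowDomain g T :=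
  ⟨_, u, w, h, rfl, rfl⟩

lemma Reaches.timeMap_eq (hg : ContDiff ℝ 1 (fun z : ℝ × ℝ × ℝ => g z.1 z.2.1 z.2.2))
    {T δ : ℝ} (hT : 0 ≤ T) {p q : ℝ × ℝ} (h : Reaches g T δ p q) : timeMap g T δ p = q := by
  obtain ⟨u, w, hs, h0, hq⟩ := h
  obtain ⟨u', w', hs', h0', hq'⟩ := reaches_timeMap (g := g) (T := T) (δ := δ) (p := p)
    ⟨q, u, w, hs, h0, hq⟩
  rw [← hq, ← hq']
  exact SolOn.unique hg hs' hs (h0'.trans h0.symm) T ⟨hT, le_rfl⟩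

lemma SolOn.timeMap_eq (hg : ContDiff ℝ 1 (fun z : ℝ × ℝ × ℝ => g z.1 z.2.1 z.2.2))
    {T δ : ℝ} (hT : 0 ≤ T) {u w : ℝ → ℝ} (h : SolOn g δ u w (Icc 0 T)) :
    timeMap g T δ (u 0, w 0) = (u T, w T) :=
  Reaches.timeMap_eq hg hT ⟨u, w, h, rfl, rfl⟩

lemma dist_assoc_comm (δ δ' : ℝ) (p p' : ℝ × ℝ) :
    dist (p.1, p.2, δ) (p'.1, p'.2, δ') = dist (δ, p) (δ', p') := by
  simp only [Prod.dist_eq]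
  rw [← max_assoc, max_comm]

/-- The time map is locally Lipschitz, jointly in the parameter and the data. -/
lemma exists_lipschitz_timeMap (hg : ContDiff ℝ 1 (fun z : ℝ × ℝ × ℝ => g z.1 z.2.1 z.2.2))
    {T : ℝ} (hT : 0 ≤ T) {x : ℝ × ℝ × ℝ} (hx : x ∈ flowDomain g T) :
    ∃ ε > 0, ∃ K : ℝ≥0, Metric.ball x ε ⊆ flowDomain g T ∧
      LipschitzOnWith K (fun y => timeMap g T y.1 y.2) (Metric.ball x ε) := by
  obtain ⟨δ₀, p₀⟩ := x
  obtain ⟨q, u₀, w₀, h₀, h₀0, -⟩ := hx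
  obtain ⟨ε, hε, K, hK1, hex, hlip⟩ := SolOn.exists_nearby hg hT h₀
  simp only [] at h₀0
  subst h₀0
  have hex' : ∀ y ∈ Metric.ball (δ₀, u₀ 0, w₀ 0) ε,
      ∃ u w, SolOn g y.1 u w (Icc 0 T) ∧ (u 0, w 0) = y.2 := by
    intro y hy
    refine hex y.1 y.2 ?_
    have := dist_assoc_comm y.1 δ₀ y.2 (u₀ 0, w₀ 0)
    simp only [] at this
    rw [this]
    exact hy
  refine ⟨ε, hε, ⟨K, by linarith⟩, fun y hy => ?_, LipschitzOnWith.of_dist_le_mul ?_⟩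
  · obtain ⟨u, w, h, h0⟩ := hex' y hy
    exact ⟨_, u, w, h, h0, rfl⟩
  · intro y hy z hz
    obtain ⟨u, w, h, h0⟩ := hex' y hy
    obtain ⟨u', w', h', h0'⟩ := hex' z hz
    obtain ⟨δ, p⟩ := y
    obtain ⟨δ', p'⟩ := z
    simp only [] at h0 h0' h h' ⊢
    subst h0 h0'
    rw [SolOn.timeMap_eq hg hT h, SolOn.timeMap_eq hg hT h']
    have e := dist_assoc_comm δ δ' (u 0, w 0) (u' 0, w' 0)
    have e1 := dist_assoc_comm δ δ₀ (u 0, w 0) (u₀ 0, w₀ 0)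
    have e2 := dist_assoc_comm δ' δ₀ (u' 0, w' 0) (u₀ 0, w₀ 0)
    simp only [] at e e1 e2
    change _ ≤ K * _
    rw [← e]
    refine le_trans ?_ (hlip δ δ' u w u' w' h h' (e1 ▸ hy) (e2 ▸ hz) T ⟨hT, le_rfl⟩)
    simp only [Prod.dist_eq]
    exact max_le_max le_rfl (le_max_left _ _)

lemma isOpen_flowDomain (hg : ContDiff ℝ 1 (fun z : ℝ × ℝ × ℝ => g z.1 z.2.1 z.2.2))
    {T : ℝ} (hT : 0 ≤ T) : IsOpen (flowDomain g T) := by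
  rw [Metric.isOpen_iff]
  intro x hx
  obtain ⟨ε, hε, -, h, -⟩ := exists_lipschitz_timeMap hg hT hx
  exact ⟨ε, hε, h⟩

lemma continuousAt_timeMap (hg : ContDiff ℝ 1 (fun z : ℝ × ℝ × ℝ => g z.1 z.2.1 z.2.2))
    {T : ℝ} (hT : 0 ≤ T) {x : ℝ × ℝ × ℝ} (hx : x ∈ flowDomain g T) :
    ContinuousAt (fun y : ℝ × ℝ × ℝ => timeMap g T y.1 y.2) x := by
  obtain ⟨ε, hε, K, -, h⟩ := exists_lipschitz_timeMap hg hT hx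
  exact h.continuousOn.continuousAt (Metric.ball_mem_nhds _ hε)

lemma hasDerivAt_snd_arg (hg : ContDiff ℝ 1 (fun z : ℝ × ℝ × ℝ => g z.1 z.2.1 z.2.2))
    (t δ v : ℝ) : HasDerivAt (g t δ)
      (fderiv ℝ (fun z : ℝ × ℝ × ℝ => g z.1 z.2.1 z.2.2) (t, δ, v) (0, 0, 1)) v := by
  have h1 : HasDerivAt (fun v : ℝ => (t, δ, v)) ((0 : ℝ), (0 : ℝ), (1 : ℝ)) v :=
    (hasDerivAt_const _ _).prodMk ((hasDerivAt_const _ _).prodMk (hasDerivAt_id _))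
  have h2 := (hg.differentiable one_ne_zero (t, δ, v)).hasFDerivAt
  exact h2.comp_hasDerivAt v h1

lemma exists_slope_eq {f f' : ℝ → ℝ} (hf : ∀ v, HasDerivAt f (f' v) v) (a b : ℝ) :
    ∃ ξ ∈ uIcc a b, f b - f a = f' ξ * (b - a) := by
  rcases lt_trichotomy a b with h | rfl | h
  · obtain ⟨c, hc, e⟩ := exists_hasDerivAt_eq_slope f f' h
      (fun x _ => (hf x).continuousAt.continuousWithinAt) (fun x _ => hf x)
    refine ⟨c, Icc_subset_uIcc ⟨hc.1.le, hc.2.le⟩, ?_⟩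
    rw [e, div_mul_cancel₀ _ (by linarith)]
  · exact ⟨a, left_mem_uIcc, by simp⟩
  · obtain ⟨c, hc, e⟩ := exists_hasDerivAt_eq_slope f f' h
      (fun x _ => (hf x).continuousAt.continuousWithinAt) (fun x _ => hf x)
    refine ⟨c, Icc_subset_uIcc' ⟨hc.1.le, hc.2.le⟩, ?_⟩
    have : a - b ≠ 0 := by linarith
    rw [e]; field_simp; ring

/-- The Wronskian of two small displacements is nearly constant. -/
lemma wronskian_estimate (hg : ContDiff ℝ 1 (fun z : ℝ × ℝ × ℝ => g z.1 z.2.1 z.2.2))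
    {T δ : ℝ} {u w : ℝ → ℝ} (h : SolOn g δ u w (Icc 0 T)) {η : ℝ} (hη : 0 < η) :
    ∃ r > 0, ∀ u₁ w₁ u₂ w₂ : ℝ → ℝ, SolOn g δ u₁ w₁ (Icc 0 T) → SolOn g δ u₂ w₂ (Icc 0 T) →
      ∀ m, (∀ t ∈ Icc 0 T, |u₁ t - u t| ≤ m) → (∀ t ∈ Icc 0 T, |u₂ t - u t| ≤ m) → m < r →
      ∀ t ∈ Icc 0 T,
        |((u₁ t - u t) * (w₂ t - w t) - (w₁ t - w t) * (u₂ t - u t)) -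
          ((u₁ 0 - u 0) * (w₂ 0 - w 0) - (w₁ 0 - w 0) * (u₂ 0 - u 0))| ≤ η * m ^ 2 * t := by
  obtain ⟨R, hR0, hδ, hR⟩ := h.exists_bound
  set dg : ℝ × ℝ → ℝ := fun q =>
    fderiv ℝ (fun z : ℝ × ℝ × ℝ => g z.1 z.2.1 z.2.2) (q.1, δ, q.2) (0, 0, 1) with hdg
  have hdgc : Continuous dg := by
    have h1 := (hg.continuous_fderiv one_ne_zero).comp
      (by fun_prop : Continuous fun q : ℝ × ℝ => (q.1, δ, q.2))
    exact h1.clm_apply continuous_const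
  have huc := (isCompact_Icc.prod (isCompact_Icc (a := -(R + 1)) (b := R + 1))
    ).uniformContinuousOn_of_continuous (s := Icc 0 T ×ˢ Icc (-(R + 1)) (R + 1)) hdgc.continuousOn
  obtain ⟨r, hr, hr'⟩ := Metric.uniformContinuousOn_iff.1 huc η hη
  refine ⟨min (r / 2) 1, by positivity, fun u₁ w₁ u₂ w₂ h₁ h₂ m hm₁ hm₂ hm t ht => ?_⟩
  have hmr : m < r / 2 := hm.trans_le (min_le_left _ _)
  have hm1 : m < 1 := hm.trans_le (min_le_right _ _)
  -- In the derivative of the Wronskian the products of velocities cancel. By the mean value theorem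
  -- the rest is the difference of two values of `∂g/∂u` at nearby points times the product of the
  -- displacements, hence at most `η * m ^ 2`.
  have key := norm_image_sub_le_of_norm_deriv_le_segment'
    (f := fun t => (u₁ t - u t) * (w₂ t - w t) - (w₁ t - w t) * (u₂ t - u t))
    (f' := fun t => (u₁ t - u t) * (g t δ (u₂ t) - g t δ (u t)) -
      (g t δ (u₁ t) - g t δ (u t)) * (u₂ t - u t)) (a := 0) (b := T) (C := η * m ^ 2) ?_ ?_ t ht
  · simpa using key
  · intro x hx
    have d := h x hx
    have d1 := h₁ x hx
    have d2 := h₂ x hx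
    refine (((d1.1.sub d.1).mul (d2.2.sub d.2)).sub
      ((d1.2.sub d.2).mul (d2.1.sub d.1))).congr_deriv ?_
    simp only [Pi.sub_apply]
    ring
  · intro x hx
    have hx' : x ∈ Icc 0 T := ⟨hx.1, hx.2.le⟩
    have hm1x := hm₁ x hx'
    have hm2x := hm₂ x hx'
    have hmem : ∀ v, |v - u x| ≤ m → ∀ ξ ∈ uIcc (u x) v,
        (x, ξ) ∈ Icc 0 T ×ˢ Icc (-(R + 1)) (R + 1) ∧ |ξ - u x| ≤ m := by
      intro v hv ξ hξ
      have h1 : |ξ - u x| ≤ m := (abs_sub_left_of_mem_uIcc hξ).trans hv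
      have h2 := (hR x hx').1
      rw [abs_le] at h2 
      have h3 := abs_le.1 h1
      exact ⟨⟨hx', by constructor <;> simp only <;> linarith⟩, h1⟩
    obtain ⟨ξ₁, hξ₁, e₁⟩ := exists_slope_eq (fun v => hasDerivAt_snd_arg hg x δ v) (u x) (u₁ x)
    obtain ⟨ξ₂, hξ₂, e₂⟩ := exists_slope_eq (fun v => hasDerivAt_snd_arg hg x δ v) (u x) (u₂ x)
    obtain ⟨k1, k1'⟩ := hmem _ hm1x ξ₁ hξ₁
    obtain ⟨k2, k2'⟩ := hmem _ hm2x ξ₂ hξ₂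
    have hd : dist (x, ξ₂) (x, ξ₁) < r := by
      rw [Prod.dist_eq, dist_self, max_lt_iff, Real.dist_eq]
      refine ⟨hr, ?_⟩
      rw [abs_le] at k1' k2'
      rw [abs_lt]; constructor <;> linarith
    have := hr' _ k2 _ k1 hd
    rw [Real.dist_eq] at this
    rw [Real.norm_eq_abs, e₁, e₂]
    have e : (u₁ x - u x) * (dg (x, ξ₂) * (u₂ x - u x)) - dg (x, ξ₁) * (u₁ x - u x) * (u₂ x - u x)
      = (dg (x, ξ₂) - dg (x, ξ₁)) * ((u₁ x - u x) * (u₂ x - u x)) := by ring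
    simp only [hdg] at e this
    have hm0 : 0 ≤ m := (abs_nonneg _).trans hm1x
    rw [e, abs_mul, abs_mul, sq]
    gcongr

/-- The linearization of the time map preserves area. -/
theorem det_fderiv_timeMap (hg : ContDiff ℝ 1 (fun z : ℝ × ℝ × ℝ => g z.1 z.2.1 z.2.2))
    {T δ : ℝ} (hT : 0 ≤ T) {p : ℝ × ℝ} (hp : (δ, p) ∈ flowDomain g T)
    {L : ℝ × ℝ →L[ℝ] ℝ × ℝ} (hL : HasFDerivAt (timeMap g T δ) L p) :
    (L (1, 0)).1 * (L (0, 1)).2 - (L (1, 0)).2 * (L (0, 1)).1 = 1 := by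
  obtain ⟨-, u, w, h, h0, -⟩ := hp
  simp only [] at h h0
  subst h0
  obtain ⟨ε, hε, K, hK1, hex, hlip⟩ := SolOn.exists_nearby hg hT h
  set P := timeMap g T δ with hP
  set p : ℝ × ℝ := (u 0, w 0) with hp
  -- Differentiability is only given at one point, so the determinant is computed as a limit of
  -- Wronskians of difference quotients instead of through the variational equation.
  have hlim : ∀ e : ℝ × ℝ, Tendsto (fun s : ℝ => s⁻¹ • (P (p + s • e) - P p)) (𝓝[>] 0) (𝓝 (L e)) :=
    fun e => (hL.hasLineDerivAt e).tendsto_slope_zero_right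
  have hW : Tendsto (fun s : ℝ =>
      (s⁻¹ • (P (p + s • ((1 : ℝ), (0 : ℝ))) - P p)).1 *
        (s⁻¹ • (P (p + s • ((0 : ℝ), (1 : ℝ))) - P p)).2 -
      (s⁻¹ • (P (p + s • ((1 : ℝ), (0 : ℝ))) - P p)).2 *
        (s⁻¹ • (P (p + s • ((0 : ℝ), (1 : ℝ))) - P p)).1) (𝓝[>] 0)
      (𝓝 ((L (1, 0)).1 * (L (0, 1)).2 - (L (1, 0)).2 * (L (0, 1)).1)) := by
    have h1 := hlim (1, 0)
    have h2 := hlim (0, 1)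
    exact ((h1.fst_nhds).mul (h2.snd_nhds)).sub ((h1.snd_nhds).mul (h2.fst_nhds))
  refine tendsto_nhds_unique hW ?_
  rw [Metric.tendsto_nhds]
  intro μ hμ
  -- For initial displacements `s` along the axes, later displacements are at most `K * s` and the
  -- initial Wronskian is `s ^ 2`; this `η` makes the error, divided by `s ^ 2`, smaller than `μ`.
  obtain ⟨r, hr, hr'⟩ := wronskian_estimate hg h (η := μ / (2 * K ^ 2 * (T + 1))) (by positivity)
  have hs : ∀ᶠ s : ℝ in 𝓝[>] 0, s < min ε (r / K) :=
    nhdsWithin_le_nhds (Iio_mem_nhds (by positivity))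
  filter_upwards [hs, self_mem_nhdsWithin] with s hs hs0
  have hs0 : 0 < s := hs0
  have hsε : s < ε := hs.trans_le (min_le_left _ _)
  have hsr : K * s < r := by
    have := hs.trans_le (min_le_right _ _)
    rw [lt_div_iff₀ (by linarith)] at this
    linarith
  have hd1 : dist (u 0 + s, w 0, δ) (u 0, w 0, δ) = s := by
    simp [Prod.dist_eq, hs0.le]
  have hd2 : dist (u 0, w 0 + s, δ) (u 0, w 0, δ) = s := by
    simp [Prod.dist_eq, hs0.le]
  obtain ⟨u₁, w₁, h₁, i₁⟩ := hex δ (u 0 + s, w 0) (by rw [hd1]; exact hsε)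
  obtain ⟨u₂, w₂, h₂, i₂⟩ := hex δ (u 0, w 0 + s) (by rw [hd2]; exact hsε)
  have P1 := SolOn.timeMap_eq hg hT h₁
  have P2 := SolOn.timeMap_eq hg hT h₂
  have P0 := SolOn.timeMap_eq hg hT h
  simp only [Prod.mk.injEq] at i₁ i₂
  have hb : ∀ u' w' : ℝ → ℝ, SolOn g δ u' w' (Icc 0 T) → dist (u' 0, w' 0, δ) (u 0, w 0, δ) = s →
      ∀ t ∈ Icc 0 T, |u' t - u t| ≤ K * s := by
    intro u' w' h' hd t ht
    have := hlip δ δ u' w' u w h' h (by rw [hd]; exact hsε) (by simpa using hε) t ht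
    rw [hd, Prod.dist_eq, max_le_iff] at this
    exact this.1
  have key := hr' u₁ w₁ u₂ w₂ h₁ h₂ (K * s) (hb u₁ w₁ h₁ (by rw [i₁.1, i₁.2, hd1]))
    (hb u₂ w₂ h₂ (by rw [i₂.1, i₂.2, hd2])) hsr T ⟨hT, le_rfl⟩
  rw [i₁.1, i₁.2] at P1
  rw [i₂.1, i₂.2] at P2
  rw [i₁.1, i₁.2, i₂.1, i₂.2] at key
  have E1 : P (p + s • ((1 : ℝ), (0 : ℝ))) = (u₁ T, w₁ T) := by rw [← P1]; simp [hp, hP]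
  have E2 : P (p + s • ((0 : ℝ), (1 : ℝ))) = (u₂ T, w₂ T) := by rw [← P2]; simp [hp, hP]
  have E0 : P p = (u T, w T) := P0
  rw [E1, E2, E0, Real.dist_eq]
  simp only [Prod.mk_sub_mk, Prod.smul_mk, smul_eq_mul]
  have e : s⁻¹ * (u₁ T - u T) * (s⁻¹ * (w₂ T - w T)) - s⁻¹ * (w₁ T - w T) * (s⁻¹ * (u₂ T - u T)) - 1
      = (((u₁ T - u T) * (w₂ T - w T) - (w₁ T - w T) * (u₂ T - u T)) -
        ((u 0 + s - u 0) * (w 0 + s - w 0) - (w 0 - w 0) * (u 0 - u 0))) / s ^ 2 := by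
    field_simp; ring
  rw [e, abs_div, abs_of_pos (by positivity : (0 : ℝ) < s ^ 2), div_lt_iff₀ (by positivity)]
  refine key.trans_lt ?_
  have e2 : μ / (2 * K ^ 2 * (T + 1)) * (K * s) ^ 2 * T = μ * s ^ 2 * (T / (2 * (T + 1))) := by
    field_simp
  rw [e2]
  have : T / (2 * (T + 1)) < 1 := by rw [div_lt_one (by positivity)]; linarith
  have : 0 < μ * s ^ 2 := by positivity
  nlinarith

end StripMap
end

noncomputable section

namespace StripMap

/-! ### Closed curves with a single-valued logarithm -/

/-- The closed curve `φ` on `[a, b]` has a continuous logarithm that is again closed. -/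
def HasClosedLog (a b : ℝ) (φ : ℝ → ℂ) : Prop :=
  ∃ g : ℝ → ℂ, ContinuousOn g (Icc a b) ∧ (∀ t ∈ Icc a b, Complex.exp (g t) = φ t) ∧ g a = g b

variable {a b : ℝ}

/-- The quotient `φ / ψ` stays in the unit disc around 1, where the principal logarithm is
continuous and single-valued; it is added to the logarithm of `ψ`. -/
lemma HasClosedLog.of_close {φ ψ : ℝ → ℂ} (h : HasClosedLog a b ψ) (hab : a ≤ b)
    (hφ : ContinuousOn φ (Icc a b)) (hφab : φ a = φ b)
    (hc : ∀ t ∈ Icc a b, ‖φ t - ψ t‖ < ‖ψ t‖) : HasClosedLog a b φ := by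
  obtain ⟨g, hg, he, hgab⟩ := h
  have hψ : ContinuousOn ψ (Icc a b) :=
    (Complex.continuous_exp.comp_continuousOn hg).congr fun t ht => (he t ht).symm
  have hψ0 : ∀ t ∈ Icc a b, ψ t ≠ 0 := fun t ht => by rw [← he t ht]; exact Complex.exp_ne_zero _
  have hs : ∀ t ∈ Icc a b, φ t / ψ t ∈ Complex.slitPlane := by
    intro t ht
    have h1 : φ t / ψ t = 1 + (φ t - ψ t) / ψ t := by field_simp [hψ0 t ht]; ring
    rw [h1]
    apply Complex.mem_slitPlane_of_norm_lt_one
    rw [norm_div, div_lt_one (norm_pos_iff.2 (hψ0 t ht))]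
    exact hc t ht
  have ha : a ∈ Icc a b := ⟨le_rfl, hab⟩
  have hb : b ∈ Icc a b := ⟨hab, le_rfl⟩
  have hψab : ψ a = ψ b := by rw [← he a ha, ← he b hb, hgab]
  refine ⟨fun t => g t + Complex.log (φ t / ψ t), hg.add ((hφ.div hψ hψ0).clog hs), ?_, ?_⟩
  · intro t ht
    rw [Complex.exp_add, he t ht, Complex.exp_log (Complex.slitPlane_ne_zero (hs t ht))]
    field_simp [hψ0 t ht]
  · simp only [hgab, hφab, hψab]

lemma HasClosedLog.of_re_pos {φ : ℝ → ℂ} (hφ : ContinuousOn φ (Icc a b)) (hφab : φ a = φ b)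
    (hp : ∀ t ∈ Icc a b, 0 < (φ t).re) : HasClosedLog a b φ :=
  ⟨fun t => Complex.log (φ t), hφ.clog fun t ht => Or.inl (hp t ht),
    fun t ht => Complex.exp_log (Complex.slitPlane_ne_zero (Or.inl (hp t ht))), by simp [hφab]⟩

lemma HasClosedLog.neg {φ : ℝ → ℂ} (h : HasClosedLog a b φ) : HasClosedLog a b (fun t => -φ t) := by
  obtain ⟨g, hg, he, hgab⟩ := h
  refine ⟨fun t => g t + Real.pi * Complex.I, hg.add continuousOn_const, fun t ht => ?_, by
    simp [hgab]⟩
  rw [Complex.exp_add, he t ht, Complex.exp_pi_mul_I]; ring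

/-- The property of having a closed logarithm is invariant under homotopies through curves that
avoid the origin. -/
theorem HasClosedLog.of_homotopy {f : ℝ → ℝ → ℂ} {x₀ x₁ : ℝ} (hx : x₀ ≤ x₁) (hab : a ≤ b)
    (hf : ContinuousOn (fun q : ℝ × ℝ => f q.1 q.2) (Icc x₀ x₁ ×ˢ Icc a b))
    (h0 : ∀ x ∈ Icc x₀ x₁, ∀ t ∈ Icc a b, f x t ≠ 0)
    (hper : ∀ x ∈ Icc x₀ x₁, f x a = f x b) (h1 : HasClosedLog a b (f x₁)) :
    HasClosedLog a b (f x₀) := by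
  have hK : IsCompact (Icc x₀ x₁ ×ˢ Icc a b) := isCompact_Icc.prod isCompact_Icc
  obtain ⟨q, hq, hmin⟩ := hK.exists_isMinOn
    ⟨(x₀, a), ⟨le_rfl, hx⟩, ⟨le_rfl, hab⟩⟩ hf.norm
  set m := ‖f q.1 q.2‖
  have hm : 0 < m := norm_pos_iff.2 (h0 _ hq.1 _ hq.2)
  obtain ⟨d, hd, hd'⟩ := Metric.uniformContinuousOn_iff.1
    (hK.uniformContinuousOn_of_continuous hf) m hm
  have hslice : ∀ x ∈ Icc x₀ x₁, ContinuousOn (f x) (Icc a b) := fun x hx =>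
    hf.comp (by fun_prop : ContinuousOn (fun t => (x, t)) (Icc a b)) fun t ht => ⟨hx, ht⟩
  -- Slices at distance less than `d` differ by less than the minimal modulus `m`, so
  -- `HasClosedLog.of_close` passes from one to the other; finitely many steps of length `d / 2`
  -- then lead from `x₁` down to `x₀`.
  have step : ∀ x ∈ Icc x₀ x₁, ∀ x' ∈ Icc x₀ x₁, |x - x'| < d → HasClosedLog a b (f x) →
      HasClosedLog a b (f x') := by
    intro x hx x' hx' hxx h
    refine h.of_close hab (hslice x' hx') (hper x' hx') fun t ht => ?_
    have h2 := hd' (x', t) ⟨hx', ht⟩ (x, t) ⟨hx, ht⟩ (by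
      rw [Prod.dist_eq, dist_self, max_lt_iff, dist_comm, Real.dist_eq]; exact ⟨hxx, hd⟩)
    rw [dist_eq_norm] at h2
    have h3 : m ≤ ‖f x t‖ := hmin (a := (x, t)) ⟨hx, ht⟩
    exact h2.trans_le h3
  have main : ∀ n : ℕ, ∀ x ∈ Icc x₀ x₁, x₁ - x ≤ n * (d / 2) → HasClosedLog a b (f x) := by
    intro n
    induction n with
    | zero =>
      intro x hx hn
      have : x = x₁ := by simp at hn; linarith [hx.2]
      rw [this]; exact h1
    | succ n ih =>
      intro x hx' hn
      have h2 : min x₁ (x + d / 2) ∈ Icc x₀ x₁ :=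
        ⟨le_min hx (by linarith [hx'.1]), min_le_left _ _⟩
      have h3 : 0 ≤ (n : ℝ) * (d / 2) := by positivity
      refine step _ h2 x hx' ?_ (ih _ h2 ?_)
      · rw [abs_lt]
        constructor
        · rcases le_total x₁ (x + d / 2) with h | h
          · rw [min_eq_left h]; linarith [hx'.2]
          · rw [min_eq_right h]; linarith
        · linarith [min_le_right x₁ (x + d / 2)]
      · push_cast at hn
        rcases le_total x₁ (x + d / 2) with h | h
        · rw [min_eq_left h]; linarith
        · rw [min_eq_right h]; linarith
  obtain ⟨n, hn⟩ := exists_nat_ge ((x₁ - x₀) / (d / 2))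
  refine main n x₀ ⟨le_rfl, hx⟩ ?_
  rwa [div_le_iff₀ (by positivity)] at hn

lemma IsPreconnected.eq_of_intCast {s : Set ℝ} (hs : IsPreconnected s) {f : ℝ → ℝ}
    (hf : ContinuousOn f s) (hint : ∀ t ∈ s, ∃ n : ℤ, f t = n) {x y : ℝ} (hx : x ∈ s) (hy : y ∈ s) :
    f x = f y := by
  have key : ∀ x ∈ s, ∀ y ∈ s, ¬ f x < f y := by
    intro x hx y hy hlt
    obtain ⟨m, hm⟩ := hint x hx
    obtain ⟨n, hn⟩ := hint y hy
    have hmn : m + 1 ≤ n := by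
      rw [hm, hn] at hlt; exact_mod_cast hlt
    have hmn' : (m : ℝ) + 1 ≤ n := by exact_mod_cast hmn
    obtain ⟨t, ht, hft⟩ := hs.intermediate_value hx hy hf
      (show (m : ℝ) + 1 / 2 ∈ Icc (f x) (f y) by rw [hm, hn]; constructor <;> linarith)
    obtain ⟨k, hk⟩ := hint t ht
    rw [hk] at hft
    have h1 : (m : ℝ) < k := by linarith
    have h2 : (k : ℝ) < m + 1 := by linarith
    have h3 : m < k := by exact_mod_cast h1
    have h4 : k < m + 1 := by exact_mod_cast h2
    omega
  exact le_antisymm (not_lt.1 (key y hy x hx)) (not_lt.1 (key x hx y hy))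

/-- A closed curve that crosses the segment from `i c` to `i d` exactly once cannot have closed
logarithms with respect to both ends of the segment. -/
theorem false_of_single_crossing {z : ℝ → ℂ} {c d ts : ℝ} (hts : ts ∈ Ioo a b) (hcd : c < d)
    (hz : ContinuousOn z (Icc a b)) (hzab : z a = z b)
    (hc : HasClosedLog a b (fun t => z t - c * Complex.I))
    (hd : HasClosedLog a b (fun t => z t - d * Complex.I))
    (h0 : (z ts).re = 0) (h1 : (z ts).im ∈ Ioo c d)
    (honly : ∀ t ∈ Icc a b, (z t).re = 0 → (z t).im ∈ Icc c d → t = ts)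
    (hl : ∀ᶠ t in 𝓝[<] ts, (z t).re < 0) (hr : ∀ᶠ t in 𝓝[>] ts, 0 < (z t).re) : False := by
  obtain ⟨gc, hgc, hec, hcab⟩ := hc
  obtain ⟨gd, hgd, hed, hdab⟩ := hd
  -- `g` is a closed logarithm of `n`, whose argument is the angle at which the segment is seen from
  -- `z`. The value `n t` leaves the slit plane exactly when `z t` lies on the segment.
  set g : ℝ → ℂ := fun t => gd t + (starRingEnd ℂ) (gc t) with hg
  set n : ℝ → ℂ := fun t => (z t - d * Complex.I) * (starRingEnd ℂ) (z t - c * Complex.I) with hn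
  have hgcont : ContinuousOn g (Icc a b) :=
    hgd.add (Complex.continuous_conj.comp_continuousOn hgc)
  have hncont : ContinuousOn n (Icc a b) :=
    (hz.sub continuousOn_const).mul
      (Complex.continuous_conj.comp_continuousOn (hz.sub continuousOn_const))
  have hexp : ∀ t ∈ Icc a b, Complex.exp (g t) = n t := by
    intro t ht
    simp only [hg, hn]
    rw [Complex.exp_add, Complex.exp_conj, hec t ht, hed t ht]
  have hre : ∀ t, (n t).re = (z t).re ^ 2 + ((z t).im - d) * ((z t).im - c) := by
    intro t; simp [hn]; ring
  have him : ∀ t, (n t).im = (z t).re * (c - d) := by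
    intro t; simp [hn]; ring
  have hslit : ∀ t ∈ Icc a b, t ≠ ts → n t ∈ Complex.slitPlane := by
    intro t ht hne
    by_contra hcon
    rw [Complex.mem_slitPlane_iff, not_or, not_lt, not_not, hre, him] at hcon
    have hx : (z t).re = 0 := by
      rcases mul_eq_zero.1 hcon.2 with h | h
      · exact h
      · linarith
    refine hne (honly t ht hx ?_)
    have h2 := hcon.1
    rw [hx] at h2
    constructor <;> nlinarith
  -- The excess of the continuous argument over the principal one, counted in full turns. It is an
  -- integer, constant on each side of `ts` and equal at both ends of the interval; yet at `ts` the
  -- principal argument jumps from `π` to `-π`, which forces a difference of one.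
  set f : ℝ → ℝ := fun t => ((g t).im - (n t).arg) / (2 * Real.pi) with hf
  have hpi := Real.pi_pos
  have hint : ∀ t ∈ Icc a b, ∃ k : ℤ, f t = k := by
    intro t ht
    have hn0 : n t ≠ 0 := by rw [← hexp t ht]; exact Complex.exp_ne_zero _
    have h2 : Complex.exp (g t) = Complex.exp (Complex.log (n t)) := by
      rw [hexp t ht, Complex.exp_log hn0]
    obtain ⟨k, hk⟩ := Complex.exp_eq_exp_iff_exists_int.1 h2
    refine ⟨k, ?_⟩
    have h3 := congrArg Complex.im hk
    simp [Complex.log_im] at h3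
    simp only [hf]
    rw [h3]; field_simp; ring
  have hfc : ∀ s ⊆ Icc a b, ts ∉ s → ContinuousOn f s := by
    intro s hs hts'
    refine ContinuousOn.div_const (ContinuousOn.sub
      (Complex.continuous_im.comp_continuousOn (hgcont.mono hs)) ?_) _
    intro t ht
    exact (Complex.continuousAt_arg (hslit t (hs ht) fun h => hts' (h ▸ ht))
      ).comp_continuousWithinAt ((hncont.mono hs) t ht)
  have hLs : Ico a ts ⊆ Icc a b := fun t ht => ⟨ht.1, ht.2.le.trans hts.2.le⟩
  have hRs : Ioc ts b ⊆ Icc a b := fun t ht => ⟨hts.1.le.trans ht.1.le, ht.2⟩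
  have hL : ∀ t ∈ Ico a ts, f t = f a := fun t ht =>
    IsPreconnected.eq_of_intCast isPreconnected_Ico (hfc _ hLs (by simp))
      (fun t ht => hint t (hLs ht)) ht ⟨le_rfl, hts.1⟩
  have hR : ∀ t ∈ Ioc ts b, f t = f b := fun t ht =>
    IsPreconnected.eq_of_intCast isPreconnected_Ioc (hfc _ hRs (by simp))
      (fun t ht => hint t (hRs ht)) ht ⟨hts.2, le_rfl⟩
  have hfab : f a = f b := by simp only [hf, hg, hn, hcab, hdab, hzab]
  have hg0 : ContinuousAt g ts := hgcont.continuousAt (Icc_mem_nhds hts.1 hts.2)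
  have hn0 : ContinuousAt n ts := hncont.continuousAt (Icc_mem_nhds hts.1 hts.2)
  have hnre : (n ts).re < 0 := by rw [hre, h0]; nlinarith [h1.1, h1.2]
  have hnim : (n ts).im = 0 := by rw [him, h0]; simp
  have hlimL : Tendsto f (𝓝[<] ts) (𝓝 (((g ts).im - Real.pi) / (2 * Real.pi))) := by
    refine Tendsto.div_const (Tendsto.sub
      ((Complex.continuous_im.tendsto _).comp (hg0.mono_left nhdsWithin_le_nhds)) ?_) _
    refine (Complex.tendsto_arg_nhdsWithin_im_nonneg_of_re_neg_of_im_zero hnre hnim).comp ?_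
    refine tendsto_nhdsWithin_iff.2 ⟨hn0.mono_left nhdsWithin_le_nhds, ?_⟩
    filter_upwards [hl] with t ht
    simp only [him]
    nlinarith
  have hlimR : Tendsto f (𝓝[>] ts) (𝓝 (((g ts).im - (-Real.pi)) / (2 * Real.pi))) := by
    refine Tendsto.div_const (Tendsto.sub
      ((Complex.continuous_im.tendsto _).comp (hg0.mono_left nhdsWithin_le_nhds)) ?_) _
    refine (Complex.tendsto_arg_nhdsWithin_im_neg_of_re_neg_of_im_zero hnre hnim).comp ?_
    refine tendsto_nhdsWithin_iff.2 ⟨hn0.mono_left nhdsWithin_le_nhds, ?_⟩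
    filter_upwards [hr] with t ht
    simp only [him]
    nlinarith
  have eL : ((g ts).im - Real.pi) / (2 * Real.pi) = f a := by
    refine tendsto_nhds_unique hlimL (tendsto_const_nhds.congr' ?_)
    filter_upwards [Ico_mem_nhdsLT hts.1] with t ht
    exact (hL t ht).symm
  have eR : ((g ts).im - (-Real.pi)) / (2 * Real.pi) = f b := by
    refine tendsto_nhds_unique hlimR (tendsto_const_nhds.congr' ?_)
    filter_upwards [Ioc_mem_nhdsGT hts.2] with t ht
    exact (hR t ht).symm
  rw [hfab, ← eR] at eL
  field_simp at eL
  linarith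

end StripMap
end

/-! ### Loops carried by the flow do not wind around collapsing data. -/

noncomputable section

namespace StripMap

variable {g : ℝ → ℝ → ℝ → ℝ}

/-- Solutions that agree at some time agree later. -/
lemma SolOn.eq_of_eq (hg : ContDiff ℝ 1 (fun z : ℝ × ℝ × ℝ => g z.1 z.2.1 z.2.2)) {δ T x : ℝ}
    {u w u' w' : ℝ → ℝ} (h : SolOn g δ u w (Icc 0 T)) (h' : SolOn g δ u' w' (Icc 0 T))
    (hx : x ∈ Icc 0 T) (he : (u x, w x) = (u' x, w' x)) : (u T, w T) = (u' T, w' T) := by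
  have hg' : ContDiff ℝ 1 (fun z : ℝ × ℝ × ℝ => (fun t δ v => g (t + x) δ v) z.1 z.2.1 z.2.2) :=
    hg.comp (by fun_prop : ContDiff ℝ 1 fun z : ℝ × ℝ × ℝ => (z.1 + x, z.2.1, z.2.2))
  have sh : ∀ {u w : ℝ → ℝ}, SolOn g δ u w (Icc 0 T) →
      SolOn (fun t δ v => g (t + x) δ v) δ (fun t => u (t + x)) (fun t => w (t + x))
        (Icc 0 (T - x)) := by
    intro u w h t ht
    have hm : MapsTo (fun t : ℝ => t + x) (Icc 0 (T - x)) (Icc 0 T) := fun s hs =>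
      ⟨by linarith [hs.1, hx.1], by linarith [hs.2]⟩
    have h1 := h (t + x) (hm ht)
    have hd : HasDerivWithinAt (fun t : ℝ => t + x) 1 (Icc 0 (T - x)) t :=
      ((hasDerivAt_id t).add_const x).hasDerivWithinAt
    exact ⟨by simpa using! h1.1.scomp t hd hm, by simpa using! h1.2.scomp t hd hm⟩
  have := SolOn.unique hg' (sh h) (sh h') (by simpa using he) (T - x) ⟨by linarith [hx.2], le_rfl⟩
  simpa using this

/-- Let `ℓ` be a closed curve of data whose solutions exist on `[0, T]`, and let `c` be data whose
solution collapses at `T`. Then `ℓ` does not wind around `c`. -/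
theorem hasClosedLog_of_collapse (hg : ContDiff ℝ 1 (fun z : ℝ × ℝ × ℝ => g z.1 z.2.1 z.2.2))
    {T δ : ℝ} (hT : 0 < T) {a b : ℝ} (hab : a ≤ b) {ℓ : ℝ → ℝ × ℝ} (hℓ : ContinuousOn ℓ (Icc a b))
    (hℓab : ℓ a = ℓ b) (hdom : ∀ t ∈ Icc a b, (δ, ℓ t) ∈ flowDomain g T)
    {uc wc : ℝ → ℝ} (hc : SolOn g δ uc wc (Ico 0 T))
    (hcol : Tendsto (fun x => |uc x|) (𝓝[<] T) atTop) {e₁ e₂ : ℝ} (he₁ : e₁ ≠ 0) (he₂ : e₂ ≠ 0) :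
    HasClosedLog a b (fun t => ⟨e₁ * ((ℓ t).1 - uc 0), e₂ * ((ℓ t).2 - wc 0)⟩) := by
  have hex : ∀ t, ∃ u w : ℝ → ℝ, t ∈ Icc a b → SolOn g δ u w (Icc 0 T) ∧ (u 0, w 0) = ℓ t := by
    intro t
    by_cases ht : t ∈ Icc a b
    · obtain ⟨q, u, w, h, h0, -⟩ := hdom t ht
      exact ⟨u, w, fun _ => ⟨h, h0⟩⟩
    · exact ⟨0, 0, fun h => absurd h ht⟩
  choose U W hUW using hex
  have hZ : ContinuousOn (fun q : ℝ × ℝ => (U q.2 q.1, W q.2 q.1)) (Icc 0 T ×ˢ Icc a b) := by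
    rintro ⟨x, t⟩ ⟨hx, ht⟩
    simp only [] at hx ht
    obtain ⟨ε, hε, K, hK1, -, hlip⟩ := SolOn.exists_nearby hg hT.le (hUW t ht).1
    have hd : ∀ t₁ ∈ Icc a b,
        dist (U t₁ 0, W t₁ 0, δ) (U t 0, W t 0, δ) = dist (ℓ t₁) (ℓ t) := by
      intro t₁ ht₁
      rw [← (hUW t ht).2, ← (hUW t₁ ht₁).2]
      simp [Prod.dist_eq]
    have hlim2 : Tendsto (fun q : ℝ × ℝ => K * dist (ℓ q.2) (ℓ t) +
        dist (U t q.1, W t q.1) (U t x, W t x)) (𝓝[Icc 0 T ×ˢ Icc a b] (x, t)) (𝓝 (K * 0 + 0)) := by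
      have h1 : Tendsto (fun q : ℝ × ℝ => ℓ q.2) (𝓝[Icc 0 T ×ˢ Icc a b] (x, t)) (𝓝 (ℓ t)) :=
        (hℓ t ht).tendsto.comp (tendsto_nhdsWithin_iff.2
          ⟨(continuous_snd.tendsto (x, t)).mono_left nhdsWithin_le_nhds,
            eventually_nhdsWithin_of_forall fun q hq => hq.2⟩)
      have h2 : Tendsto (fun q : ℝ × ℝ => (U t q.1, W t q.1))
          (𝓝[Icc 0 T ×ˢ Icc a b] (x, t)) (𝓝 (U t x, W t x)) :=
        ((hUW t ht).1.continuousOn x hx).tendsto.comp (tendsto_nhdsWithin_iff.2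
          ⟨(continuous_fst.tendsto (x, t)).mono_left nhdsWithin_le_nhds,
            eventually_nhdsWithin_of_forall fun q hq => hq.1⟩)
      exact ((tendsto_iff_dist_tendsto_zero.1 h1).const_mul K).add
        (tendsto_iff_dist_tendsto_zero.1 h2)
    rw [mul_zero, add_zero] at hlim2
    refine tendsto_iff_dist_tendsto_zero.2
      (squeeze_zero' (Eventually.of_forall fun _ => dist_nonneg) ?_ hlim2)
    have hclose : ∀ᶠ q : ℝ × ℝ in 𝓝[Icc 0 T ×ˢ Icc a b] (x, t), dist (ℓ q.2) (ℓ t) < ε := by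
      have h1 : Tendsto (fun q : ℝ × ℝ => ℓ q.2) (𝓝[Icc 0 T ×ˢ Icc a b] (x, t)) (𝓝 (ℓ t)) :=
        (hℓ t ht).tendsto.comp (tendsto_nhdsWithin_iff.2
          ⟨(continuous_snd.tendsto (x, t)).mono_left nhdsWithin_le_nhds,
            eventually_nhdsWithin_of_forall fun q hq => hq.2⟩)
      exact h1 (Metric.ball_mem_nhds _ hε)
    filter_upwards [hclose, self_mem_nhdsWithin] with q hq hqm
    refine (dist_triangle _ (U t q.1, W t q.1) _).trans (add_le_add ?_ le_rfl)
    have := hlip δ δ (U q.2) (W q.2) (U t) (W t) (hUW q.2 hqm.2).1 (hUW t ht).1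
      (by rw [hd _ hqm.2]; exact hq) (by simpa using hε) q.1 hqm.1
    rw [hd _ hqm.2] at this
    refine le_trans ?_ this
    simp only [Prod.dist_eq]
    exact max_le_max le_rfl (le_max_left _ _)
  obtain ⟨R, hR⟩ := (isCompact_Icc.prod isCompact_Icc).exists_bound_of_continuousOn hZ
  have hRU : ∀ x ∈ Icc 0 T, ∀ t ∈ Icc a b, |U t x| ≤ R := fun x hx t ht =>
    (le_max_left _ _).trans (hR (x, t) ⟨hx, ht⟩)
  -- The loop stays in a bounded set up to time `T`, whereas the collapsing solution leaves that set
  -- at some time `x₁ < T`; seen from there, the loop lies in a half-plane.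
  obtain ⟨x₁, hx₁R, hx₁⟩ : ∃ x₁, R < |uc x₁| ∧ x₁ ∈ Ioo 0 T :=
    ((hcol.eventually (eventually_gt_atTop R)).and (Ioo_mem_nhdsLT hT)).exists
  have hsub : Icc 0 x₁ ⊆ Icc 0 T := Icc_subset_Icc_right hx₁.2.le
  have hsubc : Icc 0 x₁ ⊆ Ico 0 T := fun t ht => ⟨ht.1, ht.2.trans_lt hx₁.2⟩
  have hcc := hc.mono hsubc
  -- The flow itself is the homotopy. It avoids the origin because solutions that meet at one time
  -- would agree at `x₁`, where their sizes differ. The factors `e₁`, `e₂` accommodate reflections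
  -- of the axes.
  set f : ℝ → ℝ → ℂ := fun x t => ⟨e₁ * (U t x - uc x), e₂ * (W t x - wc x)⟩ with hf
  have hfc : ContinuousOn (fun q : ℝ × ℝ => f q.1 q.2) (Icc 0 x₁ ×ˢ Icc a b) := by
    have h1 := hZ.mono (prod_mono hsub (Subset.refl (Icc a b)))
    have h2 : ContinuousOn (fun q : ℝ × ℝ => (uc q.1, wc q.1)) (Icc 0 x₁ ×ˢ Icc a b) :=
      hcc.continuousOn.comp continuousOn_fst fun q hq => hq.1
    have h3 : ContinuousOn (fun q : ℝ × ℝ => (e₁ * (U q.2 q.1 - uc q.1), e₂ * (W q.2 q.1 - wc q.1)))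
        (Icc 0 x₁ ×ˢ Icc a b) :=
      (continuousOn_const.mul (h1.fst.sub h2.fst)).prodMk
        (continuousOn_const.mul (h1.snd.sub h2.snd))
    exact Complex.equivRealProdCLM.symm.continuous.comp_continuousOn h3
  have hx₁0 : x₁ ∈ Icc 0 x₁ := ⟨hx₁.1.le, le_rfl⟩
  have hne : ∀ x ∈ Icc 0 x₁, ∀ t ∈ Icc a b, f x t ≠ 0 := by
    intro x hx t ht h0
    have hre : e₁ * (U t x - uc x) = 0 := congrArg Complex.re h0
    have him : e₂ * (W t x - wc x) = 0 := congrArg Complex.im h0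
    have h1 : U t x = uc x := by
      rcases mul_eq_zero.1 hre with h | h
      · exact absurd h he₁
      · linarith
    have h2 : W t x = wc x := by
      rcases mul_eq_zero.1 him with h | h
      · exact absurd h he₂
      · linarith
    have := SolOn.eq_of_eq hg ((hUW t ht).1.mono hsub) hcc hx (by rw [h1, h2])
    simp only [Prod.mk.injEq] at this
    have h3 := hRU x₁ (hsub hx₁0) t ht
    rw [this.1] at h3
    linarith
  have hper : ∀ x ∈ Icc 0 x₁, f x a = f x b := by
    intro x hx
    have ha : a ∈ Icc a b := ⟨le_rfl, hab⟩
    have hb : b ∈ Icc a b := ⟨hab, le_rfl⟩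
    have := SolOn.unique hg (hUW a ha).1 (hUW b hb).1
      ((hUW a ha).2.trans (hℓab.trans (hUW b hb).2.symm)) x (hsub hx)
    simp only [Prod.mk.injEq] at this
    simp only [hf, this.1, this.2]
  have hend : HasClosedLog a b (f x₁) := by
    have hslice : ContinuousOn (f x₁) (Icc a b) :=
      hfc.comp (by fun_prop : ContinuousOn (fun t => (x₁, t)) (Icc a b)) fun t ht => ⟨hx₁0, ht⟩
    have habs : ∀ t ∈ Icc a b, |U t x₁| < |uc x₁| := fun t ht =>
      (hRU x₁ (hsub hx₁0) t ht).trans_lt hx₁R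
    have hsign : (∀ t ∈ Icc a b, 0 < (f x₁ t).re) ∨ (∀ t ∈ Icc a b, 0 < (-(f x₁ t)).re) := by
      rcases lt_or_gt_of_ne he₁ with he | he <;> rcases le_total 0 (uc x₁) with hu | hu
      · left; intro t ht
        have := habs t ht
        rw [abs_of_nonneg hu, abs_lt] at this
        exact mul_pos_of_neg_of_neg he (by linarith [this.2])
      · right; intro t ht
        have := habs t ht
        rw [abs_of_nonpos hu, abs_lt] at this
        simp only [Complex.neg_re, hf]
        have : 0 < U t x₁ - uc x₁ := by linarith [this.1]
        nlinarith
      · right; intro t ht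
        have := habs t ht
        rw [abs_of_nonneg hu, abs_lt] at this
        simp only [Complex.neg_re, hf]
        have : U t x₁ - uc x₁ < 0 := by linarith [this.2]
        nlinarith
      · left; intro t ht
        have := habs t ht
        rw [abs_of_nonpos hu, abs_lt] at this
        exact mul_pos he (by linarith [this.1])
    rcases hsign with h | h
    · exact HasClosedLog.of_re_pos hslice (hper x₁ hx₁0) h
    · have := (HasClosedLog.of_re_pos (φ := fun t => -(f x₁ t)) hslice.neg
        (by simp only [hper x₁ hx₁0]) h).neg
      simpa using this
  have key := HasClosedLog.of_homotopy hx₁.1.le hab hfc hne hper hend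
  obtain ⟨l, hl, hle, hlab⟩ := key
  refine ⟨l, hl, fun t ht => ?_, hlab⟩
  rw [hle t ht]
  have := (hUW t ht).2
  simp only [hf, ← this]

end StripMap
end

noncomputable section

namespace StripMap

/-! ### Curvilinear quadrangles given by four global functions -/

/-- The data of a quadrangle whose lower and upper sides lie on the graphs `y = am u`, `y = ap u`
and whose left and right sides lie on the graphs `u = bm y`, `u = bp y`. -/
structure Quad where
  am : ℝ → ℝ
  ap : ℝ → ℝ
  bm : ℝ → ℝ
  bp : ℝ → ℝ

namespace Quad

variable (K : Quad)

/-- The open quadrangle. -/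
def region : Set (ℝ × ℝ) :=
  {p | K.am p.1 < p.2 ∧ p.2 < K.ap p.1 ∧ K.bm p.2 < p.1 ∧ p.1 < K.bp p.2}

/-- The closed quadrangle. -/
def closedRegion : Set (ℝ × ℝ) :=
  {p | K.am p.1 ≤ p.2 ∧ p.2 ≤ K.ap p.1 ∧ K.bm p.2 ≤ p.1 ∧ p.1 ≤ K.bp p.2}

/-- Quadrangles with nondecreasing lower and upper sides and nonincreasing left and right sides,
all of them `γ`-Lipschitz, of widths at most `M`. -/
structure IsGood (γ M : ℝ) : Prop where
  am_mono : Monotone K.am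
  ap_mono : Monotone K.ap
  bm_anti : Antitone K.bm
  bp_anti : Antitone K.bp
  a_lt : ∀ u, K.am u < K.ap u
  b_lt : ∀ y, K.bm y < K.bp y
  am_lip : ∀ x y, x ≤ y → K.am y - K.am x ≤ γ * (y - x)
  ap_lip : ∀ x y, x ≤ y → K.ap y - K.ap x ≤ γ * (y - x)
  bm_lip : ∀ x y, x ≤ y → K.bm x - K.bm y ≤ γ * (y - x)
  bp_lip : ∀ x y, x ≤ y → K.bp x - K.bp y ≤ γ * (y - x)
  a_width : ∀ u, K.ap u - K.am u ≤ M
  b_width : ∀ y, K.bp y - K.bm y ≤ M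
  bdd : ∃ C, ∀ t, |K.am t| ≤ C ∧ |K.ap t| ≤ C ∧ |K.bm t| ≤ C ∧ |K.bp t| ≤ C

/-- The intermediate curves between the lower and the upper side. -/
def hLeaf (s u : ℝ) : ℝ := (1 - s) * K.am u + s * K.ap u

/-- The intermediate curves between the left and the right side. -/
def vLeaf (r y : ℝ) : ℝ := (1 - r) * K.bm y + r * K.bp y

/-- The coordinate that labels the intermediate curve between lower and upper side. -/
def sCo (p : ℝ × ℝ) : ℝ := (p.2 - K.am p.1) / (K.ap p.1 - K.am p.1)

/-- The coordinate that labels the intermediate curve between left and right side. -/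
def rCo (p : ℝ × ℝ) : ℝ := (p.1 - K.bm p.2) / (K.bp p.2 - K.bm p.2)

end Quad

lemma continuous_of_mono_lip {f : ℝ → ℝ} {γ : ℝ} (hf : Monotone f)
    (h : ∀ x y, x ≤ y → f y - f x ≤ γ * (y - x)) : Continuous f := by
  have hγ : 0 ≤ γ := by
    have h1 := h 0 1 zero_le_one
    have h2 := hf (zero_le_one (α := ℝ))
    linarith
  refine (LipschitzWith.of_dist_le_mul (K := ⟨γ, hγ⟩) fun x y => ?_).continuous
  rw [Real.dist_eq, Real.dist_eq]
  change _ ≤ γ * _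
  rcases le_total x y with hxy | hxy
  · rw [abs_sub_comm, abs_of_nonneg (sub_nonneg.2 (hf hxy)), abs_sub_comm,
      abs_of_nonneg (sub_nonneg.2 hxy)]
    exact h x y hxy
  · rw [abs_of_nonneg (sub_nonneg.2 (hf hxy)), abs_of_nonneg (sub_nonneg.2 hxy)]
    exact h y x hxy

lemma continuous_of_anti_lip {f : ℝ → ℝ} {γ : ℝ} (hf : Antitone f)
    (h : ∀ x y, x ≤ y → f x - f y ≤ γ * (y - x)) : Continuous f := by
  have := continuous_of_mono_lip (f := fun x => -f x) (γ := γ) hf.neg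
    (fun x y hxy => by have := h x y hxy; linarith)
  exact this.neg.congr fun x => neg_neg (f x)

namespace Quad

variable {K : Quad} {γ M : ℝ}

lemma region_subset_closedRegion : K.region ⊆ K.closedRegion :=
  fun _ h => ⟨h.1.le, h.2.1.le, h.2.2.1.le, h.2.2.2.le⟩

namespace IsGood

variable (h : K.IsGood γ M)
include h

lemma gamma_nonneg : 0 ≤ γ := by
  have h1 := h.am_lip 0 1 zero_le_one
  have h2 := h.am_mono (zero_le_one (α := ℝ))
  linarith

lemma M_pos : 0 < M := by
  have h1 := h.a_width 0
  have h2 := h.a_lt 0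
  linarith

lemma continuous_am : Continuous K.am := continuous_of_mono_lip h.am_mono h.am_lip
lemma continuous_ap : Continuous K.ap := continuous_of_mono_lip h.ap_mono h.ap_lip
lemma continuous_bm : Continuous K.bm := continuous_of_anti_lip h.bm_anti h.bm_lip
lemma continuous_bp : Continuous K.bp := continuous_of_anti_lip h.bp_anti h.bp_lip

lemma hLeaf_mono {s : ℝ} (h0 : 0 ≤ s) (h1 : s ≤ 1) : Monotone (K.hLeaf s) := fun x y hxy => by
  have := h.am_mono hxy
  have := h.ap_mono hxy
  have : 0 ≤ 1 - s := by linarith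
  unfold hLeaf
  gcongr

lemma vLeaf_anti {s : ℝ} (h0 : 0 ≤ s) (h1 : s ≤ 1) : Antitone (K.vLeaf s) := fun x y hxy => by
  have := h.bm_anti hxy
  have := h.bp_anti hxy
  have : 0 ≤ 1 - s := by linarith
  unfold vLeaf
  gcongr

lemma hLeaf_lip {s : ℝ} (h0 : 0 ≤ s) (h1 : s ≤ 1) {x y : ℝ} (hxy : x ≤ y) :
    K.hLeaf s y - K.hLeaf s x ≤ γ * (y - x) := by
  have := h.am_lip x y hxy
  have := h.ap_lip x y hxy
  have : 0 ≤ 1 - s := by linarith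
  unfold hLeaf
  nlinarith

lemma vLeaf_lip {s : ℝ} (h0 : 0 ≤ s) (h1 : s ≤ 1) {x y : ℝ} (hxy : x ≤ y) :
    K.vLeaf s x - K.vLeaf s y ≤ γ * (y - x) := by
  have := h.bm_lip x y hxy
  have := h.bp_lip x y hxy
  have : 0 ≤ 1 - s := by linarith
  unfold vLeaf
  nlinarith

lemma continuous_hLeaf : Continuous (fun q : ℝ × ℝ => K.hLeaf q.1 q.2) := by
  have := h.continuous_am
  have := h.continuous_ap
  unfold hLeaf
  fun_prop

lemma continuous_vLeaf : Continuous (fun q : ℝ × ℝ => K.vLeaf q.1 q.2) := by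
  have := h.continuous_bm
  have := h.continuous_bp
  unfold vLeaf
  fun_prop

lemma continuous_hLeaf' (s : ℝ) : Continuous (K.hLeaf s) :=
  h.continuous_hLeaf.comp (by fun_prop : Continuous fun u : ℝ => (s, u))

lemma continuous_vLeaf' (s : ℝ) : Continuous (K.vLeaf s) :=
  h.continuous_vLeaf.comp (by fun_prop : Continuous fun u : ℝ => (s, u))

lemma hLeaf_lt {s s' : ℝ} (hs : s < s') (u : ℝ) : K.hLeaf s u < K.hLeaf s' u := by
  have := h.a_lt u
  unfold hLeaf
  nlinarith

lemma vLeaf_lt {s s' : ℝ} (hs : s < s') (u : ℝ) : K.vLeaf s u < K.vLeaf s' u := by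
  have := h.b_lt u
  unfold vLeaf
  nlinarith

lemma hLeaf_sub_le {s s' : ℝ} (hs : s ≤ s') (u : ℝ) :
    K.hLeaf s' u - K.hLeaf s u ≤ (s' - s) * M := by
  have := h.a_width u
  have := h.a_lt u
  unfold hLeaf
  nlinarith

lemma vLeaf_sub_le {s s' : ℝ} (hs : s ≤ s') (u : ℝ) :
    K.vLeaf s' u - K.vLeaf s u ≤ (s' - s) * M := by
  have := h.b_width u
  have := h.b_lt u
  unfold vLeaf
  nlinarith

lemma continuous_sCo : Continuous K.sCo := by
  have h1 := h.continuous_am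
  have h2 := h.continuous_ap
  unfold sCo
  exact Continuous.div (by fun_prop) (by fun_prop) fun p => by linarith [h.a_lt p.1]

lemma continuous_rCo : Continuous K.rCo := by
  have h1 := h.continuous_bm
  have h2 := h.continuous_bp
  unfold rCo
  exact Continuous.div (by fun_prop) (by fun_prop) fun p => by linarith [h.b_lt p.2]

/-- The width of the quadrangle factors out and is positive, so the position of a point relative to
a leaf is the order of their labels; the equivalences below rest on this and on `sub_vLeaf`. -/
lemma sub_hLeaf (s : ℝ) (p : ℝ × ℝ) :
    p.2 - K.hLeaf s p.1 = (K.sCo p - s) * (K.ap p.1 - K.am p.1) := by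
  have : K.ap p.1 - K.am p.1 ≠ 0 := by linarith [h.a_lt p.1]
  unfold hLeaf sCo
  field_simp
  ring

lemma sub_vLeaf (r : ℝ) (p : ℝ × ℝ) :
    p.1 - K.vLeaf r p.2 = (K.rCo p - r) * (K.bp p.2 - K.bm p.2) := by
  have : K.bp p.2 - K.bm p.2 ≠ 0 := by linarith [h.b_lt p.2]
  unfold vLeaf rCo
  field_simp
  ring

lemma hLeaf_lt_iff {s : ℝ} {p : ℝ × ℝ} : K.hLeaf s p.1 < p.2 ↔ s < K.sCo p := by
  rw [← sub_pos, h.sub_hLeaf s p, mul_pos_iff_of_pos_right (by linarith [h.a_lt p.1]), sub_pos]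

lemma lt_hLeaf_iff {s : ℝ} {p : ℝ × ℝ} : p.2 < K.hLeaf s p.1 ↔ K.sCo p < s := by
  rw [← sub_neg, h.sub_hLeaf s p, ← sub_neg (b := s),
    mul_neg_iff, or_iff_right fun h2 => by linarith [h.a_lt p.1, h2.2],
    and_iff_left (sub_pos.2 (h.a_lt p.1))]

lemma vLeaf_lt_iff {s : ℝ} {p : ℝ × ℝ} : K.vLeaf s p.2 < p.1 ↔ s < K.rCo p := by
  rw [← sub_pos, h.sub_vLeaf s p, mul_pos_iff_of_pos_right (by linarith [h.b_lt p.2]), sub_pos]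

lemma lt_vLeaf_iff {s : ℝ} {p : ℝ × ℝ} : p.1 < K.vLeaf s p.2 ↔ K.rCo p < s := by
  rw [← sub_neg, h.sub_vLeaf s p, ← sub_neg (b := s),
    mul_neg_iff, or_iff_right fun h2 => by linarith [h.b_lt p.2, h2.2],
    and_iff_left (sub_pos.2 (h.b_lt p.2))]

lemma eq_hLeaf_iff {s : ℝ} {p : ℝ × ℝ} : p.2 = K.hLeaf s p.1 ↔ K.sCo p = s := by
  rw [← sub_eq_zero, h.sub_hLeaf s p, mul_eq_zero, sub_eq_zero, or_iff_left]
  linarith [h.a_lt p.1]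

lemma eq_vLeaf_iff {s : ℝ} {p : ℝ × ℝ} : p.1 = K.vLeaf s p.2 ↔ K.rCo p = s := by
  rw [← sub_eq_zero, h.sub_vLeaf s p, mul_eq_zero, sub_eq_zero, or_iff_left]
  linarith [h.b_lt p.2]

lemma sCo_leaf (s u : ℝ) : K.sCo (u, K.hLeaf s u) = s := h.eq_hLeaf_iff.1 rfl
lemma rCo_leaf (r y : ℝ) : K.rCo (K.vLeaf r y, y) = r := h.eq_vLeaf_iff.1 rfl

omit h in
lemma hLeaf_zero (u : ℝ) : K.hLeaf 0 u = K.am u := by simp [hLeaf]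
omit h in
lemma hLeaf_one (u : ℝ) : K.hLeaf 1 u = K.ap u := by simp [hLeaf]
omit h in
lemma vLeaf_zero (u : ℝ) : K.vLeaf 0 u = K.bm u := by simp [vLeaf]
omit h in
lemma vLeaf_one (u : ℝ) : K.vLeaf 1 u = K.bp u := by simp [vLeaf]

lemma mem_region_iff {p : ℝ × ℝ} :
    p ∈ K.region ↔ (0 < K.sCo p ∧ K.sCo p < 1) ∧ 0 < K.rCo p ∧ K.rCo p < 1 := by
  rw [← h.hLeaf_lt_iff, ← h.lt_hLeaf_iff, ← h.vLeaf_lt_iff, ← h.lt_vLeaf_iff, hLeaf_zero,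
    hLeaf_one, vLeaf_zero, vLeaf_one, and_assoc]
  rfl

lemma mem_closedRegion_iff {p : ℝ × ℝ} :
    p ∈ K.closedRegion ↔ (0 ≤ K.sCo p ∧ K.sCo p ≤ 1) ∧ 0 ≤ K.rCo p ∧ K.rCo p ≤ 1 := by
  rw [← not_lt, ← not_lt, ← not_lt, ← not_lt, ← h.hLeaf_lt_iff, ← h.lt_hLeaf_iff,
    ← h.vLeaf_lt_iff, ← h.lt_vLeaf_iff, hLeaf_zero,
    hLeaf_one, vLeaf_zero, vLeaf_one, not_lt, not_lt, not_lt, not_lt, and_assoc]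
  rfl

lemma isOpen_region : IsOpen K.region := by
  have h1 := h.continuous_sCo
  have h2 := h.continuous_rCo
  have : K.region = {p | 0 < K.sCo p} ∩ {p | K.sCo p < 1} ∩ ({p | 0 < K.rCo p} ∩ {p | K.rCo p < 1}) := by
    ext p; rw [h.mem_region_iff]; rfl
  rw [this]
  exact ((isOpen_lt continuous_const h1).inter (isOpen_lt h1 continuous_const)).inter
    ((isOpen_lt continuous_const h2).inter (isOpen_lt h2 continuous_const))

lemma isClosed_closedRegion : IsClosed K.closedRegion := by
  have h1 := h.continuous_sCo
  have h2 := h.continuous_rCo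
  have : K.closedRegion =
      {p | 0 ≤ K.sCo p} ∩ {p | K.sCo p ≤ 1} ∩ ({p | 0 ≤ K.rCo p} ∩ {p | K.rCo p ≤ 1}) := by
    ext p; rw [h.mem_closedRegion_iff]; rfl
  rw [this]
  exact ((isClosed_le continuous_const h1).inter (isClosed_le h1 continuous_const)).inter
    ((isClosed_le continuous_const h2).inter (isClosed_le h2 continuous_const))

lemma closure_region_subset : closure K.region ⊆ K.closedRegion :=
  h.isClosed_closedRegion.closure_subset_iff.2 region_subset_closedRegion

lemma isCompact_closedRegion : IsCompact K.closedRegion := by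
  obtain ⟨C, hC⟩ := h.bdd
  refine ((isCompact_Icc (a := -C) (b := C)).prod (isCompact_Icc (a := -C) (b := C))
    ).of_isClosed_subset h.isClosed_closedRegion fun p hp => ?_
  have h1 := hC p.1
  have h2 := hC p.2
  simp only [abs_le] at h1 h2
  exact ⟨⟨by linarith [hp.2.2.1], by linarith [hp.2.2.2]⟩,
    ⟨by linarith [hp.1], by linarith [hp.2.1]⟩⟩

/-- Moving right and not down increases the coordinate `r`. -/
lemma rCo_gap_lt {r : ℝ} (h0 : 0 ≤ r) (h1 : r ≤ 1) {p q : ℝ × ℝ} (hx : p.1 < q.1) (hy : p.2 ≤ q.2) :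
    p.1 - K.vLeaf r p.2 < q.1 - K.vLeaf r q.2 := by
  have := h.vLeaf_anti h0 h1 hy
  linarith

/-- A nonincreasing curve in the strip between two curves of the second family, from one given
point to another. -/
lemma exists_anti_path {p q : ℝ × ℝ} (hp : 0 < K.rCo p ∧ K.rCo p < 1)
    (hq : 0 < K.rCo q ∧ K.rCo q < 1) (hx : q.1 ≤ p.1) (hy : p.2 < q.2) :
    ∃ v : ℝ → ℝ, Continuous v ∧ Antitone v ∧ v p.2 = p.1 ∧ v q.2 = q.1 ∧
      ∀ y, K.bm y < v y ∧ v y < K.bp y := by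
  -- Both points lie between the leaves `ε` and `1 - ε`. Clamping the straight line through them
  -- between these two falling leaves fixes the points, keeps the curve nonincreasing and keeps it
  -- strictly inside.
  set ε := min (min (K.rCo p) (K.rCo q)) (min (1 - K.rCo p) (1 - K.rCo q)) with hε
  have e1 : ε ≤ K.rCo p := (min_le_left _ _).trans (min_le_left _ _)
  have e2 : ε ≤ K.rCo q := (min_le_left _ _).trans (min_le_right _ _)
  have e3 : ε ≤ 1 - K.rCo p := (min_le_right _ _).trans (min_le_left _ _)
  have e4 : ε ≤ 1 - K.rCo q := (min_le_right _ _).trans (min_le_right _ _)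
  have e0 : 0 < ε := by
    refine lt_min (lt_min hp.1 hq.1) (lt_min ?_ ?_) <;> linarith
  set l : ℝ → ℝ := fun y => p.1 + (y - p.2) * ((q.1 - p.1) / (q.2 - p.2)) with hl
  have hsl : (q.1 - p.1) / (q.2 - p.2) ≤ 0 := div_nonpos_of_nonpos_of_nonneg (by linarith) (by linarith)
  have hla : Antitone l := fun a b hab => by simp only [hl]; nlinarith
  have hlp : l p.2 = p.1 := by simp [hl]
  have hlq : l q.2 = q.1 := by
    have : q.2 - p.2 ≠ 0 := by linarith
    simp only [hl]; field_simp; ring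
  have hval : ∀ z : ℝ × ℝ, l z.2 = z.1 → ε ≤ K.rCo z → ε ≤ 1 - K.rCo z →
      max (K.vLeaf ε z.2) (min (K.vLeaf (1 - ε) z.2) (l z.2)) = z.1 := by
    intro z hz h1 h2
    rw [hz, min_eq_right, max_eq_right]
    · exact not_lt.1 fun hc => by rw [h.lt_vLeaf_iff] at hc; linarith
    · exact not_lt.1 fun hc => by rw [h.vLeaf_lt_iff] at hc; linarith
  have hε1 : ε ≤ 1 - ε := by linarith
  refine ⟨fun y => max (K.vLeaf ε y) (min (K.vLeaf (1 - ε) y) (l y)), ?_, ?_, hval p hlp e1 e3,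
    hval q hlq e2 e4, fun y => ⟨?_, ?_⟩⟩
  · have h1 := h.continuous_vLeaf' ε
    have h2 := h.continuous_vLeaf' (1 - ε)
    have h3 : Continuous l := by simp only [hl]; fun_prop
    fun_prop
  · exact (h.vLeaf_anti e0.le (by linarith)).max ((h.vLeaf_anti (by linarith) (by linarith)).min hla)
  · rw [← vLeaf_zero]
    exact (h.vLeaf_lt e0 y).trans_le (le_max_left _ _)
  · rw [← vLeaf_one]
    refine max_lt (h.vLeaf_lt (by linarith) y) ((min_le_left _ _).trans_lt (h.vLeaf_lt (by linarith) y))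

end IsGood
end Quad

/-- A function that is locally monotone on an interval is monotone there. -/
lemma monotoneOn_of_locally {f : ℝ → ℝ} {S : Set ℝ} (hS : S.OrdConnected)
    (h : ∀ x ∈ S, ∃ ε > 0, ∀ y ∈ S, ∀ z ∈ S, |y - x| < ε → |z - x| < ε → y ≤ z → f y ≤ f z) :
    MonotoneOn f S := by
  intro a ha b hb hab
  have hsub : Icc a b ⊆ S := hS.out ha hb
  choose! ε hε hmono using h
  obtain ⟨η, hη, hη'⟩ := lebesgue_number_lemma_of_metric (s := Icc a b)
    (c := fun x : Icc a b => Metric.ball (x : ℝ) (ε x)) isCompact_Icc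
    (fun _ => Metric.isOpen_ball) (fun x hx => mem_iUnion.2 ⟨⟨x, hx⟩,
      Metric.mem_ball_self (hε x (hsub hx))⟩)
  have step : ∀ y ∈ Icc a b, ∀ z ∈ Icc a b, y ≤ z → z - y < η → f y ≤ f z := by
    intro y hy z hz hyz hd
    obtain ⟨⟨x, hx⟩, hxb⟩ := hη' y hy
    have h1 : |y - x| < ε x := hxb (Metric.mem_ball_self hη)
    have h2 : |z - x| < ε x := hxb (by
      rw [Metric.mem_ball, Real.dist_eq, abs_of_nonneg (by linarith)]; exact hd)
    exact hmono x (hsub hx) y (hsub hy) z (hsub hz) h1 h2 hyz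
  have main : ∀ n : ℕ, ∀ y ∈ Icc a b, ∀ z ∈ Icc a b, y ≤ z → z - y ≤ n * (η / 2) → f y ≤ f z := by
    intro n
    induction n with
    | zero =>
      intro y _ z _ hyz hn
      have : y = z := by simp at hn; linarith
      rw [this]
    | succ n ih =>
      intro y hy z hz hyz hn
      push_cast at hn
      have hn0 : 0 ≤ (n : ℝ) * (η / 2) := by positivity
      rcases le_total z (y + η / 2) with h1 | h1
      · exact step y hy z hz hyz (by linarith)
      · have hm : y + η / 2 ∈ Icc a b := ⟨by linarith [hy.1], h1.trans hz.2⟩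
        exact (step y hy _ hm (by linarith) (by linarith)).trans (ih _ hm z hz h1 (by linarith))
  obtain ⟨n, hn⟩ := exists_nat_ge ((b - a) / (η / 2))
  refine main n a ⟨le_rfl, hab⟩ b ⟨hab, le_rfl⟩ hab ?_
  rwa [div_le_iff₀ (by positivity)] at hn

end StripMap
end

noncomputable section

namespace StripMap

/-! ### Maps that stretch one quadrangle across another -/

/-- The points of `S` that `Q` sends to `E`. -/
def transitSet (S E : Quad) (Q : ℝ × ℝ → ℝ × ℝ) : Set (ℝ × ℝ) :=
  {p ∈ S.region | Q p ∈ E.region}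

/-- The bounds on the linearization `L`: positive entries, the first of them at least `ρ`, the
lower row at most `B`, and determinant `κ`. -/
structure IsStretching (ρ B κ : ℝ) (L : ℝ × ℝ →L[ℝ] ℝ × ℝ) : Prop where
  le₁₁ : ρ ≤ (L (1, 0)).1
  pos₁₂ : 0 < (L (0, 1)).1
  pos₂₁ : 0 < (L (1, 0)).2
  pos₂₂ : 0 < (L (0, 1)).2
  le₂₁ : (L (1, 0)).2 ≤ B
  le₂₂ : (L (0, 1)).2 ≤ B
  det : (L (1, 0)).1 * (L (0, 1)).2 - (L (1, 0)).2 * (L (0, 1)).1 = κ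

/-- `Q`, with inverse `T`, is defined on `S` and stretches the part of `S` that it maps to `E`.
Points on the left and right sides of `S` and points on the lower and upper sides of `E` do not
take part, and curves in `Q(S) ∪ E` do not wind around points of the lower and upper sides
of `E`. -/
structure Crossing (S E : Quad) (Q T : ℝ × ℝ → ℝ × ℝ) (γ M ρ B κ : ℝ) : Prop where
  source : S.IsGood γ M
  target : E.IsGood γ M
  one_lt : 1 < ρ
  cont : ContinuousOn Q S.region
  lin : ∀ p ∈ closure (transitSet S E Q), ∃ L : ℝ × ℝ →L[ℝ] ℝ × ℝ,
    HasFDerivAt Q L p ∧ IsStretching ρ B κ L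
  left_avoid : ∀ p ∈ closure (transitSet S E Q), p.1 ≠ S.bm p.2
  right_avoid : ∀ p ∈ closure (transitSet S E Q), p.1 ≠ S.bp p.2
  lower_avoid : ∀ p ∈ closure (transitSet S E Q), (Q p).2 ≠ E.am (Q p).1
  upper_avoid : ∀ p ∈ closure (transitSet S E Q), (Q p).2 ≠ E.ap (Q p).1
  leftInv : ∀ p ∈ closure (transitSet S E Q), T (Q p) = p
  invCont : ∀ p ∈ transitSet S E Q, ContinuousAt T (Q p)
  rightInv : ∀ p ∈ transitSet S E Q, ∀ᶠ q in 𝓝 (Q p), Q (T q) = q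
  wind : ∀ (a b : ℝ) (ℓ : ℝ → ℝ × ℝ), a ≤ b → ContinuousOn ℓ (Icc a b) → ℓ a = ℓ b →
    (∀ t ∈ Icc a b, ℓ t ∈ Q '' S.region ∪ E.region) → ∀ c ∈ E.closedRegion,
    (c.2 = E.am c.1 ∨ c.2 = E.ap c.1) →
    HasClosedLog a b (fun t => ⟨(ℓ t).1 - c.1, (ℓ t).2 - c.2⟩)

lemma clm_apply_eq (L : ℝ × ℝ →L[ℝ] ℝ × ℝ) (x y : ℝ) :
    L (x, y) = (x * (L (1, 0)).1 + y * (L (0, 1)).1, x * (L (1, 0)).2 + y * (L (0, 1)).2) := by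
  have : ((x, y) : ℝ × ℝ) = x • ((1 : ℝ), (0 : ℝ)) + y • ((0 : ℝ), (1 : ℝ)) := by simp
  rw [this, map_add, map_smul, map_smul]
  simp [Prod.ext_iff]

/-- Mean value theorem for a linear combination of the components of a plane map. -/
lemma exists_mvt {A : Set (ℝ × ℝ)} (hA : Convex ℝ A) {f : ℝ × ℝ → ℝ × ℝ}
    {P : (ℝ × ℝ →L[ℝ] ℝ × ℝ) → Prop}
    (hf : ∀ p ∈ A, ∃ L : ℝ × ℝ →L[ℝ] ℝ × ℝ, HasFDerivAt f L p ∧ P L)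
    {p q : ℝ × ℝ} (hp : p ∈ A) (hq : q ∈ A) (α β : ℝ) :
    ∃ L : ℝ × ℝ →L[ℝ] ℝ × ℝ, P L ∧
      α * ((f q).1 - (f p).1) + β * ((f q).2 - (f p).2) =
        α * ((q.1 - p.1) * (L (1, 0)).1 + (q.2 - p.2) * (L (0, 1)).1) +
        β * ((q.1 - p.1) * (L (1, 0)).2 + (q.2 - p.2) * (L (0, 1)).2) := by
  choose! L hL hP using hf
  -- An intermediate point exists only for scalar functions, so the combination of the two
  -- components is fixed beforehand.
  obtain ⟨z, hz, e⟩ := domain_mvt (f := fun p => α * (f p).1 + β * (f p).2)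
    (f' := fun p => α • ((ContinuousLinearMap.fst ℝ ℝ ℝ).comp (L p)) +
      β • ((ContinuousLinearMap.snd ℝ ℝ ℝ).comp (L p))) (s := A)
    (fun x hx => (((hL x hx).fst.const_mul α).add ((hL x hx).snd.const_mul β)).hasFDerivWithinAt)
    hA hp hq
  have hzA : z ∈ A := hA.segment_subset hp hq hz
  refine ⟨L z, hP z hzA, ?_⟩
  have e2 : q - p = (q.1 - p.1, q.2 - p.2) := rfl
  rw [e2] at e
  simp only [add_apply, smul_apply, ContinuousLinearMap.comp_apply,
    ContinuousLinearMap.coe_fst', ContinuousLinearMap.coe_snd', smul_eq_mul] at e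
  rw [clm_apply_eq (L z) (q.1 - p.1)] at e
  linarith

/-- The point with abscissa `u` on the leaf `s` of the first family. -/
def Quad.leafPt (S : Quad) (s u : ℝ) : ℝ × ℝ := (u, S.hLeaf s u)

lemma Quad.IsGood.continuous_leafPt {S : Quad} {γ M : ℝ} (h : S.IsGood γ M) (s : ℝ) :
    Continuous (S.leafPt s) :=
  continuous_id.prodMk (h.continuous_hLeaf' s)

namespace Crossing

variable {S E : Quad} {Q T : ℝ × ℝ → ℝ × ℝ} {γ M ρ B κ : ℝ}

lemma isOpen_transitSet (h : Crossing S E Q T γ M ρ B κ) : IsOpen (transitSet S E Q) :=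
  h.cont.isOpen_inter_preimage h.source.isOpen_region h.target.isOpen_region

lemma closure_subset (h : Crossing S E Q T γ M ρ B κ) :
    closure (transitSet S E Q) ⊆ S.closedRegion :=
  (closure_mono fun _ hp => hp.1).trans h.source.closure_region_subset

lemma isCompact_closure (h : Crossing S E Q T γ M ρ B κ) :
    IsCompact (closure (transitSet S E Q)) :=
  h.source.isCompact_closedRegion.of_isClosed_subset isClosed_closure h.closure_subset

lemma continuousAt (h : Crossing S E Q T γ M ρ B κ) {p : ℝ × ℝ}
    (hp : p ∈ closure (transitSet S E Q)) : ContinuousAt Q p := by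
  obtain ⟨L, hL, -⟩ := h.lin p hp
  exact hL.continuousAt

lemma continuousOn_closure (h : Crossing S E Q T γ M ρ B κ) :
    ContinuousOn Q (closure (transitSet S E Q)) :=
  fun _ hp => (h.continuousAt hp).continuousWithinAt

lemma map_closure (h : Crossing S E Q T γ M ρ B κ) {p : ℝ × ℝ}
    (hp : p ∈ closure (transitSet S E Q)) : Q p ∈ E.closedRegion := by
  refine h.target.closure_region_subset ?_
  exact (h.continuousAt hp).continuousWithinAt.mem_closure hp fun x hx => hx.2

lemma injOn (h : Crossing S E Q T γ M ρ B κ) : InjOn Q (closure (transitSet S E Q)) :=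
  fun p hp q hq e => by rw [← h.leftInv p hp, e, h.leftInv q hq]

/-- The closure avoids the left and right sides of the source, so these two inequalities remain
strict under limits; `sCo_map_mem` is the counterpart for the lower and upper sides of the target.
Only the other four inequalities can degenerate. -/
lemma rCo_mem (h : Crossing S E Q T γ M ρ B κ) {p : ℝ × ℝ}
    (hp : p ∈ closure (transitSet S E Q)) : 0 < S.rCo p ∧ S.rCo p < 1 := by
  have h1 := (h.source.mem_closedRegion_iff.1 (h.closure_subset hp)).2
  refine ⟨lt_of_le_of_ne h1.1 fun e => ?_, lt_of_le_of_ne h1.2 fun e => ?_⟩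
  · have := h.source.eq_vLeaf_iff.2 e.symm
    rw [Quad.IsGood.vLeaf_zero] at this
    exact h.left_avoid p hp this
  · have := h.source.eq_vLeaf_iff.2 e
    rw [Quad.IsGood.vLeaf_one] at this
    exact h.right_avoid p hp this

lemma sCo_map_mem (h : Crossing S E Q T γ M ρ B κ) {p : ℝ × ℝ}
    (hp : p ∈ closure (transitSet S E Q)) : 0 < E.sCo (Q p) ∧ E.sCo (Q p) < 1 := by
  have h1 := (h.target.mem_closedRegion_iff.1 (h.map_closure hp)).1
  refine ⟨lt_of_le_of_ne h1.1 fun e => ?_, lt_of_le_of_ne h1.2 fun e => ?_⟩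
  · have := h.target.eq_hLeaf_iff.2 e.symm
    rw [Quad.IsGood.hLeaf_zero] at this
    exact h.lower_avoid p hp this
  · have := h.target.eq_hLeaf_iff.2 e
    rw [Quad.IsGood.hLeaf_one] at this
    exact h.upper_avoid p hp this

/-- A point of the closure belongs to the set itself as soon as its two free coordinates are
interior. -/
lemma mem_transitSet_iff (h : Crossing S E Q T γ M ρ B κ) {p : ℝ × ℝ}
    (hp : p ∈ closure (transitSet S E Q)) : p ∈ transitSet S E Q ↔
      (0 < S.sCo p ∧ S.sCo p < 1) ∧ 0 < E.rCo (Q p) ∧ E.rCo (Q p) < 1 := by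
  constructor
  · intro hp'
    exact ⟨(h.source.mem_region_iff.1 hp'.1).1, (h.target.mem_region_iff.1 hp'.2).2⟩
  · rintro ⟨h1, h2⟩
    exact ⟨h.source.mem_region_iff.2 ⟨h1, h.rCo_mem hp⟩,
      h.target.mem_region_iff.2 ⟨h.sCo_map_mem hp, h2⟩⟩

/-- Linear combinations of the coordinates of the image are monotone along leaves. -/
lemma monotoneOn_leaf (h : Crossing S E Q T γ M ρ B κ) {s : ℝ} (hs0 : 0 ≤ s) (hs1 : s ≤ 1)
    {J : Set ℝ} (hJ : J.OrdConnected) (hJV : ∀ u ∈ J, S.leafPt s u ∈ transitSet S E Q)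
    {α β e : ℝ} (hcoef : ∀ L : ℝ × ℝ →L[ℝ] ℝ × ℝ, IsStretching ρ B κ L → ∀ x y, 0 ≤ x → 0 ≤ y →
      y ≤ γ * x → e * x ≤ α * (x * (L (1, 0)).1 + y * (L (0, 1)).1) +
        β * (x * (L (1, 0)).2 + y * (L (0, 1)).2)) :
    MonotoneOn (fun u => α * (Q (S.leafPt s u)).1 + β * (Q (S.leafPt s u)).2 - e * u) J := by
  -- The transit set is open but not convex, so the mean value theorem is applied in small balls. A
  -- chord of a leaf has slope between 0 and `γ`.
  refine monotoneOn_of_locally hJ fun u hu => ?_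
  obtain ⟨r, hr, hrV⟩ := Metric.isOpen_iff.1 h.isOpen_transitSet _ (hJV u hu)
  obtain ⟨ε, hε, hε'⟩ := Metric.continuousAt_iff.1
    (h.source.continuous_leafPt s).continuousAt r hr
  refine ⟨ε, hε, fun y _ z _ hy hz hyz => ?_⟩
  obtain ⟨L, hL, hLe⟩ := exists_mvt (convex_ball (S.leafPt s u) r)
    (fun p hp => h.lin p (subset_closure (hrV hp))) (p := S.leafPt s y) (q := S.leafPt s z)
    (hε' hy) (hε' hz) α β
  have hm := h.source.hLeaf_mono hs0 hs1 hyz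
  have hl := h.source.hLeaf_lip hs0 hs1 hyz
  have := hcoef L hL (z - y) (S.hLeaf s z - S.hLeaf s y) (by linarith) (by linarith) hl
  simp only [Quad.leafPt] at hLe this ⊢
  linarith

/-- The rise of the leaf contributes nonnegatively because the entries are positive, and the
horizontal part alone gives the rate `ρ`. -/
lemma fst_monotoneOn (h : Crossing S E Q T γ M ρ B κ) {s : ℝ} (hs0 : 0 ≤ s) (hs1 : s ≤ 1)
    {J : Set ℝ} (hJ : J.OrdConnected) (hJV : ∀ u ∈ J, S.leafPt s u ∈ transitSet S E Q) :
    MonotoneOn (fun u => (Q (S.leafPt s u)).1 - ρ * u) J := by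
  have := h.monotoneOn_leaf hs0 hs1 hJ hJV (α := 1) (β := 0) (e := ρ) fun L hL x y hx hy _ => by
    have h1 := mul_le_mul_of_nonneg_right hL.le₁₁ hx
    have h2 := mul_nonneg hy hL.pos₁₂.le
    linarith
  simpa using this

lemma snd_monotoneOn (h : Crossing S E Q T γ M ρ B κ) {s : ℝ} (hs0 : 0 ≤ s) (hs1 : s ≤ 1)
    {J : Set ℝ} (hJ : J.OrdConnected) (hJV : ∀ u ∈ J, S.leafPt s u ∈ transitSet S E Q) :
    MonotoneOn (fun u => (Q (S.leafPt s u)).2) J := by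
  have := h.monotoneOn_leaf hs0 hs1 hJ hJV (α := 0) (β := 1) (e := 0) fun L hL x y hx hy _ => by
    have h1 := mul_nonneg hx hL.pos₂₁.le
    have h2 := mul_nonneg hy hL.pos₂₂.le
    linarith
  simpa using this

/-- Per unit of `u` the ordinate of the image gains at most `B + γ * B`, while its abscissa gains at
least `ρ > 1`. This is the source of the new Lipschitz constant. -/
lemma slope_monotoneOn (h : Crossing S E Q T γ M ρ B κ) {s : ℝ} (hs0 : 0 ≤ s) (hs1 : s ≤ 1)
    {J : Set ℝ} (hJ : J.OrdConnected) (hJV : ∀ u ∈ J, S.leafPt s u ∈ transitSet S E Q)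
    {γ' : ℝ} (hγ' : B * (1 + γ) ≤ γ') :
    MonotoneOn (fun u => γ' * (Q (S.leafPt s u)).1 - (Q (S.leafPt s u)).2) J := by
  have hγ := h.source.gamma_nonneg
  have := h.monotoneOn_leaf hs0 hs1 hJ hJV (α := γ') (β := -1) (e := 0)
    fun L hL x y hx hy hxy => by
      have hB : 0 ≤ B := hL.pos₂₁.le.trans hL.le₂₁
      have hγ0 : 0 ≤ γ' := le_trans (by positivity) hγ'
      have hρ := h.one_lt.le.trans hL.le₁₁
      have h1 : γ' * x ≤ γ' * (x * (L (1, 0)).1 + y * (L (0, 1)).1) := by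
        have := mul_nonneg hy hL.pos₁₂.le
        have : x * 1 ≤ x * (L (1, 0)).1 := by gcongr
        gcongr; linarith
      have h2 : x * (L (1, 0)).2 + y * (L (0, 1)).2 ≤ x * B + γ * x * B := by
        have := hL.le₂₁
        have := hL.le₂₂
        have := hL.pos₂₂
        gcongr
      nlinarith
  simpa [sub_eq_add_neg] using this

lemma fst_strictMonoOn (h : Crossing S E Q T γ M ρ B κ) {s : ℝ} (hs0 : 0 ≤ s) (hs1 : s ≤ 1)
    {J : Set ℝ} (hJ : J.OrdConnected) (hJV : ∀ u ∈ J, S.leafPt s u ∈ transitSet S E Q) :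
    StrictMonoOn (fun u => (Q (S.leafPt s u)).1) J := by
  intro y hy z hz hyz
  have := h.fst_monotoneOn hs0 hs1 hJ hJV hy hz hyz.le
  simp only [] at this ⊢
  nlinarith [h.one_lt]

/-- The image moves to the right and not down while the leaves of `E` fall, so it can cross each of
them only from left to right. -/
lemma gap_strictMonoOn (h : Crossing S E Q T γ M ρ B κ) {s : ℝ} (hs0 : 0 ≤ s) (hs1 : s ≤ 1)
    {J : Set ℝ} (hJ : J.OrdConnected) (hJV : ∀ u ∈ J, S.leafPt s u ∈ transitSet S E Q)
    {R : ℝ} (hR0 : 0 ≤ R) (hR1 : R ≤ 1) :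
    StrictMonoOn (fun u => (Q (S.leafPt s u)).1 - E.vLeaf R (Q (S.leafPt s u)).2) J :=
  fun _ hy _ hz hyz => h.target.rCo_gap_lt hR0 hR1 (h.fst_strictMonoOn hs0 hs1 hJ hJV hy hz hyz)
    (h.snd_monotoneOn hs0 hs1 hJ hJV hy hz hyz.le)

lemma isOpen_leafSet (h : Crossing S E Q T γ M ρ B κ) (s : ℝ) :
    IsOpen {u | S.leafPt s u ∈ transitSet S E Q} :=
  h.isOpen_transitSet.preimage (h.source.continuous_leafPt s)

lemma exists_bound (h : Crossing S E Q T γ M ρ B κ) :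
    ∃ C, ∀ s u, S.leafPt s u ∈ transitSet S E Q → |u| < C := by
  obtain ⟨C, hC⟩ := h.isCompact_closure.exists_bound_of_continuousOn continuousOn_fst
  exact ⟨C + 1, fun s u hu => by have := hC _ (subset_closure hu); simp [Quad.leafPt] at this; linarith⟩

/-- On an interior leaf of the source all inequalities but those for the coordinate `r` of the image
are automatically strict on the closure, so the set can only be left through the left or right side
of `E`. -/
lemma exit_aux (h : Crossing S E Q T γ M ρ B κ) {s b : ℝ} (hs0 : 0 < s) (hs1 : s < 1)
    (hbc : S.leafPt s b ∈ closure (transitSet S E Q)) (hb : S.leafPt s b ∉ transitSet S E Q) :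
    E.rCo (Q (S.leafPt s b)) = 0 ∨ E.rCo (Q (S.leafPt s b)) = 1 := by
  have h1 := (h.target.mem_closedRegion_iff.1 (h.map_closure hbc)).2
  rw [h.mem_transitSet_iff hbc, Quad.leafPt, h.source.sCo_leaf, and_iff_right ⟨hs0, hs1⟩,
    ← Quad.leafPt] at hb
  by_contra hcon
  rw [not_or] at hcon
  exact hb ⟨lt_of_le_of_ne h1.1 (Ne.symm hcon.1), lt_of_le_of_ne h1.2 hcon.2⟩

/-- Along a leaf, the image leaves `E` to the right through the right side. -/
lemma exists_exit_right (h : Crossing S E Q T γ M ρ B κ) {s u₀ : ℝ} (hs0 : 0 < s) (hs1 : s < 1)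
    (hu₀ : S.leafPt s u₀ ∈ transitSet S E Q) :
    ∃ b > u₀, (∀ u ∈ Ico u₀ b, S.leafPt s u ∈ transitSet S E Q) ∧
      S.leafPt s b ∈ closure (transitSet S E Q) ∧ S.leafPt s b ∉ transitSet S E Q ∧
      E.rCo (Q (S.leafPt s b)) = 1 := by
  obtain ⟨C, hC⟩ := h.exists_bound
  set N := {u | u₀ ≤ u ∧ S.leafPt s u ∉ transitSet S E Q} with hN
  have hNc : IsClosed N := isClosed_Ici.inter (h.isOpen_leafSet s).isClosed_compl
  have hNne : N.Nonempty := by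
    refine ⟨C, ?_, fun hc => ?_⟩
    · exact ((le_abs_self _).trans_lt (hC s u₀ hu₀)).le
    · exact absurd (hC s C hc) (not_lt.2 (le_abs_self _))
  have hNb : BddBelow N := ⟨u₀, fun u hu => hu.1⟩
  set b := sInf N with hb
  have hbN : b ∈ N := hNc.csInf_mem hNne hNb
  have hlt : u₀ < b := lt_of_le_of_ne hbN.1 fun e => hbN.2 (e ▸ hu₀)
  have hin : ∀ u ∈ Ico u₀ b, S.leafPt s u ∈ transitSet S E Q := fun u hu => by
    by_contra hc
    exact absurd (csInf_le hNb ⟨hu.1, hc⟩) (not_le.2 hu.2)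
  have hcl : S.leafPt s b ∈ closure (transitSet S E Q) := by
    have h1 : b ∈ closure (Ico u₀ b) := by
      rw [closure_Ico hlt.ne]; exact ⟨hlt.le, le_rfl⟩
    exact map_mem_closure (h.source.continuous_leafPt s) h1 hin
  refine ⟨b, hlt, hin, hcl, hbN.2, (h.exit_aux hs0 hs1 hcl hbN.2).resolve_left fun h0 => ?_⟩
  -- The gap to the left side is positive at `u₀` and increases up to `b`, so it cannot vanish at
  -- the exit.
  have hg := h.gap_strictMonoOn hs0.le hs1.le ordConnected_Ico hin (R := 0) le_rfl zero_le_one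
  have hpos : 0 < (Q (S.leafPt s u₀)).1 - E.vLeaf 0 (Q (S.leafPt s u₀)).2 :=
    sub_pos.2 (h.target.vLeaf_lt_iff.2 (h.target.mem_region_iff.1 hu₀.2).2.1)
  have hz : (Q (S.leafPt s b)).1 - E.vLeaf 0 (Q (S.leafPt s b)).2 = 0 :=
    sub_eq_zero.2 (h.target.eq_vLeaf_iff.2 h0)
  have hct : ContinuousAt (fun u => (Q (S.leafPt s u)).1 - E.vLeaf 0 (Q (S.leafPt s u)).2) b := by
    have h1 : ContinuousAt (fun u => Q (S.leafPt s u)) b :=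
      ContinuousAt.comp (f := S.leafPt s) (h.continuousAt hcl)
        (h.source.continuous_leafPt s).continuousAt
    exact h1.fst.sub ((h.target.continuous_vLeaf' 0).continuousAt.comp h1.snd)
  have hle : (Q (S.leafPt s u₀)).1 - E.vLeaf 0 (Q (S.leafPt s u₀)).2 ≤
      (Q (S.leafPt s b)).1 - E.vLeaf 0 (Q (S.leafPt s b)).2 := by
    refine ge_of_tendsto (hct.mono_left nhdsWithin_le_nhds : Tendsto _ (𝓝[<] b) _) ?_
    filter_upwards [Ico_mem_nhdsLT hlt] with u hu
    exact hg.monotoneOn ⟨le_rfl, hlt⟩ hu hu.1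
  linarith

/-- Along a leaf, the image leaves `E` to the left through the left side. -/
lemma exists_exit_left (h : Crossing S E Q T γ M ρ B κ) {s u₀ : ℝ} (hs0 : 0 < s) (hs1 : s < 1)
    (hu₀ : S.leafPt s u₀ ∈ transitSet S E Q) :
    ∃ b < u₀, (∀ u ∈ Ioc b u₀, S.leafPt s u ∈ transitSet S E Q) ∧
      S.leafPt s b ∈ closure (transitSet S E Q) ∧ S.leafPt s b ∉ transitSet S E Q ∧
      E.rCo (Q (S.leafPt s b)) = 0 := by
  obtain ⟨C, hC⟩ := h.exists_bound
  set N := {u | u ≤ u₀ ∧ S.leafPt s u ∉ transitSet S E Q} with hN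
  have hNc : IsClosed N := isClosed_Iic.inter (h.isOpen_leafSet s).isClosed_compl
  have hNne : N.Nonempty := by
    refine ⟨-C, ?_, fun hc => ?_⟩
    · linarith [(neg_le_abs _).trans_lt (hC s u₀ hu₀)]
    · have := hC s (-C) hc
      rw [abs_neg] at this
      exact absurd this (not_lt.2 (le_abs_self _))
  have hNb : BddAbove N := ⟨u₀, fun u hu => hu.1⟩
  set b := sSup N with hb
  have hbN : b ∈ N := hNc.csSup_mem hNne hNb
  have hlt : b < u₀ := lt_of_le_of_ne hbN.1 fun e => hbN.2 (e ▸ hu₀)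
  have hin : ∀ u ∈ Ioc b u₀, S.leafPt s u ∈ transitSet S E Q := fun u hu => by
    by_contra hc
    exact absurd (le_csSup hNb ⟨hu.2, hc⟩) (not_le.2 hu.1)
  have hcl : S.leafPt s b ∈ closure (transitSet S E Q) := by
    have h1 : b ∈ closure (Ioc b u₀) := by
      rw [closure_Ioc hlt.ne]; exact ⟨le_rfl, hlt.le⟩
    exact map_mem_closure (h.source.continuous_leafPt s) h1 hin
  refine ⟨b, hlt, hin, hcl, hbN.2, (h.exit_aux hs0 hs1 hcl hbN.2).resolve_right fun h0 => ?_⟩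
  have hg := h.gap_strictMonoOn hs0.le hs1.le ordConnected_Ioc hin (R := 1) zero_le_one le_rfl
  have hpos : (Q (S.leafPt s u₀)).1 - E.vLeaf 1 (Q (S.leafPt s u₀)).2 < 0 :=
    sub_neg.2 (h.target.lt_vLeaf_iff.2 (h.target.mem_region_iff.1 hu₀.2).2.2)
  have hz : (Q (S.leafPt s b)).1 - E.vLeaf 1 (Q (S.leafPt s b)).2 = 0 :=
    sub_eq_zero.2 (h.target.eq_vLeaf_iff.2 h0)
  have hct : ContinuousAt (fun u => (Q (S.leafPt s u)).1 - E.vLeaf 1 (Q (S.leafPt s u)).2) b := by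
    have h1 : ContinuousAt (fun u => Q (S.leafPt s u)) b :=
      ContinuousAt.comp (f := S.leafPt s) (h.continuousAt hcl)
        (h.source.continuous_leafPt s).continuousAt
    exact h1.fst.sub ((h.target.continuous_vLeaf' 1).continuousAt.comp h1.snd)
  have hle : (Q (S.leafPt s b)).1 - E.vLeaf 1 (Q (S.leafPt s b)).2 ≤
      (Q (S.leafPt s u₀)).1 - E.vLeaf 1 (Q (S.leafPt s u₀)).2 := by
    refine le_of_tendsto (hct.mono_left nhdsWithin_le_nhds : Tendsto _ (𝓝[>] b) _) ?_
    filter_upwards [Ioc_mem_nhdsGT hlt] with u hu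
    exact hg.monotoneOn hu ⟨hlt, le_rfl⟩ hu.2
  linarith

end Crossing

end StripMap
end

/-! ### A leaf passes through the target at most once. -/

noncomputable section

namespace StripMap

lemma exists_fixedPoint_of_bounded {φ : ℝ → ℝ} (hφ : Continuous φ) {C : ℝ} (hC : ∀ y, |φ y| ≤ C) :
    ∃ y, y = φ y := by
  have hC0 : 0 ≤ C := (abs_nonneg _).trans (hC 0)
  have hc : ContinuousOn (fun y => y - φ y) (Icc (-C) C) := by fun_prop
  obtain ⟨y, -, hy⟩ := intermediate_value_Icc (by linarith : -C ≤ C) hc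
    (show (0 : ℝ) ∈ Icc (-C - φ (-C)) (C - φ C) by
      have h1 := abs_le.1 (hC (-C))
      have h2 := abs_le.1 (hC C)
      constructor <;> linarith)
  exact ⟨y, by simpa [sub_eq_zero] using hy⟩

namespace Quad.IsGood

variable {K : Quad} {γ M : ℝ}

/-- Leaves of the first family meet the quadrangle in an interval. -/
lemma leafPt_mem_region (h : K.IsGood γ M) {s u₁ u u₂ : ℝ} (h₁ : K.leafPt s u₁ ∈ K.region)
    (h₂ : K.leafPt s u₂ ∈ K.region) (h1 : u₁ ≤ u) (h2 : u ≤ u₂) : K.leafPt s u ∈ K.region := by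
  rw [h.mem_region_iff, leafPt, h.sCo_leaf] at h₁ h₂ ⊢
  have hm := h.hLeaf_mono h₁.1.1.le h₁.1.2.le
  refine ⟨h₁.1, ?_, ?_⟩
  · rw [← h.vLeaf_lt_iff, vLeaf_zero]
    have := h₁.2.1
    rw [← h.vLeaf_lt_iff, vLeaf_zero] at this
    exact (h.bm_anti (hm h1)).trans_lt (this.trans_le h1)
  · rw [← h.lt_vLeaf_iff, vLeaf_one]
    have := h₂.2.2
    rw [← h.lt_vLeaf_iff, vLeaf_one] at this
    exact h2.trans_lt (this.trans_le (h.bp_anti (hm h2)))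

/-- Nonincreasing curves meet the quadrangle in an interval. -/
lemma mem_region_of_anti (h : K.IsGood γ M) {v : ℝ → ℝ} (hv : Antitone v)
    (hvb : ∀ y, K.bm y < v y ∧ v y < K.bp y) {y₁ y y₂ : ℝ} (h₁ : K.am (v y₁) < y₁)
    (h₂ : y₂ < K.ap (v y₂)) (h1 : y₁ ≤ y) (h2 : y ≤ y₂) : (v y, y) ∈ K.region :=
  ⟨(h.am_mono (hv h1)).trans_lt (h₁.trans_le h1), h2.trans_lt (h₂.trans_le (h.ap_mono (hv h2))),
    (hvb y).1, (hvb y).2⟩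

lemma vLeaf_between (h : K.IsGood γ M) {r : ℝ} (h0 : 0 < r) (h1 : r < 1) (y : ℝ) :
    K.bm y < K.vLeaf r y ∧ K.vLeaf r y < K.bp y := by
  rw [← vLeaf_zero, ← vLeaf_one]
  exact ⟨h.vLeaf_lt h0 y, h.vLeaf_lt h1 y⟩

/-- A curve of the second family runs from the lower side to the upper side. -/
lemma exists_ends (h : K.IsGood γ M) {r : ℝ} (h0 : 0 < r) (h1 : r < 1) :
    ∃ y₁ y₂, y₁ < y₂ ∧ y₁ = K.am (K.vLeaf r y₁) ∧ y₂ = K.ap (K.vLeaf r y₂) ∧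
      ∀ y, (K.vLeaf r y, y) ∈ K.region ↔ y₁ < y ∧ y < y₂ := by
  obtain ⟨C, hC⟩ := h.bdd
  obtain ⟨y₁, e₁⟩ := exists_fixedPoint_of_bounded
    (h.continuous_am.comp (h.continuous_vLeaf' r)) (C := C) fun y => (hC _).1
  obtain ⟨y₂, e₂⟩ := exists_fixedPoint_of_bounded
    (h.continuous_ap.comp (h.continuous_vLeaf' r)) (C := C) fun y => (hC _).2.1
  simp only [Function.comp] at e₁ e₂
  have ha := h.vLeaf_anti h0.le h1.le
  refine ⟨y₁, y₂, ?_, e₁, e₂, fun y => ⟨fun hy => ⟨?_, ?_⟩, fun hy => ⟨?_, ?_, ?_⟩⟩⟩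
  · by_contra hc
    have h2 := h.ap_mono (ha (not_lt.1 hc))
    have h3 := h.a_lt (K.vLeaf r y₁)
    linarith
  · by_contra hc
    have h2 := h.am_mono (ha (not_lt.1 hc))
    have := hy.1
    simp only [] at this
    linarith
  · by_contra hc
    have h2 := h.ap_mono (ha (not_lt.1 hc))
    have := hy.2.1
    simp only [] at this
    linarith
  · have h2 := h.am_mono (ha hy.1.le)
    simp only []
    linarith [hy.1]
  · have h2 := h.ap_mono (ha hy.2.le)
    simp only []
    linarith [hy.2]
  · exact h.vLeaf_between h0 h1 y

end Quad.IsGood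

namespace Crossing

variable {S E : Quad} {Q T : ℝ × ℝ → ℝ × ℝ} {γ M ρ B κ : ℝ}

lemma isClosed_leaf_level (h : Crossing S E Q T γ M ρ B κ) (s R : ℝ) :
    IsClosed {u | S.leafPt s u ∈ closure (transitSet S E Q) ∧ E.rCo (Q (S.leafPt s u)) = R} := by
  have h1 : IsClosed {u | S.leafPt s u ∈ closure (transitSet S E Q)} :=
    isClosed_closure.preimage (h.source.continuous_leafPt s)
  have h2 : ContinuousOn (fun u => E.rCo (Q (S.leafPt s u)))
      {u | S.leafPt s u ∈ closure (transitSet S E Q)} :=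
    h.target.continuous_rCo.comp_continuousOn
      (h.continuousOn_closure.comp (h.source.continuous_leafPt s).continuousOn fun u hu => hu)
  exact h2.preimage_isClosed_of_isClosed h1 (isClosed_singleton (x := R))

lemma mem_transitSet_leaf (h : Crossing S E Q T γ M ρ B κ) {s u : ℝ} (hs0 : 0 < s) (hs1 : s < 1)
    (hu : S.leafPt s u ∈ closure (transitSet S E Q))
    (h0 : 0 < E.rCo (Q (S.leafPt s u))) (h1 : E.rCo (Q (S.leafPt s u)) < 1) :
    S.leafPt s u ∈ transitSet S E Q := by
  rw [h.mem_transitSet_iff hu]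
  refine ⟨?_, h0, h1⟩
  rw [Quad.leafPt, h.source.sCo_leaf]
  exact ⟨hs0, hs1⟩

/-- Intermediate value theorem for the coordinate `r` of the image along a leaf. -/
lemma exists_level (h : Crossing S E Q T γ M ρ B κ) {s a b R : ℝ} (hab : a ≤ b)
    (hcl : ∀ u ∈ Icc a b, S.leafPt s u ∈ closure (transitSet S E Q))
    (ha : E.rCo (Q (S.leafPt s a)) < R) (hb : R < E.rCo (Q (S.leafPt s b))) :
    ∃ u ∈ Ioo a b, E.rCo (Q (S.leafPt s u)) = R := by
  have hc : ContinuousOn (fun u => E.rCo (Q (S.leafPt s u))) (Icc a b) :=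
    h.target.continuous_rCo.comp_continuousOn
      (h.continuousOn_closure.comp (h.source.continuous_leafPt s).continuousOn hcl)
  exact intermediate_value_Ioo hab hc ⟨ha, hb⟩

lemma exists_level_right (h : Crossing S E Q T γ M ρ B κ) {s u₀ R : ℝ} (hs0 : 0 < s) (hs1 : s < 1)
    (hu₀ : S.leafPt s u₀ ∈ transitSet S E Q) (hR1 : R < 1)
    (hR : E.rCo (Q (S.leafPt s u₀)) < R) :
    ∃ u > u₀, S.leafPt s u ∈ transitSet S E Q ∧ E.rCo (Q (S.leafPt s u)) = R := by
  obtain ⟨b, hb, hin, hcl, -, hr⟩ := h.exists_exit_right hs0 hs1 hu₀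
  obtain ⟨u, hu, e⟩ := h.exists_level (s := s) hb.le (fun u hu => by
    rcases hu.2.lt_or_eq with h1 | h1
    · exact subset_closure (hin u ⟨hu.1, h1⟩)
    · rw [h1]; exact hcl) hR (by rw [hr]; exact hR1)
  exact ⟨u, hu.1, hin u ⟨hu.1.le, hu.2⟩, e⟩

lemma exists_level_left (h : Crossing S E Q T γ M ρ B κ) {s u₀ R : ℝ} (hs0 : 0 < s) (hs1 : s < 1)
    (hu₀ : S.leafPt s u₀ ∈ transitSet S E Q) (hR0 : 0 < R)
    (hR : R < E.rCo (Q (S.leafPt s u₀))) {c : ℝ} (hc : c < u₀) 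
    (hcV : S.leafPt s c ∉ transitSet S E Q) :
    ∃ u ∈ Ioo c u₀, S.leafPt s u ∈ transitSet S E Q ∧ E.rCo (Q (S.leafPt s u)) = R := by
  obtain ⟨b, hb, hin, hcl, -, hr⟩ := h.exists_exit_left hs0 hs1 hu₀
  obtain ⟨u, hu, e⟩ := h.exists_level (s := s) hb.le (fun u hu => by
    rcases hu.1.lt_or_eq with h1 | h1
    · exact subset_closure (hin u ⟨h1, hu.2⟩)
    · rw [← h1]; exact hcl) (by rw [hr]; exact hR0) hR
  have hcb : c ≤ b := not_lt.1 fun hlt => hcV (hin c ⟨hlt, hc.le⟩)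
  exact ⟨u, ⟨hcb.trans_lt hu.1, hu.2⟩, hin u ⟨hu.1, hu.2.le⟩, e⟩

/-- The image of a leaf does not cross `E` twice. -/
lemma false_of_two_crossings (h : Crossing S E Q T γ M ρ B κ) {s R u₁ u₂ : ℝ} (hs0 : 0 < s)
    (hs1 : s < 1) (hR0 : 0 < R) (hR1 : R < 1) (hu : u₁ < u₂)
    (hV₁ : S.leafPt s u₁ ∈ transitSet S E Q) (hV₂ : S.leafPt s u₂ ∈ transitSet S E Q)
    (hr₁ : E.rCo (Q (S.leafPt s u₁)) = R) (hr₂ : E.rCo (Q (S.leafPt s u₂)) = R) : False := by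
  have hS := h.source
  have hE := h.target
  set V := transitSet S E Q with hV
  obtain ⟨b, hb, hin, hcl, hbV, hrb⟩ := h.exists_exit_right hs0 hs1 hV₁
  have hgR := h.gap_strictMonoOn hs0.le hs1.le ordConnected_Ico hin hR0.le hR1.le
  -- Before the exit at `b` the gap to the leaf `R` is strictly increasing, so the second point
  -- belongs to a later passage.
  have hbu₂ : b ≤ u₂ := by
    by_contra hc
    have h1 := hgR ⟨le_rfl, hb⟩ ⟨hu.le, not_le.1 hc⟩ hu
    have e1 := sub_eq_zero.2 (hE.eq_vLeaf_iff.2 hr₁)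
    have e2 := sub_eq_zero.2 (hE.eq_vLeaf_iff.2 hr₂)
    simp only [] at h1
    linarith
  -- the next crossing
  obtain ⟨m, ⟨⟨hbm', hmu₂⟩, hmV, hrm⟩, hmin⟩ : ∃ m, (m ∈ Icc b u₂ ∧ S.leafPt s m ∈ V ∧
      E.rCo (Q (S.leafPt s m)) = R) ∧ ∀ u, u ∈ Icc b u₂ → S.leafPt s u ∈ V →
      E.rCo (Q (S.leafPt s u)) = R → m ≤ u := by
    have hcpt : IsCompact (Icc b u₂ ∩
        {u | S.leafPt s u ∈ closure V ∧ E.rCo (Q (S.leafPt s u)) = R}) :=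
      isCompact_Icc.inter_right (h.isClosed_leaf_level s R)
    obtain ⟨m, hm, hmin⟩ := hcpt.exists_isLeast ⟨u₂, ⟨hbu₂, le_rfl⟩, subset_closure hV₂, hr₂⟩
    exact ⟨m, ⟨hm.1, h.mem_transitSet_leaf hs0 hs1 hm.2.1 (by rw [hm.2.2]; exact hR0)
      (by rw [hm.2.2]; exact hR1), hm.2.2⟩, fun u hu huV hr => hmin ⟨hu, subset_closure huV, hr⟩⟩
  have hbm : b < m := lt_of_le_of_ne hbm' fun e => hbV (e ▸ hmV)
  -- The loop consists of the image of `[u₁, m]` and a piece of the leaf `R`. The test leaf `R'`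
  -- lies strictly between `R` and the right side, so the first passage must cross it and the
  -- closing piece cannot meet it.
  set R' := (R + 1) / 2 with hR'
  have hRR' : R < R' := by rw [hR']; linarith
  have hR'1 : R' < 1 := by rw [hR']; linarith
  have hR'0 : 0 < R' := hR0.trans hRR'
  obtain ⟨x, hx, hrx⟩ := h.exists_level (s := s) (R := R') hb.le (fun u hu => by
    rcases hu.2.lt_or_eq with h1 | h1
    · exact subset_closure (hin u ⟨hu.1, h1⟩)
    · rw [h1]; exact hcl) (by rw [hr₁]; exact hRR') (by rw [hrb]; exact hR'1)
  have hxV : S.leafPt s x ∈ V := hin x ⟨hx.1.le, hx.2⟩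
  have hgR' := h.gap_strictMonoOn hs0.le hs1.le ordConnected_Ico hin hR'0.le hR'1.le
  have hreg : ∀ u ∈ Icc u₁ m, S.leafPt s u ∈ S.region := fun u hu =>
    hS.leafPt_mem_region hV₁.1 hmV.1 hu.1 hu.2
  obtain ⟨ym, yp, hyy, eym, eyp, hyiff⟩ := hE.exists_ends hR'0 hR'1
  obtain ⟨zm, zp, -, -, -, hziff⟩ := hE.exists_ends hR0 hR1
  -- the closed curve
  set yl : ℝ → ℝ := fun t =>
    (Q (S.leafPt s m)).2 + (t - m) * ((Q (S.leafPt s u₁)).2 - (Q (S.leafPt s m)).2) with hyl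
  set ℓ : ℝ → ℝ × ℝ := fun t =>
    if t ≤ m then Q (S.leafPt s t) else (E.vLeaf R (yl t), yl t) with hℓ
  have hℓ1 : ∀ t, t ≤ m → ℓ t = Q (S.leafPt s t) := fun t ht => if_pos ht
  have hℓ2 : ∀ t, m ≤ t → ℓ t = (E.vLeaf R (yl t), yl t) := by
    intro t ht
    rcases ht.lt_or_eq with h1 | h1
    · exact if_neg (not_le.2 h1)
    · rw [← h1, hℓ1 m le_rfl]
      have e : yl m = (Q (S.leafPt s m)).2 := by simp [hyl]
      rw [e, ← hE.eq_vLeaf_iff.2 hrm]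
  have hum : u₁ ≤ m := hb.le.trans hbm.le
  have hum1 : u₁ ≤ m + 1 := by linarith
  have hsplit : Icc u₁ (m + 1) = Icc u₁ m ∪ Icc m (m + 1) :=
    (Icc_union_Icc_eq_Icc hum (by linarith)).symm
  have hℓc : ContinuousOn ℓ (Icc u₁ (m + 1)) := by
    rw [hsplit]
    refine ContinuousOn.union_of_isClosed ?_ ?_ isClosed_Icc isClosed_Icc
    · exact (h.cont.comp (hS.continuous_leafPt s).continuousOn hreg).congr fun t ht => hℓ1 t ht.2
    · have h1 : Continuous yl := by simp only [hyl]; fun_prop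
      have h2 : Continuous fun t => (E.vLeaf R (yl t), yl t) :=
        ((hE.continuous_vLeaf' R).comp h1).prodMk h1
      exact h2.continuousOn.congr fun t ht => hℓ2 t ht.1
  have hℓend : ℓ u₁ = ℓ (m + 1) := by
    rw [hℓ1 u₁ hum, hℓ2 (m + 1) (by linarith)]
    have e : yl (m + 1) = (Q (S.leafPt s u₁)).2 := by simp [hyl]
    rw [e, ← hE.eq_vLeaf_iff.2 hr₁]
  have hℓmem : ∀ t ∈ Icc u₁ (m + 1), ℓ t ∈ Q '' S.region ∪ E.region := by
    intro t ht
    rcases le_total t m with h1 | h1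
    · rw [hℓ1 t h1]; exact Or.inl ⟨_, hreg t ⟨ht.1, h1⟩, rfl⟩
    · rw [hℓ2 t h1, mem_union, hziff]
      right
      have k1 : (E.vLeaf R (Q (S.leafPt s u₁)).2, (Q (S.leafPt s u₁)).2) ∈ E.region := by
        rw [← hE.eq_vLeaf_iff.2 hr₁]; exact hV₁.2
      have k2 : (E.vLeaf R (Q (S.leafPt s m)).2, (Q (S.leafPt s m)).2) ∈ E.region := by
        rw [← hE.eq_vLeaf_iff.2 hrm]; exact hmV.2
      rw [hziff] at k1 k2
      have ht1 : 0 ≤ t - m := by linarith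
      have ht2 : 0 ≤ 1 - (t - m) := by linarith [ht.2]
      have e : yl t = (1 - (t - m)) * (Q (S.leafPt s m)).2 + (t - m) * (Q (S.leafPt s u₁)).2 := by
        simp only [hyl]; ring
      rw [e]
      have hconv := convex_Ioo zm zp k2 k1 ht2 ht1 (by ring)
      simpa using hconv
  -- A shear that straightens the leaf `R'` to a piece of the imaginary axis.
  set z : ℝ → ℂ := fun t => ⟨(ℓ t).1 - E.vLeaf R' (ℓ t).2, (ℓ t).2⟩ with hz
  have hvc := hE.continuous_vLeaf' R'
  have hzc : ContinuousOn z (Icc u₁ (m + 1)) := by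
    have h1 : ContinuousOn (fun t => ((ℓ t).1 - E.vLeaf R' (ℓ t).2, (ℓ t).2)) (Icc u₁ (m + 1)) :=
      (hℓc.fst.sub (hvc.comp_continuousOn hℓc.snd)).prodMk hℓc.snd
    exact Complex.equivRealProdCLM.symm.continuous.comp_continuousOn h1
  -- logarithms with respect to the ends of the leaf `R'`
  have hlog : ∀ y, (y = E.am (E.vLeaf R' y) ∨ y = E.ap (E.vLeaf R' y)) →
      (∀ t ∈ Icc u₁ (m + 1), ℓ t ≠ (E.vLeaf R' y, y)) ∧
      HasClosedLog u₁ (m + 1) (fun t => z t - y * Complex.I) := by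
    intro y hy
    have hmem : (E.vLeaf R' y, y) ∈ E.closedRegion := by
      rw [hE.mem_closedRegion_iff, hE.rCo_leaf]
      refine ⟨?_, hR'0.le, hR'1.le⟩
      rcases hy with hy | hy
      · have : E.sCo (E.vLeaf R' y, y) = 0 :=
          hE.eq_hLeaf_iff.1 (by rw [Quad.IsGood.hLeaf_zero]; exact hy)
        rw [this]; simp
      · have : E.sCo (E.vLeaf R' y, y) = 1 :=
          hE.eq_hLeaf_iff.1 (by rw [Quad.IsGood.hLeaf_one]; exact hy)
        rw [this]; simp
    have hl := h.wind u₁ (m + 1) ℓ hum1 hℓc hℓend hℓmem _ hmem hy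
    have hne : ∀ t ∈ Icc u₁ (m + 1), ℓ t ≠ (E.vLeaf R' y, y) := by
      intro t ht e
      obtain ⟨l, -, hle, -⟩ := hl
      have := hle t ht
      simp only [e, sub_self] at this
      exact Complex.exp_ne_zero _ this
    refine ⟨hne, ?_⟩
    -- A homotopy from the unsheared loop to the sheared one. Ordinates do not change, and at the
    -- ordinate `y` the shear term vanishes; the origin is hit only if the loop passes through the
    -- end of the leaf.
    set f : ℝ → ℝ → ℂ := fun x t =>
      ⟨(ℓ t).1 - E.vLeaf R' y - (1 - x) * (E.vLeaf R' (ℓ t).2 - E.vLeaf R' y), (ℓ t).2 - y⟩ with hf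
    have h1 : HasClosedLog u₁ (m + 1) (f 1) := by
      convert hl using 3
      simp
    have h0 := HasClosedLog.of_homotopy (f := f) zero_le_one hum1 ?_ ?_ ?_ h1
    · convert h0 using 2 with t
      apply Complex.ext <;> simp [hf, hz]
    · have hc1 : ContinuousOn (fun q : ℝ × ℝ => ℓ q.2) (Icc 0 1 ×ˢ Icc u₁ (m + 1)) :=
        hℓc.comp continuousOn_snd fun q hq => hq.2
      have hc2 : ContinuousOn (fun q : ℝ × ℝ => ((ℓ q.2).1 - E.vLeaf R' y -
          (1 - q.1) * (E.vLeaf R' (ℓ q.2).2 - E.vLeaf R' y), (ℓ q.2).2 - y))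
          (Icc 0 1 ×ˢ Icc u₁ (m + 1)) := by
        have hc3 := hvc.comp_continuousOn hc1.snd
        refine ContinuousOn.prodMk ((hc1.fst.sub continuousOn_const).sub
          (ContinuousOn.mul (by fun_prop) (hc3.sub continuousOn_const)))
          (hc1.snd.sub continuousOn_const)
      exact Complex.equivRealProdCLM.symm.continuous.comp_continuousOn hc2
    · intro x _ t ht e
      have e2 : (ℓ t).2 - y = 0 := congrArg Complex.im e
      have e1 : (ℓ t).1 - E.vLeaf R' y - (1 - x) * (E.vLeaf R' (ℓ t).2 - E.vLeaf R' y) = 0 :=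
        congrArg Complex.re e
      have e3 : (ℓ t).2 = y := by linarith
      rw [e3, sub_self, mul_zero, sub_zero] at e1
      exact hne t ht (Prod.ext (by simpa [sub_eq_zero] using e1) e3)
    · intro x _
      simp only [hf, hℓend]
  obtain ⟨hnem, hlogm⟩ := hlog ym (Or.inl eym)
  obtain ⟨hnep, hlogp⟩ := hlog yp (Or.inr eyp)
  have hxm : x < m := hx.2.trans hbm
  have hzx : ∀ t, t ≤ m →
      (z t).re = (Q (S.leafPt s t)).1 - E.vLeaf R' (Q (S.leafPt s t)).2 := fun t ht => by
    simp only [hz, hℓ1 t ht]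
  have hzx0 : (z x).re = 0 := by
    rw [hzx x hxm.le, sub_eq_zero]; exact hE.eq_vLeaf_iff.2 hrx
  refine false_of_single_crossing (z := z) (ts := x) ⟨hx.1, by linarith⟩ hyy hzc
    (by simp only [hz, hℓend]) hlogm hlogp hzx0 ?_ ?_ ?_ ?_
  · have h1 : (z x).im = (Q (S.leafPt s x)).2 := by simp only [hz, hℓ1 x hxm.le]
    have h2 := hxV.2
    have h3 : Q (S.leafPt s x) = (E.vLeaf R' (Q (S.leafPt s x)).2, (Q (S.leafPt s x)).2) :=
      Prod.ext (hE.eq_vLeaf_iff.2 hrx) rfl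
    rw [h3, hyiff] at h2
    rw [h1]
    exact h2
  · intro t ht hre him
    have e1 : (ℓ t).1 = E.vLeaf R' (ℓ t).2 := by simpa [hz, sub_eq_zero] using hre
    have e1' : ℓ t = (E.vLeaf R' (ℓ t).2, (ℓ t).2) := Prod.ext e1 rfl
    have him' : (ℓ t).2 ∈ Icc ym yp := him
    have hmem : ℓ t ∈ E.region := by
      rw [e1', hyiff]
      refine ⟨lt_of_le_of_ne him'.1 fun e => ?_, lt_of_le_of_ne him'.2 fun e => ?_⟩
      · exact hnem t ht (by rw [e1', ← e])
      · exact hnep t ht (by rw [e1', e])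
    have hrt : E.rCo (ℓ t) = R' := hE.eq_vLeaf_iff.1 e1
    -- Up to `b`, strict monotonicity of the gap leaves only `x`. A later meeting with `R'` before
    -- `m` would, traced back to its entry through the left side, give a crossing of `R` before the
    -- minimal one. After `m` the loop runs on the leaf `R`.
    rcases le_or_gt t m with h1 | h1
    · rw [hℓ1 t h1] at hmem hrt
      have htV : S.leafPt s t ∈ V := ⟨hreg t ⟨ht.1, h1⟩, hmem⟩
      rcases lt_trichotomy t b with h2 | h2 | h2
      · refine hgR'.injOn ⟨ht.1, h2⟩ ⟨hx.1.le, hx.2⟩ ?_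
        rw [sub_eq_zero.2 (hE.eq_vLeaf_iff.2 hrt), sub_eq_zero.2 (hE.eq_vLeaf_iff.2 hrx)]
      · exact absurd (h2 ▸ htV) hbV
      · exfalso
        obtain ⟨v, hv, hvV, hvr⟩ := h.exists_level_left hs0 hs1 htV hR0 (by rw [hrt]; exact hRR') h2 hbV
        have := hmin v ⟨hv.1.le, by linarith [hv.2]⟩ hvV hvr
        linarith [hv.2]
    · exfalso
      rw [hℓ2 t h1.le, hE.rCo_leaf] at hrt
      linarith
  · filter_upwards [Ioo_mem_nhdsLT hx.1] with t ht
    rw [hzx t (ht.2.trans hxm).le, ← hzx0, hzx x hxm.le]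
    exact hgR' ⟨ht.1.le, ht.2.trans hx.2⟩ ⟨hx.1.le, hx.2⟩ ht.2
  · filter_upwards [Ioo_mem_nhdsGT hx.2] with t ht
    rw [hzx t (ht.2.trans hbm).le, ← hzx0, hzx x hxm.le]
    exact hgR' ⟨hx.1.le, hx.2⟩ ⟨(hx.1.trans ht.1).le, ht.2⟩ ht.1

end Crossing

end StripMap
end

/-! ### Leaf labels as coordinates on the transit set. -/

noncomputable section

namespace StripMap

/-- The open unit square. -/
def unitSq : Set (ℝ × ℝ) := Ioo 0 1 ×ˢ Ioo 0 1

/-- Coordinates on the transit set: `qt (s, R)` lies on the leaf `σ s` of the source, its image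
lies on the leaf `R` of the target, and the ordinate of the image increases with `s`. -/
structure IsParam (S E : Quad) (Q qt : ℝ × ℝ → ℝ × ℝ) (σ : ℝ → ℝ) : Prop where
  cont : ContinuousOn qt unitSq
  mem : ∀ x ∈ unitSq, qt x ∈ transitSet S E Q
  rCo : ∀ x ∈ unitSq, E.rCo (Q (qt x)) = x.2
  sCo : ∀ x ∈ unitSq, S.sCo (qt x) = σ x.1
  surj : ∀ p ∈ transitSet S E Q, ∃ x ∈ unitSq, qt x = p
  mono : ∀ R ∈ Ioo (0 : ℝ) 1, StrictMonoOn (fun s => (Q (qt (s, R))).2) (Ioo 0 1)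
  orient : σ = id ∨ σ = fun s => 1 - s

namespace Crossing

variable {S E : Quad} {Q T : ℝ × ℝ → ℝ × ℝ} {γ M ρ B κ : ℝ}

lemma eq_leafPt (h : Crossing S E Q T γ M ρ B κ) (p : ℝ × ℝ) : p = S.leafPt (S.sCo p) p.1 :=
  Prod.ext rfl (h.source.eq_hLeaf_iff.2 rfl)

/-- The coordinates determine the point. -/
lemma eq_of_coords (h : Crossing S E Q T γ M ρ B κ) {p p' : ℝ × ℝ} (hp : p ∈ transitSet S E Q)
    (hp' : p' ∈ transitSet S E Q) (hs : S.sCo p = S.sCo p') (hR : E.rCo (Q p) = E.rCo (Q p')) :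
    p = p' := by
  have e := h.eq_leafPt p
  have e' := h.eq_leafPt p'
  rw [← hs] at e'
  have hs01 := (h.source.mem_region_iff.1 hp.1).1
  have hR01 := (h.target.mem_region_iff.1 hp.2).2
  have hV := hp
  have hV' := hp'
  rw [e] at hV
  rw [e'] at hV'
  rcases lt_trichotomy p.1 p'.1 with h1 | h1 | h1
  · exact (h.false_of_two_crossings hs01.1 hs01.2 hR01.1 hR01.2 h1 hV hV' (by rw [← e])
      (by rw [← e', hR])).elim
  · rw [e, e', h1]
  · exact (h.false_of_two_crossings hs01.1 hs01.2 hR01.1 hR01.2 h1 hV' hV (by rw [← e', hR])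
      (by rw [← e])).elim

lemma exists_level_on_leaf (h : Crossing S E Q T γ M ρ B κ) {s u₀ R : ℝ} (hs0 : 0 < s) (hs1 : s < 1)
    (hu₀ : S.leafPt s u₀ ∈ transitSet S E Q) (hR0 : 0 < R) (hR1 : R < 1) :
    ∃ u, S.leafPt s u ∈ transitSet S E Q ∧ E.rCo (Q (S.leafPt s u)) = R := by
  rcases lt_trichotomy (E.rCo (Q (S.leafPt s u₀))) R with h1 | h1 | h1
  · obtain ⟨u, -, h2⟩ := h.exists_level_right hs0 hs1 hu₀ hR1 h1
    exact ⟨u, h2⟩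
  · exact ⟨u₀, hu₀, h1⟩
  · obtain ⟨b, hb, -, -, hbV, -⟩ := h.exists_exit_left hs0 hs1 hu₀
    obtain ⟨u, -, h2⟩ := h.exists_level_left hs0 hs1 hu₀ hR0 h1 hb hbV
    exact ⟨u, h2⟩

/-- All pairs of coordinates occur. -/
lemma exists_coords (h : Crossing S E Q T γ M ρ B κ) (hne : (transitSet S E Q).Nonempty)
    {s R : ℝ} (hs : s ∈ Ioo (0 : ℝ) 1) (hR : R ∈ Ioo (0 : ℝ) 1) :
    ∃ p ∈ transitSet S E Q, S.sCo p = s ∧ E.rCo (Q p) = R := by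
  set V := transitSet S E Q
  have hleaf : ∀ s ∈ S.sCo '' V, ∃ u, S.leafPt s u ∈ V ∧ E.rCo (Q (S.leafPt s u)) = R := by
    rintro _ ⟨p, hp, rfl⟩
    have hs01 := (h.source.mem_region_iff.1 hp.1).1
    refine h.exists_level_on_leaf (u₀ := p.1) hs01.1 hs01.2 ?_ hR.1 hR.2
    rw [← h.eq_leafPt p]; exact hp
  -- The labels that occur form an open and relatively closed subset of the connected interval `(0,
  -- 1)`.
  have hopen : IsOpen (S.sCo '' V) := by
    have : S.sCo '' V = ⋃ u, {s | S.leafPt s u ∈ V} := by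
      ext s
      simp only [mem_image, mem_iUnion, mem_ofPred_eq]
      constructor
      · rintro ⟨p, hp, rfl⟩
        exact ⟨p.1, by rw [← h.eq_leafPt p]; exact hp⟩
      · rintro ⟨u, hu⟩
        exact ⟨_, hu, h.source.sCo_leaf s u⟩
    rw [this]
    refine isOpen_iUnion fun u => h.isOpen_transitSet.preimage ?_
    exact continuous_const.prodMk
      (h.source.continuous_hLeaf.comp (by fun_prop : Continuous fun s : ℝ => (s, u)))
  -- Every occurring leaf also has a point at the level `R`. These points form a compact set, whose
  -- labels are closed, and there the condition on `r` cannot degenerate in a limit.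
  set K := {p ∈ closure V | E.rCo (Q p) = R} with hK
  have hKc : IsCompact K := by
    have : IsClosed K := (h.target.continuous_rCo.comp_continuousOn
      h.continuousOn_closure).preimage_isClosed_of_isClosed isClosed_closure
      (isClosed_singleton (x := R))
    exact h.isCompact_closure.of_isClosed_subset this fun p hp => hp.1
  have hsubK : S.sCo '' V ⊆ S.sCo '' K := by
    intro s hs
    obtain ⟨u, hu, hr⟩ := hleaf s hs
    exact ⟨_, ⟨subset_closure hu, hr⟩, h.source.sCo_leaf s u⟩
  have hcl : closure (S.sCo '' V) ∩ Ioo 0 1 ⊆ S.sCo '' V := by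
    rintro s ⟨hs, hs01⟩
    have hcK : IsClosed (S.sCo '' K) := (hKc.image h.source.continuous_sCo).isClosed
    obtain ⟨p, hp, rfl⟩ := (hcK.closure_subset_iff.2 hsubK) hs
    refine ⟨p, ?_, rfl⟩
    rw [h.mem_transitSet_iff hp.1, hp.2]
    exact ⟨hs01, hR⟩
  have hall := isPreconnected_Ioo.subset_of_closure_inter_subset hopen (by
    obtain ⟨p, hp⟩ := hne
    exact ⟨S.sCo p, (h.source.mem_region_iff.1 hp.1).1, p, hp, rfl⟩) hcl
  obtain ⟨u, hu, hr⟩ := hleaf s (hall hs)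
  exact ⟨_, hu, h.source.sCo_leaf s u, hr⟩

lemma isPreconnected_unitSq : IsPreconnected unitSq :=
  isPreconnected_Ioo.prod isPreconnected_Ioo

/-- The transit set is parametrized by its coordinates. -/
theorem exists_isParam (h : Crossing S E Q T γ M ρ B κ) (hne : (transitSet S E Q).Nonempty) :
    ∃ qt σ, IsParam S E Q qt σ := by
  set V := transitSet S E Q with hV
  have hex : ∀ x : ℝ × ℝ, ∃ p, x ∈ unitSq → p ∈ V ∧ S.sCo p = x.1 ∧ E.rCo (Q p) = x.2 := by
    intro x
    by_cases hx : x ∈ unitSq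
    · obtain ⟨p, h1, h2⟩ := h.exists_coords hne hx.1 hx.2
      exact ⟨p, fun _ => ⟨h1, h2⟩⟩
    · exact ⟨0, fun hx' => absurd hx' hx⟩
  choose pt hpt using hex
  -- Continuity of the inverse by compactness: a cluster point in the closure has the limiting
  -- coordinates, which are interior, so it belongs to `V` and is the expected point by uniqueness.
  have hpc : ContinuousOn pt unitSq := by
    intro x hx
    refine h.isCompact_closure.tendsto_nhds_of_unique_mapClusterPt
      (eventually_nhdsWithin_of_forall fun y hy => subset_closure (hpt y hy).1) fun p hp hcl => ?_
    have hΦ : ContinuousAt (fun p => (S.sCo p, E.rCo (Q p))) p :=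
      h.source.continuous_sCo.continuousAt.prodMk
        (h.target.continuous_rCo.continuousAt.comp (h.continuousAt hp))
    have h1 := hcl.continuousAt_comp hΦ
    have h2 : Tendsto ((fun p => (S.sCo p, E.rCo (Q p))) ∘ pt) (𝓝[unitSq] x) (𝓝 x) := by
      refine (tendsto_id.mono_left (nhdsWithin_le_nhds (s := unitSq) (a := x))).congr' ?_
      filter_upwards [self_mem_nhdsWithin] with y hy
      exact Prod.ext (hpt y hy).2.1.symm (hpt y hy).2.2.symm
    have h3 : (S.sCo p, E.rCo (Q p)) = x :=
      eq_of_nhds_neBot (NeBot.mono h1 (inf_le_inf_left _ h2))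
    have hpV : p ∈ V := by
      rw [h.mem_transitSet_iff hp]
      have := hx
      rw [← h3] at this
      exact this
    refine h.eq_of_coords hpV (hpt x hx).1 ?_ ?_
    · rw [(hpt x hx).2.1, ← h3]
    · rw [(hpt x hx).2.2, ← h3]
  have hQpc : ContinuousOn (fun x => Q (pt x)) unitSq :=
    h.continuousOn_closure.comp hpc fun x hx => subset_closure (hpt x hx).1
  -- On a fixed leaf of the target the ordinate determines the image point, hence the point of `V`
  -- by injectivity of `Q`, hence its label.
  have hinj : ∀ R ∈ Ioo (0 : ℝ) 1, InjOn (fun s => (Q (pt (s, R))).2) (Ioo 0 1) := by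
    intro R hR s hs s' hs' e
    have m := hpt (s, R) ⟨hs, hR⟩
    have m' := hpt (s', R) ⟨hs', hR⟩
    have e2 : Q (pt (s, R)) = Q (pt (s', R)) := by
      refine Prod.ext ?_ e
      rw [h.target.eq_vLeaf_iff.2 m.2.2, h.target.eq_vLeaf_iff.2 m'.2.2]
      exact congrArg _ e
    have e3 := h.injOn (subset_closure m.1) (subset_closure m'.1) e2
    have := m.2.1
    rw [e3, m'.2.1] at this
    exact this.symm
  have hcs : ∀ R ∈ Ioo (0 : ℝ) 1, ContinuousOn (fun s => (Q (pt (s, R))).2) (Ioo 0 1) :=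
    fun R hR => (hQpc.comp (by fun_prop : ContinuousOn (fun s : ℝ => (s, R)) (Ioo 0 1))
      fun s hs => ⟨hs, hR⟩).snd
  -- Two sample labels decide the direction on each leaf `R`. Their difference in height is
  -- continuous in `R` and never zero, so the direction is the same for all `R`; if it is downward,
  -- `s` is replaced by `1 - s`.
  set φ : ℝ → ℝ := fun R => (Q (pt (2 / 3, R))).2 - (Q (pt (1 / 3, R))).2 with hφ
  have h13 : (1 / 3 : ℝ) ∈ Ioo (0 : ℝ) 1 := by constructor <;> norm_num
  have h23 : (2 / 3 : ℝ) ∈ Ioo (0 : ℝ) 1 := by constructor <;> norm_num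
  have hφc : ContinuousOn φ (Ioo 0 1) :=
    ((hQpc.comp (by fun_prop : ContinuousOn (fun R : ℝ => ((2 / 3 : ℝ), R)) (Ioo 0 1))
      fun R hR => ⟨h23, hR⟩).snd).sub
    ((hQpc.comp (by fun_prop : ContinuousOn (fun R : ℝ => ((1 / 3 : ℝ), R)) (Ioo 0 1))
      fun R hR => ⟨h13, hR⟩).snd)
  have hφ0 : ∀ R ∈ Ioo (0 : ℝ) 1, φ R ≠ 0 := fun R hR e => by
    have := hinj R hR h23 h13 (sub_eq_zero.1 e)
    norm_num at this
  have hmono : ∀ R ∈ Ioo (0 : ℝ) 1, StrictMonoOn (fun s => (Q (pt (s, R))).2) (Ioo 0 1) ∨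
      StrictAntiOn (fun s => (Q (pt (s, R))).2) (Ioo 0 1) := fun R hR =>
    (hcs R hR).strictMonoOn_of_injOn_Ioo zero_lt_one (hinj R hR)
  have hsurj : ∀ p ∈ V, (S.sCo p, E.rCo (Q p)) ∈ unitSq ∧ pt (S.sCo p, E.rCo (Q p)) = p := by
    intro p hp
    have hx : (S.sCo p, E.rCo (Q p)) ∈ unitSq := (h.mem_transitSet_iff (subset_closure hp)).1 hp
    exact ⟨hx, h.eq_of_coords (hpt _ hx).1 hp (hpt _ hx).2.1 (hpt _ hx).2.2⟩
  have hsign : (∀ R ∈ Ioo (0 : ℝ) 1, 0 < φ R) ∨ (∀ R ∈ Ioo (0 : ℝ) 1, φ R < 0) := by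
    by_contra hcon
    push Not at hcon
    obtain ⟨⟨R, hR, hR'⟩, ⟨R₂, hR₂, hR₂'⟩⟩ := hcon
    obtain ⟨R₃, hR₃, e⟩ := isPreconnected_Ioo.intermediate_value hR hR₂ hφc
      (show (0 : ℝ) ∈ Icc (φ R) (φ R₂) from ⟨hR', hR₂'⟩)
    exact hφ0 R₃ hR₃ e
  rcases hsign with hs | hs
  · refine ⟨pt, id, hpc, fun x hx => (hpt x hx).1, fun x hx => (hpt x hx).2.2,
      fun x hx => (hpt x hx).2.1, fun p hp => ⟨_, hsurj p hp⟩, fun R hR => ?_, Or.inl rfl⟩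
    refine (hmono R hR).resolve_right fun ha => ?_
    have h1 := ha h13 h23 (by norm_num)
    have h2 := hs R hR
    simp only [hφ] at h1 h2
    linarith
  · have hmaps : ∀ x ∈ unitSq, ((1 - x.1, x.2) : ℝ × ℝ) ∈ unitSq := fun x hx =>
      ⟨⟨by linarith [hx.1.2], by linarith [hx.1.1]⟩, hx.2⟩
    refine ⟨fun x => pt (1 - x.1, x.2), fun s => 1 - s,
      hpc.comp (by fun_prop) hmaps, fun x hx => (hpt _ (hmaps x hx)).1,
      fun x hx => (hpt _ (hmaps x hx)).2.2, fun x hx => (hpt _ (hmaps x hx)).2.1,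
      fun p hp => ⟨(1 - S.sCo p, E.rCo (Q p)), hmaps _ (hsurj p hp).1, ?_⟩, fun R hR => ?_,
      Or.inr rfl⟩
    · simp only [sub_sub_cancel]; exact (hsurj p hp).2
    · have ha := (hmono R hR).resolve_left fun ha => by
        have h1 := ha h13 h23 (by norm_num)
        have h2 := hs R hR
        simp only [hφ] at h1 h2
        linarith
      intro s hs s' hs' hss
      exact ha (by constructor <;> linarith [hs'.1, hs'.2]) (by constructor <;> linarith [hs.1, hs.2])
        (by linarith)

lemma isPreconnected_transitSet (h : Crossing S E Q T γ M ρ B κ) :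
    IsPreconnected (transitSet S E Q) := by
  rcases (transitSet S E Q).eq_empty_or_nonempty with he | hne
  · rw [he]; exact isPreconnected_empty
  · obtain ⟨qt, σ, hq⟩ := h.exists_isParam hne
    have : transitSet S E Q = qt '' unitSq :=
      Subset.antisymm (fun p hp => hq.surj p hp) (by rintro _ ⟨x, hx, rfl⟩; exact hq.mem x hx)
    rw [this]
    exact isPreconnected_unitSq.image _ hq.cont

/-- Comparison of two points on one leaf. -/
lemma leaf_compare (h : Crossing S E Q T γ M ρ B κ) {p p' : ℝ × ℝ} (hp : p ∈ transitSet S E Q)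
    (hp' : p' ∈ transitSet S E Q) (hs : S.sCo p = S.sCo p') (hR : E.rCo (Q p) ≤ E.rCo (Q p')) :
    p.1 ≤ p'.1 ∧ ρ * (p'.1 - p.1) ≤ (Q p').1 - (Q p).1 ∧ (Q p).2 ≤ (Q p').2 ∧
      ∀ γ', B * (1 + γ) ≤ γ' → (Q p').2 - (Q p).2 ≤ γ' * ((Q p').1 - (Q p).1) := by
  have e := h.eq_leafPt p
  have e' := h.eq_leafPt p'
  rw [← hs] at e'
  have hs01 := (h.source.mem_region_iff.1 hp.1).1
  have hR01 := (h.target.mem_region_iff.1 hp'.2).2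
  set s := S.sCo p with hsdef
  have hV : S.leafPt s p.1 ∈ transitSet S E Q := by rw [← e]; exact hp
  -- Going right from `p`, the image reaches the level of `Q p'` before leaving the target. By
  -- uniqueness of coordinates this happens at `p'`, so the whole arc between the points lies in the
  -- transit set.
  obtain ⟨hle, hin⟩ : p.1 ≤ p'.1 ∧ ∀ u ∈ Icc p.1 p'.1, S.leafPt s u ∈ transitSet S E Q := by
    rcases hR.lt_or_eq with hlt | heq
    · obtain ⟨b, hb, hin, hcl, -, hr⟩ := h.exists_exit_right hs01.1 hs01.2 hV
      obtain ⟨u, hu, er⟩ := h.exists_level (s := s) (R := E.rCo (Q p')) hb.le (fun u hu => by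
        rcases hu.2.lt_or_eq with h1 | h1
        · exact subset_closure (hin u ⟨hu.1, h1⟩)
        · rw [h1]; exact hcl) (by rw [← e]; exact hlt) (by rw [hr]; exact hR01.2)
      have hue := h.eq_of_coords (hin u ⟨hu.1.le, hu.2⟩) hp'
        ((h.source.sCo_leaf s u).trans hs) er
      have hu1 : u = p'.1 := congrArg Prod.fst hue
      rw [← hu1]
      exact ⟨hu.1.le, fun v hv => hin v ⟨hv.1, hv.2.trans_lt hu.2⟩⟩
    · have := h.eq_of_coords hp hp' hs heq
      rw [← this]
      refine ⟨le_rfl, fun u hu => ?_⟩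
      rw [le_antisymm hu.2 hu.1, ← e]; exact hp
  have hl : p.1 ∈ Icc p.1 p'.1 := ⟨le_rfl, hle⟩
  have hr : p'.1 ∈ Icc p.1 p'.1 := ⟨hle, le_rfl⟩
  have k1 := h.fst_monotoneOn hs01.1.le hs01.2.le ordConnected_Icc hin hl hr hle
  have k2 := h.snd_monotoneOn hs01.1.le hs01.2.le ordConnected_Icc hin hl hr hle
  simp only [← e, ← e'] at k1 k2
  refine ⟨hle, by linarith, k2, fun γ' hγ' => ?_⟩
  have k3 := h.slope_monotoneOn hs01.1.le hs01.2.le ordConnected_Icc hin hγ' hl hr hle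
  simp only [← e, ← e'] at k3
  linarith

end Crossing

end StripMap
end

noncomputable section

namespace StripMap

/-! ### The band swept out by a family of increasing curves -/

/-- The quadrangle rotated by `π`. -/
def Quad.rot (K : Quad) : Quad :=
  ⟨fun u => -K.ap (-u), fun u => -K.am (-u), fun y => -K.bp (-y), fun y => -K.bm (-y)⟩

lemma Quad.IsGood.rot {K : Quad} {γ M : ℝ} (h : K.IsGood γ M) : K.rot.IsGood γ M where
  am_mono := fun x y hxy => neg_le_neg (h.ap_mono (neg_le_neg hxy))
  ap_mono := fun x y hxy => neg_le_neg (h.am_mono (neg_le_neg hxy))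
  bm_anti := fun x y hxy => neg_le_neg (h.bp_anti (neg_le_neg hxy))
  bp_anti := fun x y hxy => neg_le_neg (h.bm_anti (neg_le_neg hxy))
  a_lt := fun u => neg_lt_neg (h.a_lt (-u))
  b_lt := fun u => neg_lt_neg (h.b_lt (-u))
  am_lip := fun x y hxy => by have := h.ap_lip (-y) (-x) (neg_le_neg hxy); simp only [Quad.rot]; linarith
  ap_lip := fun x y hxy => by have := h.am_lip (-y) (-x) (neg_le_neg hxy); simp only [Quad.rot]; linarith
  bm_lip := fun x y hxy => by have := h.bp_lip (-y) (-x) (neg_le_neg hxy); simp only [Quad.rot]; linarith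
  bp_lip := fun x y hxy => by have := h.bm_lip (-y) (-x) (neg_le_neg hxy); simp only [Quad.rot]; linarith
  a_width := fun u => by have := h.a_width (-u); simp only [Quad.rot]; linarith
  b_width := fun u => by have := h.b_width (-u); simp only [Quad.rot]; linarith
  bdd := by
    obtain ⟨C, hC⟩ := h.bdd
    refine ⟨C, fun t => ?_⟩
    simp only [Quad.rot, abs_neg]
    have := hC (-t)
    exact ⟨this.2.1, this.1, this.2.2.2, this.2.2.1⟩

lemma Quad.IsGood.rCo_rot {K : Quad} {γ M : ℝ} (h : K.IsGood γ M) (p : ℝ × ℝ) :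
    K.rot.rCo (-p) = 1 - K.rCo p := by
  have : K.bp p.2 - K.bm p.2 ≠ 0 := by linarith [h.b_lt p.2]
  have h' : K.bp p.2 - K.bm p.2 = -K.bm p.2 - -K.bp p.2 := by ring
  simp only [Quad.rCo, Quad.rot, Prod.fst_neg, Prod.snd_neg, neg_neg]
  rw [← h']
  field_simp
  ring

lemma Quad.mem_rot_region {K : Quad} {p : ℝ × ℝ} : -p ∈ K.rot.region ↔ p ∈ K.region := by
  simp only [Quad.region, Quad.rot, mem_ofPred_eq, Prod.fst_neg, Prod.snd_neg, neg_neg, neg_lt_neg_iff]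
  tauto

/-- The largest nondecreasing `γ`-Lipschitz function whose graph is below `H`. -/
def lowerEnv (H : Set (ℝ × ℝ)) (γ X : ℝ) : ℝ :=
  sInf ((fun q : ℝ × ℝ => q.2 + γ * max (X - q.1) 0) '' H)

/-- A two-parameter family of points: for fixed `R`, the point `q (s, R)` moves up along the leaf
`R` of the quadrangle `E`, and for fixed `s` it moves along an increasing `γ'`-Lipschitz curve. -/
structure Sweep (E : Quad) (q : ℝ × ℝ → ℝ × ℝ) (γ M γ' : ℝ) : Prop where
  good : E.IsGood γ M
  le : γ ≤ γ'
  cont : ContinuousOn q unitSq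
  mem : ∀ x ∈ unitSq, q x ∈ E.region
  rCo : ∀ x ∈ unitSq, E.rCo (q x) = x.2
  mono : ∀ R ∈ Ioo (0 : ℝ) 1, StrictMonoOn (fun s => (q (s, R)).2) (Ioo 0 1)
  leaf : ∀ s ∈ Ioo (0 : ℝ) 1, ∀ R ∈ Ioo (0 : ℝ) 1, ∀ R' ∈ Ioo (0 : ℝ) 1, R ≤ R' →
    (q (s, R)).2 ≤ (q (s, R')).2 ∧
      (q (s, R')).2 - (q (s, R)).2 ≤ γ' * ((q (s, R')).1 - (q (s, R)).1)
  -- This keeps the two boundary curves of the band apart: the lower one lies in the first closure,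
  -- the upper one in the second.
  disj : Disjoint (closure (q '' Ioo 0 (1 / 3) ×ˢ Ioo 0 1)) (closure (q '' Ioo (2 / 3) 1 ×ˢ Ioo 0 1))

/-- The rotated family. -/
def rotFam (q : ℝ × ℝ → ℝ × ℝ) (x : ℝ × ℝ) : ℝ × ℝ := -q (1 - x.1, 1 - x.2)

lemma rotFam_rotFam (q : ℝ × ℝ → ℝ × ℝ) : rotFam (rotFam q) = q := by
  funext x; simp [rotFam]

lemma rotFam_image (q : ℝ × ℝ → ℝ × ℝ) (a b : ℝ) :
    rotFam q '' Ioo a b ×ˢ Ioo 0 1 = -(q '' Ioo (1 - b) (1 - a) ×ˢ Ioo 0 1) := by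
  ext p
  rw [Set.mem_neg]
  constructor
  · rintro ⟨x, hx, rfl⟩
    refine ⟨(1 - x.1, 1 - x.2), ⟨⟨?_, ?_⟩, ?_, ?_⟩, by simp [rotFam]⟩ <;> simp only <;>
      linarith [hx.1.1, hx.1.2, hx.2.1, hx.2.2]
  · rintro ⟨x, hx, e⟩
    refine ⟨(1 - x.1, 1 - x.2), ⟨⟨?_, ?_⟩, ?_, ?_⟩, by simp [rotFam, e]⟩ <;> simp only <;>
      linarith [hx.1.1, hx.1.2, hx.2.1, hx.2.2]

lemma closure_neg_set (A : Set (ℝ × ℝ)) : closure (-A) = -closure A :=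
  ((Homeomorph.neg (ℝ × ℝ)).preimage_closure A).symm

namespace Sweep

variable {E : Quad} {q : ℝ × ℝ → ℝ × ℝ} {γ M γ' : ℝ}

lemma flip_mem {x : ℝ × ℝ} (hx : x ∈ unitSq) : (1 - x.1, 1 - x.2) ∈ unitSq := by
  refine ⟨⟨?_, ?_⟩, ?_, ?_⟩ <;> simp only <;> linarith [hx.1.1, hx.1.2, hx.2.1, hx.2.2]

/-- The half turn exchanges the two boundaries of the band, so statements about the upper one follow
from those about the lower one. -/
lemma rot (h : Sweep E q γ M γ') : Sweep E.rot (rotFam q) γ M γ' where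
  good := h.good.rot
  le := h.le
  cont := (h.cont.comp (by fun_prop) fun x hx => flip_mem hx).neg
  mem := fun x hx => Quad.mem_rot_region.2 (h.mem _ (flip_mem hx))
  rCo := fun x hx => by
    rw [rotFam, h.good.rCo_rot, h.rCo _ (flip_mem hx)]; simp
  mono := fun R hR s hs s' hs' hss => by
    have := h.mono (1 - R) ⟨by linarith [hR.2], by linarith [hR.1]⟩
      (a := 1 - s') (b := 1 - s) ⟨by linarith [hs'.2], by linarith [hs'.1]⟩
      ⟨by linarith [hs.2], by linarith [hs.1]⟩ (by linarith)
    simp only [rotFam, Prod.snd_neg]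
    simp only at this
    linarith
  leaf := fun s hs R hR R' hR' hRR => by
    have := h.leaf (1 - s) ⟨by linarith [hs.2], by linarith [hs.1]⟩ (1 - R')
      ⟨by linarith [hR'.2], by linarith [hR'.1]⟩ (1 - R)
      ⟨by linarith [hR.2], by linarith [hR.1]⟩ (by linarith)
    simp only [rotFam, Prod.snd_neg, Prod.fst_neg]
    constructor
    · linarith [this.1]
    · linarith [this.2]
  disj := by
    rw [rotFam_image, rotFam_image, closure_neg_set, closure_neg_set, Set.disjoint_left]
    intro p hp hp'
    rw [Set.mem_neg] at hp hp'
    norm_num at hp hp'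
    have hd := h.disj
    norm_num at hd
    exact Set.disjoint_left.1 hd hp' hp

/-- The lower boundary of the band. -/
def low (q : ℝ × ℝ → ℝ × ℝ) (γ' X : ℝ) : ℝ := lowerEnv (q '' unitSq) γ' X

/-- The upper boundary of the band. -/
def upp (q : ℝ × ℝ → ℝ × ℝ) (γ' X : ℝ) : ℝ := -low (rotFam q) γ' (-X)

lemma gamma'_nonneg (h : Sweep E q γ M γ') : 0 ≤ γ' := h.good.gamma_nonneg.trans h.le

lemma half_mem : ((1 / 2 : ℝ), (1 / 2 : ℝ)) ∈ unitSq := by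
  refine ⟨⟨?_, ?_⟩, ?_, ?_⟩ <;> norm_num

/-- Because `γ ≤ γ'`, the lower side of `E` is itself a competitor in the definition of the lower
envelope. This makes the infimum finite. -/
lemma am_le (h : Sweep E q γ M γ') {p : ℝ × ℝ} (hp : p ∈ q '' unitSq) (X : ℝ) :
    E.am X ≤ p.2 + γ' * max (X - p.1) 0 := by
  obtain ⟨x, hx, rfl⟩ := hp
  have h1 := (h.mem x hx).1
  have h0 := h.gamma'_nonneg
  rcases le_total X (q x).1 with h2 | h2
  · rw [max_eq_right (by linarith)]
    linarith [h.good.am_mono h2]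
  · rw [max_eq_left (by linarith)]
    have := h.good.am_lip _ _ h2
    have := mul_le_mul_of_nonneg_right h.le (sub_nonneg.2 h2)
    linarith

lemma bddBelow (h : Sweep E q γ M γ') (X : ℝ) :
    BddBelow ((fun p : ℝ × ℝ => p.2 + γ' * max (X - p.1) 0) '' (q '' unitSq)) :=
  ⟨E.am X, by rintro _ ⟨p, hp, rfl⟩; exact h.am_le hp X⟩

lemma image_nonempty (q : ℝ × ℝ → ℝ × ℝ) : (q '' unitSq).Nonempty := ⟨_, _, half_mem, rfl⟩

lemma low_le (h : Sweep E q γ M γ') {p : ℝ × ℝ} (hp : p ∈ q '' unitSq) (X : ℝ) :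
    low q γ' X ≤ p.2 + γ' * max (X - p.1) 0 :=
  csInf_le (h.bddBelow X) ⟨p, hp, rfl⟩

lemma le_low (_h : Sweep E q γ M γ') {X a : ℝ}
    (ha : ∀ p ∈ q '' unitSq, a ≤ p.2 + γ' * max (X - p.1) 0) : a ≤ low q γ' X :=
  le_csInf ((image_nonempty q).image _) (by rintro _ ⟨p, hp, rfl⟩; exact ha p hp)

lemma low_mono (h : Sweep E q γ M γ') : Monotone (low q γ') := fun X Y hXY =>
  h.le_low fun p hp => (h.low_le hp X).trans (by
    have := h.gamma'_nonneg
    gcongr)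

lemma low_lip (h : Sweep E q γ M γ') (X Y : ℝ) (hXY : X ≤ Y) :
    low q γ' Y - low q γ' X ≤ γ' * (Y - X) := by
  rw [sub_le_comm]
  refine h.le_low fun p hp => ?_
  have h1 := h.low_le hp Y
  have h2 : max (Y - p.1) 0 ≤ max (X - p.1) 0 + (Y - X) := by
    refine max_le ?_ ?_
    · linarith [le_max_left (X - p.1) 0]
    · linarith [le_max_right (X - p.1) 0]
  have := mul_le_mul_of_nonneg_left h2 h.gamma'_nonneg
  linarith

lemma continuous_low (h : Sweep E q γ M γ') : Continuous (low q γ') :=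
  continuous_of_mono_lip h.low_mono h.low_lip

lemma upp_mono (h : Sweep E q γ M γ') : Monotone (upp q γ') := fun _ _ hXY =>
  neg_le_neg (h.rot.low_mono (neg_le_neg hXY))

lemma upp_lip (h : Sweep E q γ M γ') (X Y : ℝ) (hXY : X ≤ Y) :
    upp q γ' Y - upp q γ' X ≤ γ' * (Y - X) := by
  have := h.rot.low_lip (-Y) (-X) (neg_le_neg hXY)
  unfold upp
  linarith

lemma continuous_upp (h : Sweep E q γ M γ') : Continuous (upp q γ') :=
  continuous_of_mono_lip h.upp_mono h.upp_lip

lemma fst_eq (h : Sweep E q γ M γ') {x : ℝ × ℝ} (hx : x ∈ unitSq) :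
    (q x).1 = E.vLeaf x.2 (q x).2 := h.good.eq_vLeaf_iff.2 (h.rCo x hx)

/-- Halving `s` leads strictly down along the same falling leaf, to a point that is not further
left; its ordinate alone already bounds the envelope at the given abscissa. -/
lemma low_lt (h : Sweep E q γ M γ') {x : ℝ × ℝ} (hx : x ∈ unitSq) :
    low q γ' (q x).1 < (q x).2 := by
  have hx' : (x.1 / 2, x.2) ∈ unitSq := ⟨⟨by linarith [hx.1.1], by linarith [hx.1.1, hx.1.2]⟩, hx.2⟩
  have h1 : (q (x.1 / 2, x.2)).2 < (q x).2 := h.mono x.2 hx.2 hx'.1 hx.1 (by simp only; linarith [hx.1.1])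
  have h2 := h.good.vLeaf_anti hx.2.1.le hx.2.2.le h1.le
  have h3 := h.low_le ⟨_, hx', rfl⟩ (q x).1
  rw [h.fst_eq hx', h.fst_eq hx, max_eq_right (by simp only; linarith)] at h3
  rw [h.fst_eq hx]
  linarith

/-- Some point `q x` has its cone passing below `p`. The curve through `q x` with constant `s` meets
the leaf of `p` below `p`: otherwise it would meet it at or above `p` and not to the right of `p`,
against the Lipschitz bound or the monotonicity of the curve. -/
lemma exists_lt (h : Sweep E q γ M γ') {p : ℝ × ℝ} (hp : E.rCo p ∈ Ioo (0 : ℝ) 1)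
    (hl : low q γ' p.1 < p.2) : ∃ s ∈ Ioo (0 : ℝ) 1, (q (s, E.rCo p)).2 < p.2 := by
  obtain ⟨_, ⟨_, ⟨x, hx, rfl⟩, rfl⟩, hlt⟩ := exists_lt_of_csInf_lt ((image_nonempty q).image _) hl
  simp only at hlt
  refine ⟨x.1, hx.1, ?_⟩
  have hx₁ : (x.1, E.rCo p) ∈ unitSq := ⟨hx.1, hp⟩
  by_contra hc
  rw [not_lt] at hc
  have hle := h.good.vLeaf_anti hp.1.le hp.2.le hc
  rw [← h.fst_eq hx₁, ← h.good.eq_vLeaf_iff.2 rfl] at hle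
  have h0 := mul_nonneg h.gamma'_nonneg (le_max_right (p.1 - (q x).1) 0)
  rcases le_total x.2 (E.rCo p) with h1 | h1
  · have := (h.leaf x.1 hx.1 x.2 hx.2 _ hp h1).2
    have h2 := mul_le_mul_of_nonneg_left ((le_max_left (p.1 - (q x).1) 0)) h.gamma'_nonneg
    have h3 := mul_le_mul_of_nonneg_left hle h.gamma'_nonneg
    simp only [Prod.mk.eta] at this
    linarith
  · have := (h.leaf x.1 hx.1 _ hp x.2 hx.2 h1).1
    simp only [Prod.mk.eta] at this
    linarith

lemma lt_upp (h : Sweep E q γ M γ') {x : ℝ × ℝ} (hx : x ∈ unitSq) :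
    (q x).2 < upp q γ' (q x).1 := by
  have := h.rot.low_lt (flip_mem hx)
  simp only [rotFam, sub_sub_cancel, Prod.mk.eta, Prod.fst_neg, Prod.snd_neg] at this
  unfold upp
  exact lt_neg_of_lt_neg this

lemma exists_gt (h : Sweep E q γ M γ') {p : ℝ × ℝ} (hp : E.rCo p ∈ Ioo (0 : ℝ) 1)
    (hl : p.2 < upp q γ' p.1) : ∃ s ∈ Ioo (0 : ℝ) 1, p.2 < (q (s, E.rCo p)).2 := by
  have e := h.good.rCo_rot p
  obtain ⟨s, hs, hlt⟩ := h.rot.exists_lt (p := -p)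
    (by rw [e]; constructor <;> linarith [hp.1, hp.2])
    (by simp only [Prod.fst_neg, Prod.snd_neg]; unfold upp at hl; exact lt_neg_of_lt_neg hl)
  rw [e] at hlt
  simp only [rotFam, sub_sub_cancel, Prod.snd_neg, neg_lt_neg_iff] at hlt
  exact ⟨1 - s, ⟨by linarith [hs.2], by linarith [hs.1]⟩, hlt⟩

lemma exists_param (h : Sweep E q γ M γ') {p : ℝ × ℝ} (hp : E.rCo p ∈ Ioo (0 : ℝ) 1)
    (hl : low q γ' p.1 < p.2) (hu : p.2 < upp q γ' p.1) :
    ∃ s ∈ Ioo (0 : ℝ) 1, q (s, E.rCo p) = p := by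
  obtain ⟨s₁, hs₁, h1⟩ := h.exists_lt hp hl
  obtain ⟨s₂, hs₂, h2⟩ := h.exists_gt hp hu
  obtain ⟨s, hs, e⟩ := isPreconnected_Ioo.intermediate_value hs₁ hs₂
    ((h.cont.comp (by fun_prop : ContinuousOn (fun s : ℝ => (s, E.rCo p)) (Ioo 0 1))
      fun s hs => ⟨hs, hp⟩).snd) ⟨h1.le, h2.le⟩
  refine ⟨s, hs, Prod.ext ?_ e⟩
  simp only [Function.comp] at e
  rw [h.fst_eq (x := (s, E.rCo p)) ⟨hs, hp⟩, e]
  exact (h.good.eq_vLeaf_iff.2 rfl).symm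

lemma mem_image_iff (h : Sweep E q γ M γ') {p : ℝ × ℝ} (hp : p ∈ E.region) :
    p ∈ q '' unitSq ↔ low q γ' p.1 < p.2 ∧ p.2 < upp q γ' p.1 := by
  constructor
  · rintro ⟨x, hx, rfl⟩
    exact ⟨h.low_lt hx, h.lt_upp hx⟩
  · rintro ⟨h1, h2⟩
    have hR := (h.good.mem_region_iff.1 hp).2
    obtain ⟨s, hs, e⟩ := h.exists_param hR h1 h2
    exact ⟨(s, _), ⟨hs, hR⟩, e⟩

/-- A point of the band on the leaf through `(X, low q γ' X)` lies strictly between the boundaries.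
It cannot lie at or below that boundary point, and from above it the inequality carries over to `X`
because the upper boundary rises and the leaf falls. -/
lemma low_lt_upp (h : Sweep E q γ M γ') {X : ℝ} (hX : E.rCo (X, low q γ' X) ∈ Ioo (0 : ℝ) 1) :
    low q γ' X < upp q γ' X := by
  set R := E.rCo (X, low q γ' X) with hR
  have hx : ((1 / 2 : ℝ), R) ∈ unitSq := ⟨half_mem.1, hX⟩
  have e : X = E.vLeaf R (low q γ' X) := h.good.eq_vLeaf_iff.2 hR.symm
  have h1 := h.low_lt hx
  have h2 := h.lt_upp hx
  have e' := h.fst_eq hx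
  simp only at e'
  by_cases hc : (q (1 / 2, R)).2 ≤ low q γ' X
  · have := h.good.vLeaf_anti hX.1.le hX.2.le hc
    rw [← e', ← e] at this
    linarith [h.low_mono this]
  · rw [not_le] at hc
    have := h.good.vLeaf_anti hX.1.le hX.2.le hc.le
    rw [← e', ← e] at this
    linarith [h.upp_mono this]

/-- Just above the boundary point, its leaf runs inside the band and below `q (s, R)`. Since heights
increase with the parameter, these nearby points have parameters less than `s`. -/
lemma mem_closure_low_of_Ioo (h : Sweep E q γ M γ') {X : ℝ}
    (hX : E.rCo (X, low q γ' X) ∈ Ioo (0 : ℝ) 1) {s : ℝ} (hs : s ∈ Ioo (0 : ℝ) 1) :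
    (X, low q γ' X) ∈ closure (q '' Ioo 0 s ×ˢ Ioo 0 1) := by
  have hlu := h.low_lt_upp hX
  set R := E.rCo (X, low q γ' X) with hR
  have e : X = E.vLeaf R (low q γ' X) := h.good.eq_vLeaf_iff.2 hR.symm
  have ha := h.good.vLeaf_anti hX.1.le hX.2.le
  have hc := h.good.continuous_vLeaf' R
  have hx : (s, R) ∈ unitSq := ⟨hs, hX⟩
  have hlt : low q γ' X < (q (s, R)).2 := by
    by_contra hcon
    have h1 := h.low_lt hx
    rw [h.fst_eq hx] at h1
    have h2 := ha (not_lt.1 hcon)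
    rw [← e] at h2
    simp only at h1
    linarith [h.low_mono h2]
  have hcu : Continuous fun y => upp q γ' (E.vLeaf R y) := h.continuous_upp.comp hc
  have hev : ∀ᶠ y in 𝓝[>] (low q γ' X), (E.vLeaf R y, y) ∈ q '' Ioo 0 s ×ˢ Ioo 0 1 := by
    have h1 : ∀ᶠ y in 𝓝 (low q γ' X), y < upp q γ' (E.vLeaf R y) :=
      continuousAt_id.eventually_lt hcu.continuousAt (by rw [← e]; exact hlu)
    filter_upwards [h1.filter_mono nhdsWithin_le_nhds, Ioo_mem_nhdsGT hlt] with y hy hy'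
    have hRy : E.rCo (E.vLeaf R y, y) = R := h.good.rCo_leaf R y
    have hly : low q γ' (E.vLeaf R y) < y := by
      have := h.low_mono (ha hy'.1.le)
      rw [← e] at this
      linarith [hy'.1]
    obtain ⟨s', hs', es⟩ := h.exists_param (p := (E.vLeaf R y, y)) (by rw [hRy]; exact hX) hly hy
    rw [hRy] at es
    refine ⟨(s', R), ⟨⟨hs'.1, ?_⟩, hX⟩, es⟩
    by_contra hcon
    have := (h.mono R hX).monotoneOn hs hs' (not_lt.1 hcon)
    simp only [es] at this
    linarith [hy'.2]
  have hlim : Tendsto (fun y => (E.vLeaf R y, y)) (𝓝[>] (low q γ' X)) (𝓝 (X, low q γ' X)) := by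
    have h1 : Continuous fun y => (E.vLeaf R y, y) := hc.prodMk continuous_id
    have h2 := h1.tendsto (low q γ' X)
    rw [← e] at h2
    exact h2.mono_left nhdsWithin_le_nhds
  exact mem_closure_of_tendsto hlim hev

/-- `c` is an increasing curve that runs across `E` from the left to the right side. -/
structure Spans (E : Quad) (c : Arc) : Prop where
  mono : Monotone c.f
  cont : Continuous c.f
  left : c.lo = E.bm (c.f c.lo)
  right : c.hi = E.bp (c.f c.hi)

/-- The ends lie where the graph of `f` meets the two sides; their ordinates are fixed points of `f
∘ bm` and `f ∘ bp`. -/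
lemma exists_spans (hE : E.IsGood γ M) {f : ℝ → ℝ} (hf : Monotone f) (hc : Continuous f) :
    ∃ c : Arc, c.f = f ∧ Spans E c := by
  obtain ⟨C, hC⟩ := hE.bdd
  obtain ⟨C', hC'⟩ := (isCompact_Icc (a := -C) (b := C)).exists_bound_of_continuousOn hc.continuousOn
  obtain ⟨y₁, e₁⟩ := exists_fixedPoint_of_bounded (hc.comp hE.continuous_bm) (C := C')
    fun y => hC' _ (abs_le.1 (hC y).2.2.1)
  obtain ⟨y₂, e₂⟩ := exists_fixedPoint_of_bounded (hc.comp hE.continuous_bp) (C := C')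
    fun y => hC' _ (abs_le.1 (hC y).2.2.2)
  simp only [Function.comp] at e₁ e₂
  have hlt : E.bm y₁ < E.bp y₂ := by
    by_contra hcon
    have h1 := hf (not_lt.1 hcon)
    rw [← e₁, ← e₂] at h1
    have h2 := hE.bp_anti h1
    linarith [hE.b_lt y₁]
  refine ⟨⟨E.bm y₁, E.bp y₂, hlt, f⟩, rfl, hf, hc, ?_, ?_⟩
  · simp only; rw [← e₁]
  · simp only; rw [← e₂]

lemma Spans.fst_gt {c : Arc} (hc : Spans E c) (hE : E.IsGood γ M) {X : ℝ} (hX : c.lo < X) :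
    E.bm (c.f X) < X :=
  (hE.bm_anti (hc.mono hX.le)).trans_lt (by rw [← hc.left]; exact hX)

lemma Spans.fst_lt {c : Arc} (hc : Spans E c) (hE : E.IsGood γ M) {X : ℝ} (hX : X < c.hi) :
    X < E.bp (c.f X) :=
  lt_of_lt_of_le (by rw [← hc.right]; exact hX) (hE.bp_anti (hc.mono hX.le))

lemma Spans.rCo_mem {c : Arc} (hc : Spans E c) (hE : E.IsGood γ M) {X : ℝ} (hX : X ∈ Ioo c.lo c.hi) :
    E.rCo (X, c.f X) ∈ Ioo (0 : ℝ) 1 := by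
  constructor
  · rw [← hE.vLeaf_lt_iff, Quad.IsGood.vLeaf_zero]; exact hc.fst_gt hE hX.1
  · rw [← hE.lt_vLeaf_iff, Quad.IsGood.vLeaf_one]; exact hc.fst_lt hE hX.2

lemma ext_of_mem {c : Arc} {X : ℝ} (hX : X ∈ Icc c.lo c.hi) : c.ext X = c.f X := by
  rw [Arc.ext, min_eq_right hX.2, max_eq_right hX.1]

lemma ext_of_le {c : Arc} {X : ℝ} (hX : X ≤ c.lo) : c.ext X = c.f c.lo := by
  rw [Arc.ext, min_eq_right (hX.trans c.lo_lt_hi.le), max_eq_left hX]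

lemma ext_of_ge {c : Arc} {X : ℝ} (hX : c.hi ≤ X) : c.ext X = c.f c.hi := by
  rw [Arc.ext, min_eq_left hX, max_eq_right c.lo_lt_hi.le]

/-- Inside `E`, the continuation by constants may be replaced by the function itself. -/
lemma Spans.sign {c : Arc} (hc : Spans E c) (hE : E.IsGood γ M) {p : ℝ × ℝ}
    (hp₁ : E.bm p.2 < p.1) (hp₂ : p.1 < E.bp p.2) :
    (c.ext p.1 < p.2 ↔ c.f p.1 < p.2) ∧ (p.2 < c.ext p.1 ↔ p.2 < c.f p.1) := by
  rcases lt_or_ge p.1 c.lo with h1 | h1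
  · rw [ext_of_le h1.le]
    -- A point of the quadrangle to the left of the arc lies above its left end, since the left side
    -- falls; there both the constant and the function are below the point. Right of the arc the
    -- situation is mirrored.
    have : c.f c.lo < p.2 := by
      by_contra hcon
      have := hE.bm_anti (not_lt.1 hcon)
      rw [← hc.left] at this
      linarith
    have h2 := hc.mono h1.le
    constructor <;> constructor <;> intro <;> linarith
  rcases lt_or_ge c.hi p.1 with h2 | h2
  · rw [ext_of_ge h2.le]
    have : p.2 < c.f c.hi := by
      by_contra hcon
      have := hE.bp_anti (not_lt.1 hcon)
      rw [← hc.right] at this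
      linarith
    have h2 := hc.mono h2.le
    constructor <;> constructor <;> intro <;> linarith
  · rw [ext_of_mem ⟨h1, h2⟩]; exact ⟨Iff.rfl, Iff.rfl⟩

lemma mem_closure_low (h : Sweep E q γ M γ') {c : Arc} (hc : Spans E c) (hf : c.f = low q γ')
    {X : ℝ} (hX : X ∈ Icc c.lo c.hi) {s : ℝ} (hs : s ∈ Ioo (0 : ℝ) 1) :
    (X, c.f X) ∈ closure (q '' Ioo 0 s ×ˢ Ioo 0 1) := by
  have h1 : X ∈ closure (Ioo c.lo c.hi) := by rwa [closure_Ioo c.lo_lt_hi.ne]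
  have h2 : Continuous fun X => (X, c.f X) := continuous_id.prodMk hc.cont
  rw [← closure_closure]
  refine map_mem_closure (f := fun X => (X, c.f X)) h2 h1 fun X hX => ?_
  have := hc.rCo_mem h.good hX
  rw [hf] at this ⊢
  exact h.mem_closure_low_of_Ioo this hs

lemma Spans.rot {c : Arc} (hc : Spans E c) : ∃ c' : Arc, Spans E.rot c' ∧
    c'.f = (fun X => -c.f (-X)) ∧ c'.lo = -c.hi ∧ c'.hi = -c.lo := by
  refine ⟨⟨-c.hi, -c.lo, neg_lt_neg c.lo_lt_hi, fun X => -c.f (-X)⟩,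
    ⟨fun x y hxy => neg_le_neg (hc.mono (neg_le_neg hxy)), (hc.cont.comp continuous_neg).neg, ?_, ?_⟩,
    rfl, rfl, rfl⟩
  · simp only [Quad.rot, neg_neg]; rw [← hc.right]
  · simp only [Quad.rot, neg_neg]; rw [← hc.left]

lemma mem_closure_upp (h : Sweep E q γ M γ') {c : Arc} (hc : Spans E c) (hf : c.f = upp q γ')
    {X : ℝ} (hX : X ∈ Icc c.lo c.hi) {s : ℝ} (hs : s ∈ Ioo (0 : ℝ) 1) :
    (X, c.f X) ∈ closure (q '' Ioo s 1 ×ˢ Ioo 0 1) := by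
  obtain ⟨c', hc', e, e1, e2⟩ := hc.rot
  have := h.rot.mem_closure_low hc' (by rw [e, hf]; funext X; simp [upp]) (X := -X)
    (by rw [e1, e2]; exact ⟨neg_le_neg hX.2, neg_le_neg hX.1⟩) (s := 1 - s)
    ⟨by linarith [hs.2], by linarith [hs.1]⟩
  rw [rotFam_image, closure_neg_set, Set.mem_neg, e] at this
  simpa using this

end Sweep

end StripMap
end

/-! ### The band is a strip: order, closure and thickness of its boundary curves. -/

noncomputable section

namespace StripMap

namespace Sweep

variable {E : Quad} {q : ℝ × ℝ → ℝ × ℝ} {γ M γ' : ℝ}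

lemma low_rotFam (q : ℝ × ℝ → ℝ × ℝ) (X : ℝ) : low (rotFam q) γ' X = -upp q γ' (-X) := by
  simp [upp]

lemma upp_rotFam (q : ℝ × ℝ → ℝ × ℝ) (X : ℝ) : upp (rotFam q) γ' X = -low q γ' (-X) := by
  simp [upp, rotFam_rotFam]

/-- Were the corners in the wrong order, some point of the left side would lie above the upper and
below the lower boundary function. The same would hold on a leaf close to that side, which contains
points of the band; sliding along the falling leaf contradicts the monotonicity of the boundaries.
-/
lemma left_corner_le (h : Sweep E q γ M γ') {c d : Arc} (hc : Spans E c) (hd : Spans E d)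
    (hcf : c.f = low q γ') (hdf : d.f = upp q γ') : c.f c.lo ≤ d.f d.lo := by
  by_contra hcon
  rw [not_le] at hcon
  obtain ⟨y, hy1, hy2⟩ := exists_between hcon
  have hl : y < low q γ' (E.vLeaf 0 y) := by
    rw [Quad.IsGood.vLeaf_zero, ← hcf]
    have := hc.mono (h.good.bm_anti hy2.le)
    rw [← hc.left] at this
    linarith
  have hu : upp q γ' (E.vLeaf 0 y) < y := by
    rw [Quad.IsGood.vLeaf_zero, ← hdf]
    have := hd.mono (h.good.bm_anti hy1.le)
    rw [← hd.left] at this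
    linarith
  have hv : Continuous fun R => E.vLeaf R y :=
    h.good.continuous_vLeaf.comp (by fun_prop : Continuous fun R : ℝ => (R, y))
  have e1 : ∀ᶠ R in 𝓝[>] (0 : ℝ), y < low q γ' (E.vLeaf R y) :=
    (continuousAt_const.eventually_lt (h.continuous_low.comp hv).continuousAt hl).filter_mono
      nhdsWithin_le_nhds
  have e2 : ∀ᶠ R in 𝓝[>] (0 : ℝ), upp q γ' (E.vLeaf R y) < y :=
    ((h.continuous_upp.comp hv).continuousAt.eventually_lt continuousAt_const hu).filter_mono
      nhdsWithin_le_nhds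
  obtain ⟨R, ⟨h1, h2⟩, hR⟩ := ((e1.and e2).and (Ioo_mem_nhdsGT zero_lt_one)).exists
  have hx : ((1 / 2 : ℝ), R) ∈ unitSq := ⟨half_mem.1, hR⟩
  have k1 := h.low_lt hx
  have k2 := h.lt_upp hx
  rw [h.fst_eq hx] at k1 k2
  simp only at k1 k2
  rcases le_total (q (1 / 2, R)).2 y with h3 | h3
  · have := h.low_mono (h.good.vLeaf_anti hR.1.le hR.2.le h3)
    linarith
  · have := h.upp_mono (h.good.vLeaf_anti hR.1.le hR.2.le h3)
    linarith

/-- The weak inequality extends from the interior of the domain by continuity. A common point would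
be a limit of points with parameters below `1 / 3` and also of points with parameters above `2 / 3`.
-/
lemma lt_of_mem (h : Sweep E q γ M γ') {c d : Arc} (hc : Spans E c) (hd : Spans E d)
    (hcf : c.f = low q γ') (hdf : d.f = upp q γ') {X : ℝ} (hX : X ∈ Icc c.lo c.hi)
    (hX' : X ∈ Icc d.lo d.hi) : c.f X < d.f X := by
  refine lt_of_le_of_ne ?_ fun e => ?_
  · have h1 : X ∈ closure (Ioo c.lo c.hi) := by rwa [closure_Ioo c.lo_lt_hi.ne]
    refine closure_minimal (t := {X | c.f X ≤ d.f X}) (fun X hX => ?_)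
      (isClosed_le hc.cont hd.cont) h1
    have := hc.rCo_mem h.good hX
    rw [hcf] at this
    rw [mem_ofPred_eq, hcf, hdf]
    exact (h.low_lt_upp this).le
  · have h1 := h.mem_closure_low hc hcf hX (s := 1 / 3) (by constructor <;> norm_num)
    have h2 := h.mem_closure_upp hd hdf hX' (s := 2 / 3) (by constructor <;> norm_num)
    rw [e] at h1
    exact Set.disjoint_left.1 h.disj h1 h2

lemma left_corner_lt (h : Sweep E q γ M γ') {c d : Arc} (hc : Spans E c) (hd : Spans E d)
    (hcf : c.f = low q γ') (hdf : d.f = upp q γ') : c.f c.lo < d.f d.lo := by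
  refine lt_of_le_of_ne (h.left_corner_le hc hd hcf hdf) fun e => ?_
  have e' : c.lo = d.lo := by rw [hc.left, hd.left, e]
  have := h.lt_of_mem hc hd hcf hdf (X := c.lo) ⟨le_rfl, c.lo_lt_hi.le⟩
    (by rw [e']; exact ⟨le_rfl, d.lo_lt_hi.le⟩)
  rw [e, ← e'] at this
  exact lt_irrefl _ this

lemma right_corner_lt (h : Sweep E q γ M γ') {c d : Arc} (hc : Spans E c) (hd : Spans E d)
    (hcf : c.f = low q γ') (hdf : d.f = upp q γ') : c.f c.hi < d.f d.hi := by
  obtain ⟨c', hc', e, e1, -⟩ := hc.rot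
  obtain ⟨d', hd', k, k1, -⟩ := hd.rot
  have := h.rot.left_corner_lt hd' hc' (by rw [k, hdf]; funext X; rw [low_rotFam])
    (by rw [e, hcf]; funext X; rw [upp_rotFam])
  rw [e, k, e1, k1] at this
  simpa using this

lemma lo_le (h : Sweep E q γ M γ') {c d : Arc} (hc : Spans E c) (hd : Spans E d)
    (hcf : c.f = low q γ') (hdf : d.f = upp q γ') : d.lo ≤ c.lo := by
  rw [hc.left, hd.left]
  exact h.good.bm_anti (h.left_corner_lt hc hd hcf hdf).le

lemma hi_le (h : Sweep E q γ M γ') {c d : Arc} (hc : Spans E c) (hd : Spans E d)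
    (hcf : c.f = low q γ') (hdf : d.f = upp q γ') : d.hi ≤ c.hi := by
  rw [hc.right, hd.right]
  exact h.good.bp_anti (h.right_corner_lt hc hd hcf hdf).le

lemma ext_lt_ext (h : Sweep E q γ M γ') {c d : Arc} (hc : Spans E c) (hd : Spans E d)
    (hcf : c.f = low q γ') (hdf : d.f = upp q γ') (t : ℝ) : c.ext t < d.ext t := by
  have h1 := h.left_corner_lt hc hd hcf hdf
  have h2 := h.right_corner_lt hc hd hcf hdf
  have h3 := h.lo_le hc hd hcf hdf
  have h4 := h.hi_le hc hd hcf hdf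
  rcases le_total t c.lo with ht | ht
  · rw [ext_of_le ht]
    exact h1.trans_le (hd.mono (le_max_left _ _))
  rcases le_total d.hi t with ht' | ht'
  · rw [ext_of_ge ht']
    exact (hc.mono (max_le c.lo_lt_hi.le (min_le_left _ _))).trans_lt h2
  · have m1 : t ∈ Icc c.lo c.hi := ⟨ht, ht'.trans h4⟩
    have m2 : t ∈ Icc d.lo d.hi := ⟨h3.trans ht, ht'⟩
    rw [ext_of_mem m1, ext_of_mem m2]
    exact h.lt_of_mem hc hd hcf hdf m1 m2

lemma image_eq (h : Sweep E q γ M γ') {c d : Arc} (hc : Spans E c) (hd : Spans E d)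
    (hcf : c.f = low q γ') (hdf : d.f = upp q γ') :
    q '' unitSq = {p ∈ E.region | c.ext p.1 < p.2 ∧ p.2 < d.ext p.1} := by
  ext p
  rw [mem_ofPred_eq]
  constructor
  · intro hp
    have hpE : p ∈ E.region := by obtain ⟨x, hx, rfl⟩ := hp; exact h.mem x hx
    refine ⟨hpE, ?_⟩
    rw [(hc.sign h.good hpE.2.2.1 hpE.2.2.2).1, (hd.sign h.good hpE.2.2.1 hpE.2.2.2).2, hcf, hdf]
    exact (h.mem_image_iff hpE).1 hp
  · rintro ⟨hpE, hp⟩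
    rw [(hc.sign h.good hpE.2.2.1 hpE.2.2.2).1, (hd.sign h.good hpE.2.2.1 hpE.2.2.2).2, hcf,
      hdf] at hp
    exact (h.mem_image_iff hpE).2 hp

lemma closure_image_subset (h : Sweep E q γ M γ') {a b : ℝ} (ha : 0 ≤ a) (hb : b ≤ 1) :
    closure (q '' Ioo a b ×ˢ Ioo 0 1) ⊆ closure E.region := by
  refine closure_mono ?_
  rintro _ ⟨x, hx, rfl⟩
  exact h.mem x ⟨⟨ha.trans_lt hx.1.1, hx.1.2.trans_le hb⟩, hx.2⟩

/-- Both boundary points are limits of points of the band. The strict inequality of abscissas passes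
to the approximating points, so the hypothesis on pairs in the band applies to them. -/
lemma thickness_aux (h : Sweep E q γ M γ') {c d : Arc} (hc : Spans E c) (hd : Spans E d)
    (hcf : c.f = low q γ') (hdf : d.f = upp q γ') {w : ℝ}
    (hw : ∀ x ∈ unitSq, ∀ x' ∈ unitSq, (q x').1 ≤ (q x).1 → (q x).2 < (q x').2 →
      (q x').2 - (q x).2 ≤ w) {t₀ t₁ : ℝ} (h₀ : t₀ ∈ Icc c.lo c.hi) (h₁ : t₁ ∈ Icc d.lo d.hi)
    (hlt : t₁ < t₀) : d.f t₁ - c.f t₀ ≤ w := by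
  have m13 : ((1 / 3 : ℝ), (1 / 2 : ℝ)) ∈ unitSq := by
    refine ⟨⟨?_, ?_⟩, ?_, ?_⟩ <;> norm_num
  have hw0 : 0 ≤ w := by
    have hlt := h.mono (1 / 2) half_mem.1 m13.1 half_mem.1 (by norm_num)
    have := hw _ m13 _ half_mem (by
      rw [h.fst_eq m13, h.fst_eq half_mem]
      exact h.good.vLeaf_anti half_mem.1.1.le half_mem.1.2.le hlt.le) hlt
    simp only at hlt
    linarith
  rcases le_or_gt (d.f t₁) (c.f t₀) with hle | hgt
  · linarith
  have k0 := h.mem_closure_low hc hcf h₀ half_mem.1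
  have k1 := h.mem_closure_upp hd hdf h₁ half_mem.1
  obtain ⟨a, ha, hat⟩ := mem_closure_iff_seq_limit.1 k0
  obtain ⟨b, hb, hbt⟩ := mem_closure_iff_seq_limit.1 k1
  refine le_of_tendsto (hbt.snd_nhds.sub hat.snd_nhds) ?_
  filter_upwards [hbt.fst_nhds.eventually_lt hat.fst_nhds hlt,
    hat.snd_nhds.eventually_lt hbt.snd_nhds hgt] with n h1 h2
  obtain ⟨x, hx, ex⟩ := ha n
  obtain ⟨y, hy, ey⟩ := hb n
  rw [← ex, ← ey] at h1 h2 ⊢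
  exact hw x ⟨⟨hx.1.1, hx.1.2.trans (by norm_num)⟩, hx.2⟩ y
    ⟨⟨lt_trans (by norm_num) hy.1.1, hy.1.2⟩, hy.2⟩ h1.le h2

/-- The domain of the upper curve is shifted to the left of that of the lower one, so the constant
continuations compare values at clamped abscissas `t₁ ≤ t₀`. Equality is reached as a limit of the
strict case, by moving `t₁` to the left or, at the left end, `t₀` to the right. -/
lemma thickness_le (h : Sweep E q γ M γ') {c d : Arc} (hc : Spans E c) (hd : Spans E d)
    (hcf : c.f = low q γ') (hdf : d.f = upp q γ') {w : ℝ}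
    (hw : ∀ x ∈ unitSq, ∀ x' ∈ unitSq, (q x').1 ≤ (q x).1 → (q x).2 < (q x').2 →
      (q x').2 - (q x).2 ≤ w) (t : ℝ) : d.ext t - c.ext t ≤ w := by
  have hlo := h.lo_le hc hd hcf hdf
  have hhi := h.hi_le hc hd hcf hdf
  have key : ∀ t₀ ∈ Icc c.lo c.hi, ∀ t₁ ∈ Icc d.lo d.hi, t₁ ≤ t₀ → d.f t₁ - c.f t₀ ≤ w := by
    intro t₀ h₀ t₁ h₁ hle
    rcases hle.lt_or_eq with hlt | rfl
    · exact h.thickness_aux hc hd hcf hdf hw h₀ h₁ hlt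
    rcases h₁.1.lt_or_eq with h2 | h2
    · have ht : Tendsto (fun t => d.f t - c.f t₁) (𝓝[<] t₁) (𝓝 (d.f t₁ - c.f t₁)) :=
        ((hd.cont.sub continuous_const).tendsto t₁).mono_left nhdsWithin_le_nhds
      refine le_of_tendsto ht ?_
      filter_upwards [Ioo_mem_nhdsLT h2] with t ht
      exact h.thickness_aux hc hd hcf hdf hw h₀ ⟨ht.1.le, ht.2.le.trans h₁.2⟩ ht.2
    · have h3 : t₁ < c.hi := by
        have := c.lo_lt_hi
        have := h₀.1
        linarith
      have ht : Tendsto (fun t => d.f t₁ - c.f t) (𝓝[>] t₁) (𝓝 (d.f t₁ - c.f t₁)) :=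
        ((continuous_const.sub hc.cont).tendsto t₁).mono_left nhdsWithin_le_nhds
      refine le_of_tendsto ht ?_
      filter_upwards [Ioo_mem_nhdsGT h3] with t ht
      exact h.thickness_aux hc hd hcf hdf hw ⟨h₀.1.trans ht.1.le, ht.2.le⟩ h₁ ht.1
  refine key _ ⟨le_max_left _ _, max_le c.lo_lt_hi.le (min_le_left _ _)⟩ _
    ⟨le_max_left _ _, max_le d.lo_lt_hi.le (min_le_left _ _)⟩ ?_
  exact max_le_max hlo (min_le_min_right _ hhi)

/-- The band is bounded by two curves that run across `E`. -/
theorem exists_strip (h : Sweep E q γ M γ') : ∃ c d : Arc, Spans E c ∧ Spans E d ∧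
    (∀ x y, x ≤ y → c.f y - c.f x ≤ γ' * (y - x)) ∧
    (∀ x y, x ≤ y → d.f y - d.f x ≤ γ' * (y - x)) ∧
    c.hGraph ⊆ closure E.region ∧ d.hGraph ⊆ closure E.region ∧ (∀ t, c.ext t < d.ext t) ∧
    q '' unitSq = {p ∈ E.region | c.ext p.1 < p.2 ∧ p.2 < d.ext p.1} ∧
    ∀ w, (∀ x ∈ unitSq, ∀ x' ∈ unitSq, (q x').1 ≤ (q x).1 → (q x).2 < (q x').2 →
      (q x').2 - (q x).2 ≤ w) → ∀ t, d.ext t - c.ext t ≤ w := by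
  obtain ⟨c, hcf, hc⟩ := exists_spans h.good h.low_mono h.continuous_low
  obtain ⟨d, hdf, hd⟩ := exists_spans h.good h.upp_mono h.continuous_upp
  refine ⟨c, d, hc, hd, by rw [hcf]; exact h.low_lip, by rw [hdf]; exact h.upp_lip, ?_, ?_,
    h.ext_lt_ext hc hd hcf hdf, h.image_eq hc hd hcf hdf,
    fun w hw => h.thickness_le hc hd hcf hdf hw⟩
  · rintro ⟨X, y⟩ ⟨hX, hy⟩
    simp only at hX hy
    rw [hy]
    exact h.closure_image_subset le_rfl half_mem.1.2.le (h.mem_closure_low hc hcf hX half_mem.1)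
  · rintro ⟨X, y⟩ ⟨hX, hy⟩
    simp only at hX hy
    rw [hy]
    exact h.closure_image_subset half_mem.1.1.le le_rfl (h.mem_closure_upp hd hdf hX half_mem.1)

end Sweep

namespace Crossing

variable {S E : Quad} {Q T qt : ℝ × ℝ → ℝ × ℝ} {σ : ℝ → ℝ} {γ M ρ B κ γ' : ℝ}

/-- The image of the transit set is a band. -/
lemma sweep (h : Crossing S E Q T γ M ρ B κ) (hq : IsParam S E Q qt σ) (hγ : γ ≤ γ')
    (hB : B * (1 + γ) ≤ γ') : Sweep E (fun x => Q (qt x)) γ M γ' where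
  good := h.target
  le := hγ
  cont := h.continuousOn_closure.comp hq.cont fun x hx => subset_closure (hq.mem x hx)
  mem := fun x hx => (hq.mem x hx).2
  rCo := hq.rCo
  mono := hq.mono
  leaf := fun s hs R hR R' hR' hRR => by
    have := h.leaf_compare (hq.mem (s, R) ⟨hs, hR⟩) (hq.mem (s, R') ⟨hs, hR'⟩)
      (by rw [hq.sCo _ ⟨hs, hR⟩, hq.sCo _ ⟨hs, hR'⟩])
      (by rw [hq.rCo _ ⟨hs, hR⟩, hq.rCo _ ⟨hs, hR'⟩]; exact hRR)
    exact ⟨this.2.2.1, this.2.2.2 γ' hB⟩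
  disj := by
    have hsub : ∀ a b : ℝ, 0 ≤ a → b ≤ 1 → ∀ s ∈ Ioo a b ×ˢ Ioo (0 : ℝ) 1, s ∈ unitSq :=
      fun a b ha hb s hs => ⟨⟨ha.trans_lt hs.1.1, hs.1.2.trans_le hb⟩, hs.2⟩
    -- Limits of image points are images of points of the compact closure, with labels in the closed
    -- interval. Injectivity of `Q` on the closure then separates the two pieces.
    have himg : ∀ a b : ℝ, 0 ≤ a → b ≤ 1 →
        closure ((fun x => Q (qt x)) '' Ioo a b ×ˢ Ioo 0 1) ⊆
          Q '' (closure (transitSet S E Q) ∩ {p | S.sCo p ∈ closure (σ '' Ioo a b)}) := by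
      intro a b ha hb
      have hK : IsCompact (closure (transitSet S E Q) ∩ {p | S.sCo p ∈ closure (σ '' Ioo a b)}) :=
        h.isCompact_closure.inter_right (isClosed_closure.preimage h.source.continuous_sCo)
      refine (hK.image_of_continuousOn
        (h.continuousOn_closure.mono inter_subset_left)).isClosed.closure_subset_iff.2 ?_
      rintro _ ⟨x, hx, rfl⟩
      have hx' := hsub a b ha hb x hx
      refine ⟨qt x, ⟨subset_closure (hq.mem x hx'), ?_⟩, rfl⟩
      rw [mem_ofPred_eq, hq.sCo x hx']
      exact subset_closure ⟨_, hx.1, rfl⟩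
    refine Disjoint.mono (himg 0 (1 / 3) le_rfl (by norm_num)) (himg (2 / 3) 1 (by norm_num) le_rfl) ?_
    rw [Set.disjoint_left]
    rintro _ ⟨p, hp, rfl⟩ ⟨p', hp', e⟩
    have e2 := h.injOn hp'.1 hp.1 e
    rw [e2] at hp'
    have h1 := hp.2
    have h2 := hp'.2
    rw [mem_ofPred_eq] at h1 h2
    rcases hq.orient with hσ | hσ
    · rw [hσ, image_id, closure_Ioo (by norm_num)] at h1 h2
      linarith [h1.2, h2.1]
    · rw [hσ, image_const_sub_Ioo, closure_Ioo (by norm_num)] at h1 h2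
      linarith [h1.1, h2.2]

end Crossing

end StripMap
end

/-! ### Inverse linearization, contraction of thickness, motion into the interior. -/

noncomputable section

namespace StripMap

/-- An invertible linear map of the plane is inverted by the adjugate matrix. -/
lemma exists_clm_inverse {L : ℝ × ℝ →L[ℝ] ℝ × ℝ} {κ : ℝ} (hκ : κ * κ = 1)
    (hdet : (L (1, 0)).1 * (L (0, 1)).2 - (L (1, 0)).2 * (L (0, 1)).1 = κ) :
    ∃ e : (ℝ × ℝ) ≃L[ℝ] (ℝ × ℝ), (e : ℝ × ℝ →L[ℝ] ℝ × ℝ) = L ∧ ∀ x y,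
      e.symm (x, y) = (κ * ((L (0, 1)).2 * x - (L (0, 1)).1 * y),
        κ * ((L (1, 0)).1 * y - (L (1, 0)).2 * x)) := by
  set a := (L (1, 0)).1 with ha
  set b := (L (0, 1)).1 with hb
  set c := (L (1, 0)).2 with hc
  set d := (L (0, 1)).2 with hd
  set L' : ℝ × ℝ →L[ℝ] ℝ × ℝ :=
    ((κ * d) • ContinuousLinearMap.fst ℝ ℝ ℝ - (κ * b) • ContinuousLinearMap.snd ℝ ℝ ℝ).prod
      ((κ * a) • ContinuousLinearMap.snd ℝ ℝ ℝ - (κ * c) • ContinuousLinearMap.fst ℝ ℝ ℝ) with hL'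
  have hL'a : ∀ x y, L' (x, y) = (κ * (d * x - b * y), κ * (a * y - c * x)) := fun x y => by
    simp only [hL', ContinuousLinearMap.prod_apply, sub_apply, smul_apply,
      ContinuousLinearMap.coe_fst', ContinuousLinearMap.coe_snd', smul_eq_mul]
    exact Prod.ext (by ring) (by ring)
  have hLa : ∀ x y, L (x, y) = (x * a + y * b, x * c + y * d) := fun x y => clm_apply_eq L x y
  refine ⟨ContinuousLinearEquiv.equivOfInverse L L' ?_ ?_, ?_, ?_⟩
  · rintro ⟨x, y⟩
    rw [hLa, hL'a]
    refine Prod.ext ?_ ?_ <;> simp only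
    · linear_combination (κ * x) * hdet + x * hκ
    · linear_combination (κ * y) * hdet + y * hκ
  · rintro ⟨x, y⟩
    rw [hL'a, hLa]
    refine Prod.ext ?_ ?_ <;> simp only
    · linear_combination (κ * x) * hdet + x * hκ
    · linear_combination (κ * y) * hdet + y * hκ
  · ext <;> rfl
  · intro x y
    exact hL'a x y

namespace Crossing

variable {S E : Quad} {Q T qt : ℝ × ℝ → ℝ × ℝ} {σ : ℝ → ℝ} {γ M ρ B κ γ' : ℝ}

lemma image_transitSet (hq : IsParam S E Q qt σ) :
    (fun x => Q (qt x)) '' unitSq = Q '' transitSet S E Q := by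
  ext p
  constructor
  · rintro ⟨x, hx, rfl⟩
    exact ⟨_, hq.mem x hx, rfl⟩
  · rintro ⟨p, hp, rfl⟩
    obtain ⟨x, hx, rfl⟩ := hq.surj p hp
    exact ⟨x, hx, rfl⟩

/-- The derivative of the inverse. -/
lemma hasFDerivAt_inverse (h : Crossing S E Q T γ M ρ B κ) (hκ : κ * κ = 1) {q : ℝ × ℝ}
    (hq : q ∈ Q '' transitSet S E Q) : ∃ L' : ℝ × ℝ →L[ℝ] ℝ × ℝ, HasFDerivAt T L' q ∧
      ∃ L : ℝ × ℝ →L[ℝ] ℝ × ℝ, IsStretching ρ B κ L ∧ ∀ x y,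
      L' (x, y) = (κ * ((L (0, 1)).2 * x - (L (0, 1)).1 * y),
        κ * ((L (1, 0)).1 * y - (L (1, 0)).2 * x)) := by
  obtain ⟨p, hp, rfl⟩ := hq
  obtain ⟨L, hL, hs⟩ := h.lin p (subset_closure hp)
  obtain ⟨e, he, he'⟩ := exists_clm_inverse hκ hs.det
  refine ⟨e.symm, ?_, L, hs, he'⟩
  refine HasFDerivAt.of_local_left_inverse (f := Q) (h.invCont p hp) ?_ (h.rightInv p hp)
  rw [h.leftInv p (subset_closure hp), he]
  exact hL

/-- Moving up and left in the image moves the preimage up and left (down and right, if the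
orientation is reversed), and the vertical motion is contracted by the map. -/
lemma pull_back (h : Crossing S E Q T γ M ρ B κ) (hκ : κ * κ = 1) {p p' : ℝ × ℝ}
    (hp : p ∈ transitSet S E Q) (hp' : p' ∈ transitSet S E Q) (hX : (Q p').1 ≤ (Q p).1)
    (hY : (Q p).2 < (Q p').2) :
    ρ * ((Q p').2 - (Q p).2) ≤ κ * (p'.2 - p.2) ∧ κ * (p'.1 - p.1) ≤ 0 := by
  obtain ⟨qt, σ, hq⟩ := h.exists_isParam ⟨p, hp⟩
  have hsw := h.sweep hq (le_max_left γ (B * (1 + γ))) (le_max_right _ _)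
  set γ' := max γ (B * (1 + γ))
  have himg := image_transitSet hq
  have hiff : ∀ q ∈ E.region, q ∈ Q '' transitSet S E Q ↔
      Sweep.low (fun x => Q (qt x)) γ' q.1 < q.2 ∧ q.2 < Sweep.upp (fun x => Q (qt x)) γ' q.1 :=
    fun q hq => by rw [← himg]; exact hsw.mem_image_iff hq
  -- The image is the part of the open target strictly between two continuous curves. Openness
  -- provides balls for the mean value theorem applied to `T`.
  have hopen : IsOpen (Q '' transitSet S E Q) := by
    have : Q '' transitSet S E Q = E.region ∩
        ({q | Sweep.low (fun x => Q (qt x)) γ' q.1 < q.2} ∩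
          {q | q.2 < Sweep.upp (fun x => Q (qt x)) γ' q.1}) := by
      ext q
      constructor
      · intro hq'
        have hE : q ∈ E.region := by obtain ⟨p, hp, rfl⟩ := hq'; exact hp.2
        exact ⟨hE, (hiff q hE).1 hq'⟩
      · rintro ⟨hE, hq'⟩
        exact (hiff q hE).2 hq'
    rw [this]
    exact h.target.isOpen_region.inter
      ((isOpen_lt (hsw.continuous_low.comp continuous_fst) continuous_snd).inter
        (isOpen_lt continuous_snd (hsw.continuous_upp.comp continuous_fst)))
  have hqR := (h.target.mem_region_iff.1 hp.2).2
  have hqR' := (h.target.mem_region_iff.1 hp'.2).2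
  -- A path from `Q p` to `Q p'` that never moves to the right while going up. Since the boundaries
  -- of the band rise, it stays above the lower one and below the upper one, hence in the image.
  obtain ⟨v, hvc, hva, hv1, hv2, hvb⟩ := h.target.exists_anti_path hqR hqR' hX hY
  have hin : ∀ y ∈ Icc (Q p).2 (Q p').2, (v y, y) ∈ Q '' transitSet S E Q := by
    intro y hy
    have hE : (v y, y) ∈ E.region := h.target.mem_region_of_anti hva hvb
      (by rw [hv1]; exact hp.2.1) (by rw [hv2]; exact hp'.2.2.1) hy.1 hy.2
    rw [hiff _ hE]
    have k1 := ((hiff _ hp.2).1 ⟨p, hp, rfl⟩).1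
    have k2 := ((hiff _ hp'.2).1 ⟨p', hp', rfl⟩).2
    have k3 := hsw.low_mono (hva hy.1)
    have k4 := hsw.upp_mono (hva hy.2)
    rw [hv1] at k3
    rw [hv2] at k4
    exact ⟨by simp only; linarith [hy.1], by simp only; linarith [hy.2]⟩
  have hloc : ∀ α β e : ℝ, (∀ L : ℝ × ℝ →L[ℝ] ℝ × ℝ, IsStretching ρ B κ L → ∀ x y, x ≤ 0 → 0 ≤ y →
      e * y ≤ α * (κ * ((L (0, 1)).2 * x - (L (0, 1)).1 * y)) +
        β * (κ * ((L (1, 0)).1 * y - (L (1, 0)).2 * x))) →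
      MonotoneOn (fun y => α * (T (v y, y)).1 + β * (T (v y, y)).2 - e * y)
        (Icc (Q p).2 (Q p').2) := by
    intro α β e hcoef
    refine monotoneOn_of_locally ordConnected_Icc fun y hy => ?_
    obtain ⟨r, hr, hrV⟩ := Metric.isOpen_iff.1 hopen _ (hin y hy)
    have hvv : Continuous fun y => (v y, y) := hvc.prodMk continuous_id
    obtain ⟨ε, hε, hε'⟩ := Metric.continuousAt_iff.1 hvv.continuousAt r hr
    refine ⟨ε, hε, fun y₁ _ y₂ _ hy₁ hy₂ hyy => ?_⟩
    obtain ⟨L', ⟨L, hL, hLL⟩, hLe⟩ := exists_mvt (convex_ball (v y, y) r)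
      (fun q hq => h.hasFDerivAt_inverse hκ (hrV hq)) (p := (v y₁, y₁)) (q := (v y₂, y₂))
      (hε' hy₁) (hε' hy₂) α β
    have := hcoef L hL (v y₂ - v y₁) (y₂ - y₁) (by linarith [hva hyy]) (by linarith)
    rw [hLL, hLL] at hLe
    simp only at hLe ⊢
    linarith
  have hl : (Q p).2 ∈ Icc (Q p).2 (Q p').2 := ⟨le_rfl, hY.le⟩
  have hr : (Q p').2 ∈ Icc (Q p).2 (Q p').2 := ⟨hY.le, le_rfl⟩
  have hT : T (v (Q p).2, (Q p).2) = p := by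
    rw [hv1]; exact h.leftInv p (subset_closure hp)
  have hT' : T (v (Q p').2, (Q p').2) = p' := by
    rw [hv2]; exact h.leftInv p' (subset_closure hp')
  constructor
  -- As `κ * κ = 1`, the ordinate of the preimage changes, up to the factor `κ`, by `a₁₁ y - a₂₁ x`.
  -- Here `x ≤ 0 ≤ y` and the entries are positive, so this is at least `ρ * y`.
  · have := hloc 0 κ ρ (fun L hL x y hx hy => by
      have h1 := mul_nonneg_of_nonpos_of_nonpos hx (neg_nonpos.2 hL.pos₂₁.le)
      have h2 := mul_le_mul_of_nonneg_right hL.le₁₁ hy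
      have h3 : κ * (κ * ((L (1, 0)).1 * y - (L (1, 0)).2 * x)) =
        (L (1, 0)).1 * y - (L (1, 0)).2 * x := by rw [← mul_assoc, hκ, one_mul]
      rw [h3]
      linarith) hl hr hY.le
    simp only [hT, hT'] at this
    linarith
  · have := hloc (-κ) 0 0 (fun L hL x y hx hy => by
      have h1 := mul_nonneg_of_nonpos_of_nonpos hx (neg_nonpos.2 hL.pos₂₂.le)
      have h2 := mul_nonneg hL.pos₁₂.le hy
      have h3 : -κ * (κ * ((L (0, 1)).2 * x - (L (0, 1)).1 * y)) =
        (L (0, 1)).1 * y - (L (0, 1)).2 * x := by linear_combination (-((L (0, 1)).2 * x - (L (0, 1)).1 * y)) * hκ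
      rw [h3]
      linarith) hl hr hY.le
    simp only [hT, hT'] at this
    linarith

lemma sign_cases (hκ : κ * κ = 1) : κ = 1 ∨ κ = -1 := mul_self_eq_one_iff.1 hκ

/-- Vertical distances in the image are smaller than those in the source. -/
lemma image_snd_sub_le (h : Crossing S E Q T γ M ρ B κ) (hκ : κ * κ = 1) {w : ℝ}
    (hw : ∀ u, S.ap u - S.am u ≤ w) {p p' : ℝ × ℝ} (hp : p ∈ transitSet S E Q)
    (hp' : p' ∈ transitSet S E Q) (hX : (Q p').1 ≤ (Q p).1) (hY : (Q p).2 < (Q p').2) :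
    (Q p').2 - (Q p).2 ≤ w / ρ := by
  have hρ := h.one_lt
  rw [le_div_iff₀ (by linarith)]
  obtain ⟨h1, h2⟩ := h.pull_back hκ hp hp' hX hY
  -- For `κ = 1` the preimage moves to the left and up, so the rising upper side bounds `p'.2` by
  -- `S.ap p.1`, directly above `p`. For `κ = -1` the two points exchange roles.
  rcases sign_cases hκ with rfl | rfl
  · have := h.source.ap_mono (by linarith : p'.1 ≤ p.1)
    linarith [hw p.1, hp'.1.2.1, hp.1.1]
  · have := h.source.ap_mono (by linarith : p.1 ≤ p'.1)
    linarith [hw p'.1, hp.1.2.1, hp'.1.1]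

/-- Motion along a leaf of the source is controlled by the coordinate in the target. -/
lemma dist_le_of_sCo_eq (h : Crossing S E Q T γ M ρ B κ) {p p' : ℝ × ℝ}
    (hp : p ∈ transitSet S E Q) (hp' : p' ∈ transitSet S E Q) (hs : S.sCo p = S.sCo p') :
    dist p p' ≤ (1 + γ) * M * |E.rCo (Q p) - E.rCo (Q p')| := by
  wlog hR : E.rCo (Q p) ≤ E.rCo (Q p') generalizing p p'
  · rw [dist_comm, abs_sub_comm]
    exact this hp' hp hs.symm (not_le.1 hR).le
  obtain ⟨h1, h2, h3, -⟩ := h.leaf_compare hp hp' hs hR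
  have hγ := h.source.gamma_nonneg
  have hM := h.source.M_pos
  have hs01 := (h.source.mem_region_iff.1 hp.1).1
  have hR01 := (h.target.mem_region_iff.1 hp'.2).2
  have e1 : (Q p).1 = E.vLeaf (E.rCo (Q p)) (Q p).2 := h.target.eq_vLeaf_iff.2 rfl
  have e2 : (Q p').1 = E.vLeaf (E.rCo (Q p')) (Q p').2 := h.target.eq_vLeaf_iff.2 rfl
  have h4 := h.target.vLeaf_anti hR01.1.le hR01.2.le h3
  have h5 := h.target.vLeaf_sub_le hR (Q p).2
  -- Expansion is used only in the form `ρ > 1`, so the constant depends on the geometry of the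
  -- quadrangles and not on the map. This matters for uniformity in the angle, as `ρ` may depend on
  -- it.
  have hd : p'.1 - p.1 ≤ (E.rCo (Q p') - E.rCo (Q p)) * M := by
    have : p'.1 - p.1 ≤ ρ * (p'.1 - p.1) := by nlinarith [h.one_lt]
    linarith
  have e3 : p.2 = S.hLeaf (S.sCo p) p.1 := h.source.eq_hLeaf_iff.2 rfl
  have e4 : p'.2 = S.hLeaf (S.sCo p) p'.1 := h.source.eq_hLeaf_iff.2 hs.symm
  have h6 := h.source.hLeaf_mono hs01.1.le hs01.2.le h1
  have h7 := h.source.hLeaf_lip hs01.1.le hs01.2.le h1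
  rw [← e3, ← e4] at h6 h7
  have hRM : 0 ≤ (E.rCo (Q p') - E.rCo (Q p)) * M := mul_nonneg (by linarith) hM.le
  rw [abs_of_nonpos (by linarith), Prod.dist_eq, Real.dist_eq, Real.dist_eq,
    abs_of_nonpos (by linarith), abs_of_nonpos (by linarith)]
  have h8 : γ * (p'.1 - p.1) ≤ γ * ((E.rCo (Q p') - E.rCo (Q p)) * M) := by gcongr
  have h9 := mul_nonneg hγ hRM
  refine max_le ?_ ?_ <;> linarith

/-- Motion of the image along a leaf of the target is controlled by the coordinate in the source. -/
lemma dist_map_le_of_rCo_eq (h : Crossing S E Q T γ M ρ B κ) (hκ : κ * κ = 1) {p p' : ℝ × ℝ}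
    (hp : p ∈ transitSet S E Q) (hp' : p' ∈ transitSet S E Q) (hR : E.rCo (Q p) = E.rCo (Q p')) :
    dist (Q p) (Q p') ≤ (1 + γ) * M * |S.sCo p - S.sCo p'| := by
  wlog hY : (Q p).2 ≤ (Q p').2 generalizing p p'
  · rw [dist_comm, abs_sub_comm]
    exact this hp' hp hR.symm (not_le.1 hY).le
  have hγ := h.source.gamma_nonneg
  have hM := h.source.M_pos
  have hR01 := (h.target.mem_region_iff.1 hp.2).2
  have e1 : (Q p).1 = E.vLeaf (E.rCo (Q p)) (Q p).2 := h.target.eq_vLeaf_iff.2 rfl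
  have e2 : (Q p').1 = E.vLeaf (E.rCo (Q p)) (Q p').2 := h.target.eq_vLeaf_iff.2 hR.symm
  have h1 := h.target.vLeaf_anti hR01.1.le hR01.2.le hY
  have h2 := h.target.vLeaf_lip hR01.1.le hR01.2.le hY
  rw [← e1, ← e2] at h1 h2
  have hd : (Q p').2 - (Q p).2 ≤ M * |S.sCo p - S.sCo p'| := by
    rcases hY.lt_or_eq with hlt | heq
    · obtain ⟨k1, k2⟩ := h.pull_back hκ hp hp' h1 hlt
      have k3 : (Q p').2 - (Q p).2 ≤ ρ * ((Q p').2 - (Q p).2) := by nlinarith [h.one_lt]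
      have key : ∀ z z' : ℝ × ℝ, z ∈ S.region → z' ∈ S.region → z'.1 ≤ z.1 → 0 ≤ z'.2 - z.2 →
          z'.2 - z.2 ≤ M * |S.sCo z - S.sCo z'| := by
        intro z z' hz hz' hzz hpos
        have hs := (h.source.mem_region_iff.1 hz').1
        have a1 : z.2 = S.hLeaf (S.sCo z) z.1 := h.source.eq_hLeaf_iff.2 rfl
        have a2 : z'.2 = S.hLeaf (S.sCo z') z'.1 := h.source.eq_hLeaf_iff.2 rfl
        have a3 := h.source.hLeaf_mono hs.1.le hs.2.le hzz
        rcases le_total (S.sCo z) (S.sCo z') with hc | hc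
        · have a4 := h.source.hLeaf_sub_le hc z.1
          rw [abs_of_nonpos (by linarith)]
          linarith
        · have a4 := (h.source.hLeaf_sub_le hc z.1)
          have a5 : S.hLeaf (S.sCo z') z.1 ≤ S.hLeaf (S.sCo z) z.1 := by
            rcases hc.lt_or_eq with h' | h'
            · exact (h.source.hLeaf_lt h' _).le
            · rw [h']
          have : 0 ≤ M * |S.sCo z - S.sCo z'| := by positivity
          linarith
      have hρ0 : 0 ≤ ρ * ((Q p').2 - (Q p).2) := by
        have := h.one_lt
        exact mul_nonneg (by linarith) (by linarith)
      rcases sign_cases hκ with rfl | rfl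
      · have := key p p' hp.1 hp'.1 (by linarith) (by linarith)
        linarith
      · have := key p' p hp'.1 hp.1 (by linarith) (by linarith)
        rw [abs_sub_comm] at this
        linarith
    · rw [heq, sub_self]; positivity
  have h8 : γ * ((Q p').2 - (Q p).2) ≤ γ * (M * |S.sCo p - S.sCo p'|) := by gcongr
  have h9 : 0 ≤ M * |S.sCo p - S.sCo p'| := by positivity
  have h10 := mul_nonneg hγ h9
  rw [Prod.dist_eq, Real.dist_eq, Real.dist_eq, abs_of_nonneg (by linarith),
    abs_of_nonpos (by linarith)]
  refine max_le ?_ ?_ <;> linarith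

lemma clamp_aux {ε s : ℝ} (hε : 0 < ε) (hε' : ε < 1 / 2) (hs : 0 < s ∧ s < 1) :
    max ε (min (1 - ε) s) ∈ Icc ε (1 - ε) ∧ |s - max ε (min (1 - ε) s)| ≤ ε := by
  refine ⟨⟨le_max_left _ _, max_le (by linarith) (min_le_left _ _)⟩, ?_⟩
  rw [abs_le]
  rcases le_total s (1 - ε) with h1 | h1
  · rw [min_eq_right h1]
    rcases le_total ε s with h2 | h2
    · rw [max_eq_right h2]; constructor <;> linarith
    · rw [max_eq_left h2]; constructor <;> linarith
  · rw [min_eq_left h1, max_eq_right (by linarith)]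
    constructor <;> linarith

/-- Every point of the transit set can be moved to one with interior coordinates, by a small step
in the source followed by a small step in the target. -/
lemma exists_interior (h : Crossing S E Q T γ M ρ B κ) (hκ : κ * κ = 1) {ε : ℝ} (hε : 0 < ε)
    (hε' : ε < 1 / 2) {p : ℝ × ℝ} (hp : p ∈ transitSet S E Q) :
    ∃ p₁ ∈ transitSet S E Q, ∃ p₂ ∈ transitSet S E Q, dist p p₁ ≤ (1 + γ) * M * ε ∧
      dist (Q p₁) (Q p₂) ≤ (1 + γ) * M * ε ∧ S.sCo p₂ ∈ Icc ε (1 - ε) ∧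
      E.rCo (Q p₂) ∈ Icc ε (1 - ε) := by
  have hC : 0 ≤ (1 + γ) * M := by
    have := h.source.gamma_nonneg
    have := h.source.M_pos
    positivity
  have hs := (h.source.mem_region_iff.1 hp.1).1
  have hR := (h.target.mem_region_iff.1 hp.2).2
  obtain ⟨s1, s2⟩ := clamp_aux hε hε' hs
  obtain ⟨r1, r2⟩ := clamp_aux hε hε' hR
  have hsub : ∀ {x : ℝ}, x ∈ Icc ε (1 - ε) → x ∈ Ioo (0 : ℝ) 1 :=
    fun hx => ⟨hε.trans_le hx.1, hx.2.trans_lt (by linarith)⟩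
  -- First only the coordinate in the target is corrected, then only that in the source; each change
  -- is controlled by one of the two preceding estimates.
  obtain ⟨p₁, hp₁, a1, a2⟩ := h.exists_coords ⟨p, hp⟩ hs (hsub r1)
  obtain ⟨p₂, hp₂, b1, b2⟩ := h.exists_coords ⟨p, hp⟩ (hsub s1) (hsub r1)
  refine ⟨p₁, hp₁, p₂, hp₂, ?_, ?_, by rw [b1]; exact s1, by rw [b2]; exact r1⟩
  · refine (h.dist_le_of_sCo_eq hp hp₁ a1.symm).trans ?_
    rw [a2]
    gcongr
  · refine (h.dist_map_le_of_rCo_eq hκ hp₁ hp₂ (by rw [a2, b2])).trans ?_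
    rw [a1, b1]
    gcongr

/-- The transit set meets every horizontal strip. -/
lemma exists_mem_between (h : Crossing S E Q T γ M ρ B κ) (hne : (transitSet S E Q).Nonempty)
    {φ ψ : ℝ → ℝ} (hφ : Continuous φ) (hψ : Continuous ψ) (hlt : ∀ u, φ u < ψ u)
    (h₀ : ∀ p ∈ S.closedRegion, p.2 = S.am p.1 → p.2 ≤ φ p.1)
    (h₁ : ∀ p ∈ S.closedRegion, p.2 = S.ap p.1 → ψ p.1 ≤ p.2) :
    ∃ p ∈ transitSet S E Q, φ p.1 < p.2 ∧ p.2 < ψ p.1 := by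
  have hex : ∀ s ∈ Ioo (0 : ℝ) 1, ∃ p ∈ transitSet S E Q, S.sCo p = s := fun s hs => by
    obtain ⟨p, hp, e, -⟩ := h.exists_coords hne hs Sweep.half_mem.1
    exact ⟨p, hp, e⟩
  have hne' : (closure (transitSet S E Q)).Nonempty := hne.closure
  -- All labels in `(0, 1)` occur in the transit set, so the extreme labels on its compact closure
  -- are 0 and 1: the closure touches the lower and the upper side of the source.
  obtain ⟨p₀, hp₀, hmin⟩ := h.isCompact_closure.exists_isMinOn hne' h.source.continuous_sCo.continuousOn
  obtain ⟨p₁, hp₁, hmax⟩ := h.isCompact_closure.exists_isMaxOn hne' h.source.continuous_sCo.continuousOn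
  have c0 := (h.source.mem_closedRegion_iff.1 (h.closure_subset hp₀)).1
  have c1 := (h.source.mem_closedRegion_iff.1 (h.closure_subset hp₁)).1
  have e0 : S.sCo p₀ = 0 := by
    refine le_antisymm ?_ c0.1
    by_contra hcon
    rw [not_le] at hcon
    obtain ⟨p, hp, e⟩ := hex (S.sCo p₀ / 2) ⟨by linarith, by linarith⟩
    have := hmin (subset_closure hp)
    rw [mem_ofPred_eq, e] at this
    linarith
  have e1 : S.sCo p₁ = 1 := by
    refine le_antisymm c1.2 ?_
    by_contra hcon
    rw [not_le] at hcon
    obtain ⟨p, hp, e⟩ := hex ((1 + S.sCo p₁) / 2) ⟨by linarith, by linarith⟩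
    have := hmax (subset_closure hp)
    rw [mem_ofPred_eq, e] at this
    linarith
  have b0 := h₀ p₀ (h.closure_subset hp₀) (by
    rw [← Quad.IsGood.hLeaf_zero (K := S)]; exact h.source.eq_hLeaf_iff.2 e0)
  have b1 := h₁ p₁ (h.closure_subset hp₁) (by
    rw [← Quad.IsGood.hLeaf_one (K := S)]; exact h.source.eq_hLeaf_iff.2 e1)
  have o1 : IsOpen {p : ℝ × ℝ | φ p.1 < p.2} := isOpen_lt (hφ.comp continuous_fst) continuous_snd
  have o2 : IsOpen {p : ℝ × ℝ | p.2 < ψ p.1} := isOpen_lt continuous_snd (hψ.comp continuous_fst)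
  -- The points above `φ` and those below `ψ` form an open cover of a connected set with both
  -- members nonempty, so they overlap.
  obtain ⟨p, hp, k⟩ := h.isPreconnected_transitSet.closure _ _ o1 o2
    (fun p _ => by
      rcases lt_or_ge (φ p.1) p.2 with hc | hc
      · exact Or.inl hc
      · exact Or.inr (hc.trans_lt (hlt _)))
    ⟨p₁, hp₁, (hlt _).trans_le b1⟩ ⟨p₀, hp₀, b0.trans_lt (hlt _)⟩
  obtain ⟨p', h1, h2⟩ := mem_closure_iff.1 hp _ (o1.inter o2) k
  exact ⟨p', h2, h1⟩

end Crossing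

end StripMap
end

/-! ### Upper semicontinuity of the transit sets in the parameter. -/

noncomputable section

namespace StripMap

/-- A family of maps `Q δ`, with inverses `T δ`, between quadrangles `S δ` and `E δ` that deform
continuously. The maps are defined on the slices of the open sets `U` and `W`; these do not meet
the left and right sides of `S δ`, respectively the lower and upper sides of `E δ`. Points of the
transit set can be moved to interior coordinates by small steps. -/
structure CrossingFamily (S E : ℝ → Quad) (Q T : ℝ → ℝ × ℝ → ℝ × ℝ) (U W : Set (ℝ × ℝ × ℝ))
    (γ M C : ℝ) : Prop where
  source : ∀ δ, (S δ).IsGood γ M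
  target : ∀ δ, (E δ).IsGood γ M
  sCo_source : Continuous fun z : ℝ × ℝ × ℝ => (S z.1).sCo z.2
  rCo_source : Continuous fun z : ℝ × ℝ × ℝ => (S z.1).rCo z.2
  sCo_target : Continuous fun z : ℝ × ℝ × ℝ => (E z.1).sCo z.2
  rCo_target : Continuous fun z : ℝ × ℝ × ℝ => (E z.1).rCo z.2
  isOpen_dom : IsOpen U
  isOpen_codom : IsOpen W
  continuousAt_map : ∀ z ∈ U, ContinuousAt (fun z : ℝ × ℝ × ℝ => Q z.1 z.2) z
  continuousAt_inv : ∀ z ∈ W, ContinuousAt (fun z : ℝ × ℝ × ℝ => T z.1 z.2) z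
  map_mem : ∀ δ p, (δ, p) ∈ U → (δ, Q δ p) ∈ W
  leftInv : ∀ δ p, (δ, p) ∈ U → T δ (Q δ p) = p
  region_subset : ∀ δ, ∀ p ∈ (S δ).region, (δ, p) ∈ U
  rCo_mem : ∀ δ, ∀ p ∈ (S δ).closedRegion, (δ, p) ∈ U → (S δ).rCo p ∈ Ioo (0 : ℝ) 1
  sCo_mem : ∀ δ, ∀ q ∈ (E δ).closedRegion, (δ, q) ∈ W → (E δ).sCo q ∈ Ioo (0 : ℝ) 1
  nonempty : ∀ δ, (transitSet (S δ) (E δ) (Q δ)).Nonempty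
  closure_subset : ∀ δ, ∀ p ∈ closure (transitSet (S δ) (E δ) (Q δ)), (δ, p) ∈ U
  connected : ∀ δ, IsPreconnected (transitSet (S δ) (E δ) (Q δ))
  move : ∀ δ ε, 0 < ε → ε < 1 / 2 → ∀ p ∈ transitSet (S δ) (E δ) (Q δ),
    ∃ p₁ ∈ transitSet (S δ) (E δ) (Q δ), ∃ p₂ ∈ transitSet (S δ) (E δ) (Q δ),
      dist p p₁ ≤ C * ε ∧ dist (Q δ p₁) (Q δ p₂) ≤ C * ε ∧ (S δ).sCo p₂ ∈ Icc ε (1 - ε) ∧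
      (E δ).rCo (Q δ p₂) ∈ Icc ε (1 - ε)

namespace CrossingFamily

variable {S E : ℝ → Quad} {Q T : ℝ → ℝ × ℝ → ℝ × ℝ} {U W : Set (ℝ × ℝ × ℝ)} {γ M C δ₀ : ℝ}

/-- Limits of points of the transit sets belong to the closure of the limiting transit set. -/
lemma mem_closure_of_tendsto (h : CrossingFamily S E Q T U W γ M C) {δ : ℕ → ℝ}
    (hδ : Tendsto δ atTop (𝓝 δ₀)) {r : ℕ → ℝ × ℝ} {r₀ : ℝ × ℝ} (hr : Tendsto r atTop (𝓝 r₀))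
    (hrV : ∀ n, r n ∈ transitSet (S (δ n)) (E (δ n)) (Q (δ n))) (hr₀ : (δ₀, r₀) ∈ U) :
    r₀ ∈ closure (transitSet (S δ₀) (E δ₀) (Q δ₀)) := by
  rw [Metric.mem_closure_iff]
  -- In the limit strict inequalities may degenerate, and such a point need not be approximated by
  -- the limiting transit set. Therefore the points are first moved to coordinates with a margin
  -- `ε`; their limit keeps the margin and lies in the limiting transit set, within `η` of `r₀`.
  intro η' hη'
  have hUo : IsOpen {p : ℝ × ℝ | (δ₀, p) ∈ U} := h.isOpen_dom.preimage (by fun_prop)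
  obtain ⟨η₁, hη₁, hη₁U⟩ := Metric.isOpen_iff.1 hUo r₀ hr₀
  obtain ⟨η, hη, hηlt⟩ := exists_between (lt_min hη' hη₁)
  have hηη' : η < η' := hηlt.trans_le (min_le_left _ _)
  have hηU : ∀ p, dist p r₀ ≤ η → (δ₀, p) ∈ U := fun p hp =>
    hη₁U (hp.trans_lt (hηlt.trans_le (min_le_right _ _)))
  set q₀ := Q δ₀ r₀ with hq₀
  have hq₀W : (δ₀, q₀) ∈ W := h.map_mem _ _ hr₀
  -- The second step of the motion is small only after applying `Q`; joint continuity of the inverse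
  -- turns this into closeness in the source.
  obtain ⟨η₂, hη₂, hT⟩ : ∃ η₂ > 0, ∀ δ' q, dist δ' δ₀ < η₂ → dist q q₀ < η₂ →
      dist (T δ' q) r₀ < η ∧ (δ₀, q) ∈ W := by
    have hWo : IsOpen {p : ℝ × ℝ | (δ₀, p) ∈ W} := h.isOpen_codom.preimage (by fun_prop)
    obtain ⟨a, ha, ha'⟩ := Metric.isOpen_iff.1 hWo q₀ hq₀W
    obtain ⟨b, hb, hb'⟩ := Metric.continuousAt_iff.1 (h.continuousAt_inv _ hq₀W) η hη
    refine ⟨min a b, lt_min ha hb, fun δ' q h1 h2 => ⟨?_, ha' (h2.trans_le (min_le_left _ _))⟩⟩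
    have := hb' (x := (δ', q)) (max_lt (h1.trans_le (min_le_right _ _))
      (h2.trans_le (min_le_right _ _)))
    rwa [h.leftInv _ _ hr₀] at this
  obtain ⟨η₃, hη₃, hQ⟩ : ∃ η₃ > 0, ∀ δ' p, dist δ' δ₀ < η₃ → dist p r₀ < η₃ →
      dist (Q δ' p) q₀ < η₂ / 4 := by
    obtain ⟨b, hb, hb'⟩ := Metric.continuousAt_iff.1 (h.continuousAt_map _ hr₀) (η₂ / 4)
      (by positivity)
    exact ⟨b, hb, fun δ' p h1 h2 => hb' (x := (δ', p)) (max_lt h1 h2)⟩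
  obtain ⟨ε, hε, hε2, hCε, hCε'⟩ : ∃ ε, 0 < ε ∧ ε < 1 / 2 ∧ C * ε < η₃ / 2 ∧ C * ε < η₂ / 4 := by
    have h1 : Tendsto (fun ε => C * ε) (𝓝[>] (0 : ℝ)) (𝓝 0) := by
      have : Tendsto (fun ε => C * ε) (𝓝 (0 : ℝ)) (𝓝 (C * 0)) :=
        (continuous_const.mul continuous_id).tendsto 0
      rw [mul_zero] at this
      exact this.mono_left nhdsWithin_le_nhds
    obtain ⟨ε, ⟨h2, h3⟩, h4⟩ := (((h1.eventually_lt_const (show 0 < η₃ / 2 by positivity)).and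
      (h1.eventually_lt_const (show 0 < η₂ / 4 by positivity))).and
      (Ioo_mem_nhdsGT (show (0 : ℝ) < 1 / 2 by norm_num))).exists
    exact ⟨ε, h4.1, h4.2, h2, h3⟩
  choose p₁ hp₁ p₂ hp₂ d₁ d₂ hs hR using fun n => h.move (δ n) ε hε hε2 (r n) (hrV n)
  have hev : ∀ᶠ n in atTop, dist (Q (δ n) (p₂ n)) q₀ ≤ η₂ / 2 ∧ dist (p₂ n) r₀ ≤ η := by
    have e1 := (Metric.tendsto_nhds.1 hδ) (min η₂ η₃) (lt_min hη₂ hη₃)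
    have e2 := (Metric.tendsto_nhds.1 hr) (η₃ / 2) (by positivity)
    filter_upwards [e1, e2] with n h1 h2
    have k1 : dist (p₁ n) r₀ < η₃ := by
      have := dist_triangle_left (p₁ n) r₀ (r n)
      have := d₁ n
      linarith
    have k2 := hQ _ _ (h1.trans_le (min_le_right _ _)) k1
    have k3 : dist (Q (δ n) (p₂ n)) q₀ ≤ η₂ / 2 := by
      have := dist_triangle_left (Q (δ n) (p₂ n)) q₀ (Q (δ n) (p₁ n))
      have := d₂ n
      linarith
    refine ⟨k3, ?_⟩
    have := (hT _ _ (h1.trans_le (min_le_left _ _)) (k3.trans_lt (by linarith))).1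
    rw [h.leftInv _ _ (h.region_subset _ _ (hp₂ n).1)] at this
    exact this.le
  obtain ⟨p', hp'b, φ, hφ, hφt⟩ := (isCompact_closedBall r₀ η).tendsto_subseq'
    (hev.mono fun n hn => Metric.mem_closedBall.2 hn.2).frequently
  have hp'U : (δ₀, p') ∈ U := hηU p' (Metric.mem_closedBall.1 hp'b)
  have hδφ : Tendsto (δ ∘ φ) atTop (𝓝 δ₀) := hδ.comp hφ.tendsto_atTop
  have hpair : Tendsto (fun n => ((δ ∘ φ) n, (p₂ ∘ φ) n)) atTop (𝓝 (δ₀, p')) :=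
    hδφ.prodMk_nhds hφt
  have hQt : Tendsto (fun n => Q (δ (φ n)) (p₂ (φ n))) atTop (𝓝 (Q δ₀ p')) :=
    (h.continuousAt_map _ hp'U).tendsto.comp hpair
  have hpairQ : Tendsto (fun n => (δ (φ n), Q (δ (φ n)) (p₂ (φ n)))) atTop (𝓝 (δ₀, Q δ₀ p')) :=
    hδφ.prodMk_nhds hQt
  have hq'W : (δ₀, Q δ₀ p') ∈ W := h.map_mem _ _ hp'U
  have t1 := (h.sCo_source.tendsto (δ₀, p')).comp hpair
  have t2 := (h.rCo_source.tendsto (δ₀, p')).comp hpair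
  have t3 := (h.sCo_target.tendsto (δ₀, Q δ₀ p')).comp hpairQ
  have t4 := (h.rCo_target.tendsto (δ₀, Q δ₀ p')).comp hpairQ
  have m1 : (S δ₀).sCo p' ∈ Icc ε (1 - ε) :=
    isClosed_Icc.mem_of_tendsto t1 (Eventually.of_forall fun n => hs (φ n))
  have m2 : (S δ₀).rCo p' ∈ Icc (0 : ℝ) 1 := isClosed_Icc.mem_of_tendsto t2
    (Eventually.of_forall fun n => by
      have := ((h.source _).mem_region_iff.1 (hp₂ (φ n)).1).2
      exact ⟨this.1.le, this.2.le⟩)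
  have m3 : (E δ₀).sCo (Q δ₀ p') ∈ Icc (0 : ℝ) 1 := isClosed_Icc.mem_of_tendsto t3
    (Eventually.of_forall fun n => by
      have := ((h.target _).mem_region_iff.1 (hp₂ (φ n)).2).1
      exact ⟨this.1.le, this.2.le⟩)
  have m4 : (E δ₀).rCo (Q δ₀ p') ∈ Icc ε (1 - ε) :=
    isClosed_Icc.mem_of_tendsto t4 (Eventually.of_forall fun n => hR (φ n))
  have c1 : p' ∈ (S δ₀).closedRegion :=
    (h.source _).mem_closedRegion_iff.2 ⟨⟨by linarith [m1.1], by linarith [m1.2]⟩, m2⟩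
  have c2 : Q δ₀ p' ∈ (E δ₀).closedRegion :=
    (h.target _).mem_closedRegion_iff.2 ⟨m3, by linarith [m4.1], by linarith [m4.2]⟩
  refine ⟨p', ⟨(h.source _).mem_region_iff.2 ⟨⟨by linarith [m1.1], by linarith [m1.2]⟩,
    h.rCo_mem _ _ c1 hp'U⟩, (h.target _).mem_region_iff.2 ⟨h.sCo_mem _ _ c2 hq'W,
      by linarith [m4.1], by linarith [m4.2]⟩⟩, ?_⟩
  rw [dist_comm]
  exact (Metric.mem_closedBall.1 hp'b).trans_lt hηη'

/-- The transit sets depend upper semicontinuously on the parameter. -/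
theorem eventually_closure_subset (h : CrossingFamily S E Q T U W γ M C) {A : Set (ℝ × ℝ)}
    (hA : IsOpen A) (hKA : closure (transitSet (S δ₀) (E δ₀) (Q δ₀)) ⊆ A) :
    ∀ᶠ δ in 𝓝 δ₀, closure (transitSet (S δ) (E δ) (Q δ)) ⊆ A := by
  set V := fun δ => transitSet (S δ) (E δ) (Q δ) with hV
  set K := closure (V δ₀) with hK
  have hKc : IsCompact K := (h.source δ₀).isCompact_closedRegion.of_isClosed_subset isClosed_closure
    ((closure_mono fun _ hp => hp.1).trans (h.source δ₀).closure_region_subset)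
  -- The neighbourhood of `K` is also taken inside the domain of the map, since limits are
  -- controlled only there.
  have hUo : IsOpen {p : ℝ × ℝ | (δ₀, p) ∈ U} := h.isOpen_dom.preimage (by fun_prop)
  obtain ⟨r, hr, hrA⟩ := hKc.exists_cthickening_subset_open (hA.inter hUo)
    (subset_inter hKA fun p hp => h.closure_subset δ₀ p hp)
  have hKne : K.Nonempty := (h.nonempty δ₀).closure
  have hcth : ∀ p, Metric.infDist p K ≤ r → p ∈ Metric.cthickening r K := fun p hp => by
    rw [Metric.cthickening_eq_preimage_infEDist, mem_preimage, mem_Iic,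
      ← ENNReal.ofReal_toReal (Metric.infEDist_ne_top hKne)]
    exact ENNReal.ofReal_le_ofReal hp
  have hmeet : ∀ᶠ δ in 𝓝 δ₀, ∃ p ∈ V δ, Metric.infDist p K < r := by
    obtain ⟨p, hp⟩ := h.nonempty δ₀
    have hpU := h.region_subset _ _ hp.1
    have c1 : ContinuousAt (fun δ => (δ, p)) δ₀ := by fun_prop
    have c2 : ContinuousAt (fun δ => Q δ p) δ₀ :=
      ContinuousAt.comp (f := fun δ => (δ, p)) (h.continuousAt_map (δ₀, p) hpU) c1
    have c3 : ContinuousAt (fun δ => (δ, Q δ p)) δ₀ := continuousAt_id.prodMk c2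
    have s1 := (h.source _).mem_region_iff.1 hp.1
    have s2 := (h.target _).mem_region_iff.1 hp.2
    have t1 := h.sCo_source.continuousAt.comp (f := fun δ => (δ, p)) c1
    have t2 := h.rCo_source.continuousAt.comp (f := fun δ => (δ, p)) c1
    have t3 := ContinuousAt.comp (f := fun δ => (δ, Q δ p)) h.sCo_target.continuousAt c3
    have t4 := ContinuousAt.comp (f := fun δ => (δ, Q δ p)) h.rCo_target.continuousAt c3
    filter_upwards [t1.eventually (Ioo_mem_nhds s1.1.1 s1.1.2),
      t2.eventually (Ioo_mem_nhds s1.2.1 s1.2.2), t3.eventually (Ioo_mem_nhds s2.1.1 s2.1.2),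
      t4.eventually (Ioo_mem_nhds s2.2.1 s2.2.2)] with δ k1 k2 k3 k4
    refine ⟨p, ⟨(h.source _).mem_region_iff.2 ⟨k1, k2⟩, (h.target _).mem_region_iff.2 ⟨k3, k4⟩⟩, ?_⟩
    rw [Metric.infDist_zero_of_mem (subset_closure hp)]
    exact hr
  have hmain : ∀ᶠ δ in 𝓝 δ₀, ∀ p ∈ V δ, Metric.infDist p K < r := by
    by_contra hcon
    rw [not_eventually] at hcon
    -- Each nearby transit set meets the `r`-neighbourhood of `K` and is connected. If it left the
    -- neighbourhood it would contain a point at distance exactly `r`; a limit of such points would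
    -- lie in `K` and yet have distance `r` from it.
    have hfreq : ∃ᶠ δ in 𝓝 δ₀, ∃ p ∈ V δ, Metric.infDist p K = r := by
      refine (hcon.and_eventually hmeet).mono fun δ hδ => ?_
      obtain ⟨h1, p, hp, hlt⟩ := hδ
      push Not at h1
      obtain ⟨p', hp', hge⟩ := h1
      obtain ⟨z, hz, e⟩ := (h.connected δ).intermediate_value hp hp'
        (Metric.continuous_infDist_pt K).continuousOn ⟨hlt.le, hge⟩
      exact ⟨z, hz, e⟩
    obtain ⟨δ, hδ, hex⟩ := exists_seq_forall_of_frequently hfreq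
    choose p hp e using hex
    obtain ⟨p₀, hp₀, φ, hφ, hφt⟩ := (hKc.cthickening (r := r)).tendsto_subseq
      (fun n => hcth (p n) (e n).le)
    have hd : Metric.infDist p₀ K = r := by
      have t := ((Metric.continuous_infDist_pt K).tendsto p₀).comp hφt
      refine tendsto_nhds_unique t ?_
      simp only [Function.comp_def, e]
      exact tendsto_const_nhds
    have hmem : p₀ ∈ K := h.mem_closure_of_tendsto (hδ.comp hφ.tendsto_atTop) hφt
      (fun n => hp (φ n)) (hrA hp₀).2
    rw [Metric.infDist_zero_of_mem hmem] at hd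
    exact hr.ne hd
  filter_upwards [hmain] with δ hδ p hp
  refine (hrA (hcth p ?_)).1
  exact closure_minimal (t := {p | Metric.infDist p K ≤ r}) (fun p hp => (hδ p hp).le)
    (isClosed_le (Metric.continuous_infDist_pt K) continuous_const) hp

end CrossingFamily

end StripMap
end

noncomputable section

namespace StripMap

/-! ### The Poincaré map and its inverse as time maps -/

/-- A function that solves the equation for `g`, read backwards from the time `c`. -/
lemma SolOn.reflect {g g' : ℝ → ℝ → ℝ → ℝ} {δ δ' c : ℝ} {u w : ℝ → ℝ} {s s' : Set ℝ}
    (h : SolOn g δ u w s) (hg : ∀ t v, g' t δ' v = g (c - t) δ v)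
    (hs : ∀ t ∈ s', c - t ∈ s) :
    SolOn g' δ' (fun t => u (c - t)) (fun t => -w (c - t)) s' := by
  intro t ht
  have hd : HasDerivWithinAt (fun t => c - t) (-1) s' t := by
    simpa using (hasDerivWithinAt_id t s').const_sub c
  obtain ⟨h1, h2⟩ := h _ (hs t ht)
  constructor
  · have := HasDerivWithinAt.comp t h1 hd hs
    rw [mul_neg, mul_one] at this
    exact this
  · have := (HasDerivWithinAt.comp t h2 hd hs).neg
    rw [mul_neg, mul_one, neg_neg] at this
    rw [hg]
    exact this

/-- A collapsing solution does not exist up to the time of collapse. -/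
lemma not_mem_flowDomain_of_collapse {g : ℝ → ℝ → ℝ → ℝ}
    (hg : ContDiff ℝ 1 (fun z : ℝ × ℝ × ℝ => g z.1 z.2.1 z.2.2)) {T δ : ℝ} (hT : 0 < T)
    {u w : ℝ → ℝ} (h : SolOn g δ u w (Ico 0 T))
    (hcol : Tendsto (fun x => |u x|) (𝓝[<] T) atTop) : (δ, u 0, w 0) ∉ flowDomain g T := by
  rintro ⟨q, u', w', h', h0, -⟩
  obtain ⟨R, -, -, hR⟩ := h'.exists_bound
  obtain ⟨t, ht, ht'⟩ := ((hcol.eventually_gt_atTop R).and (Ioo_mem_nhdsLT hT)).exists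
  have := SolOn.unique hg (h'.mono (Icc_subset_Icc_right ht'.2.le))
    (h.mono (fun x hx => ⟨hx.1, hx.2.trans_lt ht'.2⟩)) h0 t ⟨ht'.1.le, le_rfl⟩
  have h2 := (hR t ⟨ht'.1.le, ht'.2.le⟩).1
  have h3 : u' t = u t := congrArg Prod.fst this
  rw [h3] at h2
  exact absurd ht (not_lt.2 h2)

/-- The right-hand side along the line `Y = θ x + δ`. -/
def fwd (F : ℝ → ℝ → ℝ → ℝ) (θ x δ u : ℝ) : ℝ := F x (θ * x + δ) u

/-- The right-hand side for reversed time. -/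
def bwd (F : ℝ → ℝ → ℝ → ℝ) (θ t δ u : ℝ) : ℝ := F (-t) (-(θ * t) + δ) u

/-- Reversal of the velocity. -/
def conj (p : ℝ × ℝ) : ℝ × ℝ := (p.1, -p.2)

@[simp] lemma conj_conj (p : ℝ × ℝ) : conj (conj p) = p := by simp [conj]

lemma continuous_conj : Continuous conj := continuous_fst.prodMk continuous_snd.neg

/-- The Poincaré map over the representative `δ` of an angle. -/
def fwdMap (F : ℝ → ℝ → ℝ → ℝ) (θ δ : ℝ) : ℝ × ℝ → ℝ × ℝ := timeMap (fwd F θ) (2 * Real.pi) δ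

/-- The inverse of `fwdMap F θ δ`. -/
def bwdMap (F : ℝ → ℝ → ℝ → ℝ) (θ δ : ℝ) (q : ℝ × ℝ) : ℝ × ℝ :=
  conj (timeMap (bwd F θ) (2 * Real.pi) (δ + 2 * θ * Real.pi) (conj q))

/-- The domain of `fwdMap`. -/
def fwdDom (F : ℝ → ℝ → ℝ → ℝ) (θ : ℝ) : Set (ℝ × ℝ × ℝ) := flowDomain (fwd F θ) (2 * Real.pi)

/-- The domain of `bwdMap`. -/
def bwdDom (F : ℝ → ℝ → ℝ → ℝ) (θ : ℝ) : Set (ℝ × ℝ × ℝ) :=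
  {z | (z.1 + 2 * θ * Real.pi, conj z.2) ∈ flowDomain (bwd F θ) (2 * Real.pi)}

namespace IsAdmissible

variable {F : ℝ → ℝ → ℝ → ℝ} {θ : ℝ}

lemma contDiff_fwd (h : IsAdmissible F) (θ : ℝ) :
    ContDiff ℝ 1 (fun z : ℝ × ℝ × ℝ => fwd F θ z.1 z.2.1 z.2.2) :=
  h.contDiff.comp (by fun_prop : ContDiff ℝ 1 fun z : ℝ × ℝ × ℝ => (z.1, θ * z.1 + z.2.1, z.2.2))

lemma contDiff_bwd (h : IsAdmissible F) (θ : ℝ) :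
    ContDiff ℝ 1 (fun z : ℝ × ℝ × ℝ => bwd F θ z.1 z.2.1 z.2.2) :=
  h.contDiff.comp
    (by fun_prop : ContDiff ℝ 1 fun z : ℝ × ℝ × ℝ => (-z.1, -(θ * z.1) + z.2.1, z.2.2))

lemma add_eq_of_coe_eq (h : IsAdmissible F) {δ δ' : ℝ} (e : (δ : Real.Angle) = δ') (X Y u : ℝ) :
    F X (Y + δ) u = F X (Y + δ') u := by
  obtain ⟨k, hk⟩ := Real.Angle.angle_eq_iff_two_pi_dvd_sub.1 e
  have hp : Function.Periodic (fun Y => F X Y u) (2 * Real.pi) := fun Y => h.periodic_snd X Y u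
  have := hp.int_mul k (Y + δ')
  rw [← this]
  congr 1
  linear_combination hk

lemma solOn_iff (h : IsAdmissible F) {δ : ℝ} {Δ : Real.Angle} (e : (δ : Real.Angle) = Δ)
    {u w : ℝ → ℝ} {s : Set ℝ} : SolOn (fwd F θ) δ u w s ↔ IsSolutionOn F θ Δ u w s := by
  have : ∀ x, F x (θ * x + δ) (u x) = F x (θ * x + Δ.toReal) (u x) := fun x =>
    h.add_eq_of_coe_eq (by rw [e, Real.Angle.coe_toReal]) _ _ _
  simp only [SolOn, IsSolutionOn, fwd, this]

lemma reaches_iff (h : IsAdmissible F) {δ : ℝ} {Δ : Real.Angle} (e : (δ : Real.Angle) = Δ)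
    {p q : ℝ × ℝ} : Reaches (fwd F θ) (2 * Real.pi) δ p q ↔ FlowsTo F θ Δ p q := by
  simp only [Reaches, FlowsTo, h.solOn_iff e]

lemma fwdMap_eq (h : IsAdmissible F) {δ : ℝ} {Δ : Real.Angle} (e : (δ : Real.Angle) = Δ) :
    fwdMap F θ δ = poincare F θ Δ := by
  funext p
  simp only [fwdMap, timeMap, poincare, h.reaches_iff e]

lemma mem_fwdDom_iff (h : IsAdmissible F) {δ : ℝ} {Δ : Real.Angle} (e : (δ : Real.Angle) = Δ)
    {p : ℝ × ℝ} : (δ, p) ∈ fwdDom F θ ↔ p ∈ forwardDomain F θ Δ := by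
  simp only [fwdDom, flowDomain, mem_ofPred_eq, forwardDomain, h.reaches_iff e]

/-- The second arguments agree because `-θ t + δ + 2 θ π = θ (2 π - t) + δ`, and the first ones
differ by the period `2π`. Thus the inverse over `δ` is the reversed flow over the shifted angle. -/
lemma bwd_eq (h : IsAdmissible F) (δ t v : ℝ) :
    bwd F θ t (δ + 2 * θ * Real.pi) v = fwd F θ (2 * Real.pi - t) δ v := by
  have := h.periodic_fst (-t) (-(θ * t) + (δ + 2 * θ * Real.pi)) v
  rw [bwd, fwd, ← this]
  congr 1 <;> ring

/-- The solution read backwards, with reversed velocity, starts from the reflected image of `p` and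
ends at the reflection of `p`. -/
lemma map_mem (h : IsAdmissible F) {δ : ℝ} {p : ℝ × ℝ} (hp : (δ, p) ∈ fwdDom F θ) :
    (δ, fwdMap F θ δ p) ∈ bwdDom F θ ∧ bwdMap F θ δ (fwdMap F θ δ p) = p := by
  obtain ⟨u, w, hs, h0, h1⟩ := reaches_timeMap hp
  have hr := hs.reflect (g' := bwd F θ) (δ' := δ + 2 * θ * Real.pi) (s' := Icc 0 (2 * Real.pi))
    (fun t v => h.bwd_eq δ t v) (fun t ht => ⟨by linarith [ht.2], by linarith [ht.1]⟩)
  have e1 : conj (fwdMap F θ δ p) = (u (2 * Real.pi), -w (2 * Real.pi)) := by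
    rw [fwdMap, ← h1]; rfl
  have hm := hr.mem_flowDomain
  have ht := hr.timeMap_eq (h.contDiff_bwd θ) Real.two_pi_pos.le
  simp only [sub_zero, sub_self] at hm ht
  rw [← e1] at hm ht
  refine ⟨hm, ?_⟩
  rw [bwdMap, ht, ← h0]
  simp [conj]

lemma inv_mem (h : IsAdmissible F) {δ : ℝ} {q : ℝ × ℝ} (hq : (δ, q) ∈ bwdDom F θ) :
    (δ, bwdMap F θ δ q) ∈ fwdDom F θ ∧ fwdMap F θ δ (bwdMap F θ δ q) = q := by
  obtain ⟨u, w, hs, h0, h1⟩ := reaches_timeMap hq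
  have hr := hs.reflect (g' := fwd F θ) (δ' := δ) (s' := Icc 0 (2 * Real.pi)) (c := 2 * Real.pi)
    (fun t v => by rw [h.bwd_eq, sub_sub_cancel])
    (fun t ht => ⟨by linarith [ht.2], by linarith [ht.1]⟩)
  have e1 : bwdMap F θ δ q = (u (2 * Real.pi), -w (2 * Real.pi)) := by
    rw [bwdMap, ← h1]; rfl
  have hm := hr.mem_flowDomain
  have ht := hr.timeMap_eq (h.contDiff_fwd θ) Real.two_pi_pos.le
  simp only [sub_zero, sub_self] at hm ht
  rw [← e1] at hm ht
  refine ⟨hm, ?_⟩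
  rw [fwdMap, ht]
  simp only at h0
  have := congrArg conj h0
  rwa [conj_conj] at this

lemma isOpen_fwdDom (h : IsAdmissible F) (θ : ℝ) : IsOpen (fwdDom F θ) :=
  isOpen_flowDomain (h.contDiff_fwd θ) Real.two_pi_pos.le

lemma continuous_shift_conj (θ : ℝ) :
    Continuous fun z : ℝ × ℝ × ℝ => (z.1 + 2 * θ * Real.pi, conj z.2) :=
  (by fun_prop : Continuous fun z : ℝ × ℝ × ℝ => z.1 + 2 * θ * Real.pi).prodMk
    (continuous_conj.comp continuous_snd)

lemma isOpen_bwdDom (h : IsAdmissible F) (θ : ℝ) : IsOpen (bwdDom F θ) :=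
  (isOpen_flowDomain (h.contDiff_bwd θ) Real.two_pi_pos.le).preimage (continuous_shift_conj θ)

lemma continuousAt_fwdMap (h : IsAdmissible F) {z : ℝ × ℝ × ℝ} (hz : z ∈ fwdDom F θ) :
    ContinuousAt (fun z : ℝ × ℝ × ℝ => fwdMap F θ z.1 z.2) z :=
  continuousAt_timeMap (h.contDiff_fwd θ) Real.two_pi_pos.le hz

lemma continuousAt_bwdMap (h : IsAdmissible F) {z : ℝ × ℝ × ℝ} (hz : z ∈ bwdDom F θ) :
    ContinuousAt (fun z : ℝ × ℝ × ℝ => bwdMap F θ z.1 z.2) z := by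
  have h1 := continuousAt_timeMap (h.contDiff_bwd θ) Real.two_pi_pos.le hz
  exact continuous_conj.continuousAt.comp
    (ContinuousAt.comp (f := fun z : ℝ × ℝ × ℝ => (z.1 + 2 * θ * Real.pi, conj z.2)) h1
      (continuous_shift_conj θ).continuousAt)

lemma not_mem_fwdDom (h : IsAdmissible F) {δ : ℝ} {Δ : Real.Angle} (e : (δ : Real.Angle) = Δ)
    {p : ℝ × ℝ} (hp : CollapsesForward F θ Δ p) : (δ, p) ∉ fwdDom F θ := by
  obtain ⟨u, w, hs, rfl, hc⟩ := hp
  exact not_mem_flowDomain_of_collapse (h.contDiff_fwd θ) Real.two_pi_pos ((h.solOn_iff e).2 hs) hc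

/-- A backward collapse is a collapse of the reversed equation. -/
lemma exists_collapse (h : IsAdmissible F) {δ : ℝ} {Δ : Real.Angle} (e : (δ : Real.Angle) = Δ)
    {q : ℝ × ℝ} (hq : CollapsesBackward F θ Δ q) :
    ∃ u w : ℝ → ℝ, SolOn (bwd F θ) δ u w (Ico 0 (2 * Real.pi)) ∧ (u 0, w 0) = conj q ∧
      Tendsto (fun x => |u x|) (𝓝[<] (2 * Real.pi)) atTop := by
  obtain ⟨u, w, hs, rfl, hc⟩ := hq
  refine ⟨fun t => u (0 - t), fun t => -w (0 - t),
    ((h.solOn_iff e).2 hs).reflect (fun t v => ?_) (fun t ht => ⟨?_, ?_⟩), by simp [conj], ?_⟩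
  · rw [bwd, fwd]; congr 1 <;> ring
  · linarith [ht.2]
  · linarith [ht.1]
  · refine hc.comp ?_
    refine tendsto_nhdsWithin_iff.2 ⟨?_, ?_⟩
    · have : Continuous fun t : ℝ => 0 - t := by fun_prop
      have := this.tendsto (2 * Real.pi)
      rw [zero_sub] at this
      exact this.mono_left nhdsWithin_le_nhds
    · filter_upwards [self_mem_nhdsWithin] with t ht
      rw [mem_Iio] at ht
      rw [mem_Ioi]
      linarith

lemma not_mem_bwdDom (h : IsAdmissible F) {δ : ℝ} {Δ : Real.Angle}
    (e : ((δ + 2 * θ * Real.pi : ℝ) : Real.Angle) = Δ) {q : ℝ × ℝ}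
    (hq : CollapsesBackward F θ Δ q) : (δ, q) ∉ bwdDom F θ := by
  obtain ⟨u, w, hs, h0, hc⟩ := h.exists_collapse e hq
  have := not_mem_flowDomain_of_collapse (h.contDiff_bwd θ) Real.two_pi_pos hs hc
  rw [h0] at this
  exact this

lemma mem_bwdDom (h : IsAdmissible F) {δ : ℝ} {Δ : Real.Angle}
    (e : ((δ + 2 * θ * Real.pi : ℝ) : Real.Angle) = Δ) {q : ℝ × ℝ}
    (hq : q ∈ backwardDomain F θ Δ) : (δ, q) ∈ bwdDom F θ := by
  obtain ⟨u, w, hs, rfl⟩ := hq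
  have := (((h.solOn_iff (θ := θ) e).2 hs).reflect (g' := bwd F θ) (δ' := δ + 2 * θ * Real.pi)
    (s' := Icc 0 (2 * Real.pi)) (c := 0) (fun t v => by rw [bwd, fwd]; congr 1 <;> ring)
    (fun t ht => ⟨by linarith [ht.2], by linarith [ht.1]⟩)).mem_flowDomain
  simpa [bwdDom, conj] using this

/-- Loops in the domain of the inverse do not wind around points of collapse. -/
lemma hasClosedLog (h : IsAdmissible F) {δ : ℝ} {Δ : Real.Angle}
    (e : ((δ + 2 * θ * Real.pi : ℝ) : Real.Angle) = Δ) {q : ℝ × ℝ}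
    (hq : CollapsesBackward F θ Δ q) {a b : ℝ} (hab : a ≤ b) {ℓ : ℝ → ℝ × ℝ}
    (hℓ : ContinuousOn ℓ (Icc a b)) (hℓab : ℓ a = ℓ b) (hdom : ∀ t ∈ Icc a b, (δ, ℓ t) ∈ bwdDom F θ)
    {e₁ e₂ : ℝ} (he₁ : e₁ ≠ 0) (he₂ : e₂ ≠ 0) :
    HasClosedLog a b (fun t => ⟨e₁ * ((ℓ t).1 - q.1), e₂ * ((ℓ t).2 - q.2)⟩) := by
  obtain ⟨u, w, hs, h0, hc⟩ := h.exists_collapse e hq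
  have := hasClosedLog_of_collapse (δ := δ + 2 * θ * Real.pi) (ℓ := fun t => conj (ℓ t))
    (h.contDiff_bwd θ) Real.two_pi_pos hab
    (continuous_conj.comp_continuousOn hℓ) (congrArg conj hℓab) hdom hs hc he₁ (neg_ne_zero.2 he₂)
  have e1 : u 0 = q.1 := congrArg Prod.fst h0
  have e2 : w 0 = -q.2 := congrArg Prod.snd h0
  simp only [e1, e2, conj] at this
  convert this using 3
  ring

end IsAdmissible

end StripMap
end

noncomputable section

namespace StripMap

/-! ### Islands in normal position -/

namespace Arc

/-- The graph reflected in the horizontal axis. -/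
def negVal (c : Arc) : Arc := ⟨c.lo, c.hi, c.lo_lt_hi, fun t => -c.f t⟩

/-- The graph reflected in the vertical axis. -/
def negArg (c : Arc) : Arc := ⟨-c.hi, -c.lo, neg_lt_neg c.lo_lt_hi, fun t => c.f (-t)⟩

lemma clamp_mem (c : Arc) (t : ℝ) : max c.lo (min c.hi t) ∈ Icc c.lo c.hi :=
  ⟨le_max_left _ _, max_le c.lo_lt_hi.le (min_le_left _ _)⟩

lemma negVal_ext (c : Arc) (t : ℝ) : c.negVal.ext t = -c.ext t := rfl

lemma negArg_ext (c : Arc) (t : ℝ) : c.negArg.ext t = c.ext (-t) := by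
  have : -max (-c.hi) (min (-c.lo) t) = max c.lo (min c.hi (-t)) := by
    rw [← min_neg_neg, ← max_neg_neg, neg_neg, neg_neg, min_max_distrib_left,
      min_eq_right c.lo_lt_hi.le]
  simp only [ext, negArg, this]

lemma ext_mono {c : Arc} (h : MonotoneOn c.f (Icc c.lo c.hi)) : Monotone c.ext := fun x y hxy =>
  h (c.clamp_mem x) (c.clamp_mem y) (max_le_max le_rfl (min_le_min le_rfl hxy))

lemma ext_anti {c : Arc} (h : AntitoneOn c.f (Icc c.lo c.hi)) : Antitone c.ext := fun x y hxy =>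
  h (c.clamp_mem x) (c.clamp_mem y) (max_le_max le_rfl (min_le_min le_rfl hxy))

lemma abs_ext_sub_le {c : Arc} {γ : ℝ≥0} (h : c.IsLipschitz γ) (x y : ℝ) :
    |c.ext x - c.ext y| ≤ γ * |x - y| := by
  have h1 := h.dist_le_mul _ (c.clamp_mem x) _ (c.clamp_mem y)
  rw [Real.dist_eq, Real.dist_eq] at h1
  refine h1.trans (mul_le_mul_of_nonneg_left ?_ γ.coe_nonneg)
  refine (abs_max_sub_max_le_max c.lo _ c.lo _).trans ?_
  simpa using abs_min_sub_min_le_max c.hi x c.hi y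

lemma ext_sub_le {c : Arc} {γ : ℝ≥0} (h : c.IsLipschitz γ) (x y : ℝ) (hxy : x ≤ y) :
    c.ext y - c.ext x ≤ γ * (y - x) := by
  have := (le_abs_self _).trans (abs_ext_sub_le h y x)
  rwa [abs_of_nonneg (sub_nonneg.2 hxy)] at this

lemma ext_sub_le' {c : Arc} {γ : ℝ≥0} (h : c.IsLipschitz γ) (x y : ℝ) (hxy : x ≤ y) :
    c.ext x - c.ext y ≤ γ * (y - x) := by
  have := (le_abs_self _).trans (abs_ext_sub_le h x y)
  rwa [abs_sub_comm x y, abs_of_nonneg (sub_nonneg.2 hxy)] at this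

lemma continuous_ext {c : Arc} {γ : ℝ≥0} (h : c.IsLipschitz γ) : Continuous c.ext :=
  (LipschitzWith.of_dist_le_mul fun x y => by
    rw [Real.dist_eq, Real.dist_eq]; exact abs_ext_sub_le h x y).continuous

lemma exists_ext_bound {c : Arc} {γ : ℝ≥0} (h : c.IsLipschitz γ) : ∃ C, ∀ t, |c.ext t| ≤ C := by
  obtain ⟨C, hC⟩ := (isCompact_Icc (a := c.lo) (b := c.hi)).exists_bound_of_continuousOn h.continuousOn
  exact ⟨C, fun t => hC _ (c.clamp_mem t)⟩

lemma abs_ext_sub_le_thickness {c d : Arc} {γ γ' : ℝ≥0} (hc : c.IsLipschitz γ)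
    (hd : d.IsLipschitz γ') (t : ℝ) : |d.ext t - c.ext t| ≤ thickness c d := by
  set a := min c.lo d.lo
  set b := max c.hi d.hi
  have hac : a ≤ c.lo := min_le_left _ _
  have had : a ≤ d.lo := min_le_right _ _
  have hbc : c.hi ≤ b := le_max_left _ _
  have hbd : d.hi ≤ b := le_max_right _ _
  have hbdd : BddAbove ((fun t => |d.ext t - c.ext t|) '' Icc a b) :=
    isCompact_Icc.bddAbove_image
      ((continuous_ext hd).sub (continuous_ext hc)).abs.continuousOn
  have hmem : ∀ t ∈ Icc a b, |d.ext t - c.ext t| ≤ thickness c d := fun t ht =>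
    le_csSup hbdd ⟨t, ht, rfl⟩
  have hab : a ≤ b := hac.trans (c.lo_lt_hi.le.trans hbc)
  rcases le_total t a with h | h
  · have := hmem a ⟨le_rfl, hab⟩
    rwa [Sweep.ext_of_le hac, Sweep.ext_of_le had, ← Sweep.ext_of_le (h.trans hac),
      ← Sweep.ext_of_le (h.trans had)] at this
  rcases le_total b t with h' | h'
  · have := hmem b ⟨hab, le_rfl⟩
    rwa [Sweep.ext_of_ge hbc, Sweep.ext_of_ge hbd, ← Sweep.ext_of_ge (hbc.trans h'),
      ← Sweep.ext_of_ge (hbd.trans h')] at this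
  · exact hmem t ⟨h, h'⟩

lemma thickness_le {c d : Arc} {w : ℝ} (h : ∀ t, |d.ext t - c.ext t| ≤ w) : thickness c d ≤ w := by
  refine csSup_le (Set.Nonempty.image _ ⟨c.lo, min_le_left _ _, ?_⟩) ?_
  · exact c.lo_lt_hi.le.trans (le_max_left _ _)
  · rintro _ ⟨t, -, rfl⟩; exact h t

lemma IsLipschitz.negVal {c : Arc} {γ : ℝ≥0} (h : c.IsLipschitz γ) : c.negVal.IsLipschitz γ :=
  LipschitzOnWith.of_dist_le_mul fun x hx y hy => by
    have := h.dist_le_mul x hx y hy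
    simp only [Arc.negVal, dist_neg_neg]
    exact this

lemma neg_mem_of_negArg {c : Arc} {x : ℝ} (hx : x ∈ Icc c.negArg.lo c.negArg.hi) :
    -x ∈ Icc c.lo c.hi := ⟨by have := hx.2; simp only [negArg] at this; linarith,
  by have := hx.1; simp only [negArg] at this; linarith⟩

lemma IsLipschitz.negArg {c : Arc} {γ : ℝ≥0} (h : c.IsLipschitz γ) : c.negArg.IsLipschitz γ :=
  LipschitzOnWith.of_dist_le_mul fun x hx y hy => by
    have := h.dist_le_mul (-x) (neg_mem_of_negArg hx) (-y) (neg_mem_of_negArg hy)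
    rw [dist_neg_neg] at this
    exact this

end Arc

/-- The quadrangle reflected in the horizontal axis. -/
def Quadrangle.flip (D : Quadrangle) : Quadrangle :=
  ⟨D.αp.negVal, D.αm.negVal, D.βm.negArg, D.βp.negArg⟩

/-- The global functions that describe a quadrangle. -/
def Quadrangle.quad (D : Quadrangle) : Quad := ⟨D.αm.ext, D.αp.ext, D.βm.ext, D.βp.ext⟩

lemma Quadrangle.quad_region (D : Quadrangle) : D.quad.region = D.region := rfl

/-- Curvilinear quadrangles with increasing lower and upper sides. -/
structure IsShape (γ : ℝ≥0) (D : Quadrangle) : Prop where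
  corner_bl : (D.αm.lo, D.αm.f D.αm.lo) = (D.βm.f D.βm.lo, D.βm.lo)
  corner_br : (D.αm.hi, D.αm.f D.αm.hi) = (D.βp.f D.βp.lo, D.βp.lo)
  corner_tl : (D.αp.lo, D.αp.f D.αp.lo) = (D.βm.f D.βm.hi, D.βm.hi)
  corner_tr : (D.αp.hi, D.αp.f D.αp.hi) = (D.βp.f D.βp.hi, D.βp.hi)
  α_disjoint : Disjoint D.αm.hGraph D.αp.hGraph
  β_disjoint : Disjoint D.βm.vGraph D.βp.vGraph
  αm_lipschitz : D.αm.IsLipschitz γ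
  αp_lipschitz : D.αp.IsLipschitz γ
  βm_lipschitz : D.βm.IsLipschitz γ
  βp_lipschitz : D.βp.IsLipschitz γ
  αm_mono : MonotoneOn D.αm.f (Icc D.αm.lo D.αm.hi)
  αp_mono : MonotoneOn D.αp.f (Icc D.αp.lo D.αp.hi)
  βm_anti : AntitoneOn D.βm.f (Icc D.βm.lo D.βm.hi)
  βp_anti : AntitoneOn D.βp.f (Icc D.βp.lo D.βp.hi)

namespace IsShape

variable {γ : ℝ≥0} {D : Quadrangle}

lemma bl₁ (h : IsShape γ D) : D.αm.lo = D.βm.f D.βm.lo := congrArg Prod.fst h.corner_bl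
lemma bl₂ (h : IsShape γ D) : D.αm.f D.αm.lo = D.βm.lo := congrArg Prod.snd h.corner_bl
lemma br₁ (h : IsShape γ D) : D.αm.hi = D.βp.f D.βp.lo := congrArg Prod.fst h.corner_br
lemma br₂ (h : IsShape γ D) : D.αm.f D.αm.hi = D.βp.lo := congrArg Prod.snd h.corner_br
lemma tl₁ (h : IsShape γ D) : D.αp.lo = D.βm.f D.βm.hi := congrArg Prod.fst h.corner_tl
lemma tl₂ (h : IsShape γ D) : D.αp.f D.αp.lo = D.βm.hi := congrArg Prod.snd h.corner_tl
lemma tr₁ (h : IsShape γ D) : D.αp.hi = D.βp.f D.βp.hi := congrArg Prod.fst h.corner_tr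
lemma tr₂ (h : IsShape γ D) : D.αp.f D.αp.hi = D.βp.hi := congrArg Prod.snd h.corner_tr

lemma lt_of_ne_on {f g : ℝ → ℝ} {a b : ℝ} (hf : ContinuousOn f (Icc a b))
    (hg : ContinuousOn g (Icc a b)) (hne : ∀ t ∈ Icc a b, f t ≠ g t) (ha : f a < g a) {t : ℝ}
    (ht : t ∈ Icc a b) : f t < g t := by
  by_contra hcon
  obtain ⟨z, hz, e⟩ := isPreconnected_Icc.intermediate_value ht (left_mem_Icc.2 (ht.1.trans ht.2))
    (hg.sub hf) (show (0 : ℝ) ∈ Icc (g t - f t) (g a - f a) from ⟨by linarith, by linarith⟩)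
  exact hne z hz (sub_eq_zero.1 e).symm

lemma left_lo (h : IsShape γ D) : D.αp.lo ≤ D.αm.lo := by
  rw [h.bl₁, h.tl₁]
  exact h.βm_anti (left_mem_Icc.2 D.βm.lo_lt_hi.le) (right_mem_Icc.2 D.βm.lo_lt_hi.le) D.βm.lo_lt_hi.le

lemma right_hi (h : IsShape γ D) : D.αp.hi ≤ D.αm.hi := by
  rw [h.br₁, h.tr₁]
  exact h.βp_anti (left_mem_Icc.2 D.βp.lo_lt_hi.le) (right_mem_Icc.2 D.βp.lo_lt_hi.le) D.βp.lo_lt_hi.le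

lemma lower_lo (h : IsShape γ D) : D.βm.lo ≤ D.βp.lo := by
  rw [← h.bl₂, ← h.br₂]
  exact h.αm_mono (left_mem_Icc.2 D.αm.lo_lt_hi.le) (right_mem_Icc.2 D.αm.lo_lt_hi.le) D.αm.lo_lt_hi.le

lemma upper_hi (h : IsShape γ D) : D.βm.hi ≤ D.βp.hi := by
  rw [← h.tl₂, ← h.tr₂]
  exact h.αp_mono (left_mem_Icc.2 D.αp.lo_lt_hi.le) (right_mem_Icc.2 D.αp.lo_lt_hi.le) D.αp.lo_lt_hi.le

/-- To the left of the lower side its value is the ordinate of the bottom left corner, and the upper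
side never falls below the top left corner; to the right the argument is mirrored. In between, the
graphs are disjoint, so the order at one end persists. -/
lemma α_lt (h : IsShape γ D) (t : ℝ) : D.αm.ext t < D.αp.ext t := by
  have bl : D.αm.f D.αm.lo = D.βm.lo := h.bl₂
  have br : D.αm.f D.αm.hi = D.βp.lo := h.br₂
  have tl : D.αp.f D.αp.lo = D.βm.hi := h.tl₂
  have tr : D.αp.f D.αp.hi = D.βp.hi := h.tr₂
  have hm := Arc.ext_mono h.αm_mono
  have hp := Arc.ext_mono h.αp_mono
  have k1 := D.βm.lo_lt_hi
  have k2 := D.βp.lo_lt_hi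
  have lo' : ∀ t, D.βm.hi ≤ D.αp.ext t := fun t => by
    rw [← tl]
    exact h.αp_mono (left_mem_Icc.2 D.αp.lo_lt_hi.le) (D.αp.clamp_mem t) (le_max_left _ _)
  have hi' : ∀ t, D.αm.ext t ≤ D.βp.lo := fun t => by
    rw [← br]
    exact h.αm_mono (D.αm.clamp_mem t) (right_mem_Icc.2 D.αm.lo_lt_hi.le) (D.αm.clamp_mem t).2
  rcases le_total t D.αm.lo with h1 | h1
  · have := lo' t
    rw [Sweep.ext_of_le h1, bl]
    linarith
  rcases le_total D.αp.hi t with h2 | h2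
  · have := hi' t
    rw [Sweep.ext_of_ge h2, tr]
    linarith
  refine lt_of_ne_on (f := D.αm.ext) (g := D.αp.ext) (a := D.αm.lo) (b := D.αp.hi)
    (Arc.continuous_ext h.αm_lipschitz).continuousOn (Arc.continuous_ext h.αp_lipschitz).continuousOn
    (fun t ht e => ?_) ?_ ⟨h1, h2⟩
  · have m1 : t ∈ Icc D.αm.lo D.αm.hi := ⟨ht.1, ht.2.trans h.right_hi⟩
    have m2 : t ∈ Icc D.αp.lo D.αp.hi := ⟨h.left_lo.trans ht.1, ht.2⟩
    rw [Sweep.ext_of_mem m1, Sweep.ext_of_mem m2] at e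
    exact Set.disjoint_left.1 h.α_disjoint (show (t, D.αm.f t) ∈ _ from ⟨m1, rfl⟩) ⟨m2, e⟩
  · have := lo' D.αm.lo
    rw [Sweep.ext_of_le le_rfl, bl]
    linarith

lemma β_lt (h : IsShape γ D) (t : ℝ) : D.βm.ext t < D.βp.ext t := by
  have bl : D.αm.lo = D.βm.f D.βm.lo := h.bl₁
  have br : D.αm.hi = D.βp.f D.βp.lo := h.br₁
  have tl : D.αp.lo = D.βm.f D.βm.hi := h.tl₁
  have tr : D.αp.hi = D.βp.f D.βp.hi := h.tr₁
  have k1 := D.αm.lo_lt_hi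
  have k2 := D.αp.lo_lt_hi
  have lo' : ∀ t, D.βm.ext t ≤ D.αm.lo := fun t => by
    rw [bl]
    exact h.βm_anti (left_mem_Icc.2 D.βm.lo_lt_hi.le) (D.βm.clamp_mem t) (le_max_left _ _)
  have hi' : ∀ t, D.αp.hi ≤ D.βp.ext t := fun t => by
    rw [tr]
    exact h.βp_anti (D.βp.clamp_mem t) (right_mem_Icc.2 D.βp.lo_lt_hi.le) (D.βp.clamp_mem t).2
  rcases le_total t D.βp.lo with h1 | h1
  · have := lo' t
    rw [Sweep.ext_of_le h1, ← br]
    linarith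
  rcases le_total D.βm.hi t with h2 | h2
  · have := hi' t
    rw [Sweep.ext_of_ge h2, ← tl]
    linarith
  refine lt_of_ne_on (f := D.βm.ext) (g := D.βp.ext) (a := D.βp.lo) (b := D.βm.hi)
    (Arc.continuous_ext h.βm_lipschitz).continuousOn (Arc.continuous_ext h.βp_lipschitz).continuousOn
    (fun t ht e => ?_) ?_ ⟨h1, h2⟩
  · have m1 : t ∈ Icc D.βm.lo D.βm.hi := ⟨h.lower_lo.trans ht.1, ht.2⟩
    have m2 : t ∈ Icc D.βp.lo D.βp.hi := ⟨ht.1, ht.2.trans h.upper_hi⟩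
    rw [Sweep.ext_of_mem m1, Sweep.ext_of_mem m2] at e
    exact Set.disjoint_left.1 h.β_disjoint (show (D.βm.f t, t) ∈ _ from ⟨m1, rfl⟩) ⟨m2, e⟩
  · have := lo' D.βp.lo
    rw [Sweep.ext_of_le (c := D.βp) le_rfl, ← br]
    linarith

lemma isGood (h : IsShape γ D) {M : ℝ} (hα : ∀ t, |D.αp.ext t - D.αm.ext t| ≤ M)
    (hβ : ∀ t, |D.βp.ext t - D.βm.ext t| ≤ M) : D.quad.IsGood γ M where
  am_mono := Arc.ext_mono h.αm_mono
  ap_mono := Arc.ext_mono h.αp_mono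
  bm_anti := Arc.ext_anti h.βm_anti
  bp_anti := Arc.ext_anti h.βp_anti
  a_lt := h.α_lt
  b_lt := h.β_lt
  am_lip := Arc.ext_sub_le h.αm_lipschitz
  ap_lip := Arc.ext_sub_le h.αp_lipschitz
  bm_lip := Arc.ext_sub_le' h.βm_lipschitz
  bp_lip := Arc.ext_sub_le' h.βp_lipschitz
  a_width := fun t => (le_abs_self _).trans (hα t)
  b_width := fun t => (le_abs_self _).trans (hβ t)
  bdd := by
    obtain ⟨C₁, h₁⟩ := Arc.exists_ext_bound h.αm_lipschitz
    obtain ⟨C₂, h₂⟩ := Arc.exists_ext_bound h.αp_lipschitz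
    obtain ⟨C₃, h₃⟩ := Arc.exists_ext_bound h.βm_lipschitz
    obtain ⟨C₄, h₄⟩ := Arc.exists_ext_bound h.βp_lipschitz
    exact ⟨max (max C₁ C₂) (max C₃ C₄), fun t =>
      ⟨(h₁ t).trans (le_max_of_le_left (le_max_left _ _)),
        (h₂ t).trans (le_max_of_le_left (le_max_right _ _)),
        (h₃ t).trans (le_max_of_le_right (le_max_left _ _)),
        (h₄ t).trans (le_max_of_le_right (le_max_right _ _))⟩⟩

/-- The constant continuation of a side beyond a corner runs outside the closed quadrangle, so
collapse needs to be known only on the actual side. -/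
lemma mem_βm (h : IsShape γ D) {p : ℝ × ℝ} (hp : p ∈ D.quad.closedRegion) (e : p.1 = D.βm.ext p.2) :
    p ∈ D.βm.vGraph := by
  have h1 := hp.1
  have h2 := hp.2.1
  simp only [Quadrangle.quad] at h1 h2
  have m : p.2 ∈ Icc D.βm.lo D.βm.hi := by
    constructor
    · by_contra hc
      rw [not_le] at hc
      rw [Sweep.ext_of_le hc.le, ← h.bl₁] at e
      rw [e, Sweep.ext_of_le le_rfl, h.bl₂] at h1
      linarith
    · by_contra hc
      rw [not_le] at hc
      rw [Sweep.ext_of_ge hc.le, ← h.tl₁] at e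
      rw [e, Sweep.ext_of_le le_rfl, h.tl₂] at h2
      linarith
  rw [Sweep.ext_of_mem m] at e
  exact ⟨m, e⟩

lemma mem_βp (h : IsShape γ D) {p : ℝ × ℝ} (hp : p ∈ D.quad.closedRegion) (e : p.1 = D.βp.ext p.2) :
    p ∈ D.βp.vGraph := by
  have h1 := hp.1
  have h2 := hp.2.1
  simp only [Quadrangle.quad] at h1 h2
  have m : p.2 ∈ Icc D.βp.lo D.βp.hi := by
    constructor
    · by_contra hc
      rw [not_le] at hc
      rw [Sweep.ext_of_le hc.le, ← h.br₁] at e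
      rw [e, Sweep.ext_of_ge le_rfl, h.br₂] at h1
      linarith
    · by_contra hc
      rw [not_le] at hc
      rw [Sweep.ext_of_ge hc.le, ← h.tr₁] at e
      rw [e, Sweep.ext_of_ge le_rfl, h.tr₂] at h2
      linarith
  rw [Sweep.ext_of_mem m] at e
  exact ⟨m, e⟩

lemma mem_αm (h : IsShape γ D) {p : ℝ × ℝ} (hp : p ∈ D.quad.closedRegion) (e : p.2 = D.αm.ext p.1) :
    p ∈ D.αm.hGraph := by
  have h1 := hp.2.2.1
  have h2 := hp.2.2.2
  simp only [Quadrangle.quad] at h1 h2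
  have m : p.1 ∈ Icc D.αm.lo D.αm.hi := by
    constructor
    · by_contra hc
      rw [not_le] at hc
      rw [Sweep.ext_of_le hc.le, h.bl₂] at e
      rw [e, Sweep.ext_of_le le_rfl, ← h.bl₁] at h1
      linarith
    · by_contra hc
      rw [not_le] at hc
      rw [Sweep.ext_of_ge hc.le, h.br₂] at e
      rw [e, Sweep.ext_of_le le_rfl, ← h.br₁] at h2
      linarith
  rw [Sweep.ext_of_mem m] at e
  exact ⟨m, e⟩

lemma mem_αp (h : IsShape γ D) {p : ℝ × ℝ} (hp : p ∈ D.quad.closedRegion) (e : p.2 = D.αp.ext p.1) :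
    p ∈ D.αp.hGraph := by
  have h1 := hp.2.2.1
  have h2 := hp.2.2.2
  simp only [Quadrangle.quad] at h1 h2
  have m : p.1 ∈ Icc D.αp.lo D.αp.hi := by
    constructor
    · by_contra hc
      rw [not_le] at hc
      rw [Sweep.ext_of_le hc.le, h.tl₂] at e
      rw [e, Sweep.ext_of_ge le_rfl, ← h.tl₁] at h1
      linarith
    · by_contra hc
      rw [not_le] at hc
      rw [Sweep.ext_of_ge hc.le, h.tr₂] at e
      rw [e, Sweep.ext_of_ge le_rfl, ← h.tr₁] at h2
      linarith
  rw [Sweep.ext_of_mem m] at e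
  exact ⟨m, e⟩

end IsShape

end StripMap
end

/-! ### Reflections, half turns and sign patterns. -/

noncomputable section

namespace StripMap

/-- The sign of a type of monotonicity. -/
def MonoType.sgn : MonoType → ℝ
  | .increasing => 1
  | .decreasing => -1

lemma MonoType.sgn_mul_self (τ : MonoType) : τ.sgn * τ.sgn = 1 := by cases τ <;> simp [sgn]

lemma MonoType.sgn_ne_zero (τ : MonoType) : τ.sgn ≠ 0 := by cases τ <;> simp [sgn]

/-- The quadrangle in normal position: reflected in the horizontal axis, if its `α`-borders are
decreasing. -/
def Quadrangle.norm (D : Quadrangle) : MonoType → Quadrangle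
  | .increasing => D
  | .decreasing => D.flip

/-- The reflection that brings quadrangles of the given type into normal position. -/
def refl (τ : MonoType) (p : ℝ × ℝ) : ℝ × ℝ := (p.1, τ.sgn * p.2)

@[simp] lemma refl_refl (τ : MonoType) (p : ℝ × ℝ) : refl τ (refl τ p) = p := by
  simp [refl, ← mul_assoc, τ.sgn_mul_self]

lemma continuous_refl (τ : MonoType) : Continuous (refl τ) := by unfold refl; fun_prop

/-- The reflection as a homeomorphism. -/
def reflHomeo (τ : MonoType) : (ℝ × ℝ) ≃ₜ (ℝ × ℝ) where
  toFun := refl τ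
  invFun := refl τ
  left_inv := refl_refl τ
  right_inv := refl_refl τ
  continuous_toFun := continuous_refl τ
  continuous_invFun := continuous_refl τ

lemma Quadrangle.mem_norm_region {D : Quadrangle} {τ : MonoType} {p : ℝ × ℝ} :
    p ∈ (D.norm τ).region ↔ refl τ p ∈ D.region := by
  cases τ with
  | increasing => simp [norm, refl, MonoType.sgn]
  | decreasing =>
    simp only [region, norm, flip, refl, MonoType.sgn, Arc.negVal_ext, Arc.negArg_ext,
      mem_ofPred_eq, neg_one_mul]
    constructor
    · rintro ⟨h1, h2, h3, h4⟩
      exact ⟨by linarith, by linarith, h3, h4⟩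
    · rintro ⟨h1, h2, h3, h4⟩
      exact ⟨by linarith, by linarith, h3, h4⟩

lemma mem_vGraph_of_negArg {c : Arc} {p : ℝ × ℝ} (hp : p ∈ c.negArg.vGraph) :
    refl .decreasing p ∈ c.vGraph := by
  refine ⟨?_, ?_⟩
  · simpa [refl, MonoType.sgn] using Arc.neg_mem_of_negArg hp.1
  · have := hp.2
    simp only [Arc.negArg] at this
    simp [refl, MonoType.sgn, this]

lemma mem_hGraph_of_negVal {c : Arc} {p : ℝ × ℝ} (hp : p ∈ c.negVal.hGraph) :
    refl .decreasing p ∈ c.hGraph :=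
  ⟨hp.1, by have := hp.2; simp only [Arc.negVal] at this; simp [refl, MonoType.sgn, this]⟩

lemma refl_increasing (p : ℝ × ℝ) : refl .increasing p = p := by simp [refl, MonoType.sgn]

namespace IsIsland

variable {F : ℝ → ℝ → ℝ → ℝ} {θ : ℝ} {Δ : Real.Angle} {γ : ℝ≥0} {τ : MonoType} {D : Quadrangle}

lemma shape (h : IsIsland F θ Δ γ τ D) : IsShape γ (D.norm τ) := by
  cases τ with
  | increasing =>
    exact ⟨h.corner_bl, h.corner_br, h.corner_tl, h.corner_tr, h.α_disjoint, h.β_disjoint,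
      h.αm_lipschitz, h.αp_lipschitz, h.βm_lipschitz, h.βp_lipschitz, h.αm_type, h.αp_type,
      h.βm_type, h.βp_type⟩
  | decreasing =>
    have hneg : ∀ {c : Arc}, c.HasType .decreasing →
        MonotoneOn c.negVal.f (Icc c.negVal.lo c.negVal.hi) := fun hc => hc.neg
    have harg : ∀ {c : Arc}, c.HasType .increasing →
        AntitoneOn c.negArg.f (Icc c.negArg.lo c.negArg.hi) := fun hc x hx y hy hxy =>
      hc (Arc.neg_mem_of_negArg hy) (Arc.neg_mem_of_negArg hx) (neg_le_neg hxy)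
    refine ⟨?_, ?_, ?_, ?_, ?_, ?_, h.αp_lipschitz.negVal, h.αm_lipschitz.negVal,
      h.βm_lipschitz.negArg, h.βp_lipschitz.negArg, hneg h.αp_type, hneg h.αm_type,
      harg h.βm_type, harg h.βp_type⟩
    · have := h.corner_tl
      simp only [Prod.mk.injEq] at this
      simp only [Quadrangle.norm, Quadrangle.flip, Arc.negVal, Arc.negArg, neg_neg]
      rw [this.2, this.1]
    · have := h.corner_tr
      simp only [Prod.mk.injEq] at this
      simp only [Quadrangle.norm, Quadrangle.flip, Arc.negVal, Arc.negArg, neg_neg]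
      rw [this.2, this.1]
    · have := h.corner_bl
      simp only [Prod.mk.injEq] at this
      simp only [Quadrangle.norm, Quadrangle.flip, Arc.negVal, Arc.negArg, neg_neg]
      rw [this.2, this.1]
    · have := h.corner_br
      simp only [Prod.mk.injEq] at this
      simp only [Quadrangle.norm, Quadrangle.flip, Arc.negVal, Arc.negArg, neg_neg]
      rw [this.2, this.1]
    · refine Set.disjoint_left.2 fun p hp hp' => ?_
      exact Set.disjoint_left.1 h.α_disjoint (mem_hGraph_of_negVal hp') (mem_hGraph_of_negVal hp)
    · refine Set.disjoint_left.2 fun p hp hp' => ?_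
      exact Set.disjoint_left.1 h.β_disjoint (mem_vGraph_of_negArg hp) (mem_vGraph_of_negArg hp')

lemma isGood (h : IsIsland F θ Δ γ τ D) {M : ℝ} (hα : Arc.thickness D.αm D.αp ≤ M)
    (hβ : Arc.thickness D.βm D.βp ≤ M) : (D.norm τ).quad.IsGood γ M := by
  have h1 := fun t => (Arc.abs_ext_sub_le_thickness h.αm_lipschitz h.αp_lipschitz t).trans hα
  have h2 := fun t => (Arc.abs_ext_sub_le_thickness h.βm_lipschitz h.βp_lipschitz t).trans hβ
  refine h.shape.isGood (fun t => ?_) (fun t => ?_)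
  · cases τ with
    | increasing => exact h1 t
    | decreasing =>
      have := h1 t
      simp only [Quadrangle.norm, Quadrangle.flip, Arc.negVal_ext]
      rwa [neg_sub_neg]
  · cases τ with
    | increasing => exact h2 t
    | decreasing =>
      simp only [Quadrangle.norm, Quadrangle.flip, Arc.negArg_ext]
      exact h2 (-t)

lemma collapse_β (h : IsIsland F θ Δ γ τ D) {p : ℝ × ℝ} (hp : p ∈ (D.norm τ).quad.closedRegion)
    (e : p.1 = (D.norm τ).quad.bm p.2 ∨ p.1 = (D.norm τ).quad.bp p.2) :
    CollapsesForward F θ Δ (refl τ p) := by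
  have hs := h.shape
  refine h.β_collapse _ ?_
  rcases e with e | e
  · have := hs.mem_βm hp e
    cases τ with
    | increasing => rw [refl_increasing]; exact Or.inl this
    | decreasing => exact Or.inl (mem_vGraph_of_negArg this)
  · have := hs.mem_βp hp e
    cases τ with
    | increasing => rw [refl_increasing]; exact Or.inr this
    | decreasing => exact Or.inr (mem_vGraph_of_negArg this)

lemma collapse_α (h : IsIsland F θ Δ γ τ D) {p : ℝ × ℝ} (hp : p ∈ (D.norm τ).quad.closedRegion)
    (e : p.2 = (D.norm τ).quad.am p.1 ∨ p.2 = (D.norm τ).quad.ap p.1) :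
    CollapsesBackward F θ Δ (refl τ p) := by
  have hs := h.shape
  refine h.α_collapse _ ?_
  rcases e with e | e
  · have := hs.mem_αm hp e
    cases τ with
    | increasing => rw [refl_increasing]; exact Or.inl this
    | decreasing => exact Or.inr (mem_hGraph_of_negVal this)
  · have := hs.mem_αp hp e
    cases τ with
    | increasing => rw [refl_increasing]; exact Or.inr this
    | decreasing => exact Or.inl (mem_hGraph_of_negVal this)

end IsIsland

/-! ### Turned quadrangles -/

/-- The quadrangle `K`, turned by `π` if `ε = -1`. -/
def Quad.turn (K : Quad) (ε : ℝ) : Quad := if ε = 1 then K else K.rot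

section turn

variable {K : Quad} {γ M ε : ℝ}

lemma Quad.turn_one (K : Quad) : K.turn 1 = K := if_pos rfl

lemma Quad.turn_neg_one (K : Quad) : K.turn (-1) = K.rot := if_neg (by norm_num)

lemma Quad.IsGood.turn (h : K.IsGood γ M) (ε : ℝ) : (K.turn ε).IsGood γ M := by
  unfold Quad.turn
  split_ifs
  · exact h
  · exact h.rot

lemma Quad.mem_turn_region (hε : ε = 1 ∨ ε = -1) {q : ℝ × ℝ} :
    ε • q ∈ (K.turn ε).region ↔ q ∈ K.region := by
  rcases hε with rfl | rfl
  · rw [turn_one, one_smul]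
  · rw [turn_neg_one, neg_one_smul, mem_rot_region]

lemma smul_smul_self (hε : ε = 1 ∨ ε = -1) (q : ℝ × ℝ) : ε • ε • q = q := by
  rcases hε with rfl | rfl <;> simp

lemma Quad.mem_closedRegion_of_turn (hε : ε = 1 ∨ ε = -1) {q : ℝ × ℝ}
    (hq : q ∈ (K.turn ε).closedRegion) : ε • q ∈ K.closedRegion := by
  rcases hε with rfl | rfl
  · rw [turn_one] at hq; rwa [one_smul (M := ℝ)]
  · rw [turn_neg_one] at hq
    simp only [closedRegion, rot, mem_ofPred_eq] at hq
    simp only [closedRegion, neg_one_smul, mem_ofPred_eq, Prod.fst_neg, Prod.snd_neg]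
    exact ⟨by linarith, by linarith, by linarith, by linarith⟩

lemma Quad.alpha_of_turn (hε : ε = 1 ∨ ε = -1) {q : ℝ × ℝ}
    (hq : q.2 = (K.turn ε).am q.1 ∨ q.2 = (K.turn ε).ap q.1) :
    (ε • q).2 = K.am (ε • q).1 ∨ (ε • q).2 = K.ap (ε • q).1 := by
  rcases hε with rfl | rfl
  · rw [turn_one] at hq; rwa [one_smul (M := ℝ)]
  · rw [turn_neg_one] at hq
    simp only [rot] at hq
    simp only [neg_one_smul, Prod.fst_neg, Prod.snd_neg]
    rcases hq with hq | hq
    · exact Or.inr (by linarith)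
    · exact Or.inl (by linarith)

lemma Quad.IsGood.rCo_turn_mem (h : K.IsGood γ M) (hε : ε = 1 ∨ ε = -1) {q : ℝ × ℝ} {a : ℝ}
    (hq : (K.turn ε).rCo (ε • q) ∈ Icc a (1 - a)) : K.rCo q ∈ Icc a (1 - a) := by
  rcases hε with rfl | rfl
  · rwa [Quad.turn_one, one_smul] at hq
  · rw [Quad.turn_neg_one, neg_one_smul, h.rCo_rot] at hq
    exact ⟨by linarith [hq.2], by linarith [hq.1]⟩

end turn

/-- The common sign `ε` in the admissible patterns. -/
lemma AllowedPattern.exists_sign {τ τ' : MonoType} {P : Matrix (Fin 2) (Fin 2) SignType}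
    (h : AllowedPattern τ τ' P) : ∃ ε : ℝ, (ε = 1 ∨ ε = -1) ∧
      ∀ A : Matrix (Fin 2) (Fin 2) ℝ, A.map SignType.sign = P →
        0 < ε * A 0 0 ∧ 0 < ε * (τ.sgn * A 0 1) ∧ 0 < ε * (τ'.sgn * A 1 0) ∧
          0 < ε * (τ.sgn * τ'.sgn * A 1 1) := by
  have key : ∀ a b c d : SignType, P = !![a, b; c, d] → ∀ A : Matrix (Fin 2) (Fin 2) ℝ,
      A.map SignType.sign = P → SignType.sign (A 0 0) = a ∧ SignType.sign (A 0 1) = b ∧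
        SignType.sign (A 1 0) = c ∧ SignType.sign (A 1 1) = d := by
    rintro a b c d rfl A e
    exact ⟨congrFun₂ e 0 0, congrFun₂ e 0 1, congrFun₂ e 1 0, congrFun₂ e 1 1⟩
  have neg' : ∀ {x : ℝ}, SignType.sign x = -1 ↔ x < 0 := sign_eq_neg_one_iff
  cases τ <;> cases τ' <;> rcases h with h | h
  -- Reflecting the source changes the sign of the second column, reflecting the target that of the
  -- second row. In each allowed pattern all entries then share one sign, which is `ε`.
  all_goals
    first
    | refine ⟨1, Or.inl rfl, fun A e => ?_⟩
      have k := key _ _ _ _ h A e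
      simp only [sign_eq_one_iff, neg'] at k
      simp only [MonoType.sgn]
      exact ⟨by linarith [k.1], by linarith [k.2.1], by linarith [k.2.2.1], by linarith [k.2.2.2]⟩
    | refine ⟨-1, Or.inr rfl, fun A e => ?_⟩
      have k := key _ _ _ _ h A e
      simp only [sign_eq_one_iff, neg'] at k
      simp only [MonoType.sgn]
      exact ⟨by linarith [k.1], by linarith [k.2.1], by linarith [k.2.2.1], by linarith [k.2.2.2]⟩

end StripMap
end

/-! ### The Poincaré map in normal position is a crossing. -/

noncomputable section

namespace StripMap

/-- The Poincaré map in normal position. -/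
def normMap (F : ℝ → ℝ → ℝ → ℝ) (θ : ℝ) (τ τ' : MonoType) (ε δ : ℝ) (p : ℝ × ℝ) : ℝ × ℝ :=
  ε • refl τ' (fwdMap F θ δ (refl τ p))

/-- The inverse of `normMap`. -/
def normInv (F : ℝ → ℝ → ℝ → ℝ) (θ : ℝ) (τ τ' : MonoType) (ε δ : ℝ) (q : ℝ × ℝ) : ℝ × ℝ :=
  refl τ (bwdMap F θ δ (refl τ' (ε • q)))

/-- The reflection as a linear map. -/
def reflL (τ : MonoType) : ℝ × ℝ →L[ℝ] ℝ × ℝ :=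
  (ContinuousLinearMap.fst ℝ ℝ ℝ).prod (τ.sgn • ContinuousLinearMap.snd ℝ ℝ ℝ)

lemma reflL_apply (τ : MonoType) (p : ℝ × ℝ) : reflL τ p = refl τ p := rfl

lemma hasFDerivAt_refl (τ : MonoType) (p : ℝ × ℝ) : HasFDerivAt (refl τ) (reflL τ) p :=
  (reflL τ).hasFDerivAt

/-- Linearizations of the time map are bounded near a compact set, uniformly in the parameter. -/
lemma exists_bound_fderiv {g : ℝ → ℝ → ℝ → ℝ}
    (hg : ContDiff ℝ 1 (fun z : ℝ × ℝ × ℝ => g z.1 z.2.1 z.2.2)) {T δ₀ : ℝ} (hT : 0 ≤ T)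
    {K : Set (ℝ × ℝ)} (hK : IsCompact K) (hKd : ∀ p ∈ K, (δ₀, p) ∈ flowDomain g T) :
    ∃ (B : ℝ) (A : Set (ℝ × ℝ)), IsOpen A ∧ K ⊆ A ∧ ∀ᶠ δ in 𝓝 δ₀, ∀ p ∈ A,
      ∀ L : ℝ × ℝ →L[ℝ] ℝ × ℝ, HasFDerivAt (timeMap g T δ) L p → ‖L‖ ≤ B := by
  refine hK.induction_on (p := fun K => ∃ (B : ℝ) (A : Set (ℝ × ℝ)), IsOpen A ∧ K ⊆ A ∧
    ∀ᶠ δ in 𝓝 δ₀, ∀ p ∈ A, ∀ L : ℝ × ℝ →L[ℝ] ℝ × ℝ, HasFDerivAt (timeMap g T δ) L p → ‖L‖ ≤ B)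
    ?_ ?_ ?_ ?_
  · exact ⟨0, ∅, isOpen_empty, Subset.rfl, Eventually.of_forall fun _ _ hp => hp.elim⟩
  · rintro s t hst ⟨B, A, hA, htA, h⟩
    exact ⟨B, A, hA, hst.trans htA, h⟩
  · rintro s t ⟨B, A, hA, hsA, h⟩ ⟨B', A', hA', htA', h'⟩
    refine ⟨max B B', A ∪ A', hA.union hA', union_subset_union hsA htA', ?_⟩
    filter_upwards [h, h'] with δ h1 h2 p hp L hL
    rcases hp with hp | hp
    · exact (h1 p hp L hL).trans (le_max_left _ _)
    · exact (h2 p hp L hL).trans (le_max_right _ _)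
  · intro p hp
    -- A joint Lipschitz constant near `(δ₀, p)` bounds every derivative of every nearby slice map,
    -- so continuity of the derivative is not needed.
    obtain ⟨r, hr, C, -, hlip⟩ := exists_lipschitz_timeMap hg hT (hKd p hp)
    refine ⟨Metric.ball p r, mem_nhdsWithin_of_mem_nhds (Metric.ball_mem_nhds p hr), C,
      Metric.ball p r, Metric.isOpen_ball, Subset.rfl, ?_⟩
    filter_upwards [Metric.ball_mem_nhds δ₀ hr] with δ hδ p' hp' L hL
    refine hL.le_of_lipschitzOn (Metric.isOpen_ball.mem_nhds hp') ?_
    refine LipschitzOnWith.of_dist_le_mul fun x hx y hy => ?_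
    have hb : ∀ x ∈ Metric.ball p r, (δ, x) ∈ Metric.ball (δ₀, p) r := fun x hx => by
      rw [Metric.mem_ball, Prod.dist_eq]; exact max_lt hδ hx
    have := hlip.dist_le_mul (δ, x) (hb x hx) (δ, y) (hb y hy)
    simpa [Prod.dist_eq] using this

section

variable {F : ℝ → ℝ → ℝ → ℝ} {θ δ : ℝ} {γ : ℝ≥0} {τ τ' : MonoType} {D E : Quadrangle} {ε M ρ B : ℝ}

lemma coe_shift (θ δ : ℝ) : ((δ + 2 * θ * Real.pi : ℝ) : Real.Angle) = shift θ δ := by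
  rw [shift, Real.Angle.coe_add]

lemma transitSet_turn (hF : IsAdmissible F) (hε : ε = 1 ∨ ε = -1) :
    transitSet (D.norm τ).quad ((E.norm τ').quad.turn ε) (normMap F θ τ τ' ε δ) =
      refl τ ⁻¹' transit F θ δ D E := by
  ext p
  simp only [transitSet, transit, mem_ofPred_eq, mem_preimage, normMap, Quad.mem_turn_region hε,
    Quadrangle.quad_region, Quadrangle.mem_norm_region, refl_refl, hF.fwdMap_eq rfl]

lemma closure_transitSet_turn (hF : IsAdmissible F) (hε : ε = 1 ∨ ε = -1) :
    closure (transitSet (D.norm τ).quad ((E.norm τ').quad.turn ε) (normMap F θ τ τ' ε δ)) =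
      refl τ ⁻¹' closure (transit F θ δ D E) := by
  rw [transitSet_turn hF hε]
  exact ((reflHomeo τ).preimage_closure _).symm

lemma normInv_normMap (hF : IsAdmissible F) (hε : ε = 1 ∨ ε = -1) {p : ℝ × ℝ}
    (hp : (δ, refl τ p) ∈ fwdDom F θ) :
    normInv F θ τ τ' ε δ (normMap F θ τ τ' ε δ p) = p := by
  rw [normInv, normMap, smul_smul_self hε, refl_refl, (hF.map_mem hp).2, refl_refl]

lemma normMap_mem (hF : IsAdmissible F) (hε : ε = 1 ∨ ε = -1) {p : ℝ × ℝ}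
    (hp : (δ, refl τ p) ∈ fwdDom F θ) :
    (δ, refl τ' (ε • normMap F θ τ τ' ε δ p)) ∈ bwdDom F θ := by
  rw [normMap, smul_smul_self hε, refl_refl]
  exact (hF.map_mem hp).1

lemma normMap_normInv (hF : IsAdmissible F) (hε : ε = 1 ∨ ε = -1) {q : ℝ × ℝ}
    (hq : (δ, refl τ' (ε • q)) ∈ bwdDom F θ) :
    normMap F θ τ τ' ε δ (normInv F θ τ τ' ε δ q) = q := by
  rw [normInv, normMap, refl_refl, (hF.inv_mem hq).2, refl_refl, smul_smul_self hε]

lemma continuousAt_normMap (hF : IsAdmissible F) {z : ℝ × ℝ × ℝ}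
    (hz : (z.1, refl τ z.2) ∈ fwdDom F θ) :
    ContinuousAt (fun z : ℝ × ℝ × ℝ => normMap F θ τ τ' ε z.1 z.2) z := by
  have h1 : Continuous fun z : ℝ × ℝ × ℝ => (z.1, refl τ z.2) :=
    continuous_fst.prodMk ((continuous_refl τ).comp continuous_snd)
  exact (((continuous_refl τ').continuousAt.comp (ContinuousAt.comp
    (f := fun z : ℝ × ℝ × ℝ => (z.1, refl τ z.2)) (hF.continuousAt_fwdMap hz)
    h1.continuousAt)).const_smul ε)

lemma continuousAt_normInv (hF : IsAdmissible F) {z : ℝ × ℝ × ℝ}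
    (hz : (z.1, refl τ' (ε • z.2)) ∈ bwdDom F θ) :
    ContinuousAt (fun z : ℝ × ℝ × ℝ => normInv F θ τ τ' ε z.1 z.2) z := by
  have h1 : Continuous fun z : ℝ × ℝ × ℝ => (z.1, refl τ' (ε • z.2)) :=
    continuous_fst.prodMk ((continuous_refl τ').comp (continuous_snd.const_smul ε))
  exact (continuous_refl τ).continuousAt.comp (ContinuousAt.comp
    (f := fun z : ℝ × ℝ × ℝ => (z.1, refl τ' (ε • z.2))) (hF.continuousAt_bwdMap hz)
    h1.continuousAt)

lemma mem_fwdDom_of_mem_region (hF : IsAdmissible F) (hD : IsIsland F θ δ γ τ D) {p : ℝ × ℝ}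
    (hp : p ∈ (D.norm τ).quad.region) : (δ, refl τ p) ∈ fwdDom F θ :=
  (hF.mem_fwdDom_iff rfl).2 (hD.region_subset (Quadrangle.mem_norm_region.1 hp)).1

lemma mem_bwdDom_of_mem_region (hF : IsAdmissible F) (hE : IsIsland F θ (shift θ δ) γ τ' E)
    {q : ℝ × ℝ} (hq : q ∈ (E.norm τ').quad.region) : (δ, refl τ' q) ∈ bwdDom F θ :=
  hF.mem_bwdDom (coe_shift θ δ) (hE.region_subset (Quadrangle.mem_norm_region.1 hq)).2

/-- The flow has determinant 1. The two reflections multiply it by `τ.sgn * τ'.sgn`, and the half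
turn leaves it unchanged. -/
lemma exists_stretching (hF : IsAdmissible F) (hε : ε = 1 ∨ ε = -1) {p : ℝ × ℝ}
    (hp : refl τ p ∈ forwardDomain F θ δ)
    (hA : 0 < ε * jacobian F θ δ (refl τ p) 0 0 ∧ 0 < ε * (τ.sgn * jacobian F θ δ (refl τ p) 0 1) ∧
      0 < ε * (τ'.sgn * jacobian F θ δ (refl τ p) 1 0) ∧
      0 < ε * (τ.sgn * τ'.sgn * jacobian F θ δ (refl τ p) 1 1))
    (hρ : ρ ≤ |jacobian F θ δ (refl τ p) 0 0|) (hB : ‖fderiv ℝ (poincare F θ δ) (refl τ p)‖ ≤ B) :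
    ∃ L : ℝ × ℝ →L[ℝ] ℝ × ℝ, HasFDerivAt (normMap F θ τ τ' ε δ) L p ∧
      IsStretching ρ B (τ.sgn * τ'.sgn) L := by
  set L₀ := fderiv ℝ (poincare F θ δ) (refl τ p) with hL₀
  have a00 : jacobian F θ δ (refl τ p) 0 0 = (L₀ (1, 0)).1 := rfl
  have a01 : jacobian F θ δ (refl τ p) 0 1 = (L₀ (0, 1)).1 := rfl
  have a10 : jacobian F θ δ (refl τ p) 1 0 = (L₀ (1, 0)).2 := rfl
  have a11 : jacobian F θ δ (refl τ p) 1 1 = (L₀ (0, 1)).2 := rfl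
  rw [a00, a01, a10, a11] at hA
  rw [a00] at hρ
  -- At a point without derivative `fderiv` is zero by convention, which the strict sign of `a₁₁`
  -- excludes.
  have hd : DifferentiableAt ℝ (poincare F θ δ) (refl τ p) := by
    by_contra hcon
    have h0 := hA.1
    rw [hL₀, fderiv_zero_of_not_differentiableAt hcon] at h0
    simp at h0
  have hf : HasFDerivAt (fwdMap F θ δ) L₀ (refl τ p) := by
    rw [hF.fwdMap_eq rfl]; exact hd.hasFDerivAt
  have hdet := det_fderiv_timeMap (hF.contDiff_fwd θ) Real.two_pi_pos.le
    ((hF.mem_fwdDom_iff rfl).2 hp) hf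
  have hL : HasFDerivAt (normMap F θ τ τ' ε δ) (ε • ((reflL τ').comp (L₀.comp (reflL τ)))) p :=
    (((hasFDerivAt_refl τ' _).comp p (hf.comp p (hasFDerivAt_refl τ p))).const_smul ε)
  refine ⟨_, hL, ?_⟩
  have v1 : (ε • ((reflL τ').comp (L₀.comp (reflL τ)))) (1, 0) =
      (ε * (L₀ (1, 0)).1, ε * (τ'.sgn * (L₀ (1, 0)).2)) := by
    have : refl τ ((1 : ℝ), (0 : ℝ)) = (1, 0) := by simp [refl]
    rw [smul_apply, ContinuousLinearMap.comp_apply, ContinuousLinearMap.comp_apply, reflL_apply,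
      reflL_apply, this]
    rfl
  have v2 : (ε • ((reflL τ').comp (L₀.comp (reflL τ)))) (0, 1) =
      (ε * (τ.sgn * (L₀ (0, 1)).1), ε * (τ.sgn * τ'.sgn * (L₀ (0, 1)).2)) := by
    have : refl τ ((0 : ℝ), (1 : ℝ)) = τ.sgn • ((0 : ℝ), (1 : ℝ)) := by simp [refl]
    rw [smul_apply, ContinuousLinearMap.comp_apply, ContinuousLinearMap.comp_apply, reflL_apply,
      reflL_apply, this, map_smul]
    simp only [refl, Prod.smul_mk, Prod.smul_fst, Prod.smul_snd, smul_eq_mul]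
    exact Prod.ext rfl (by ring)
  have hεε : ε * ε = 1 := by rcases hε with rfl | rfl <;> norm_num
  have habs : |ε| = 1 := by rcases hε with rfl | rfl <;> norm_num
  have hs : ∀ τ : MonoType, |τ.sgn| = 1 := fun τ => by cases τ <;> simp [MonoType.sgn]
  have n1 : |(L₀ (1, 0)).2| ≤ B := by
    refine ((norm_snd_le _).trans (L₀.le_opNorm _)).trans ?_
    simpa using hB
  have n2 : |(L₀ (0, 1)).2| ≤ B := by
    refine ((norm_snd_le _).trans (L₀.le_opNorm _)).trans ?_
    simpa using hB
  constructor
  · rw [v1]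
    refine hρ.trans_eq ?_
    rw [← abs_of_pos hA.1, abs_mul, habs, one_mul]
  · rw [v2]; exact hA.2.1
  · rw [v1]; exact hA.2.2.1
  · rw [v2]; exact hA.2.2.2
  · rw [v1]
    refine (le_abs_self _).trans ?_
    simp only [abs_mul, habs, hs, one_mul]
    exact n1
  · rw [v2]
    refine (le_abs_self _).trans ?_
    simp only [abs_mul, habs, hs, one_mul]
    exact n2
  · rw [v1, v2]
    have ht := τ'.sgn_mul_self
    simp only
    linear_combination (τ.sgn * τ'.sgn) * hdet + (τ.sgn * τ'.sgn *
      ((L₀ (1, 0)).1 * (L₀ (0, 1)).2 - (L₀ (1, 0)).2 * (L₀ (0, 1)).1)) * hεε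

/-- The Poincaré map in normal position is a crossing. -/
theorem crossing_normMap (hF : IsAdmissible F) (hD : IsIsland F θ δ γ τ D)
    (hE : IsIsland F θ (shift θ δ) γ τ' E) (hDg : (D.norm τ).quad.IsGood γ M)
    (hEg : (E.norm τ').quad.IsGood γ M) (hε : ε = 1 ∨ ε = -1) (hρ : 1 < ρ)
    (hlin : ∀ p, refl τ p ∈ closure (transit F θ δ D E) → refl τ p ∈ forwardDomain F θ δ ∧
      ∃ L : ℝ × ℝ →L[ℝ] ℝ × ℝ, HasFDerivAt (normMap F θ τ τ' ε δ) L p ∧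
        IsStretching ρ B (τ.sgn * τ'.sgn) L) :
    Crossing (D.norm τ).quad ((E.norm τ').quad.turn ε) (normMap F θ τ τ' ε δ)
      (normInv F θ τ τ' ε δ) γ M ρ B (τ.sgn * τ'.sgn) := by
  have hcl : ∀ p ∈ closure (transitSet (D.norm τ).quad ((E.norm τ').quad.turn ε)
      (normMap F θ τ τ' ε δ)), refl τ p ∈ closure (transit F θ δ D E) := fun p hp => by
    rw [closure_transitSet_turn hF hε] at hp; exact hp
  have hdom : ∀ p ∈ closure (transitSet (D.norm τ).quad ((E.norm τ').quad.turn ε)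
      (normMap F θ τ τ' ε δ)), (δ, refl τ p) ∈ fwdDom F θ := fun p hp =>
    (hF.mem_fwdDom_iff rfl).2 (hlin p (hcl p hp)).1
  have hclD : ∀ p ∈ closure (transitSet (D.norm τ).quad ((E.norm τ').quad.turn ε)
      (normMap F θ τ τ' ε δ)), p ∈ (D.norm τ).quad.closedRegion := fun p hp =>
    hDg.closure_region_subset (closure_mono (fun _ h => h.1) hp)
  have hclE : ∀ p ∈ closure (transitSet (D.norm τ).quad ((E.norm τ').quad.turn ε)
      (normMap F θ τ τ' ε δ)), normMap F θ τ τ' ε δ p ∈ ((E.norm τ').quad.turn ε).closedRegion := by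
    intro p hp
    obtain ⟨-, L, hL, -⟩ := hlin p (hcl p hp)
    exact (hEg.turn ε).closure_region_subset
      (hL.continuousAt.continuousWithinAt.mem_closure hp fun x hx => hx.2)
  -- A solution that collapses at `2π` cannot exist on `[0, 2π]`, while the map is defined on the
  -- closure. For the α-sides of the target the same is said of the inverse.
  have hβ : ∀ p ∈ closure (transitSet (D.norm τ).quad ((E.norm τ').quad.turn ε)
      (normMap F θ τ τ' ε δ)), ¬(p.1 = (D.norm τ).quad.bm p.2 ∨ p.1 = (D.norm τ).quad.bp p.2) :=
    fun p hp e => hF.not_mem_fwdDom rfl (hD.collapse_β (hclD p hp) e) (hdom p hp)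
  have hcol : ∀ c ∈ ((E.norm τ').quad.turn ε).closedRegion,
      (c.2 = ((E.norm τ').quad.turn ε).am c.1 ∨ c.2 = ((E.norm τ').quad.turn ε).ap c.1) →
      CollapsesBackward F θ (shift θ δ) (refl τ' (ε • c)) := fun c hc e =>
    hE.collapse_α (Quad.mem_closedRegion_of_turn hε hc) (Quad.alpha_of_turn hε e)
  have hα : ∀ p ∈ closure (transitSet (D.norm τ).quad ((E.norm τ').quad.turn ε)
      (normMap F θ τ τ' ε δ)), ¬((normMap F θ τ τ' ε δ p).2 =
        ((E.norm τ').quad.turn ε).am (normMap F θ τ τ' ε δ p).1 ∨ (normMap F θ τ τ' ε δ p).2 =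
        ((E.norm τ').quad.turn ε).ap (normMap F θ τ τ' ε δ p).1) := fun p hp e =>
    hF.not_mem_bwdDom (coe_shift θ δ) (hcol _ (hclE p hp) e) (normMap_mem hF hε (hdom p hp))
  have hslice : Continuous fun p : ℝ × ℝ => (δ, p) := by fun_prop
  refine ⟨hDg, hEg.turn ε, hρ, fun p hp => ?_, fun p hp => (hlin p (hcl p hp)).2,
    fun p hp e => hβ p hp (Or.inl e), fun p hp e => hβ p hp (Or.inr e),
    fun p hp e => hα p hp (Or.inl e), fun p hp e => hα p hp (Or.inr e),
    fun p hp => normInv_normMap hF hε (hdom p hp), fun p hp => ?_, fun p hp => ?_, ?_⟩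
  · exact (ContinuousAt.comp (f := fun p : ℝ × ℝ => (δ, p))
      (continuousAt_normMap (z := (δ, p)) hF (mem_fwdDom_of_mem_region hF hD hp))
      hslice.continuousAt).continuousWithinAt
  · exact ContinuousAt.comp (f := fun p : ℝ × ℝ => (δ, p))
      (continuousAt_normInv (z := (δ, normMap F θ τ τ' ε δ p)) hF
        (normMap_mem hF hε (hdom p (subset_closure hp)))) hslice.continuousAt
  · have ho : IsOpen {q : ℝ × ℝ | (δ, refl τ' (ε • q)) ∈ bwdDom F θ} :=
      (hF.isOpen_bwdDom θ).preimage (hslice.comp ((continuous_refl τ').comp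
        (continuous_id.const_smul ε)))
    filter_upwards [ho.mem_nhds (normMap_mem hF hε (hdom p (subset_closure hp)))] with q hq
    exact normMap_normInv hF hε hq
  -- Images of the source and points of the target island both have solutions on the preceding
  -- period, so the loop lies in the domain of the inverse and the winding argument applies.
  · intro a b ℓ hab hℓ hℓab hmem c hc e
    have hd : ∀ t ∈ Icc a b, (δ, refl τ' (ε • ℓ t)) ∈ bwdDom F θ := by
      intro t ht
      rcases hmem t ht with ⟨p, hp, ep⟩ | hq
      · rw [← ep]
        exact normMap_mem hF hε (mem_fwdDom_of_mem_region hF hD hp)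
      · refine mem_bwdDom_of_mem_region hF hE ?_
        rw [← Quad.mem_turn_region hε, smul_smul_self hε]
        exact hq
    have hε0 : ε ≠ 0 := by rcases hε with rfl | rfl <;> norm_num
    have hεε : ε * ε = 1 := by rcases hε with rfl | rfl <;> norm_num
    have := hF.hasClosedLog (coe_shift θ δ) (hcol c hc e) hab
      ((continuous_refl τ').comp_continuousOn (hℓ.const_smul ε))
      (congrArg (fun q => refl τ' (ε • q)) hℓab) hd hε0 (mul_ne_zero hε0 τ'.sgn_ne_zero)
    convert this using 3 with t
    · simp only [Function.comp, Pi.smul_apply, refl, Prod.smul_fst, smul_eq_mul]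
      linear_combination (-((ℓ t).1 - c.1)) * hεε
    · simp only [Function.comp, Pi.smul_apply, refl, Prod.smul_snd, smul_eq_mul]
      linear_combination (-((ℓ t).2 - c.2)) * hεε - ((ℓ t).2 - c.2) * ε * ε * τ'.sgn_mul_self

end

end StripMap
end

/-! ### Continuity in the angle and the uniform bound. -/

noncomputable section

namespace StripMap

lemma Arc.IsContinuousFamily.continuous_ext {c : Real.Angle → Arc} (h : Arc.IsContinuousFamily c) :
    Continuous fun z : Real.Angle × ℝ => (c z.1).ext z.2 := by
  obtain ⟨h1, h2, h3⟩ := h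
  have k1 : Continuous fun z : Real.Angle × ℝ => (c z.1).lo := h1.comp continuous_fst
  have k2 : Continuous fun z : Real.Angle × ℝ => (c z.1).hi := h2.comp continuous_fst
  exact h3.comp_continuous (f := fun z : Real.Angle × ℝ =>
    (z.1, max (c z.1).lo (min (c z.1).hi z.2))) (continuous_fst.prodMk
      (k1.max (k2.min continuous_snd))) fun z => (c z.1).clamp_mem z.2

/-- The four functions that describe a family of quadrangles are continuous. -/
structure Quad.IsContinuousFamily (K : ℝ → Quad) : Prop where
  am : Continuous fun z : ℝ × ℝ => (K z.1).am z.2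
  ap : Continuous fun z : ℝ × ℝ => (K z.1).ap z.2
  bm : Continuous fun z : ℝ × ℝ => (K z.1).bm z.2
  bp : Continuous fun z : ℝ × ℝ => (K z.1).bp z.2

namespace Quad.IsContinuousFamily

variable {K : ℝ → Quad} {γ M : ℝ}

lemma sCo (h : IsContinuousFamily K) (hg : ∀ δ, (K δ).IsGood γ M) :
    Continuous fun z : ℝ × ℝ × ℝ => (K z.1).sCo z.2 := by
  have c : Continuous fun z : ℝ × ℝ × ℝ => (z.1, z.2.1) := by fun_prop
  have h1 := h.am.comp c
  have h2 := h.ap.comp c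
  exact ((continuous_snd.comp continuous_snd).sub h1).div (h2.sub h1) fun z => by
    have := (hg z.1).a_lt z.2.1
    exact (sub_pos.2 this).ne'

lemma rCo (h : IsContinuousFamily K) (hg : ∀ δ, (K δ).IsGood γ M) :
    Continuous fun z : ℝ × ℝ × ℝ => (K z.1).rCo z.2 := by
  have c : Continuous fun z : ℝ × ℝ × ℝ => (z.1, z.2.2) := by fun_prop
  have h1 := h.bm.comp c
  have h2 := h.bp.comp c
  exact ((continuous_fst.comp continuous_snd).sub h1).div (h2.sub h1) fun z => by
    have := (hg z.1).b_lt z.2.2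
    exact (sub_pos.2 this).ne'

end Quad.IsContinuousFamily

lemma IsDonut.isContinuousFamily {F : ℝ → ℝ → ℝ → ℝ} {θ : ℝ} {γ : ℝ≥0} {τ : MonoType}
    {D : Real.Angle → Quadrangle} (h : IsDonut F θ γ τ D) {φ : ℝ → Real.Angle} (hφ : Continuous φ) :
    Quad.IsContinuousFamily fun δ => ((D (φ δ)).norm τ).quad := by
  have c1 : Continuous fun z : ℝ × ℝ => (φ z.1, z.2) :=
    (hφ.comp continuous_fst).prodMk continuous_snd
  have c2 : Continuous fun z : ℝ × ℝ => (φ z.1, -z.2) :=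
    (hφ.comp continuous_fst).prodMk continuous_snd.neg
  cases τ with
  | increasing =>
    exact ⟨h.αm_cont.continuous_ext.comp c1, h.αp_cont.continuous_ext.comp c1,
      h.βm_cont.continuous_ext.comp c1, h.βp_cont.continuous_ext.comp c1⟩
  | decreasing =>
    refine ⟨(h.αp_cont.continuous_ext.comp c1).neg, (h.αm_cont.continuous_ext.comp c1).neg, ?_, ?_⟩
    · simp only [Quadrangle.norm, Quadrangle.flip, Quadrangle.quad, Arc.negArg_ext]
      exact h.βm_cont.continuous_ext.comp c2
    · simp only [Quadrangle.norm, Quadrangle.flip, Quadrangle.quad, Arc.negArg_ext]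
      exact h.βp_cont.continuous_ext.comp c2

section

variable {F : ℝ → ℝ → ℝ → ℝ} {θ δ : ℝ} {γ : ℝ≥0} {τ τ' : MonoType} {D E : Quadrangle} {M ρ B : ℝ}

lemma isCompact_closure_transit (hF : IsAdmissible F) (hDg : (D.norm τ).quad.IsGood γ M) :
    IsCompact (closure (transit F θ δ D E)) := by
  have h1 : IsCompact (closure (transitSet (D.norm τ).quad ((E.norm .increasing).quad.turn 1)
      (normMap F θ τ .increasing 1 δ))) := hDg.isCompact_closedRegion.of_isClosed_subset isClosed_closure
    ((closure_mono fun _ hp => hp.1).trans hDg.closure_region_subset)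
  rw [closure_transitSet_turn hF (Or.inl rfl)] at h1
  have h2 := h1.image (continuous_refl τ)
  rwa [image_preimage_eq _ (show Function.Surjective (refl τ) from (reflHomeo τ).surjective)] at h2

/-- The hypotheses at one angle give a crossing. -/
lemma exists_crossing (hF : IsAdmissible F) (hD : IsIsland F θ δ γ τ D)
    (hE : IsIsland F θ (shift θ δ) γ τ' E) (hDg : (D.norm τ).quad.IsGood γ M)
    (hEg : (E.norm τ').quad.IsGood γ M) (h1 : SignCondition F θ δ τ τ' D E) (hρ : 1 < ρ)
    (h2 : ∀ p ∈ closure (transit F θ δ D E), ρ ≤ |jacobian F θ δ p 0 0|)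
    (hB : ∀ p ∈ closure (transit F θ δ D E), ‖fderiv ℝ (poincare F θ δ) p‖ ≤ B) :
    ∃ ε : ℝ, (ε = 1 ∨ ε = -1) ∧ Crossing (D.norm τ).quad ((E.norm τ').quad.turn ε)
      (normMap F θ τ τ' ε δ) (normInv F θ τ τ' ε δ) γ M ρ B (τ.sgn * τ'.sgn) := by
  obtain ⟨-, P, hP, hall⟩ := h1
  obtain ⟨ε, hε, hA⟩ := hP.exists_sign
  refine ⟨ε, hε, crossing_normMap hF hD hE hDg hEg hε hρ fun p hp => ⟨(hall _ hp).1, ?_⟩⟩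
  exact exists_stretching hF hε (hall _ hp).1 (hA _ (hall _ hp).2) (h2 _ hp) (hB _ hp)

lemma sgn_mul_mul_self (τ τ' : MonoType) : (τ.sgn * τ'.sgn) * (τ.sgn * τ'.sgn) = 1 := by
  linear_combination (τ'.sgn * τ'.sgn) * τ.sgn_mul_self + τ'.sgn_mul_self

end

section

variable {F : ℝ → ℝ → ℝ → ℝ} {θ : ℝ} {γ : ℝ≥0} {τ τ' : MonoType} {D E : Real.Angle → Quadrangle}
  {M : ℝ} {ρ : Real.Angle → ℝ}

lemma continuous_shift_coe (θ : ℝ) : Continuous fun δ : ℝ => shift θ (δ : Real.Angle) :=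
  Real.Angle.continuous_coe.add continuous_const

/-- The Poincaré maps between the slices of two donuts form a family of crossings. -/
lemma crossingFamily (hF : IsAdmissible F) (hD : IsDonut F θ γ τ D) (hE : IsDonut F θ γ τ' E)
    (hDM : ∀ Δ, ((D Δ).norm τ).quad.IsGood γ M) (hEM : ∀ Δ, ((E Δ).norm τ').quad.IsGood γ M)
    (h1 : ∀ Δ, SignCondition F θ Δ τ τ' (D Δ) (E (shift θ Δ)))
    (h2 : ∀ Δ, 1 < ρ Δ ∧ ∀ p ∈ closure (transit F θ Δ (D Δ) (E (shift θ Δ))),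
      ρ Δ ≤ |jacobian F θ Δ p 0 0|) :
    CrossingFamily (fun δ => ((D δ).norm τ).quad) (fun δ => ((E (shift θ δ)).norm τ').quad)
      (fun δ => normMap F θ τ τ' 1 δ) (fun δ => normInv F θ τ τ' 1 δ)
      {z | (z.1, refl τ z.2) ∈ fwdDom F θ} {z | (z.1, refl τ' ((1 : ℝ) • z.2)) ∈ bwdDom F θ}
      γ M ((1 + γ) * M) := by
  have hDc := hD.isContinuousFamily Real.Angle.continuous_coe
  have hEc := hE.isContinuousFamily (continuous_shift_coe θ)
  have hcross : ∀ δ : ℝ, ∃ ε B : ℝ, (ε = 1 ∨ ε = -1) ∧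
      Crossing ((D δ).norm τ).quad (((E (shift θ δ)).norm τ').quad.turn ε)
        (normMap F θ τ τ' ε δ) (normInv F θ τ τ' ε δ) γ M (ρ δ) B (τ.sgn * τ'.sgn) := by
    intro δ
    -- The bound found here may depend on the angle. This does no harm: the constant `(1 + γ) * M`
    -- of the family does not involve it.
    obtain ⟨B, A, -, hKA, hev⟩ := exists_bound_fderiv (hF.contDiff_fwd θ) Real.two_pi_pos.le
      (isCompact_closure_transit (E := E (shift θ δ)) hF (hDM δ))
      (fun p hp => (hF.mem_fwdDom_iff rfl).2 ((h1 δ).2.choose_spec.2 p hp).1)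
    obtain ⟨ε, hε, h⟩ := exists_crossing (B := max B 0) hF (hD.island δ) (hE.island _) (hDM δ) (hEM _)
      (h1 δ) (h2 δ).1 (h2 δ).2 (fun p hp => by
        by_cases hd : DifferentiableAt ℝ (poincare F θ δ) p
        · refine (hev.self_of_nhds p (hKA hp) _ ?_).trans (le_max_left _ _)
          have e := hF.fwdMap_eq (θ := θ) (δ := δ) rfl
          change HasFDerivAt (fwdMap F θ δ) (fderiv ℝ (poincare F θ δ) p) p
          rw [e]
          exact hd.hasFDerivAt
        · rw [fderiv_zero_of_not_differentiableAt hd, norm_zero]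
          exact le_max_right _ _)
    exact ⟨ε, _, hε, h⟩
  -- The sign `ε` is found for each angle separately, but the transit set does not depend on it.
  -- Hence the family can be formed with `ε = 1`, and the crossings only supply connectedness and
  -- the small motions.
  have hset : ∀ δ ε : ℝ, (ε = 1 ∨ ε = -1) →
      transitSet ((D δ).norm τ).quad ((E (shift θ δ)).norm τ').quad (normMap F θ τ τ' 1 δ) =
        transitSet ((D δ).norm τ).quad (((E (shift θ δ)).norm τ').quad.turn ε)
          (normMap F θ τ τ' ε δ) := fun δ ε hε => by
    rw [transitSet_turn hF hε, ← transitSet_turn hF (Or.inl rfl), Quad.turn_one]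
  have hset1 : ∀ δ : ℝ, transitSet ((D δ).norm τ).quad ((E (shift θ δ)).norm τ').quad
      (normMap F θ τ τ' 1 δ) = refl τ ⁻¹' transit F θ δ (D δ) (E (shift θ δ)) := fun δ => by
    rw [hset δ 1 (Or.inl rfl), transitSet_turn hF (Or.inl rfl)]
  refine ⟨fun δ => hDM δ, fun δ => hEM _, hDc.sCo fun δ => hDM δ, hDc.rCo fun δ => hDM δ,
    hEc.sCo fun δ => hEM _, hEc.rCo fun δ => hEM _, ?_, ?_, fun z hz => continuousAt_normMap hF hz,
    fun z hz => continuousAt_normInv hF hz, fun δ p hp => normMap_mem hF (Or.inl rfl) hp,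
    fun δ p hp => normInv_normMap hF (Or.inl rfl) hp,
    fun δ p hp => mem_fwdDom_of_mem_region hF (hD.island δ) hp, ?_, ?_, ?_, ?_, ?_, ?_⟩
  · exact (hF.isOpen_fwdDom θ).preimage
      (continuous_fst.prodMk ((continuous_refl τ).comp continuous_snd))
  · exact (hF.isOpen_bwdDom θ).preimage
      (continuous_fst.prodMk ((continuous_refl τ').comp (continuous_snd.const_smul (1 : ℝ))))
  · intro δ p hp hpU
    have h := ((hDM δ).mem_closedRegion_iff.1 hp).2
    have hne : ¬(p.1 = ((D δ).norm τ).quad.bm p.2 ∨ p.1 = ((D δ).norm τ).quad.bp p.2) := fun e =>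
      hF.not_mem_fwdDom rfl ((hD.island δ).collapse_β hp e) hpU
    rw [not_or] at hne
    refine ⟨lt_of_le_of_ne h.1 fun e => hne.1 ?_, lt_of_le_of_ne h.2 fun e => hne.2 ?_⟩
    · rw [← Quad.IsGood.vLeaf_zero]; exact (hDM δ).eq_vLeaf_iff.2 e.symm
    · rw [← Quad.IsGood.vLeaf_one]; exact (hDM δ).eq_vLeaf_iff.2 e
  · intro δ q hq hqW
    have h := ((hEM (shift θ δ)).mem_closedRegion_iff.1 hq).1
    have hne : ¬(q.2 = ((E (shift θ δ)).norm τ').quad.am q.1 ∨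
        q.2 = ((E (shift θ δ)).norm τ').quad.ap q.1) := fun e => by
      refine hF.not_mem_bwdDom (coe_shift θ δ) ((hE.island _).collapse_α hq e) ?_
      rw [mem_ofPred_eq, one_smul] at hqW
      exact hqW
    rw [not_or] at hne
    refine ⟨lt_of_le_of_ne h.1 fun e => hne.1 ?_, lt_of_le_of_ne h.2 fun e => hne.2 ?_⟩
    · rw [← Quad.IsGood.hLeaf_zero]; exact (hEM _).eq_hLeaf_iff.2 e.symm
    · rw [← Quad.IsGood.hLeaf_one]; exact (hEM _).eq_hLeaf_iff.2 e
  · intro δ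
    rw [hset1 δ]
    exact (h1 δ).1.preimage (reflHomeo τ).surjective
  · intro δ p hp
    rw [hset δ 1 (Or.inl rfl), closure_transitSet_turn hF (Or.inl rfl)] at hp
    exact (hF.mem_fwdDom_iff rfl).2 ((h1 δ).2.choose_spec.2 _ hp).1
  · intro δ
    obtain ⟨ε, B, hε, h⟩ := hcross δ
    rw [hset δ ε hε]
    exact h.isPreconnected_transitSet
  · intro δ a ha ha' p hp
    obtain ⟨ε, B, hε, h⟩ := hcross δ
    rw [hset δ ε hε] at hp ⊢
    obtain ⟨p₁, hp₁, p₂, hp₂, d1, d2, s, r⟩ := h.exists_interior (sgn_mul_mul_self τ τ') ha ha' hp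
    have hsm : ∀ p, normMap F θ τ τ' ε δ p = ε • normMap F θ τ τ' 1 δ p := fun p => by
      simp [normMap]
    refine ⟨p₁, hp₁, p₂, hp₂, d1, ?_, s, (hEM _).rCo_turn_mem hε (by rw [← hsm]; exact r)⟩
    rw [hsm, hsm, dist_smul₀] at d2
    have : ‖ε‖ = 1 := by rcases hε with rfl | rfl <;> simp
    rwa [this, one_mul] at d2

/-- The linearizations are bounded, uniformly in the angle. -/
theorem exists_uniform_bound (hF : IsAdmissible F) (hD : IsDonut F θ γ τ D) (hE : IsDonut F θ γ τ' E)
    (hDM : ∀ Δ, ((D Δ).norm τ).quad.IsGood γ M) (hEM : ∀ Δ, ((E Δ).norm τ').quad.IsGood γ M)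
    (h1 : ∀ Δ, SignCondition F θ Δ τ τ' (D Δ) (E (shift θ Δ)))
    (h2 : ∀ Δ, 1 < ρ Δ ∧ ∀ p ∈ closure (transit F θ Δ (D Δ) (E (shift θ Δ))),
      ρ Δ ≤ |jacobian F θ Δ p 0 0|) :
    ∃ B : ℝ, ∀ Δ, ∀ p ∈ closure (transit F θ Δ (D Δ) (E (shift θ Δ))),
      ‖fderiv ℝ (poincare F θ Δ) p‖ ≤ B := by
  have hfam := crossingFamily hF hD hE hDM hEM h1 h2
  -- For angles near `δ₀` the closures stay in a neighbourhood of the closure over `δ₀`, on which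
  -- derivatives are bounded uniformly.
  have hloc : ∀ δ₀ : ℝ, ∃ B : ℝ, ∀ᶠ δ : ℝ in 𝓝 δ₀,
      ∀ p ∈ closure (transit F θ δ (D δ) (E (shift θ δ))), ‖fderiv ℝ (poincare F θ δ) p‖ ≤ B := by
    intro δ₀
    obtain ⟨B, A, hA, hKA, hev⟩ := exists_bound_fderiv (hF.contDiff_fwd θ) Real.two_pi_pos.le
      (isCompact_closure_transit (E := E (shift θ δ₀)) hF (hDM δ₀))
      (fun p hp => (hF.mem_fwdDom_iff rfl).2 ((h1 δ₀).2.choose_spec.2 p hp).1)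
    have hcl : ∀ δ : ℝ, closure (transitSet ((D δ).norm τ).quad ((E (shift θ δ)).norm τ').quad
        (normMap F θ τ τ' 1 δ)) = refl τ ⁻¹' closure (transit F θ δ (D δ) (E (shift θ δ))) := fun δ => by
      rw [← closure_transitSet_turn (τ' := τ') hF (Or.inl rfl), Quad.turn_one]
    have hsub := hfam.eventually_closure_subset (δ₀ := δ₀) (A := refl τ ⁻¹' A)
      (hA.preimage (continuous_refl τ)) (by rw [hcl]; exact preimage_mono hKA)
    refine ⟨max B 0, ?_⟩
    filter_upwards [hsub, hev] with δ hs hb p hp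
    by_cases hd : DifferentiableAt ℝ (poincare F θ δ) p
    · refine (hb p ?_ _ ?_).trans (le_max_left _ _)
      · have := hs (a := refl τ p) (by rw [hcl, mem_preimage, refl_refl]; exact hp)
        rwa [mem_preimage, refl_refl] at this
      · have e := hF.fwdMap_eq (θ := θ) (δ := δ) rfl
        change HasFDerivAt (fwdMap F θ δ) (fderiv ℝ (poincare F θ δ) p) p
        rw [e]
        exact hd.hasFDerivAt
    · rw [fderiv_zero_of_not_differentiableAt hd, norm_zero]
      exact le_max_right _ _
  -- The interval `[-π, π]` contains a representative of every angle.
  obtain ⟨B, hB⟩ := (isCompact_Icc (a := -Real.pi) (b := Real.pi)).induction_on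
    (p := fun K => ∃ B : ℝ, ∀ δ ∈ K,
      ∀ p ∈ closure (transit F θ (δ : Real.Angle) (D δ) (E (shift θ δ))),
        ‖fderiv ℝ (poincare F θ δ) p‖ ≤ B) ⟨0, fun _ h => h.elim⟩
    (fun s t hst ⟨B, hB⟩ => ⟨B, fun δ hδ => hB δ (hst hδ)⟩)
    (fun s t ⟨B, hB⟩ ⟨B', hB'⟩ => ⟨max B B', fun δ hδ p hp => hδ.elim
      (fun h => (hB δ h p hp).trans (le_max_left _ _))
      (fun h => (hB' δ h p hp).trans (le_max_right _ _))⟩)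
    (fun δ _ => by
      obtain ⟨B, hB⟩ := hloc δ
      exact ⟨_, mem_nhdsWithin_of_mem_nhds hB, B, fun δ' hδ' => hδ'⟩)
  refine ⟨B, fun Δ => ?_⟩
  have := hB Δ.toReal ⟨(Real.Angle.neg_pi_lt_toReal Δ).le, Real.Angle.toReal_le_pi Δ⟩
  rwa [Real.Angle.coe_toReal] at this

end

end StripMap
end

noncomputable section

namespace StripMap

/-! ### Strips in normal position -/

namespace Arc

lemma thickness_negVal (c d : Arc) : thickness d.negVal c.negVal = thickness c d := by
  simp only [thickness, negVal_ext, neg_sub_neg]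
  rw [show min d.negVal.lo c.negVal.lo = min c.lo d.lo from min_comm _ _,
    show max d.negVal.hi c.negVal.hi = max c.hi d.hi from max_comm _ _]

lemma negVal_negVal (c : Arc) : c.negVal.negVal = c := by simp [negVal]

lemma negArg_negArg (c : Arc) : c.negArg.negArg = c := by simp [negArg]

end Arc

lemma Quadrangle.flip_flip (D : Quadrangle) : D.flip.flip = D := by
  simp [flip, Arc.negVal_negVal, Arc.negArg_negArg]

lemma Quadrangle.flip_region (D : Quadrangle) : D.flip.region = refl .decreasing ⁻¹' D.region :=
  Set.ext fun _ => D.mem_norm_region (τ := .decreasing)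

lemma IsHCurve.flip {γ : ℝ≥0} {τ : MonoType} {D : Quadrangle} {c : Arc} (h : IsHCurve γ τ D c) :
    IsHCurve γ τ.opposite D.flip c.negVal where
  lipschitz := h.lipschitz.negVal
  type := by
    have := h.type
    cases τ with
    | increasing => exact MonotoneOn.neg this
    | decreasing => exact AntitoneOn.neg this
  left_mem := by
    have := h.left_mem
    exact ⟨⟨neg_le_neg this.1.2, neg_le_neg this.1.1⟩, by
      have := this.2
      simpa [Quadrangle.flip, Arc.negVal, Arc.negArg] using this⟩
  right_mem := by
    have := h.right_mem
    exact ⟨⟨neg_le_neg this.1.2, neg_le_neg this.1.1⟩, by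
      have := this.2
      simpa [Quadrangle.flip, Arc.negVal, Arc.negArg] using this⟩
  subset := fun p hp => by
    rw [Quadrangle.flip_region]
    have e := (reflHomeo .decreasing).preimage_closure D.region
    have : p ∈ refl .decreasing ⁻¹' closure D.region := h.subset (mem_hGraph_of_negVal hp)
    exact e.subset this

lemma IsHStrip.flip {γ : ℝ≥0} {τ : MonoType} {D : Quadrangle} {H : Set (ℝ × ℝ)} {c d : Arc}
    (h : IsHStrip γ τ D H c d) :
    IsHStrip γ τ.opposite D.flip (refl .decreasing ⁻¹' H) d.negVal c.negVal where
  lower := h.upper.flip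
  upper := h.lower.flip
  below := fun t => neg_lt_neg (h.below t)
  eq := by
    rw [h.eq]
    ext p
    rw [Quadrangle.flip_region]
    simp only [refl, MonoType.sgn, Arc.negVal_ext, mem_ofPred_eq, mem_preimage, neg_one_mul]
    constructor
    · rintro ⟨h1, h2, h3⟩
      exact ⟨h1, by linarith, by linarith⟩
    · rintro ⟨h1, h2, h3⟩
      exact ⟨h1, by linarith, by linarith⟩

lemma refl_preimage_increasing (H : Set (ℝ × ℝ)) : refl .increasing ⁻¹' H = H :=
  Set.ext fun p => by rw [mem_preimage, refl_increasing]

lemma IsHStrip.norm {γ : ℝ≥0} {τ : MonoType} {D : Quadrangle} {H : Set (ℝ × ℝ)} {c d : Arc}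
    (h : IsHStrip γ τ D H c d) : ∃ c' d' : Arc,
      IsHStrip γ .increasing (D.norm τ) (refl τ ⁻¹' H) c' d' ∧
        Arc.thickness c' d' = Arc.thickness c d := by
  cases τ with
  | increasing => exact ⟨c, d, by rw [refl_preimage_increasing]; exact h, rfl⟩
  | decreasing => exact ⟨_, _, h.flip, Arc.thickness_negVal c d⟩

lemma IsHStrip.of_norm {γ : ℝ≥0} {τ : MonoType} {D : Quadrangle} {H : Set (ℝ × ℝ)} {c d : Arc}
    (h : IsHStrip γ .increasing (D.norm τ) H c d) : ∃ c' d' : Arc,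
      IsHStrip γ τ D (refl τ ⁻¹' H) c' d' ∧ Arc.thickness c' d' = Arc.thickness c d := by
  cases τ with
  | increasing => exact ⟨c, d, by rw [refl_preimage_increasing]; exact h, rfl⟩
  | decreasing =>
    have := h.flip
    rw [show (D.norm .decreasing).flip = D from D.flip_flip] at this
    exact ⟨_, _, this, Arc.thickness_negVal c d⟩

/-- The quadrangle cut out by two `h`-curves. -/
def stripQuad (D : Quadrangle) (c d : Arc) : Quad := ⟨c.ext, d.ext, D.βm.ext, D.βp.ext⟩

section

variable {γ : ℝ≥0} {D : Quadrangle} {M : ℝ} {c d : Arc}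

/-- To the left of the curve the falling left side puts `p` above the left end, where the curve
dominates the rising lower side of `D`; to the right `p` lies below the right end. The continuation
by constants thus stays on the correct side of the borders of the island wherever it matters. -/
lemma IsHCurve.compare (hD : D.quad.IsGood γ M) (h : IsHCurve γ .increasing D c) {p : ℝ × ℝ}
    (h1 : D.βm.ext p.2 ≤ p.1) (h2 : p.1 ≤ D.βp.ext p.2) :
    (c.ext p.1 ≤ p.2 → D.αm.ext p.1 ≤ c.ext p.1) ∧ (p.2 ≤ c.ext p.1 → c.ext p.1 ≤ D.αp.ext p.1) := by
  have hmem : ∀ t ∈ Icc c.lo c.hi, D.αm.ext t ≤ c.f t ∧ c.f t ≤ D.αp.ext t := fun t ht => by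
    have := hD.closure_region_subset (h.subset (show (t, c.f t) ∈ c.hGraph from ⟨ht, rfl⟩))
    exact ⟨this.1, this.2.1⟩
  have hl : c.lo = D.βm.ext (c.f c.lo) := by
    rw [Sweep.ext_of_mem h.left_mem.1]; exact h.left_mem.2
  have hr : c.hi = D.βp.ext (c.f c.hi) := by
    rw [Sweep.ext_of_mem h.right_mem.1]; exact h.right_mem.2
  rcases lt_or_ge p.1 c.lo with k | k
  · rw [Sweep.ext_of_le k.le]
    have hlt : c.f c.lo < p.2 := by
      by_contra hcon
      have := hD.bm_anti (not_lt.1 hcon)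
      simp only [Quadrangle.quad] at this
      linarith
    refine ⟨fun _ => ?_, fun hc => absurd hc (not_le.2 hlt)⟩
    exact (hD.am_mono k.le).trans (hmem _ (left_mem_Icc.2 c.lo_lt_hi.le)).1
  rcases lt_or_ge c.hi p.1 with k' | k'
  · rw [Sweep.ext_of_ge k'.le]
    have hlt : p.2 < c.f c.hi := by
      by_contra hcon
      have := hD.bp_anti (not_lt.1 hcon)
      simp only [Quadrangle.quad] at this
      linarith
    refine ⟨fun hc => absurd hc (not_le.2 hlt), fun _ => ?_⟩
    exact (hmem _ (right_mem_Icc.2 c.lo_lt_hi.le)).2.trans (hD.ap_mono k'.le)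
  · rw [Sweep.ext_of_mem ⟨k, k'⟩]
    exact ⟨fun _ => (hmem _ ⟨k, k'⟩).1, fun _ => (hmem _ ⟨k, k'⟩).2⟩

lemma stripQuad_isGood (hD : D.quad.IsGood γ M) {H : Set (ℝ × ℝ)}
    (h : IsHStrip γ .increasing D H c d) :
    (stripQuad D c d).IsGood γ (max M (Arc.thickness c d)) where
  am_mono := Arc.ext_mono h.lower.type
  ap_mono := Arc.ext_mono h.upper.type
  bm_anti := hD.bm_anti
  bp_anti := hD.bp_anti
  a_lt := h.below
  b_lt := hD.b_lt
  am_lip := Arc.ext_sub_le h.lower.lipschitz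
  ap_lip := Arc.ext_sub_le h.upper.lipschitz
  bm_lip := hD.bm_lip
  bp_lip := hD.bp_lip
  a_width := fun t => ((le_abs_self _).trans
    (Arc.abs_ext_sub_le_thickness h.lower.lipschitz h.upper.lipschitz t)).trans (le_max_right _ _)
  b_width := fun t => (hD.b_width t).trans (le_max_left _ _)
  bdd := by
    obtain ⟨C₁, h₁⟩ := Arc.exists_ext_bound h.lower.lipschitz
    obtain ⟨C₂, h₂⟩ := Arc.exists_ext_bound h.upper.lipschitz
    obtain ⟨C₃, h₃⟩ := hD.bdd
    exact ⟨max (max C₁ C₂) C₃, fun t =>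
      ⟨(h₁ t).trans (le_max_of_le_left (le_max_left _ _)),
        (h₂ t).trans (le_max_of_le_left (le_max_right _ _)),
        (h₃ t).2.2.1.trans (le_max_right _ _), (h₃ t).2.2.2.trans (le_max_right _ _)⟩⟩

lemma stripQuad_region (hD : D.quad.IsGood γ M) {H : Set (ℝ × ℝ)}
    (h : IsHStrip γ .increasing D H c d) : (stripQuad D c d).region = H := by
  rw [h.eq]
  ext p
  constructor
  · rintro ⟨h1, h2, h3, h4⟩
    exact ⟨⟨((h.lower.compare hD h3.le h4.le).1 h1.le).trans_lt h1,
      h2.trans_le ((h.upper.compare hD h3.le h4.le).2 h2.le), h3, h4⟩, h1, h2⟩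
  · rintro ⟨⟨-, -, h3, h4⟩, h1, h2⟩
    exact ⟨h1, h2, h3, h4⟩

end

/-- Crossings restrict to strips of the source. -/
lemma Crossing.restrict {S S' E : Quad} {Q T : ℝ × ℝ → ℝ × ℝ} {γ M M' ρ B κ : ℝ}
    (h : Crossing S E Q T γ M ρ B κ) (hS : S'.IsGood γ M') (hM : M ≤ M') (hm : S'.bm = S.bm)
    (hp : S'.bp = S.bp) (hsub : S'.region ⊆ S.region) : Crossing S' E Q T γ M' ρ B κ := by
  have hV : transitSet S' E Q ⊆ transitSet S E Q := fun p hp => ⟨hsub hp.1, hp.2⟩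
  have hVc := closure_mono hV
  refine ⟨hS, { h.target with
      a_width := fun u => (h.target.a_width u).trans hM
      b_width := fun y => (h.target.b_width y).trans hM }, h.one_lt, h.cont.mono hsub,
    fun p hp => h.lin p (hVc hp), fun p hp => by rw [hm]; exact h.left_avoid p (hVc hp),
    fun p h' => by rw [hp]; exact h.right_avoid p (hVc h'), fun p hp => h.lower_avoid p (hVc hp),
    fun p hp => h.upper_avoid p (hVc hp), fun p hp => h.leftInv p (hVc hp),
    fun p hp => h.invCont p (hV hp), fun p hp => h.rightInv p (hV hp), ?_⟩
  intro a b ℓ hab hl he hmem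
  exact h.wind a b ℓ hab hl he fun t ht => (hmem t ht).imp (fun h => image_mono hsub h) id

/-- The half turn of a graph about the origin. -/
def Arc.rot (c : Arc) : Arc := c.negVal.negArg

lemma Arc.rot_ext (c : Arc) (t : ℝ) : c.rot.ext t = -c.ext (-t) := by
  rw [rot, negArg_ext, negVal_ext]

/-- The set `A` is the band of `K` between two nondecreasing `γ'`-Lipschitz curves, of thickness at
most `w`. -/
structure Quad.IsBand (K : Quad) (γ' w : ℝ) (A : Set (ℝ × ℝ)) (c d : Arc) : Prop where
  lower : Sweep.Spans K c
  upper : Sweep.Spans K d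
  lower_lip : ∀ x y, x ≤ y → c.f y - c.f x ≤ γ' * (y - x)
  upper_lip : ∀ x y, x ≤ y → d.f y - d.f x ≤ γ' * (y - x)
  lower_subset : c.hGraph ⊆ closure K.region
  upper_subset : d.hGraph ⊆ closure K.region
  below : ∀ t, c.ext t < d.ext t
  eq : A = {p ∈ K.region | c.ext p.1 < p.2 ∧ p.2 < d.ext p.1}
  width : ∀ t, d.ext t - c.ext t ≤ w

namespace Quad

variable {K : Quad} {γ' w : ℝ} {A : Set (ℝ × ℝ)} {c d : Arc}

lemma rot_rot (K : Quad) : K.rot.rot = K := by simp [rot]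

lemma spans_rot (h : Sweep.Spans K c) : Sweep.Spans K.rot c.rot where
  mono := fun _ _ hxy => neg_le_neg (h.mono (neg_le_neg hxy))
  cont := (h.cont.comp continuous_neg).neg
  left := by simp only [Arc.rot, Arc.negVal, Arc.negArg, rot, neg_neg]; rw [← h.right]
  right := by simp only [Arc.rot, Arc.negVal, Arc.negArg, rot, neg_neg]; rw [← h.left]

lemma hGraph_rot_subset (h : c.hGraph ⊆ closure K.region) : c.rot.hGraph ⊆ closure K.rot.region := by
  intro p hp
  have e : K.rot.region = -K.region := Set.ext fun q => by
    have := mem_rot_region (K := K) (p := -q)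
    rwa [neg_neg] at this
  rw [e, closure_neg_set, Set.mem_neg]
  refine h ⟨Arc.neg_mem_of_negArg hp.1, ?_⟩
  have := hp.2
  simp only [Arc.rot, Arc.negVal, Arc.negArg] at this
  simp [this]

lemma IsBand.rot (h : K.IsBand γ' w A c d) : K.rot.IsBand γ' w (-A) d.rot c.rot where
  lower := spans_rot h.upper
  upper := spans_rot h.lower
  lower_lip := fun x y hxy => by
    have := h.upper_lip (-y) (-x) (neg_le_neg hxy)
    simp only [Arc.rot, Arc.negVal, Arc.negArg]
    linarith
  upper_lip := fun x y hxy => by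
    have := h.lower_lip (-y) (-x) (neg_le_neg hxy)
    simp only [Arc.rot, Arc.negVal, Arc.negArg]
    linarith
  lower_subset := hGraph_rot_subset h.upper_subset
  upper_subset := hGraph_rot_subset h.lower_subset
  below := fun t => by
    rw [Arc.rot_ext, Arc.rot_ext]
    exact neg_lt_neg (h.below (-t))
  eq := by
    rw [h.eq]
    ext p
    have := mem_rot_region (K := K) (p := -p)
    rw [neg_neg] at this
    rw [Set.mem_neg, mem_ofPred_eq, mem_ofPred_eq, this, Arc.rot_ext, Arc.rot_ext, Prod.fst_neg,
      Prod.snd_neg]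
    constructor
    · rintro ⟨h1, h2, h3⟩
      exact ⟨h1, by linarith, by linarith⟩
    · rintro ⟨h1, h2, h3⟩
      exact ⟨h1, by linarith, by linarith⟩
  width := fun t => by
    rw [Arc.rot_ext, Arc.rot_ext]
    linarith [h.width (-t)]

lemma IsBand.of_turn {ε : ℝ} (hε : ε = 1 ∨ ε = -1) (h : (K.turn ε).IsBand γ' w A c d) :
    ∃ c' d' : Arc, K.IsBand γ' w {q | ε • q ∈ A} c' d' := by
  rcases hε with rfl | rfl
  · rw [turn_one] at h
    simp only [one_smul]
    exact ⟨c, d, h⟩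
  · rw [turn_neg_one] at h
    have := h.rot
    rw [rot_rot] at this
    simp only [neg_one_smul]
    exact ⟨_, _, this⟩

end Quad

lemma Sweep.Spans.isHCurve {D : Quadrangle} {γ γ' : ℝ≥0} {M : ℝ} {c : Arc} (hs : IsShape γ D)
    (hg : D.quad.IsGood γ M) (h : Sweep.Spans D.quad c)
    (hl : ∀ x y, x ≤ y → c.f y - c.f x ≤ γ' * (y - x)) (hc : c.hGraph ⊆ closure D.region) :
    IsHCurve γ' .increasing D c where
  lipschitz := LipschitzOnWith.of_dist_le_mul fun x _ y _ => by
    rw [Real.dist_eq, Real.dist_eq]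
    rcases le_total x y with hxy | hxy
    · rw [abs_sub_comm, abs_sub_comm x, abs_of_nonneg (sub_nonneg.2 (h.mono hxy)),
        abs_of_nonneg (sub_nonneg.2 hxy)]
      exact hl x y hxy
    · rw [abs_of_nonneg (sub_nonneg.2 (h.mono hxy)), abs_of_nonneg (sub_nonneg.2 hxy)]
      exact hl y x hxy
  type := h.mono.monotoneOn _
  left_mem := hs.mem_βm (hg.closure_region_subset
    (hc (show (c.lo, c.f c.lo) ∈ c.hGraph from ⟨left_mem_Icc.2 c.lo_lt_hi.le, rfl⟩))) h.left
  right_mem := hs.mem_βp (hg.closure_region_subset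
    (hc (show (c.hi, c.f c.hi) ∈ c.hGraph from ⟨right_mem_Icc.2 c.lo_lt_hi.le, rfl⟩))) h.right
  subset := hc

lemma Quad.IsBand.isHStrip {D : Quadrangle} {γ γ' : ℝ≥0} {M w : ℝ} {A : Set (ℝ × ℝ)} {c d : Arc}
    (hs : IsShape γ D) (hg : D.quad.IsGood γ M) (h : D.quad.IsBand γ' w A c d) :
    IsHStrip γ' .increasing D A c d ∧ Arc.thickness c d ≤ w :=
  ⟨⟨h.lower.isHCurve hs hg h.lower_lip h.lower_subset,
    h.upper.isHCurve hs hg h.upper_lip h.upper_subset, h.below, h.eq⟩,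
    Arc.thickness_le fun t => by
      rw [abs_of_pos (sub_pos.2 (h.below t))]
      exact h.width t⟩

/-- The image of a strip under a crossing is a band. -/
lemma Crossing.exists_isBand {D : Quadrangle} {E : Quad} {Q T : ℝ × ℝ → ℝ × ℝ} {γ : ℝ≥0}
    {M ρ B κ γ' : ℝ} {H : Set (ℝ × ℝ)} {c d : Arc} (h : Crossing D.quad E Q T γ M ρ B κ)
    (hκ : κ * κ = 1) (hne : (transitSet D.quad E Q).Nonempty) (hγ : (γ : ℝ) ≤ γ')
    (hB : B * (1 + γ) ≤ γ') (hH : IsHStrip γ .increasing D H c d) :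
    ∃ c' d' : Arc, E.IsBand γ' (Arc.thickness c d / ρ) (Q '' {p ∈ H | Q p ∈ E.region}) c' d' := by
  have hreg := stripQuad_region h.source hH
  have hsub : (stripQuad D c d).region ⊆ D.quad.region := by
    rw [hreg, hH.eq]; exact fun p hp => hp.1
  -- The strip becomes the source quadrangle: its left and right sides are those of the island, and
  -- its vertical width is bounded by the thickness of the strip.
  have h' := h.restrict (stripQuad_isGood h.source hH) (le_max_left _ _) rfl rfl hsub
  have htr : transitSet (stripQuad D c d) E Q = {p ∈ H | Q p ∈ E.region} := by
    rw [← hreg]; rfl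
  -- Nonemptiness is known only for the whole island; it passes to the strip because the transit set
  -- of the island reaches from the lower to the upper side.
  have hne' : (transitSet (stripQuad D c d) E Q).Nonempty := by
    obtain ⟨p, hp, k1, k2⟩ := h.exists_mem_between hne (Arc.continuous_ext hH.lower.lipschitz)
      (Arc.continuous_ext hH.upper.lipschitz) hH.below
      (fun p hp e => by
        by_contra hcon
        rw [not_le] at hcon
        have k := (hH.lower.compare h.source hp.2.2.1 hp.2.2.2).1 hcon.le
        simp only [Quadrangle.quad] at e
        linarith)
      (fun p hp e => by
        by_contra hcon
        rw [not_le] at hcon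
        have k := (hH.upper.compare h.source hp.2.2.1 hp.2.2.2).2 hcon.le
        simp only [Quadrangle.quad] at e
        linarith)
    exact ⟨p, ⟨k1, k2, hp.1.2.2⟩, hp.2⟩
  obtain ⟨qt, σ, hq⟩ := h'.exists_isParam hne'
  obtain ⟨c', d', h1, h2, h3, h4, h5, h6, h7, h8, h9⟩ := (h'.sweep hq hγ hB).exists_strip
  refine ⟨c', d', h1, h2, h3, h4, h5, h6, h7, ?_, h9 _ fun x hx x' hx' k1 k2 => ?_⟩
  · rw [← htr, ← Crossing.image_transitSet hq]
    exact h8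
  · exact h'.image_snd_sub_le hκ (fun u => (le_abs_self _).trans
      (Arc.abs_ext_sub_le_thickness hH.lower.lipschitz hH.upper.lipschitz u))
      (hq.mem x hx) (hq.mem x' hx') k1 k2

/-- The strip theorem at one angle. -/
theorem exists_isHStrip_image {F : ℝ → ℝ → ℝ → ℝ} {θ : ℝ} {Δ : Real.Angle} {γ γ' : ℝ≥0}
    {τ τ' : MonoType} {D E : Quadrangle} {M ρ B : ℝ} {H : Set (ℝ × ℝ)} {c d : Arc}
    (hF : IsAdmissible F) (hD : IsIsland F θ Δ γ τ D) (hE : IsIsland F θ (shift θ Δ) γ τ' E)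
    (hDg : (D.norm τ).quad.IsGood γ M) (hEg : (E.norm τ').quad.IsGood γ M)
    (h1 : SignCondition F θ Δ τ τ' D E) (hρ : 1 < ρ)
    (h2 : ∀ p ∈ closure (transit F θ Δ D E), ρ ≤ |jacobian F θ Δ p 0 0|)
    (hB : ∀ p ∈ closure (transit F θ Δ D E), ‖fderiv ℝ (poincare F θ Δ) p‖ ≤ B)
    (hγ : γ ≤ γ') (hBγ : B * (1 + γ) ≤ γ') (hH : IsHStrip γ τ D H c d) :
    ∃ c' d' : Arc, IsHStrip γ' τ' E (poincare F θ Δ '' H ∩ E.region) c' d' ∧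
      Arc.thickness c' d' ≤ Arc.thickness c d / ρ := by
  obtain ⟨δ, rfl⟩ : ∃ δ : ℝ, (δ : Real.Angle) = Δ := ⟨Δ.toReal, Real.Angle.coe_toReal Δ⟩
  obtain ⟨ε, hε, h⟩ := exists_crossing hF hD hE hDg hEg h1 hρ h2 hB
  obtain ⟨c₁, d₁, hH₁, e₁⟩ := hH.norm
  have hne : (transitSet (D.norm τ).quad ((E.norm τ').quad.turn ε)
      (normMap F θ τ τ' ε δ)).Nonempty := by
    rw [transitSet_turn hF hε]
    exact h1.1.preimage (reflHomeo τ).surjective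
  -- The band is found in normal position; the half turn and then the reflection are undone, neither
  -- of which affects thickness or Lipschitz constants.
  obtain ⟨c₂, d₂, h₂⟩ := h.exists_isBand (sgn_mul_mul_self τ τ') hne (NNReal.coe_le_coe.2 hγ) hBγ hH₁
  obtain ⟨c₃, d₃, h₃⟩ := h₂.of_turn hε
  obtain ⟨h₄, e₄⟩ := h₃.isHStrip hE.shape hEg
  obtain ⟨c₅, d₅, h₅, e₅⟩ := h₄.of_norm
  refine ⟨c₅, d₅, ?_, by rw [e₅, ← e₁]; exact e₄⟩
  convert h₅ using 1
  have ep : poincare F θ δ = fwdMap F θ δ := (hF.fwdMap_eq rfl).symm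
  rw [ep]
  ext q
  rw [mem_preimage, mem_ofPred_eq]
  have hreg : ∀ q, ε • refl τ' q ∈ ((E.norm τ').quad.turn ε).region ↔ q ∈ E.region := fun q => by
    rw [Quad.mem_turn_region hε, Quadrangle.quad_region, Quadrangle.mem_norm_region, refl_refl]
  constructor
  · rintro ⟨⟨p, hp, rfl⟩, hq⟩
    have e : normMap F θ τ τ' ε δ (refl τ p) = ε • refl τ' (fwdMap F θ δ p) := by
      rw [normMap, refl_refl]
    refine ⟨refl τ p, ⟨?_, ?_⟩, e⟩
    · rw [mem_preimage, refl_refl]; exact hp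
    · rw [e, hreg]; exact hq
  · rintro ⟨p, ⟨hp, hp'⟩, e⟩
    rw [e, hreg] at hp'
    refine ⟨⟨refl τ p, hp, ?_⟩, hp'⟩
    have e2 := congrArg (fun z => refl τ' (ε • z)) e
    simp only [normMap] at e2
    rwa [smul_smul_self hε, smul_smul_self hε, refl_refl, refl_refl] at e2

end StripMap
end

/-! ### The strip theorem, with a Lipschitz constant independent of the angle. -/

theorem theorem2 {ι : Type*} [Finite ι] (F : ℝ → ℝ → ℝ → ℝ) (θ : ℝ) (γ : ℝ≥0)
    (τ : ι → MonoType) (D : ι → Real.Angle → Quadrangle) (ρ : Real.Angle → ι → ι → ℝ)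
    (hF : IsAdmissible F) (hθ : 1 < θ)
    (hD : IsBoundedDonutSet F θ γ τ D)
    (h1 : ∀ Δ i j, SignCondition F θ Δ (τ i) (τ j) (D i Δ) (D j (shift θ Δ)))
    (h2 : ∀ Δ i j, 1 < ρ Δ i j ∧ ∀ p ∈ closure (transit F θ Δ (D i Δ) (D j (shift θ Δ))),
      ρ Δ i j ≤ |jacobian F θ Δ p 0 0|) :
    ∀ i j, ∃ γ' : ℝ≥0, γ ≤ γ' ∧ ∀ Δ (H : Set (ℝ × ℝ)) (c d : Arc),
      IsHStrip γ (τ i) (D i Δ) H c d →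
      ∃ c' d' : Arc,
        IsHStrip γ' (τ j) (D j (shift θ Δ))
          (poincare F θ Δ '' H ∩ (D j (shift θ Δ)).region) c' d' ∧
        Arc.thickness c' d' ≤ Arc.thickness c d / ρ Δ i j := by
  intro i j
  obtain ⟨M, hM⟩ := hD.bounded
  have hg : ∀ k Δ, ((D k Δ).norm (τ k)).quad.IsGood γ M := fun k Δ =>
    ((hD.donut k).island Δ).isGood (hM k Δ).1 (hM k Δ).2
  obtain ⟨B, hB⟩ := exists_uniform_bound hF (hD.donut i) (hD.donut j) (hg i) (hg j)
    (fun Δ => h1 Δ i j) (ρ := fun Δ => ρ Δ i j) (fun Δ => h2 Δ i j)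
  -- `B * (1 + γ)` bounds the slopes of images of leaves; at least `γ` is also needed so that the
  -- sides of the target are admissible competitors for the envelopes.
  refine ⟨max γ (B * (1 + γ)).toNNReal, le_max_left _ _, fun Δ H c d hH => ?_⟩
  refine exists_isHStrip_image hF ((hD.donut i).island Δ) ((hD.donut j).island _) (hg i Δ) (hg j _)
    (h1 Δ i j) (h2 Δ i j).1 (h2 Δ i j).2 (hB Δ) (le_max_left _ _) ?_ hH
  exact (Real.le_coe_toNNReal _).trans (NNReal.coe_le_coe.2 (le_max_right _ _))
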